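/- Conventions. A closed manifold is a compact Hausdorff smooth manifold without boundary, possibly empty, whose components may have different dimensions. A closed covering is a finite covering $p:T\to B$ of a closed manifold $B$, i.e. a covering map with finite fibres; the number of points in a fibre is locally constant but need not be constant, and fibres may be empty. For a space $X$ put $p(X)=\{(b,u)\mid b\in B,\ u:p^{-1}(b)\to X\}$; this is the total space of a bundle over $B$ with fibre $X^{p^{-1}(b)}$ over $b$, and if $M$ is a closed manifold then so is $p(M)$. For closed coverings $p:T\to B$ and $q:S\to C$ define closed coverings as follows. - The sum $p+q$ is the disjoint union $T\sqcup S\to B\sqcup C$. - The product $p\times q$ is $(T\times C)\sqcup(B\times S)\to B\times C$; its fibre over $(b,c)$ is $p^{-1}(b)\sqcup q^{-1}(c)$. - The composition $p\circ q$ has base $p(C)$, and its fibre over $(b,u)$ is $\{(t,s)\mid t\in p^{-1}(b),\ s\in q^{-1}(u(t))\}$. (They are characterized by $(p+q)(X)=p(X)+q(X)$, $(p\times q)(X)=p(X)\times q(X)$ and $(p\circ q)(X)=p(q(X))$.) Two closed coverings are cobordant if together they form the boundary of a covering: there is a finite covering $P$ of a compact smooth manifold $W$ with boundary such that the restriction of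 $P$ to $\partial W$ is isomorphic to the disjoint union of the two coverings, by an isomorphism that is a diffeomorphism on the bases. Let $N_*\Sigma$ be the set of cobordism classes of closed coverings, $N_d\Sigma\subseteq N_*\Sigma$ the subset of classes of coverings of closed manifolds all of whose components have dimension $d$, and $N_d\Sigma_n\subseteq N_d\Sigma$ the subset of classes of such coverings of constant degree $n$. Proposition 1. Cobordism is an equivalence relation on closed coverings, and it is compatible with sum, product and composition: if $p$ is cobordant to $p'$ and $q$ is cobordant to $q'$, then $p+q$, $p\times q$ and $p\circ q$ are cobordant to $p'+q'$, $p'\times q'$ and $p'\circ q'$, respectively. The sum and the product induced on cobordism classes make $N_*\Sigma$ into a commutative $\mathbf Z/2$-algebra, and the subsets $N_d\Sigma$, $d\ge 0$, are linear subspaces that make it a graded algebra. Composition induces an operation $\circ$ on $N_*\Sigma$ such that $a\circ b\in N_{mr+k}\Sigma_{mn}$ for all $a\in N_k\Sigma_m$ and $b\in N_r\Sigma_n$. -/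

import Mathlib

open Set Topology
open scoped Manifold ContDiff

noncomputable section

namespace CoveringBordism

/-- A closed smooth manifold, i.e. a compact Hausdorff smooth manifold without boundary.  As usual
in bordism theory, the components may have different dimensions: `dim x` is the dimension at `x`,
and the (open and closed) set of points of dimension `n` is a smooth manifold modelled on `ℝⁿ`. -/
structure ClosedManifold where
  carrier : Type
  [topology : TopologicalSpace carrier]
  [t2 : T2Space carrier]
  [compact : CompactSpace carrier]
  dim : carrier → ℕ
  continuous_dim : Continuous dim
  [charted : ∀ n, ChartedSpace (EuclideanSpace ℝ (Fin n)) {x : carrier // dim x = n}]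
  [smooth : ∀ n, IsManifold (𝓡 n) ∞ {x : carrier // dim x = n}]

attribute [instance] ClosedManifold.topology ClosedManifold.t2 ClosedManifold.compact
  ClosedManifold.charted ClosedManifold.smooth

/-- The union of the `n`-dimensional components. -/
abbrev ClosedManifold.part (M : ClosedManifold) (n : ℕ) : Type := {x : M.carrier // M.dim x = n}

/-- Auxiliary: a smooth atlas on `X`, with one chart around each point, in which the chart around
`x` takes values in a real vector space of dimension `dim x`. -/
structure Charts (X : Type) [TopologicalSpace X] (dim : X → ℕ) where
  V : X → Type
  [nacg : ∀ x, NormedAddCommGroup (V x)]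
  [ns : ∀ x, NormedSpace ℝ (V x)]
  [fd : ∀ x, FiniteDimensional ℝ (V x)]
  finrank_eq : ∀ x, Module.finrank ℝ (V x) = dim x
  chart : ∀ x, OpenPartialHomeomorph X (V x)
  mem_source : ∀ x, x ∈ (chart x).source
  dim_eq : ∀ x, ∀ y ∈ (chart x).source, dim y = dim x
  contDiffOn : ∀ x y, ContDiffOn ℝ ∞ (chart y ∘ (chart x).symm)
    ((chart x).target ∩ (chart x).symm ⁻¹' (chart y).source)

attribute [instance] Charts.nacg Charts.ns Charts.fd

namespace Charts

variable {X : Type} [TopologicalSpace X] {dim : X → ℕ} (A : Charts X dim)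

lemma continuous_dim (A : Charts X dim) : Continuous dim := by
  rw [continuous_iff_continuousAt]
  intro x
  refine (continuousAt_const (y := dim x)).congr ?_
  filter_upwards [(A.chart x).open_source.mem_nhds (A.mem_source x)] with y hy
  exact (A.dim_eq x y hy).symm

lemma isOpenEmbedding_part (A : Charts X dim) (n : ℕ) :
    IsOpenEmbedding (Subtype.val : {x // dim x = n} → X) :=
  IsOpen.isOpenEmbedding_subtypeVal ((isOpen_discrete {n}).preimage A.continuous_dim)

/-- A linear isomorphism of the model space of a chart with `ℝⁿ`. -/
def modelEquiv {n : ℕ} (x : {x // dim x = n}) : A.V x.1 ≃L[ℝ] EuclideanSpace ℝ (Fin n) :=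
  ContinuousLinearEquiv.ofFinrankEq (by rw [A.finrank_eq, x.2, finrank_euclideanSpace_fin])

/-- The chart around `x`, as an `ℝⁿ`-valued chart of the set of points of dimension `n`. -/
def partChart {n : ℕ} (x : {x // dim x = n}) :
    OpenPartialHomeomorph {x // dim x = n} (EuclideanSpace ℝ (Fin n)) :=
  haveI : Nonempty {x // dim x = n} := ⟨x⟩
  ((A.isOpenEmbedding_part n).toOpenPartialHomeomorph Subtype.val ≫ₕ A.chart x.1) ≫ₕ
    (A.modelEquiv x).toHomeomorph.toOpenPartialHomeomorph

/-- The charts make the set of points of dimension `n` a space with charts in `ℝⁿ`. -/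
@[reducible] def chartedSpace (n : ℕ) :
    ChartedSpace (EuclideanSpace ℝ (Fin n)) {x // dim x = n} where
  atlas := range A.partChart
  chartAt := A.partChart
  mem_chart_source x := by
    have : Nonempty {x // dim x = n} := ⟨x⟩
    simp [partChart, A.mem_source]
  chart_mem_atlas x := mem_range_self x

lemma partChart_apply {n : ℕ} (x z : {x // dim x = n}) :
    A.partChart x z = A.modelEquiv x (A.chart x.1 z.1) := rfl

lemma mem_partChart_source {n : ℕ} (x z : {x // dim x = n}) :
    z ∈ (A.partChart x).source ↔ z.1 ∈ (A.chart x.1).source := by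
  have : Nonempty {x // dim x = n} := ⟨x⟩
  simp [partChart]

lemma partChart_symm {n : ℕ} (x : {x // dim x = n}) {v : EuclideanSpace ℝ (Fin n)}
    (hv : v ∈ (A.partChart x).target) :
    (A.modelEquiv x).symm v ∈ (A.chart x.1).target ∧
      (A.chart x.1).symm ((A.modelEquiv x).symm v) = ((A.partChart x).symm v).1 := by
  have h1 := (A.mem_partChart_source x _).1 ((A.partChart x).map_target hv)
  have h2 := (A.partChart x).right_inv hv
  rw [partChart_apply, ← ContinuousLinearEquiv.eq_symm_apply] at h2
  rw [← h2]
  exact ⟨(A.chart x.1).map_source h1, (A.chart x.1).left_inv h1⟩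

lemma isManifold (n : ℕ) :
    letI := A.chartedSpace n
    IsManifold (𝓡 n) ∞ {x // dim x = n} := by
  let _ := A.chartedSpace n
  refine isManifold_of_contDiffOn _ _ _ ?_
  rintro _ _ ⟨x, rfl⟩ ⟨y, rfl⟩
  have h := (A.modelEquiv y).contDiff.comp_contDiffOn ((A.contDiffOn x.1 y.1).comp_continuousLinearMap
    ((A.modelEquiv x).symm : EuclideanSpace ℝ (Fin n) →L[ℝ] A.V x.1))
  refine (h.mono ?_).congr ?_
  · intro v hv
    have hv' : v ∈ (A.partChart x).target ∧ (A.partChart x).symm v ∈ (A.partChart y).source := by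
      simpa using hv
    obtain ⟨h1, h2⟩ := A.partChart_symm x hv'.1
    refine ⟨h1, ?_⟩
    change (A.chart x.1).symm ((A.modelEquiv x).symm v) ∈ (A.chart y.1).source
    rw [h2]
    exact (A.mem_partChart_source _ _).1 hv'.2
  · intro v hv
    have hv' : v ∈ (A.partChart x).target ∧ (A.partChart x).symm v ∈ (A.partChart y).source := by
      simpa using hv
    change A.partChart y ((A.partChart x).symm v) =
      A.modelEquiv y (A.chart y.1 ((A.chart x.1).symm ((A.modelEquiv x).symm v)))
    rw [partChart_apply, (A.partChart_symm x hv'.1).2]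

/-- The closed manifold given by an atlas on a compact Hausdorff space. -/
def toClosedManifold [T2Space X] [CompactSpace X] : ClosedManifold where
  carrier := X
  dim := dim
  continuous_dim := A.continuous_dim
  charted := A.chartedSpace
  smooth := A.isManifold

end Charts

namespace ClosedManifold

variable (M : ClosedManifold)

lemma isOpenEmbedding_part (n : ℕ) : IsOpenEmbedding (Subtype.val : M.part n → M.carrier) :=
  IsOpen.isOpenEmbedding_subtypeVal ((isOpen_discrete {n}).preimage M.continuous_dim)

/-- The preferred chart around a point, as a partially defined map on the whole manifold. -/
def partChart {n : ℕ} (x : M.part n) : OpenPartialHomeomorph M.carrier (EuclideanSpace ℝ (Fin n)) :=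
  haveI : Nonempty (M.part n) := ⟨x⟩
  ((M.isOpenEmbedding_part n).toOpenPartialHomeomorph Subtype.val).symm ≫ₕ
    chartAt (EuclideanSpace ℝ (Fin n)) x

lemma mem_partChart_source {n : ℕ} (x : M.part n) : x.1 ∈ (M.partChart x).source := by
  have : Nonempty (M.part n) := ⟨x⟩
  have := IsOpenEmbedding.toOpenPartialHomeomorph_left_inv (Subtype.val : M.part n → M.carrier)
    (M.isOpenEmbedding_part n) (x := x)
  simp [partChart, this]

lemma dim_of_mem_partChart_source {n : ℕ} (x : M.part n) {y : M.carrier}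
    (hy : y ∈ (M.partChart x).source) : M.dim y = n := by
  have : Nonempty (M.part n) := ⟨x⟩
  simp [partChart] at hy
  exact hy.1

lemma contDiffOn_partChart {n : ℕ} (x y : M.part n) :
    ContDiffOn ℝ ∞ (M.partChart y ∘ (M.partChart x).symm)
      ((M.partChart x).target ∩ (M.partChart x).symm ⁻¹' (M.partChart y).source) := by
  have : Nonempty (M.part n) := ⟨x⟩
  have h := ((contDiffGroupoid ∞ (𝓡 n)).compatible
    (chart_mem_atlas (EuclideanSpace ℝ (Fin n)) x) (chart_mem_atlas (EuclideanSpace ℝ (Fin n)) y))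
  rw [contDiffGroupoid, mem_groupoid_of_pregroupoid] at h
  have h := h.1
  simp [contDiffPregroupoid] at h
  have key (z : M.part n) := IsOpenEmbedding.toOpenPartialHomeomorph_left_inv
    (Subtype.val : M.part n → M.carrier) (M.isOpenEmbedding_part n) (x := z)
  refine (h.congr ?_).mono ?_
  · intro v hv
    simp [partChart, key]
  · intro v hv
    simp [partChart, key] at hv ⊢
    exact ⟨hv.1, hv.2.2⟩

/-- The preferred charts of a closed manifold. -/
def charts : Charts M.carrier M.dim where
  V x := EuclideanSpace ℝ (Fin (M.dim x))
  finrank_eq x := finrank_euclideanSpace_fin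
  chart x := M.partChart ⟨x, rfl⟩
  mem_source x := M.mem_partChart_source ⟨x, rfl⟩
  dim_eq x y hy := M.dim_of_mem_partChart_source ⟨x, rfl⟩ hy
  contDiffOn x y := by
    suffices ∀ (n m : ℕ) (hx : M.dim x = n) (hy : M.dim y = m),
        ContDiffOn ℝ ∞ (M.partChart ⟨y, hy⟩ ∘ (M.partChart ⟨x, hx⟩).symm)
          ((M.partChart ⟨x, hx⟩).target ∩ (M.partChart ⟨x, hx⟩).symm ⁻¹'
            (M.partChart ⟨y, hy⟩).source) from this _ _ rfl rfl
    intro n m hx hy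
    by_cases hnm : n = m
    · subst hnm
      exact M.contDiffOn_partChart _ _
    · refine fun v hv => absurd ?_ hnm
      rw [← M.dim_of_mem_partChart_source _ hv.2,
        M.dim_of_mem_partChart_source _ ((M.partChart ⟨x, hx⟩).map_target hv.1)]

end ClosedManifold

namespace Charts

variable {X Y : Type} [TopologicalSpace X] [TopologicalSpace Y] {d : X → ℕ} {e : Y → ℕ}
  (A : Charts X d) (B : Charts Y e)

/-- A chart of the first summand, as a chart of the disjoint union. -/
def inlChart (Y : Type) [TopologicalSpace Y] (x : X) : OpenPartialHomeomorph (X ⊕ Y) (A.V x) :=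
  haveI : Nonempty X := ⟨x⟩
  (IsOpenEmbedding.inl.toOpenPartialHomeomorph (Sum.inl : X → X ⊕ Y)).symm ≫ₕ A.chart x

/-- A chart of the second summand, as a chart of the disjoint union. -/
def inrChart (X : Type) [TopologicalSpace X] (y : Y) : OpenPartialHomeomorph (X ⊕ Y) (B.V y) :=
  haveI : Nonempty Y := ⟨y⟩
  (IsOpenEmbedding.inr.toOpenPartialHomeomorph (Sum.inr : Y → X ⊕ Y)).symm ≫ₕ B.chart y

lemma mem_inlChart_source (x : X) (z : X ⊕ Y) :
    z ∈ (A.inlChart Y x).source ↔ ∃ w ∈ (A.chart x).source, Sum.inl w = z := by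
  have : Nonempty X := ⟨x⟩
  have key (z : X) := IsOpenEmbedding.toOpenPartialHomeomorph_left_inv (Sum.inl : X → X ⊕ Y)
    IsOpenEmbedding.inl (x := z)
  rcases z with z | z <;> simp [inlChart, key]

lemma mem_inrChart_source (y : Y) (z : X ⊕ Y) :
    z ∈ (B.inrChart X y).source ↔ ∃ w ∈ (B.chart y).source, Sum.inr w = z := by
  have : Nonempty Y := ⟨y⟩
  have key (z : Y) := IsOpenEmbedding.toOpenPartialHomeomorph_left_inv (Sum.inr : Y → X ⊕ Y)
    IsOpenEmbedding.inr (x := z)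
  rcases z with z | z <;> simp [inrChart, key]

lemma inlChart_target (x : X) : (A.inlChart Y x).target = (A.chart x).target := by
  simp [inlChart]

lemma inrChart_target (y : Y) : (B.inrChart X y).target = (B.chart y).target := by
  simp [inrChart]

lemma inlChart_inl (x z : X) : A.inlChart Y x (Sum.inl z) = A.chart x z := by
  have : Nonempty X := ⟨x⟩
  have key := IsOpenEmbedding.toOpenPartialHomeomorph_left_inv (Sum.inl : X → X ⊕ Y)
    IsOpenEmbedding.inl (x := z)
  simp [inlChart, key]

lemma inrChart_inr (y z : Y) : B.inrChart X y (Sum.inr z) = B.chart y z := by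
  have : Nonempty Y := ⟨y⟩
  have key := IsOpenEmbedding.toOpenPartialHomeomorph_left_inv (Sum.inr : Y → X ⊕ Y)
    IsOpenEmbedding.inr (x := z)
  simp [inrChart, key]

lemma inlChart_symm (x : X) (v : A.V x) :
    (A.inlChart Y x).symm v = Sum.inl ((A.chart x).symm v) := rfl

lemma inrChart_symm (y : Y) (v : B.V y) :
    (B.inrChart X y).symm v = Sum.inr ((B.chart y).symm v) := rfl

lemma contDiffOn_inlChart (Y : Type) [TopologicalSpace Y] (x x' : X) :
    ContDiffOn ℝ ∞ (A.inlChart Y x' ∘ (A.inlChart Y x).symm)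
      ((A.inlChart Y x).target ∩ (A.inlChart Y x).symm ⁻¹' (A.inlChart Y x').source) := by
  refine ((A.contDiffOn x x').mono ?_).congr ?_
  · rintro v ⟨h1, h2⟩
    rw [mem_preimage, inlChart_symm, mem_inlChart_source] at h2
    obtain ⟨w, hw, hw'⟩ := h2
    rw [inlChart_target] at h1
    rw [Sum.inl_injective hw'] at hw
    exact ⟨h1, hw⟩
  · intro v hv
    rw [Function.comp_apply, inlChart_symm, inlChart_inl, Function.comp_apply]

lemma contDiffOn_inrChart (X : Type) [TopologicalSpace X] (y y' : Y) :
    ContDiffOn ℝ ∞ (B.inrChart X y' ∘ (B.inrChart X y).symm)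
      ((B.inrChart X y).target ∩ (B.inrChart X y).symm ⁻¹' (B.inrChart X y').source) := by
  refine ((B.contDiffOn y y').mono ?_).congr ?_
  · rintro v ⟨h1, h2⟩
    rw [mem_preimage, inrChart_symm, mem_inrChart_source] at h2
    obtain ⟨w, hw, hw'⟩ := h2
    rw [inrChart_target] at h1
    rw [Sum.inr_injective hw'] at hw
    exact ⟨h1, hw⟩
  · intro v hv
    rw [Function.comp_apply, inrChart_symm, inrChart_inr, Function.comp_apply]

/-- The charts of a disjoint union. -/
def sum : Charts (X ⊕ Y) (Sum.elim d e) where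
  V := Sum.elim A.V B.V
  nacg := Sum.rec (fun x => A.nacg x) (fun y => B.nacg y)
  ns := Sum.rec (fun x => A.ns x) (fun y => B.ns y)
  fd := Sum.rec (fun x => A.fd x) (fun y => B.fd y)
  finrank_eq := Sum.rec (fun x => A.finrank_eq x) (fun y => B.finrank_eq y)
  chart := Sum.rec (fun x => A.inlChart Y x) (fun y => B.inrChart X y)
  mem_source := Sum.rec (fun x => by simp [mem_inlChart_source, A.mem_source])
    (fun y => by simp [mem_inrChart_source, B.mem_source])
  dim_eq := by
    rintro (x | y) z hz
    · obtain ⟨w, hw, rfl⟩ := (A.mem_inlChart_source x z).1 hz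
      exact A.dim_eq x w hw
    · obtain ⟨w, hw, rfl⟩ := (B.mem_inrChart_source y z).1 hz
      exact B.dim_eq y w hw
  contDiffOn := by
    rintro (x | y) (x' | y')
    · exact A.contDiffOn_inlChart Y x x'
    · rintro v ⟨h1, h2⟩
      obtain ⟨w, hw, hw'⟩ := (B.mem_inrChart_source y' (X := X) _).1 h2
      exact (Sum.inr_ne_inl hw').elim
    · rintro v ⟨h1, h2⟩
      obtain ⟨w, hw, hw'⟩ := (A.mem_inlChart_source x' (Y := Y) _).1 h2
      exact (Sum.inl_ne_inr hw').elim
    · exact B.contDiffOn_inrChart X y y'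

/-- The charts of a product. -/
def prod : Charts (X × Y) (fun z => d z.1 + e z.2) where
  V z := A.V z.1 × B.V z.2
  finrank_eq z := by rw [Module.finrank_prod, A.finrank_eq, B.finrank_eq]
  chart z := (A.chart z.1).prod (B.chart z.2)
  mem_source z := ⟨A.mem_source z.1, B.mem_source z.2⟩
  dim_eq z w hw := by rw [A.dim_eq z.1 w.1 hw.1, B.dim_eq z.2 w.2 hw.2]
  contDiffOn z w := by
    refine ((A.contDiffOn z.1 w.1).prodMap (B.contDiffOn z.2 w.2)).mono ?_
    rintro v ⟨h1, h2⟩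
    exact ⟨⟨h1.1, h2.1⟩, ⟨h1.2, h2.2⟩⟩

end Charts

/-- The disjoint union of two closed manifolds. -/
def ClosedManifold.sum (M N : ClosedManifold) : ClosedManifold :=
  (M.charts.sum N.charts).toClosedManifold

/-- The product of two closed manifolds. -/
def ClosedManifold.prod (M N : ClosedManifold) : ClosedManifold :=
  (M.charts.prod N.charts).toClosedManifold

/-! ### The space `p(X)` -/

section PolySpace

variable {T B X : Type} [TopologicalSpace T] [TopologicalSpace B] [TopologicalSpace X]

/-- For a map `p : T → B`, the set `p(X)` of pairs `(b, u)` with `b : B` and `u : p⁻¹(b) → X`. -/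
@[ext] structure PolySpace (p : T → B) (X : Type) where
  base : B
  map : p ⁻¹' {base} → X

namespace PolySpace

/-- The pairs `(b, u)` for which `u` sends some point of `p⁻¹(b) ∩ V` into `O`. -/
def hit (p : T → B) (V : Set T) (O : Set X) : Set (PolySpace p X) :=
  {x | ∃ t : p ⁻¹' {x.base}, t.1 ∈ V ∧ x.map t ∈ O}

/-- The topology of `p(X)`, for `p` a finite covering: it is generated by the preimages of the open
subsets of `B` and by the sets `hit p V O` with `V` and `O` open.  Over an evenly covered open set
`U` with sheets indexed by `F` it is the product topology of `U × (F → X)`; see `localTriv`. -/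
instance topology (p : T → B) : TopologicalSpace (PolySpace p X) :=
  .generateFrom ({s | ∃ U : Set B, IsOpen U ∧ base ⁻¹' U = s} ∪
    {s | ∃ (V : Set T) (O : Set X), IsOpen V ∧ IsOpen O ∧ hit p V O = s})

lemma continuous_base (p : T → B) : Continuous (base : PolySpace p X → B) :=
  ⟨fun U hU => .basic _ (.inl ⟨U, hU, rfl⟩)⟩

lemma isOpen_hit (p : T → B) {V : Set T} {O : Set X} (hV : IsOpen V) (hO : IsOpen O) :
    IsOpen (hit p V O) := .basic _ (.inr ⟨V, O, hV, hO, rfl⟩)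

variable {p : T → B} (hp : IsCoveringMap p)

/-- An evenly covered neighbourhood of `b`. -/
def nbhd (b : B) : Set B := (hp b).2.choose

lemma mem_nbhd (b : B) : b ∈ nbhd hp b := (hp b).2.choose_spec.1

lemma isOpen_nbhd (b : B) : IsOpen (nbhd hp b) := (hp b).2.choose_spec.2.1

lemma isOpen_preimage_nbhd (b : B) : IsOpen (p ⁻¹' nbhd hp b) := (hp b).2.choose_spec.2.2.1

/-- A trivialization of `p` over the evenly covered neighbourhood. -/
def triv (b : B) : p ⁻¹' nbhd hp b ≃ₜ nbhd hp b × p ⁻¹' {b} := (hp b).2.choose_spec.2.2.2.choose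

lemma triv_fst (b : B) (t : p ⁻¹' nbhd hp b) : (triv hp b t).1.1 = p t :=
  (hp b).2.choose_spec.2.2.2.choose_spec t

/-- The sheet on which a point lies. -/
def idx (b : B) (t : T) (ht : p t ∈ nbhd hp b) : p ⁻¹' {b} := (triv hp b ⟨t, ht⟩).2

/-- The point over `b'` on a given sheet. -/
def sec (b : B) {b' : B} (hb : b' ∈ nbhd hp b) (i : p ⁻¹' {b}) : p ⁻¹' {b'} :=
  ⟨(triv hp b).symm (⟨b', hb⟩, i), by
    have := triv_fst hp b ((triv hp b).symm (⟨b', hb⟩, i))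
    rw [Homeomorph.apply_symm_apply] at this
    exact this.symm⟩

lemma idx_sec (b : B) {b' : B} (hb : b' ∈ nbhd hp b) (i : p ⁻¹' {b}) (h) :
    idx hp b (sec hp b hb i).1 h = i := by
  simp [idx, sec]

lemma sec_idx (b : B) {b' : B} (hb : b' ∈ nbhd hp b) (t : p ⁻¹' {b'}) (h) :
    sec hp b hb (idx hp b t.1 h) = t := by
  apply Subtype.ext
  have : (⟨b', hb⟩, idx hp b t.1 h) = triv hp b ⟨t.1, h⟩ :=
    Prod.ext (Subtype.ext ((triv_fst hp b ⟨t.1, h⟩).trans t.2).symm) rfl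
  change ((triv hp b).symm (⟨b', hb⟩, idx hp b t.1 h)).1 = t.1
  rw [this, Homeomorph.symm_apply_apply]

/-- A sheet of `p` over the evenly covered neighbourhood. -/
def sheet (b : B) (i : p ⁻¹' {b}) : Set T := {t | ∃ h : p t ∈ nbhd hp b, idx hp b t h = i}

lemma isOpen_sheet (b : B) (i : p ⁻¹' {b}) : IsOpen (sheet hp b i) := by
  have := (hp b).1
  have h : IsOpen {t : p ⁻¹' nbhd hp b | (triv hp b t).2 = i} :=
    (isOpen_discrete {i}).preimage (continuous_snd.comp (triv hp b).continuous)
  convert (isOpen_preimage_nbhd hp b).isOpenMap_subtype_val _ h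
  ext t
  simp [sheet, idx]

lemma sec_mem_sheet (b : B) {b' : B} (hb : b' ∈ nbhd hp b) (i : p ⁻¹' {b}) :
    (sec hp b hb i).1 ∈ sheet hp b i :=
  ⟨(sec hp b hb i).2.symm ▸ hb, idx_sec hp b hb i _⟩

lemma eq_sec_of_mem_sheet (b : B) {b' : B} (hb : b' ∈ nbhd hp b) (i : p ⁻¹' {b})
    (t : p ⁻¹' {b'}) (ht : t.1 ∈ sheet hp b i) : t = sec hp b hb i := by
  obtain ⟨h, rfl⟩ := ht
  rw [sec_idx]

open Classical in
/-- The trivialization of `p(X)` over an evenly covered neighbourhood, as a function.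
(Its values outside of the domain of definition are irrelevant.) -/
def toLocal (x y : PolySpace p X) : B × (p ⁻¹' {x.base} → X) :=
  if h : y.base ∈ nbhd hp x.base then (y.base, fun i => y.map (sec hp x.base h i)) else (x.base, x.map)

open Classical in
/-- The inverse of `toLocal`. -/
def ofLocal (x : PolySpace p X) (z : B × (p ⁻¹' {x.base} → X)) : PolySpace p X :=
  if h : z.1 ∈ nbhd hp x.base then ⟨z.1, fun t => z.2 (idx hp x.base t.1 (t.2.symm ▸ h))⟩ else x

lemma toLocal_of_mem (x y : PolySpace p X) (h : y.base ∈ nbhd hp x.base) :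
    toLocal hp x y = (y.base, fun i => y.map (sec hp x.base h i)) := dif_pos h

lemma ofLocal_of_mem (x : PolySpace p X) (z : B × (p ⁻¹' {x.base} → X)) (h : z.1 ∈ nbhd hp x.base) :
    ofLocal hp x z = ⟨z.1, fun t => z.2 (idx hp x.base t.1 (t.2.symm ▸ h))⟩ := dif_pos h

lemma ofLocal_fst (x : PolySpace p X) (z : B × (p ⁻¹' {x.base} → X)) (h : z.1 ∈ nbhd hp x.base) :
    (ofLocal hp x z).base = z.1 := by rw [ofLocal_of_mem hp x z h]

/-- The trivialization of `p(X)` over the evenly covered neighbourhood of the base point of `x`. -/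
def localTriv [∀ b, Finite (p ⁻¹' {b})] (x : PolySpace p X) :
    OpenPartialHomeomorph (PolySpace p X) (B × (p ⁻¹' {x.base} → X)) where
  toFun := toLocal hp x
  invFun := ofLocal hp x
  source := {y | y.base ∈ nbhd hp x.base}
  target := {z | z.1 ∈ nbhd hp x.base}
  map_source' y hy := by
    rw [toLocal_of_mem hp x y hy]
    exact hy
  map_target' z hz := by
    rw [ofLocal_of_mem hp x z hz]
    exact hz
  left_inv' y hy := by
    rw [toLocal_of_mem hp x y hy, ofLocal_of_mem hp x _ (by exact hy)]
    simp [sec_idx]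
  right_inv' z hz := by
    rw [ofLocal_of_mem hp x z hz, toLocal_of_mem hp x _ (by exact hz)]
    simp [idx_sec]
  open_source := (isOpen_nbhd hp x.base).preimage (continuous_base p)
  open_target := (isOpen_nbhd hp x.base).preimage continuous_fst
  continuousOn_toFun := by
    have h1 : ContinuousOn (fun y => (toLocal hp x y).1) {y : PolySpace p X | y.base ∈ nbhd hp x.base} :=
      (continuous_base p).continuousOn.congr fun y hy => by rw [toLocal_of_mem hp x y hy]
    have ho : IsOpen {y : PolySpace p X | y.base ∈ nbhd hp x.base} :=
      (isOpen_nbhd hp x.base).preimage (continuous_base p)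
    suffices h2 : ∀ i, ContinuousOn (fun y => (toLocal hp x y).2 i)
        {y : PolySpace p X | y.base ∈ nbhd hp x.base} from h1.prodMk (continuousOn_pi.2 h2)
    intro i
    rw [continuousOn_open_iff ho]
    intro O hO
    convert ho.inter (isOpen_hit p (isOpen_sheet hp x.base i) hO) using 1
    ext y
    refine and_congr_right fun hy => ?_
    rw [mem_preimage, toLocal_of_mem hp x y hy]
    constructor
    · exact fun h => ⟨sec hp x.base hy i, sec_mem_sheet hp x.base hy i, h⟩
    · rintro ⟨t, ht, h⟩
      rwa [eq_sec_of_mem_sheet hp x.base hy i t ht] at h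
  continuousOn_invFun := by
    refine continuousOn_isOpen_of_generateFrom ?_
    rintro _ (⟨U, hU, rfl⟩ | ⟨V, O, hV, hO, rfl⟩)
    · convert ((isOpen_nbhd hp x.base).inter hU).preimage
        (continuous_fst : Continuous (Prod.fst : B × (p ⁻¹' {x.base} → X) → B)) using 1
      ext z
      refine and_congr_right fun hz => ?_
      rw [mem_preimage, mem_preimage, ofLocal_fst hp x z hz]
    · have hV' (i : p ⁻¹' {x.base}) : IsOpen (p '' (V ∩ sheet hp x.base i)) :=
        hp.isOpenMap _ (hV.inter (isOpen_sheet hp x.base i))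
      have : IsOpen (⋃ i : p ⁻¹' {x.base}, {z : B × (p ⁻¹' {x.base} → X) |
          z.1 ∈ p '' (V ∩ sheet hp x.base i) ∧ z.2 i ∈ O}) :=
        isOpen_iUnion fun i => ((hV' i).preimage continuous_fst).inter
          (hO.preimage ((continuous_apply i).comp continuous_snd))
      convert ((isOpen_nbhd hp x.base).preimage continuous_fst).inter this using 1
      ext z
      refine and_congr_right fun hz => ?_
      rw [mem_preimage, ofLocal_of_mem hp x z hz, mem_iUnion]
      constructor
      · rintro ⟨t, ht, h⟩
        exact ⟨_, ⟨t.1, ⟨ht, ⟨_, rfl⟩⟩, t.2⟩, h⟩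
      · rintro ⟨i, ⟨t, ⟨ht, ⟨h1, h2⟩⟩, h3⟩, h⟩
        refine ⟨⟨t, h3⟩, ht, ?_⟩
        subst h2
        exact h

lemma compactSpace_of_local {Y Z : Type} [TopologicalSpace Y] [TopologicalSpace Z] [CompactSpace Z]
    (f : Y → Z) (h : ∀ z, ∃ K ∈ 𝓝 z, IsCompact (f ⁻¹' K)) : CompactSpace Y := by
  choose K hK hc using h
  obtain ⟨t, -, ht⟩ := isCompact_univ.elim_nhds_subcover K fun z _ => hK z
  refine ⟨(t.isCompact_biUnion fun z _ => hc z).of_isClosed_subset isClosed_univ fun y _ => ?_⟩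
  obtain ⟨z, hz, hy⟩ := mem_iUnion₂.1 (ht (mem_univ (f y)))
  exact mem_iUnion₂.2 ⟨z, hz, hy⟩

lemma t2Space_total (hp : IsCoveringMap p) [T2Space B] : T2Space T := by
  refine ⟨fun s t hst => ?_⟩
  by_cases h : p s = p t
  · exact hp.isSeparatedMap s t h hst
  · exact separated_by_continuous hp.continuous h

lemma compactSpace_total (hp : IsCoveringMap p) [T2Space B] [CompactSpace B]
    [∀ b, Finite (p ⁻¹' {b})] : CompactSpace T := by
  refine compactSpace_of_local p fun b => ?_
  have := (hp b).1
  obtain ⟨K, hK, hKU, hKc⟩ := local_compact_nhds ((isOpen_nbhd hp b).mem_nhds (mem_nbhd hp b))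
  refine ⟨K, hK, ?_⟩
  have h0 : IsCompact ((Subtype.val : nbhd hp b → B) ⁻¹' K) :=
    (IsInducing.subtypeVal.isCompact_preimage_iff (by simpa using hKU)).2 hKc
  have h1 := h0.prod (isCompact_univ : IsCompact (univ : Set (p ⁻¹' {b})))
  convert (h1.image (triv hp b).symm.continuous).image continuous_subtype_val using 1
  ext t
  constructor
  · intro ht
    refine ⟨⟨t, hKU ht⟩, ⟨triv hp b ⟨t, hKU ht⟩, ⟨?_, mem_univ _⟩, by simp⟩, rfl⟩
    rw [mem_preimage, triv_fst]
    exact ht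
  · rintro ⟨_, ⟨z, hz, rfl⟩, rfl⟩
    have := triv_fst hp b ((triv hp b).symm z)
    rw [Homeomorph.apply_symm_apply] at this
    rw [mem_preimage, ← this]
    exact hz.1

lemma t2Space (hp : IsCoveringMap p) [T2Space B] [T2Space X] [∀ b, Finite (p ⁻¹' {b})] :
    T2Space (PolySpace p X) := by
  refine ⟨fun x y hxy => ?_⟩
  by_cases h : x.base = y.base
  · have hx : x ∈ (localTriv hp x).source := mem_nbhd hp x.base
    have hy : y ∈ (localTriv hp x).source := by
      change y.base ∈ nbhd hp x.base
      rw [← h]; exact mem_nbhd hp x.base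
    obtain ⟨u, v, hu, hv, hxu, hyv, huv⟩ := t2_separation ((localTriv hp x).injOn.ne hx hy hxy)
    refine ⟨_, _, (localTriv hp x).isOpen_inter_preimage hu,
      (localTriv hp x).isOpen_inter_preimage hv, ⟨hx, hxu⟩, ⟨hy, hyv⟩, ?_⟩
    exact (huv.preimage _).mono inter_subset_right inter_subset_right
  · exact separated_by_continuous (continuous_base p) h

lemma compactSpace (hp : IsCoveringMap p) [T2Space B] [CompactSpace B] [CompactSpace X]
    [∀ b, Finite (p ⁻¹' {b})] : CompactSpace (PolySpace p X) := by
  refine compactSpace_of_local base fun b => ?_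
  rcases isEmpty_or_nonempty (p ⁻¹' {b} → X) with he | ⟨⟨u⟩⟩
  · refine ⟨nbhd hp b, (isOpen_nbhd hp b).mem_nhds (mem_nbhd hp b), ?_⟩
    convert isCompact_empty
    refine eq_empty_of_forall_notMem fun y hy => he.false fun i => y.map (sec hp b hy i)
  obtain ⟨K, hK, hKU, hKc⟩ := local_compact_nhds ((isOpen_nbhd hp b).mem_nhds (mem_nbhd hp b))
  refine ⟨K, hK, ?_⟩
  have h1 : IsCompact (K ×ˢ (univ : Set (p ⁻¹' {b} → X))) := hKc.prod isCompact_univ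
  convert h1.image_of_continuousOn ((localTriv hp ⟨b, u⟩).continuousOn_symm.mono ?_) using 1
  · ext y
    constructor
    · intro hy
      refine ⟨localTriv hp ⟨b, u⟩ y, ⟨?_, mem_univ _⟩, (localTriv hp ⟨b, u⟩).left_inv (hKU hy)⟩
      change (toLocal hp ⟨b, u⟩ y).1 ∈ K
      rw [toLocal_of_mem hp ⟨b, u⟩ y (hKU hy)]
      exact hy
    · rintro ⟨z, hz, rfl⟩
      change (ofLocal hp ⟨b, u⟩ z).base ∈ K
      rw [ofLocal_fst hp ⟨b, u⟩ z (hKU hz.1)]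
      exact hz.1
  · rintro z hz
    exact hKU hz.1

/-- The dimension of `p(X)` at the point `(b, u)`: the dimension of `B` at `b` plus the sum of the
dimensions of `X` at the points `u(t)`. -/
def dim (d : B → ℕ) (e : X → ℕ) (x : PolySpace p X) : ℕ :=
  d x.base + ∑ᶠ t : p ⁻¹' {x.base}, e (x.map t)

attribute [local instance] Fintype.ofFinite

/-- The bijection of the fibres over the points of an evenly covered neighbourhood. -/
def secEquiv (b : B) {b' : B} (hb : b' ∈ nbhd hp b) : p ⁻¹' {b} ≃ p ⁻¹' {b'} where
  toFun i := sec hp b hb i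
  invFun t := idx hp b t.1 (t.2.symm ▸ hb)
  left_inv i := idx_sec hp b hb i _
  right_inv t := sec_idx hp b hb t _

/-- The local coordinates of `x` itself. -/
def coord (x : PolySpace p X) (i : p ⁻¹' {x.base}) : X :=
  x.map (sec hp x.base (mem_nbhd hp x.base) i)

/-- The chart of `p(X)` around `x`: a trivialization followed by charts of `B` and `X`. -/
def polyChart [∀ b, Finite (p ⁻¹' {b})] {d : B → ℕ} {e : X → ℕ} (A : Charts B d) (D : Charts X e)
    (x : PolySpace p X) : OpenPartialHomeomorph (PolySpace p X)
      (A.V x.base × (∀ i : p ⁻¹' {x.base}, D.V (coord hp x i))) :=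
  localTriv hp x ≫ₕ
    (A.chart x.base).prod (OpenPartialHomeomorph.pi fun i => D.chart (coord hp x i))

section

variable [∀ b, Finite (p ⁻¹' {b})] {d : B → ℕ} {e : X → ℕ} (A : Charts B d) (D : Charts X e)

lemma mem_polyChart_source (x y : PolySpace p X) :
    y ∈ (polyChart hp A D x).source ↔ ∃ h : y.base ∈ nbhd hp x.base,
      y.base ∈ (A.chart x.base).source ∧
        ∀ i, y.map (sec hp x.base h i) ∈ (D.chart (coord hp x i)).source := by
  have h1 : y ∈ (polyChart hp A D x).source ↔ y.base ∈ nbhd hp x.base ∧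
      (toLocal hp x y).1 ∈ (A.chart x.base).source ∧
        ∀ i ∈ univ, (toLocal hp x y).2 i ∈ (D.chart (coord hp x i)).source := Iff.rfl
  rw [h1, ← exists_prop]
  refine exists_congr fun h => ?_
  rw [toLocal_of_mem hp x y h]
  simp

lemma polyChart_apply (x y : PolySpace p X) (h : y.base ∈ nbhd hp x.base) :
    polyChart hp A D x y = (A.chart x.base y.base,
      fun i => D.chart (coord hp x i) (y.map (sec hp x.base h i))) := by
  have h1 : polyChart hp A D x y = (A.chart x.base (toLocal hp x y).1,
      fun i => D.chart (coord hp x i) ((toLocal hp x y).2 i)) := rfl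
  rw [h1, toLocal_of_mem hp x y h]

lemma mem_polyChart_target (x : PolySpace p X)
    {v : A.V x.base × (∀ i : p ⁻¹' {x.base}, D.V (coord hp x i))}
    (hv : v ∈ (polyChart hp A D x).target) : v.1 ∈ (A.chart x.base).target ∧
      (∀ i, v.2 i ∈ (D.chart (coord hp x i)).target) ∧
      ∃ h : (A.chart x.base).symm v.1 ∈ nbhd hp x.base,
        (polyChart hp A D x).symm v = ⟨(A.chart x.base).symm v.1, fun t =>
          (D.chart (coord hp x (idx hp x.base t.1 (t.2.symm ▸ h)))).symm (v.2 _)⟩ := by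
  have h1 : (v.1 ∈ (A.chart x.base).target ∧
      ∀ i ∈ univ, v.2 i ∈ (D.chart (coord hp x i)).target) ∧
      (A.chart x.base).symm v.1 ∈ nbhd hp x.base := hv
  refine ⟨h1.1.1, fun i => h1.1.2 i (mem_univ i), h1.2, ?_⟩
  exact ofLocal_of_mem hp x ((A.chart x.base).symm v.1,
    fun i => (D.chart (coord hp x i)).symm (v.2 i)) h1.2

lemma polyChart_symm_apply (x y : PolySpace p X)
    {v : A.V x.base × (∀ i : p ⁻¹' {x.base}, D.V (coord hp x i))}
    (hv : v ∈ (polyChart hp A D x).target ∩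
      (polyChart hp A D x).symm ⁻¹' (polyChart hp A D y).source) :
    v.1 ∈ (A.chart x.base).target ∧ (A.chart x.base).symm v.1 ∈ (A.chart y.base).source ∧
      (polyChart hp A D y ((polyChart hp A D x).symm v)).1 =
        A.chart y.base ((A.chart x.base).symm v.1) ∧
      ∀ i, ∃ j, (A.chart x.base).symm v.1 ∈ p '' (sheet hp y.base i ∩ sheet hp x.base j) := by
  obtain ⟨h1, h2, h3, h4⟩ := mem_polyChart_target hp A D x hv.1
  have h5 := hv.2
  rw [mem_preimage, h4, mem_polyChart_source] at h5
  obtain ⟨h6, h7, h8⟩ := h5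
  refine ⟨h1, h7, ?_, fun i => ⟨idx hp x.base (sec hp y.base h6 i).1
    ((sec hp y.base h6 i).2.symm ▸ h3), _, ⟨sec_mem_sheet hp y.base h6 i, ⟨_, rfl⟩⟩,
    (sec hp y.base h6 i).2⟩⟩
  rw [h4, polyChart_apply hp A D y _ h6]

lemma polyChart_symm_apply_snd (x y : PolySpace p X)
    {v : A.V x.base × (∀ i : p ⁻¹' {x.base}, D.V (coord hp x i))}
    (hv : v ∈ (polyChart hp A D x).target ∩
      (polyChart hp A D x).symm ⁻¹' (polyChart hp A D y).source) (i : p ⁻¹' {y.base})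
    (j : p ⁻¹' {x.base})
    (hj : (A.chart x.base).symm v.1 ∈ p '' (sheet hp y.base i ∩ sheet hp x.base j)) :
    v.2 j ∈ (D.chart (coord hp x j)).target ∩
      (D.chart (coord hp x j)).symm ⁻¹' (D.chart (coord hp y i)).source ∧
    (polyChart hp A D y ((polyChart hp A D x).symm v)).2 i =
        D.chart (coord hp y i) ((D.chart (coord hp x j)).symm (v.2 j)) := by
  obtain ⟨h1, h2, h3, h4⟩ := mem_polyChart_target hp A D x hv.1
  have h5 := hv.2
  rw [mem_preimage, h4, mem_polyChart_source] at h5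
  obtain ⟨h6, h7, h8⟩ := h5
  rw [h4, polyChart_apply hp A D y _ h6]
  obtain ⟨t, ⟨ht1, ht2, ht3⟩, ht4⟩ := hj
  have h9 := eq_sec_of_mem_sheet hp y.base h6 i ⟨t, ht4⟩ ht1
  specialize h8 i
  dsimp only at h8 ⊢
  rw [← h9] at h8
  subst ht3
  refine ⟨⟨h2 _, h8⟩, ?_⟩
  rw [← h9]

lemma contDiffOn_polyChart (x y : PolySpace p X) :
    ContDiffOn ℝ ∞ (polyChart hp A D y ∘ (polyChart hp A D x).symm)
      ((polyChart hp A D x).target ∩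
        (polyChart hp A D x).symm ⁻¹' (polyChart hp A D y).source) := by
  set S := (polyChart hp A D x).target ∩
        (polyChart hp A D x).symm ⁻¹' (polyChart hp A D y).source with hS
  suffices h : ContDiffOn ℝ ∞ (fun v => (polyChart hp A D y ((polyChart hp A D x).symm v)).1) S ∧
      ∀ i, ContDiffOn ℝ ∞ (fun v => (polyChart hp A D y ((polyChart hp A D x).symm v)).2 i) S from
    h.1.prodMk (contDiffOn_pi.2 h.2)
  constructor
  · refine ((A.contDiffOn x.base y.base).comp contDiff_fst.contDiffOn (s := S) ?_).congr ?_
    · intro v hv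
      obtain ⟨h1, h2, -, -⟩ := polyChart_symm_apply hp A D x y hv
      exact ⟨h1, h2⟩
    · intro v hv
      exact (polyChart_symm_apply hp A D x y hv).2.2.1
  · intro i v hv
    obtain ⟨h1, h2, -, h3⟩ := polyChart_symm_apply hp A D x y hv
    obtain ⟨j, hj⟩ := h3 i
    have hopen : IsOpen (p '' (sheet hp y.base i ∩ sheet hp x.base j)) :=
      hp.isOpenMap _ ((isOpen_sheet hp y.base i).inter (isOpen_sheet hp x.base j))
    have hcont : ContinuousAt (fun w : A.V x.base × (∀ i : p ⁻¹' {x.base}, D.V (coord hp x i)) =>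
        (A.chart x.base).symm w.1) v :=
      ContinuousAt.comp (f := Prod.fst) ((A.chart x.base).continuousAt_symm h1) continuousAt_fst
    have hev := hcont.eventually (hopen.mem_nhds hj)
    have h4 := polyChart_symm_apply_snd hp A D x y hv i j hj
    have h5 := (D.contDiffOn (coord hp x j) (coord hp y i)).contDiffAt
      (((D.chart (coord hp x j)).isOpen_inter_preimage_symm
        (D.chart (coord hp y i)).open_source).mem_nhds h4.1)
    have h6 : ContDiffAt ℝ ∞
        (fun w : A.V x.base × (∀ i : p ⁻¹' {x.base}, D.V (coord hp x i)) => w.2 j) v :=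
      (contDiff_pi.1 contDiff_snd j).contDiffAt
    have h7 := ContDiffAt.comp (g := D.chart (coord hp y i) ∘ (D.chart (coord hp x j)).symm) v h5 h6
    refine h7.contDiffWithinAt.congr_of_eventuallyEq ?_ h4.2
    filter_upwards [self_mem_nhdsWithin, nhdsWithin_le_nhds hev] with w hw hw'
    exact (polyChart_symm_apply_snd hp A D x y hw i j hw').2

end

/-- The charts of `p(X)`: locally, `p(X)` is the product `B × Xⁿ`. -/
def charts [∀ b, Finite (p ⁻¹' {b})] {d : B → ℕ} {e : X → ℕ} (A : Charts B d) (D : Charts X e) :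
    Charts (PolySpace p X) (dim d e) where
  V x := A.V x.base × (∀ i : p ⁻¹' {x.base}, D.V (coord hp x i))
  finrank_eq x := by
    rw [Module.finrank_prod, Module.finrank_pi_fintype, A.finrank_eq, dim,
      finsum_eq_sum_of_fintype,
      ← (secEquiv hp x.base (mem_nbhd hp x.base)).sum_comp (fun t => e (x.map t))]
    exact congrArg _ (Finset.sum_congr rfl fun i _ => D.finrank_eq _)
  chart x := polyChart hp A D x
  mem_source x := (mem_polyChart_source hp A D x x).2
    ⟨mem_nbhd hp x.base, A.mem_source _, fun _ => D.mem_source _⟩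
  dim_eq x y hy := by
    obtain ⟨h, h1, h2⟩ := (mem_polyChart_source hp A D x y).1 hy
    rw [dim, dim, A.dim_eq _ _ h1, finsum_eq_sum_of_fintype, finsum_eq_sum_of_fintype,
      ← (secEquiv hp x.base (mem_nbhd hp x.base)).sum_comp, ← (secEquiv hp x.base h).sum_comp]
    exact congrArg _ (Finset.sum_congr rfl fun i _ => D.dim_eq _ _ (h2 i))
  contDiffOn x y := contDiffOn_polyChart hp A D x y

end PolySpace
end PolySpace

/-! ### Finite coverings of closed manifolds -/

/-- A finite covering of a closed manifold.  The degree need not be constant, and fibres may be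
empty.  (The total space is compact Hausdorff, and inherits a smooth structure from the base.) -/
structure ClosedCovering where
  base : ClosedManifold
  total : Type
  [topology : TopologicalSpace total]
  proj : total → base.carrier
  isCoveringMap : IsCoveringMap proj
  [finite_fiber : ∀ b, Finite (proj ⁻¹' {b})]

attribute [instance] ClosedCovering.topology ClosedCovering.finite_fiber

lemma isLocalHomeomorph_pullback {T B Y : Type} [TopologicalSpace T] [TopologicalSpace B]
    [TopologicalSpace Y] {p : T → B} (hp : IsLocalHomeomorph p) {g : Y → B} (hg : Continuous g) :
    IsLocalHomeomorph (fun z : Function.Pullback g p => z.fst) := by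
  refine IsLocalHomeomorph.mk _ fun z => ?_
  obtain ⟨e, hz, rfl⟩ := hp z.snd
  classical
  refine ⟨{ toFun := fun w => w.fst
            invFun := fun y =>
              if h : g y ∈ e.target then ⟨(y, e.symm (g y)), (e.right_inv h).symm⟩ else z
            source := {w | w.snd ∈ e.source}
            target := {y | g y ∈ e.target}
            map_source' := ?_
            map_target' := ?_
            left_inv' := ?_
            right_inv' := ?_
            open_source := ?_
            open_target := ?_
            continuousOn_toFun := ?_
            continuousOn_invFun := ?_ }, hz, fun _ _ => rfl⟩
  · intro w hw
    change g w.1.1 ∈ e.target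
    rw [w.2]
    exact e.map_source hw
  · intro y (hy : g y ∈ e.target)
    rw [dif_pos hy]
    exact e.map_target hy
  · intro w hw
    have h : g w.1.1 ∈ e.target := by
      rw [w.2]
      exact e.map_source hw
    refine (dif_pos h).trans ?_
    refine Subtype.ext (Prod.ext rfl ?_)
    change e.symm (g w.1.1) = w.1.2
    rw [w.2]
    exact e.left_inv hw
  · intro y (hy : g y ∈ e.target)
    rw [dif_pos hy]
    rfl
  · exact (continuous_fst.comp continuous_subtype_val).continuousOn
  · refine IsInducing.subtypeVal.continuousOn_iff.2 ?_
    refine (continuousOn_id.prodMk (e.continuousOn_symm.comp hg.continuousOn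
      (s := {y | g y ∈ e.target}) fun y hy => hy)).congr ?_
    intro y (hy : g y ∈ e.target)
    simp [hy]
  · exact e.open_source.preimage (continuous_snd.comp continuous_subtype_val)
  · exact e.open_target.preimage hg

lemma isLocalHomeomorph_sumElim {S T B : Type} [TopologicalSpace S] [TopologicalSpace T]
    [TopologicalSpace B] {f : S → B} {g : T → B} (hf : IsLocalHomeomorph f)
    (hg : IsLocalHomeomorph g) : IsLocalHomeomorph (Sum.elim f g) := by
  refine IsLocalHomeomorph.mk _ ?_
  rintro (s | t)
  · have : Nonempty S := ⟨s⟩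
    obtain ⟨e, he, rfl⟩ := hf s
    have key (z : S) := IsOpenEmbedding.toOpenPartialHomeomorph_left_inv (Sum.inl : S → S ⊕ T)
      IsOpenEmbedding.inl (x := z)
    refine ⟨(IsOpenEmbedding.inl.toOpenPartialHomeomorph (Sum.inl : S → S ⊕ T)).symm ≫ₕ e, ?_, ?_⟩
    · simpa [key] using he
    · rintro (z | z) hz
      · simp [key]
      · simp at hz
  · have : Nonempty T := ⟨t⟩
    obtain ⟨e, he, rfl⟩ := hg t
    have key (z : T) := IsOpenEmbedding.toOpenPartialHomeomorph_left_inv (Sum.inr : T → S ⊕ T)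
      IsOpenEmbedding.inr (x := z)
    refine ⟨(IsOpenEmbedding.inr.toOpenPartialHomeomorph (Sum.inr : T → S ⊕ T)).symm ≫ₕ e, ?_, ?_⟩
    · simpa [key] using he
    · rintro (z | z) hz
      · simp at hz
      · simp [key]

lemma isLocalHomeomorph_prodMap {S T A B : Type} [TopologicalSpace S] [TopologicalSpace T]
    [TopologicalSpace A] [TopologicalSpace B] {f : S → A} {g : T → B} (hf : IsLocalHomeomorph f)
    (hg : IsLocalHomeomorph g) : IsLocalHomeomorph (Prod.map f g) := by
  refine IsLocalHomeomorph.mk _ ?_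
  rintro ⟨s, t⟩
  obtain ⟨e, he, rfl⟩ := hf s
  obtain ⟨e', he', rfl⟩ := hg t
  exact ⟨e.prod e', ⟨he, he'⟩, fun _ _ => rfl⟩

lemma finite_fiber_of_isCoveringMap {T B : Type} [TopologicalSpace T] [TopologicalSpace B]
    [CompactSpace T] [T1Space B] {p : T → B} (hp : IsCoveringMap p) (b : B) :
    Finite (p ⁻¹' {b}) := by
  have := (hp b).1
  have : CompactSpace (p ⁻¹' {b}) :=
    isCompact_iff_compactSpace.1 (isClosed_singleton.preimage hp.continuous).isCompact
  exact finite_of_compact_of_discrete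

namespace ClosedCovering

instance (p : ClosedCovering) : T2Space p.total := PolySpace.t2Space_total p.isCoveringMap

instance (p : ClosedCovering) : CompactSpace p.total :=
  PolySpace.compactSpace_total p.isCoveringMap

/-- A local homeomorphism from a compact Hausdorff space to a closed manifold is a finite
covering. -/
def ofIsLocalHomeomorph (M : ClosedManifold) {T : Type} [TopologicalSpace T] [T2Space T]
    [CompactSpace T] (f : T → M.carrier) (hf : IsLocalHomeomorph f) : ClosedCovering where
  base := M
  total := T
  proj := f
  isCoveringMap := isLocalHomeomorph_iff_isCoveringMap.1 hf
  finite_fiber := finite_fiber_of_isCoveringMap (isLocalHomeomorph_iff_isCoveringMap.1 hf)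

/-- The sum `p + q`, with `(p + q)(X) = p(X) + q(X)`: the disjoint union of the two coverings. -/
def sum (p q : ClosedCovering) : ClosedCovering :=
  ofIsLocalHomeomorph (p.base.sum q.base) (T := p.total ⊕ q.total)
    (Sum.elim (fun t => Sum.inl (p.proj t)) (fun t => Sum.inr (q.proj t)))
    (isLocalHomeomorph_sumElim
      (IsOpenEmbedding.inl.isLocalHomeomorph.comp p.isCoveringMap.isLocalHomeomorph)
      (IsOpenEmbedding.inr.isLocalHomeomorph.comp q.isCoveringMap.isLocalHomeomorph))

/-- The product `p × q`, with `(p × q)(X) = p(X) × q(X)`: the base is the product of the bases, and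
the fibre over `(b, c)` is the disjoint union of the fibres of `p` over `b` and of `q` over `c`. -/
def prod (p q : ClosedCovering) : ClosedCovering :=
  ofIsLocalHomeomorph (p.base.prod q.base)
    (T := (p.total × q.base.carrier) ⊕ (p.base.carrier × q.total))
    (Sum.elim (fun z => (p.proj z.1, z.2)) (fun z => (z.1, q.proj z.2)))
    (isLocalHomeomorph_sumElim
      (isLocalHomeomorph_prodMap p.isCoveringMap.isLocalHomeomorph
        (Homeomorph.refl _).isLocalHomeomorph)
      (isLocalHomeomorph_prodMap (Homeomorph.refl _).isLocalHomeomorph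
        q.isCoveringMap.isLocalHomeomorph))

/-- For a covering `p : T → B` and a closed manifold `M`, the closed manifold `p(M)`. -/
def apply (p : ClosedCovering) (M : ClosedManifold) : ClosedManifold :=
  haveI := PolySpace.t2Space (X := M.carrier) p.isCoveringMap
  haveI := PolySpace.compactSpace (X := M.carrier) p.isCoveringMap
  (PolySpace.charts p.isCoveringMap p.base.charts M.charts).toClosedManifold

/-- The evaluation `((b, u), t) ↦ u(t)`, for `t` over `b`. -/
def eval {T B X : Type} {p : T → B}
    (z : Function.Pullback (PolySpace.base : PolySpace p X → B) p) : X :=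
  z.fst.map ⟨z.snd, z.2.symm⟩

lemma continuous_eval {T B X : Type} [TopologicalSpace T] [TopologicalSpace B] [TopologicalSpace X]
    {p : T → B} (hp : IsLocalHomeomorph p) :
    Continuous (eval : Function.Pullback (PolySpace.base : PolySpace p X → B) p → X) := by
  rw [continuous_def]
  intro O hO
  rw [isOpen_iff_mem_nhds]
  intro z hz
  obtain ⟨e, he, rfl⟩ := hp z.snd
  have h1 : IsOpen {w : Function.Pullback (PolySpace.base : PolySpace e X → B) e |
      w.fst ∈ PolySpace.hit e e.source O ∧ w.snd ∈ e.source} :=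
    ((PolySpace.isOpen_hit e e.open_source hO).preimage
      (continuous_fst.comp continuous_subtype_val)).inter
      (e.open_source.preimage (continuous_snd.comp continuous_subtype_val))
  refine Filter.mem_of_superset (h1.mem_nhds ⟨⟨⟨z.snd, z.2.symm⟩, he, hz⟩, he⟩) ?_
  rintro w ⟨⟨t, ht, hO'⟩, hw⟩
  have : t = ⟨w.snd, w.2.symm⟩ := Subtype.ext (e.injOn ht hw (t.2.trans w.2))
  rw [this] at hO'
  exact hO'

lemma compactSpace_pullback {X Y Z : Type} [TopologicalSpace X] [TopologicalSpace Y]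
    [TopologicalSpace Z] [CompactSpace X] [CompactSpace Z] [T2Space Y] {f : X → Y} {g : Z → Y}
    (hf : Continuous f) (hg : Continuous g) : CompactSpace (Function.Pullback f g) :=
  isCompact_iff_compactSpace.1
    (isClosed_eq (hf.comp continuous_fst) (hg.comp continuous_snd)).isCompact

/-- The composition `p ∘ q`, with `(p ∘ q)(X) = p(q(X))`.  For `p : T → B` and `q : S → C` the base
is `p(C)`, and the fibre over `(b, u)` is the set of pairs `(t, s)` with `p t = b` and
`q s = u(t)`. -/
def comp (p q : ClosedCovering) : ClosedCovering :=
  have hp := p.isCoveringMap.isLocalHomeomorph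
  have hb := PolySpace.continuous_base (X := q.base.carrier) p.proj
  have he := continuous_eval (X := q.base.carrier) hp
  haveI := PolySpace.t2Space (X := q.base.carrier) p.isCoveringMap
  haveI := PolySpace.compactSpace (X := q.base.carrier) p.isCoveringMap
  haveI := compactSpace_pullback hb hp.continuous
  haveI := compactSpace_pullback he q.isCoveringMap.continuous
  ofIsLocalHomeomorph (p.apply q.base)
    (T := Function.Pullback
      (eval : Function.Pullback (PolySpace.base : PolySpace p.proj q.base.carrier → _) p.proj → _)
      q.proj)
    (fun z => z.fst.fst)
    ((isLocalHomeomorph_pullback hp hb).comp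
      (isLocalHomeomorph_pullback q.isCoveringMap.isLocalHomeomorph he))

/-! ### Cobordism -/

/-- The union of the components of the base of dimension `n`, as an `n`-manifold. -/
abbrev basePart (p : ClosedCovering) (n : ℕ) : Type := p.base.part n

/-- The part of the total space lying over the components of the base of dimension `n`. -/
abbrev totalPart (p : ClosedCovering) (n : ℕ) : Type := {t : p.total // p.base.dim (p.proj t) = n}

/-- The covering over the components of the base of dimension `n`. -/
def projPart (p : ClosedCovering) (n : ℕ) (t : p.totalPart n) : p.basePart n :=
  ⟨p.proj t.1, t.2⟩

/-- Two coverings of closed manifolds are cobordant if together they form the boundary of a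
covering: for every `n` there are a compact smooth `(n + 1)`-manifold `W` with boundary and a finite
covering `P : S → W`, together with a diffeomorphism `i` (a bijective smooth immersion) of the
disjoint union of the `n`-dimensional parts of the two bases onto the boundary of `W`, covered by a
homeomorphism `j` (a continuous bijection of compact Hausdorff spaces) of the disjoint union of the
total spaces onto the part of `S` lying over the boundary.  As the bases are compact, their
`n`-dimensional parts are nonempty for finitely many `n` only. -/
def Cobordant (p q : ClosedCovering) : Prop :=
  ∀ n : ℕ, ∃ (W : Type) (_ : TopologicalSpace W) (_ : T2Space W) (_ : CompactSpace W)
    (_ : ChartedSpace (EuclideanHalfSpace (n + 1)) W) (_ : IsManifold (𝓡∂ (n + 1)) ∞ W)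
    (S : Type) (_ : TopologicalSpace S) (P : S → W)
    (i : p.basePart n ⊕ q.basePart n → W) (j : p.totalPart n ⊕ q.totalPart n → S),
    IsCoveringMap P ∧ (∀ w, Finite (P ⁻¹' {w})) ∧
    ContMDiff (𝓡 n) (𝓡∂ (n + 1)) ∞ i ∧
    (∀ x, Function.Injective (mfderiv (𝓡 n) (𝓡∂ (n + 1)) i x)) ∧
    Function.Injective i ∧ range i = (𝓡∂ (n + 1)).boundary W ∧
    Continuous j ∧ Function.Injective j ∧ range j = P ⁻¹' (𝓡∂ (n + 1)).boundary W ∧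
    ∀ t, P (j t) = i (Sum.map (p.projPart n) (q.projPart n) t)

end ClosedCovering

/-- The set `N_*Σ` of cobordism classes of closed coverings (formally the quotient by the
equivalence relation generated by cobordism, which is itself an equivalence relation). -/
def CobordismClasses : Type 1 := Quot ClosedCovering.Cobordant

namespace CobordismClasses

/-- The cobordism class of a closed covering. -/
def mk (p : ClosedCovering) : CobordismClasses := Quot.mk _ p

/-- The set `N_dΣ` of cobordism classes of coverings of closed manifolds of dimension `d`. -/
def ofDim (d : ℕ) : Set CobordismClasses :=
  {a | ∃ p : ClosedCovering, (∀ x, p.base.dim x = d) ∧ mk p = a}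

/-- The set `N_dΣ_n` of cobordism classes of `n`-fold coverings of closed manifolds of
dimension `d`. -/
def ofDimDegree (d n : ℕ) : Set CobordismClasses :=
  {a | ∃ p : ClosedCovering, (∀ x, p.base.dim x = d) ∧ (∀ x, Nat.card (p.proj ⁻¹' {x}) = n) ∧
    mk p = a}

end CobordismClasses

end CoveringBordism

end

open Set Topology
open scoped Manifold ContDiff

noncomputable section

namespace CoveringBordism

namespace Charts

section Smooth

variable {X Y Z : Type} [TopologicalSpace X] [TopologicalSpace Y] [TopologicalSpace Z]
  {dX : X → ℕ} {dY : Y → ℕ} {dZ : Z → ℕ}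

/-- Smoothness of a map at a point, in terms of the charts around the point and its image. -/
def SmoothAt (A : Charts X dX) (B : Charts Y dY) (f : X → Y) (x : X) : Prop :=
  ContinuousAt f x ∧ ContDiffAt ℝ ∞ (B.chart (f x) ∘ f ∘ (A.chart x).symm) (A.chart x x)

variable {A : Charts X dX} {B : Charts Y dY} {C : Charts Z dZ} {f g : X → Y} {x : X}

lemma contDiffAt_transition (A : Charts X dX) {x x₀ x₁ : X} (h₀ : x ∈ (A.chart x₀).source)
    (h₁ : x ∈ (A.chart x₁).source) :
    ContDiffAt ℝ ∞ (A.chart x₁ ∘ (A.chart x₀).symm) (A.chart x₀ x) := by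
  refine (A.contDiffOn x₀ x₁).contDiffAt
    (((A.chart x₀).isOpen_inter_preimage_symm (A.chart x₁).open_source).mem_nhds ?_)
  refine ⟨(A.chart x₀).map_source h₀, ?_⟩
  rwa [mem_preimage, (A.chart x₀).left_inv h₀]

lemma contDiffAt_change_charts (hf : ContinuousAt f x) {x₀ x₁ : X} {y₀ y₁ : Y}
    (hx₀ : x ∈ (A.chart x₀).source) (hx₁ : x ∈ (A.chart x₁).source)
    (hy₀ : f x ∈ (B.chart y₀).source) (hy₁ : f x ∈ (B.chart y₁).source)
    (h : ContDiffAt ℝ ∞ (B.chart y₀ ∘ f ∘ (A.chart x₀).symm) (A.chart x₀ x)) :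
    ContDiffAt ℝ ∞ (B.chart y₁ ∘ f ∘ (A.chart x₁).symm) (A.chart x₁ x) := by
  have h1 := A.contDiffAt_transition hx₁ hx₀
  have e1 : (A.chart x₀ ∘ (A.chart x₁).symm) (A.chart x₁ x) = A.chart x₀ x := by
    simp [(A.chart x₁).left_inv hx₁]
  have h2 := B.contDiffAt_transition hy₀ hy₁
  have e2 : (B.chart y₀ ∘ f ∘ (A.chart x₀).symm) (A.chart x₀ x) = B.chart y₀ (f x) := by
    simp [(A.chart x₀).left_inv hx₀]
  rw [← e1] at h
  have h3 := h.comp _ h1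
  rw [← e2, ← e1] at h2
  have h4 := ContDiffAt.comp (g := B.chart y₁ ∘ (B.chart y₀).symm)
    (f := (B.chart y₀ ∘ f ∘ (A.chart x₀).symm) ∘ (A.chart x₀ ∘ (A.chart x₁).symm))
    (A.chart x₁ x) h2 h3
  refine h4.congr_of_eventuallyEq ?_
  have c1 : ContinuousAt (A.chart x₁).symm (A.chart x₁ x) :=
    (A.chart x₁).continuousAt_symm ((A.chart x₁).map_source hx₁)
  have t1 : Filter.Tendsto (A.chart x₁).symm (𝓝 (A.chart x₁ x)) (𝓝 x) := by
    have := c1.tendsto; rwa [(A.chart x₁).left_inv hx₁] at this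
  filter_upwards [t1.eventually ((A.chart x₀).open_source.mem_nhds hx₀),
    t1.eventually (hf.eventually ((B.chart y₀).open_source.mem_nhds hy₀))] with v hv1 hv2
  simp [(A.chart x₀).left_inv hv1, (B.chart y₀).left_inv hv2]

lemma smoothAt_iff_of_mem_source {x₀ : X} {y₀ : Y} (hx : x ∈ (A.chart x₀).source)
    (hy : f x ∈ (B.chart y₀).source) :
    SmoothAt A B f x ↔ ContinuousAt f x ∧
      ContDiffAt ℝ ∞ (B.chart y₀ ∘ f ∘ (A.chart x₀).symm) (A.chart x₀ x) :=
  and_congr_right fun hf => ⟨contDiffAt_change_charts hf (A.mem_source x) hx (B.mem_source _) hy,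
    contDiffAt_change_charts hf hx (A.mem_source x) hy (B.mem_source _)⟩

lemma tendsto_chart_symm (A : Charts X dX) {x x₀ : X} (h : x ∈ (A.chart x₀).source) :
    Filter.Tendsto (A.chart x₀).symm (𝓝 (A.chart x₀ x)) (𝓝 x) := by
  have := ((A.chart x₀).continuousAt_symm ((A.chart x₀).map_source h)).tendsto
  rwa [(A.chart x₀).left_inv h] at this

lemma SmoothAt.congr (h : SmoothAt A B f x) (hfg : g =ᶠ[𝓝 x] f) : SmoothAt A B g x := by
  refine ⟨h.1.congr hfg.symm, ?_⟩
  rw [hfg.eq_of_nhds]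
  refine h.2.congr_of_eventuallyEq ?_
  filter_upwards [(A.tendsto_chart_symm (A.mem_source x)).eventually hfg] with v hv
  simp [hv]

lemma SmoothAt.comp {g : Y → Z} (hg : SmoothAt B C g (f x)) (hf : SmoothAt A B f x) :
    SmoothAt A C (g ∘ f) x := by
  refine ⟨hg.1.comp hf.1, ?_⟩
  have e : (B.chart (f x) ∘ f ∘ (A.chart x).symm) (A.chart x x) = B.chart (f x) (f x) := by
    simp [(A.chart x).left_inv (A.mem_source x)]
  have h := hg.2
  rw [← e] at h
  refine (h.comp _ hf.2).congr_of_eventuallyEq ?_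
  filter_upwards [(A.tendsto_chart_symm (A.mem_source x)).eventually
    (hf.1.eventually ((B.chart (f x)).open_source.mem_nhds (B.mem_source _)))] with v hv
  simp [(B.chart (f x)).left_inv hv]

lemma SmoothAt.comp_of_eq {g : Y → Z} {y : Y} (hg : SmoothAt B C g y) (hf : SmoothAt A B f x)
    (h : f x = y) : SmoothAt A C (g ∘ f) x := by
  subst h; exact hg.comp hf

lemma smoothAt_id : SmoothAt A A id x := by
  refine ⟨continuousAt_id, ?_⟩
  exact A.contDiffAt_transition (A.mem_source x) (A.mem_source x)

lemma smoothAt_const {y : Y} : SmoothAt A B (fun _ => y) x :=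
  ⟨continuousAt_const, contDiffAt_const (c := B.chart y y)⟩

/-- The charts of a vector space. -/
def model (E : Type) [NormedAddCommGroup E] [NormedSpace ℝ E] [FiniteDimensional ℝ E] :
    Charts E (fun _ => Module.finrank ℝ E) where
  V _ := E
  finrank_eq _ := rfl
  chart _ := OpenPartialHomeomorph.refl E
  mem_source _ := mem_univ _
  dim_eq _ _ _ := rfl
  contDiffOn _ _ := contDiffOn_id

section Model

variable {E F : Type} [NormedAddCommGroup E] [NormedSpace ℝ E] [FiniteDimensional ℝ E]
  [NormedAddCommGroup F] [NormedSpace ℝ F] [FiniteDimensional ℝ F]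

lemma continuousAt_of_comp_chart_symm {W : Type} [TopologicalSpace W] {h : X → W} {x₀ : X}
    (hx : x ∈ (A.chart x₀).source)
    (hc : ContinuousAt (h ∘ (A.chart x₀).symm) (A.chart x₀ x)) : ContinuousAt h x := by
  have h1 : ContinuousAt ((h ∘ (A.chart x₀).symm) ∘ A.chart x₀) x :=
    hc.comp ((A.chart x₀).continuousAt hx)
  refine h1.congr ?_
  filter_upwards [(A.chart x₀).open_source.mem_nhds hx] with y hy
  simp [(A.chart x₀).left_inv hy]

lemma smoothAt_model_iff {h : X → E} {x₀ : X} (hx : x ∈ (A.chart x₀).source) :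
    SmoothAt A (model E) h x ↔ ContDiffAt ℝ ∞ (h ∘ (A.chart x₀).symm) (A.chart x₀ x) := by
  rw [smoothAt_iff_of_mem_source hx (y₀ := h x) (mem_univ _)]
  exact ⟨fun h => h.2, fun hh => ⟨continuousAt_of_comp_chart_symm hx hh.continuousAt, hh⟩⟩

lemma smoothAt_model_model_iff {h : E → F} {v : E} :
    SmoothAt (model E) (model F) h v ↔ ContDiffAt ℝ ∞ h v :=
  smoothAt_model_iff (A := model E) (x₀ := v) (mem_univ _)

lemma smoothAt_chart (A : Charts X dX) {x x₀ : X} (h : x ∈ (A.chart x₀).source) :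
    SmoothAt A (model (A.V x₀)) (A.chart x₀) x := by
  rw [smoothAt_model_iff h]
  refine contDiffAt_id.congr_of_eventuallyEq ?_
  filter_upwards [(A.chart x₀).open_target.mem_nhds ((A.chart x₀).map_source h)] with v hv
  simp [(A.chart x₀).right_inv hv]

lemma smoothAt_chart_symm (A : Charts X dX) {x₀ : X} {v : A.V x₀} (h : v ∈ (A.chart x₀).target) :
    SmoothAt (model (A.V x₀)) A (A.chart x₀).symm v := by
  rw [smoothAt_iff_of_mem_source (x₀ := v) (y₀ := x₀) (mem_univ _) ((A.chart x₀).map_target h)]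
  refine ⟨(A.chart x₀).continuousAt_symm h, contDiffAt_id.congr_of_eventuallyEq ?_⟩
  change ∀ᶠ w in 𝓝 v, _
  filter_upwards [(A.chart x₀).open_target.mem_nhds h] with w hw
  exact (A.chart x₀).right_inv hw

end Model

/-- Smoothness into a space with charts can be tested after composition with a chart. -/
lemma smoothAt_iff_comp_chart {y₀ : Y} (hf : ContinuousAt f x) (hy : f x ∈ (B.chart y₀).source) :
    SmoothAt A B f x ↔ SmoothAt A (model (B.V y₀)) (B.chart y₀ ∘ f) x := by
  rw [smoothAt_iff_of_mem_source (A.mem_source x) hy, smoothAt_model_iff (A.mem_source x)]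
  exact and_iff_right hf

lemma smoothAt_iff_comp_chart_symm {x₀ : X} (hx : x ∈ (A.chart x₀).source) :
    SmoothAt A B f x ↔ SmoothAt (model (A.V x₀)) B (f ∘ (A.chart x₀).symm) (A.chart x₀ x) := by
  constructor
  · intro h
    exact h.comp_of_eq (A.smoothAt_chart_symm ((A.chart x₀).map_source hx))
      ((A.chart x₀).left_inv hx)
  · intro h
    refine (SmoothAt.comp h (A.smoothAt_chart hx)).congr ?_
    filter_upwards [(A.chart x₀).open_source.mem_nhds hx] with y hy
    simp [(A.chart x₀).left_inv hy]

/-! Products -/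

lemma smoothAt_fst {z : X × Y} : SmoothAt (A.prod B) A Prod.fst z := by
  refine ⟨continuousAt_fst, ?_⟩
  have h := A.contDiffAt_transition (A.mem_source z.1) (A.mem_source z.1)
  exact ContDiffAt.comp (f := Prod.fst) ((A.prod B).chart z z) h contDiffAt_fst

lemma smoothAt_snd {z : X × Y} : SmoothAt (A.prod B) B Prod.snd z := by
  refine ⟨continuousAt_snd, ?_⟩
  have h := B.contDiffAt_transition (B.mem_source z.2) (B.mem_source z.2)
  exact ContDiffAt.comp (f := Prod.snd) ((A.prod B).chart z z) h contDiffAt_snd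

lemma SmoothAt.prodMk {h : X → Z} (hf : SmoothAt A B f x) (hh : SmoothAt A C h x) :
    SmoothAt A (B.prod C) (fun x => (f x, h x)) x :=
  ⟨hf.1.prodMk hh.1, hf.2.prodMk hh.2⟩

lemma SmoothAt.fst {f : X → Y × Z} (hf : SmoothAt A (B.prod C) f x) :
    SmoothAt A B (fun x => (f x).1) x := smoothAt_fst.comp hf

lemma SmoothAt.snd {f : X → Y × Z} (hf : SmoothAt A (B.prod C) f x) :
    SmoothAt A C (fun x => (f x).2) x := smoothAt_snd.comp hf

lemma smoothAt_prod_iff {f : X → Y × Z} : SmoothAt A (B.prod C) f x ↔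
    SmoothAt A B (fun x => (f x).1) x ∧ SmoothAt A C (fun x => (f x).2) x :=
  ⟨fun h => ⟨h.fst, h.snd⟩, fun h => h.1.prodMk h.2⟩

lemma smoothAt_model_prod {E F : Type} [NormedAddCommGroup E] [NormedSpace ℝ E]
    [FiniteDimensional ℝ E] [NormedAddCommGroup F] [NormedSpace ℝ F] [FiniteDimensional ℝ F]
    {f : X → E × F} : SmoothAt A ((model E).prod (model F)) f x ↔ SmoothAt A (model (E × F)) f x := by
  rw [smoothAt_prod_iff, smoothAt_model_iff (A.mem_source x), smoothAt_model_iff (A.mem_source x),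
    smoothAt_model_iff (A.mem_source x)]
  exact ⟨fun h => h.1.prodMk h.2, fun h => ⟨contDiffAt_fst.comp _ h, contDiffAt_snd.comp _ h⟩⟩

/-! Disjoint unions -/

lemma smoothAt_inl {x : X} : SmoothAt A (A.sum B) Sum.inl x := by
  refine ⟨continuous_inl.continuousAt, ?_⟩
  refine (A.contDiffAt_transition (A.mem_source x) (A.mem_source x)).congr_of_eventuallyEq ?_
  filter_upwards with v
  exact A.inlChart_inl x _

lemma smoothAt_inr {y : Y} : SmoothAt B (A.sum B) Sum.inr y := by
  refine ⟨continuous_inr.continuousAt, ?_⟩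
  refine (B.contDiffAt_transition (B.mem_source y) (B.mem_source y)).congr_of_eventuallyEq ?_
  filter_upwards with v
  exact B.inrChart_inr y _

lemma smoothAt_sum_inl {f : X ⊕ Y → Z} {x : X} :
    SmoothAt (A.sum B) C f (Sum.inl x) ↔ SmoothAt A C (f ∘ Sum.inl) x := by
  refine ⟨fun h => h.comp smoothAt_inl, fun h => ⟨?_, ?_⟩⟩
  · exact IsOpenEmbedding.inl.continuousAt_iff.1 h.1
  · have h2 := h.2
    have e : (A.sum B).chart (Sum.inl x) (Sum.inl x) = A.chart x x := A.inlChart_inl x x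
    rw [e]
    exact h2

lemma smoothAt_sum_inr {f : X ⊕ Y → Z} {y : Y} :
    SmoothAt (A.sum B) C f (Sum.inr y) ↔ SmoothAt B C (f ∘ Sum.inr) y := by
  refine ⟨fun h => h.comp smoothAt_inr, fun h => ⟨?_, ?_⟩⟩
  · exact IsOpenEmbedding.inr.continuousAt_iff.1 h.1
  · have h2 := h.2
    have e : (A.sum B).chart (Sum.inr y) (Sum.inr y) = B.chart y y := B.inrChart_inr y y
    rw [e]
    exact h2

/-! Charts pulled back along a local homeomorphism -/

/-- The charts of the source of a local homeomorphism. -/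
def comap (B : Charts Y dY) {f : X → Y} (hf : IsLocalHomeomorph f) : Charts X (dY ∘ f) where
  V x := B.V (f x)
  finrank_eq x := B.finrank_eq (f x)
  chart x := (hf x).choose ≫ₕ B.chart (f x)
  mem_source x := by
    have h := (hf x).choose_spec
    rw [OpenPartialHomeomorph.trans_source]
    exact ⟨h.1, by rw [mem_preimage, ← h.2]; exact B.mem_source _⟩
  dim_eq x y hy := by
    have h := (hf x).choose_spec
    rw [OpenPartialHomeomorph.trans_source] at hy
    have hy2 := hy.2
    rw [mem_preimage, ← h.2] at hy2
    exact B.dim_eq _ _ hy2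
  contDiffOn x y := by
    have hx := (hf x).choose_spec
    have hy := (hf y).choose_spec
    have key : ∀ v ∈ ((hf x).choose ≫ₕ B.chart (f x)).target,
        f (((hf x).choose ≫ₕ B.chart (f x)).symm v) = (B.chart (f x)).symm v := by
      intro v hv
      rw [OpenPartialHomeomorph.trans_target] at hv
      have := (hf x).choose.right_inv hv.2
      rw [← hx.2] at this
      exact this
    refine ((B.contDiffOn (f x) (f y)).mono ?_).congr ?_
    · rintro v ⟨hv1, hv2⟩
      have h1 := key v hv1
      refine ⟨hv1.1, ?_⟩
      rw [mem_preimage, OpenPartialHomeomorph.trans_source] at hv2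
      have h3 := hv2.2
      rw [mem_preimage, ← hy.2, h1] at h3
      exact h3
    · rintro v ⟨hv1, hv2⟩
      have h1 := key v hv1
      rw [Function.comp_apply, OpenPartialHomeomorph.coe_trans, Function.comp_apply, ← hy.2, h1]
      rfl

lemma comap_chart_apply (B : Charts Y dY) {f : X → Y} (hf : IsLocalHomeomorph f) (x z : X) :
    (B.comap hf).chart x z = B.chart (f x) (f z) := by
  have h := (hf x).choose_spec
  change B.chart (f x) ((hf x).choose z) = _
  rw [← h.2]

lemma smoothAt_comap_iff {h : Z → X} {z : Z} (hf : IsLocalHomeomorph f) (hc : ContinuousAt h z) :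
    SmoothAt C (B.comap hf) h z ↔ SmoothAt C B (f ∘ h) z := by
  have h1 : ((B.comap hf).chart (h z) ∘ h ∘ (C.chart z).symm) =
      B.chart ((f ∘ h) z) ∘ (f ∘ h) ∘ (C.chart z).symm := by
    funext v
    exact comap_chart_apply B hf _ _
  exact ⟨fun hh => ⟨hf.continuous.continuousAt.comp hc, by rw [← h1]; exact hh.2⟩,
    fun hh => ⟨hc, by rw [h1]; exact hh.2⟩⟩

lemma smoothAt_of_comap (hf : IsLocalHomeomorph f) : SmoothAt (B.comap hf) B f x :=
  (smoothAt_comap_iff hf (h := id) continuousAt_id).1 smoothAt_id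

/-- A continuous local section of a local homeomorphism is smooth. -/
lemma smoothAt_section (hf : IsLocalHomeomorph f) {σ : Y → X} {y : Y} (hσ : ContinuousAt σ y)
    (h : ∀ᶠ y' in 𝓝 y, f (σ y') = y') : SmoothAt B (B.comap hf) σ y :=
  (smoothAt_comap_iff hf hσ).2 (smoothAt_id.congr h)

lemma smoothAt_comap_of_comp (hf : IsLocalHomeomorph f) {h : Y → Z} (hh : SmoothAt B C h (f x)) :
    SmoothAt (B.comap hf) C (h ∘ f) x := hh.comp (smoothAt_of_comap hf)

end Smooth

/-! The closed manifold given by an atlas -/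

section Closed

variable {X : Type} [TopologicalSpace X] [T2Space X] [CompactSpace X] {dX : X → ℕ}
  (A : Charts X dX)

lemma partChart_toClosedManifold {n : ℕ} (x : {x // dX x = n}) (z : X) (hz : dX z = n) :
    A.toClosedManifold.partChart (n := n) x z = A.modelEquiv x (A.chart x.1 z) := by
  have : Nonempty (A.toClosedManifold.part n) := ⟨x⟩
  have := IsOpenEmbedding.toOpenPartialHomeomorph_left_inv
    (Subtype.val : A.toClosedManifold.part n → A.toClosedManifold.carrier)
    (A.toClosedManifold.isOpenEmbedding_part n) (x := ⟨z, hz⟩)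
  change A.partChart x
    ((IsOpenEmbedding.toOpenPartialHomeomorph _ (A.toClosedManifold.isOpenEmbedding_part n)).symm
      (Subtype.val (⟨z, hz⟩ : A.toClosedManifold.part n))) = _
  rw [this]
  rfl

lemma smoothAt_toClosedManifold (x : X) :
    SmoothAt A A.toClosedManifold.charts (id : X → X) x := by
  refine (smoothAt_iff_comp_chart (Y := A.toClosedManifold.carrier) (y₀ := x) continuousAt_id
    (A.toClosedManifold.charts.mem_source x)).2 ?_
  have h : SmoothAt A (model (EuclideanSpace ℝ (Fin (dX x))))
      (A.modelEquiv ⟨x, rfl⟩ ∘ A.chart x) x :=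
    SmoothAt.comp (smoothAt_model_model_iff.2 (A.modelEquiv ⟨x, rfl⟩).contDiff.contDiffAt)
      (A.smoothAt_chart (A.mem_source x))
  refine h.congr ?_
  filter_upwards [(A.chart x).open_source.mem_nhds (A.mem_source x)] with z hz
  exact A.partChart_toClosedManifold ⟨x, rfl⟩ z (A.dim_eq x z hz)

lemma smoothAt_ofClosedManifold (x : X) :
    SmoothAt A.toClosedManifold.charts A (id : X → X) x := by
  refine (smoothAt_iff_comp_chart (X := A.toClosedManifold.carrier) (y₀ := (x : X)) continuousAt_id
    (A.mem_source x)).2 ?_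
  have h1 : SmoothAt A.toClosedManifold.charts (model (EuclideanSpace ℝ (Fin (dX x))))
      (A.toClosedManifold.charts.chart x) x :=
    A.toClosedManifold.charts.smoothAt_chart (A.toClosedManifold.charts.mem_source x)
  have h2 : SmoothAt (model (EuclideanSpace ℝ (Fin (dX x)))) (model (A.V x))
      (A.modelEquiv ⟨x, rfl⟩).symm (A.toClosedManifold.charts.chart x x) :=
    smoothAt_model_model_iff.2 (A.modelEquiv ⟨x, rfl⟩).symm.contDiff.contDiffAt
  refine (h2.comp h1).congr ?_
  filter_upwards [(A.chart x).open_source.mem_nhds (A.mem_source x)] with z hz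
  have : A.toClosedManifold.charts.chart x z = A.modelEquiv ⟨x, rfl⟩ (A.chart x z) :=
    A.partChart_toClosedManifold ⟨x, rfl⟩ z (A.dim_eq x z hz)
  exact ((congrArg (A.modelEquiv ⟨x, rfl⟩).symm this).trans
    (ContinuousLinearEquiv.symm_apply_apply _ _)).symm

variable {A} {Y : Type} [TopologicalSpace Y] {dY : Y → ℕ} {B : Charts Y dY}

end Closed

end Charts

/-- A finite covering with Hausdorff total space, described as a proper local homeomorphism. -/
structure FiniteCovering {S X : Type} [TopologicalSpace S] [TopologicalSpace X] (P : S → X) :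
    Prop where
  t2 : T2Space S
  isLocalHomeomorph : IsLocalHomeomorph P
  isProperMap : IsProperMap P

namespace FiniteCovering

variable {R S X Y : Type} [TopologicalSpace R] [TopologicalSpace S] [TopologicalSpace X]
  [TopologicalSpace Y] {P : S → X}

lemma continuous (h : FiniteCovering P) : Continuous P := h.isProperMap.continuous

lemma finite_fiber (h : FiniteCovering P) (x : X) : Finite (P ⁻¹' {x}) := by
  have h1 : IsCompact (P ⁻¹' {x}) := h.isProperMap.isCompact_preimage isCompact_singleton
  refine (h1.finite (IsDiscrete.of_openPartialHomeomorph P (x := x) subset_rfl ?_)).to_subtype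
  intro e _
  obtain ⟨φ, hφ, h⟩ := h.isLocalHomeomorph e
  exact ⟨φ, hφ, h.symm⟩

lemma isCoveringMap (h : FiniteCovering P) : IsCoveringMap P := by
  have := h.t2
  rw [isCoveringMap_iff_isCoveringMapOn_univ]
  refine h.isProperMap.isClosedMap.isCoveringMapOn_of_isLocalHomeomorphOn
    (fun x _ => @Set.toFinite _ _ (h.finite_fiber x)) ?_
  exact h.isLocalHomeomorph.isLocalHomeomorphOn

lemma of_compactSpace [T2Space S] [CompactSpace S] [T2Space X] (h : IsLocalHomeomorph P) :
    FiniteCovering P := ⟨inferInstance, h, h.continuous.isProperMap⟩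

lemma of_isClosedMap [T2Space S] (h : IsLocalHomeomorph P) (hc : IsClosedMap P)
    (hf : ∀ x, Finite (P ⁻¹' {x})) : FiniteCovering P :=
  ⟨inferInstance, h, isProperMap_iff_isClosedMap_and_compact_fibers.2
    ⟨h.continuous, hc, fun x => (@Set.toFinite _ _ (hf x)).isCompact⟩⟩

lemma of_homeomorph [T2Space S] (e : S ≃ₜ X) : FiniteCovering e :=
  ⟨inferInstance, e.isLocalHomeomorph, e.isProperMap⟩

lemma comp {Q : X → Y} (hQ : FiniteCovering Q) (hP : FiniteCovering P) : FiniteCovering (Q ∘ P) :=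
  ⟨hP.t2, hQ.isLocalHomeomorph.comp hP.isLocalHomeomorph, hQ.isProperMap.comp hP.isProperMap⟩

lemma _root_.isProperMap_pullback_fst [T2Space X] (hP : IsProperMap P) {g : Y → X}
    (hg : Continuous g) : IsProperMap (fun z : Function.Pullback g P => z.fst) := by
  have h1 : IsProperMap (Prod.map (id : Y → Y) P) := isProperMap_id.prodMap hP
  have hc : IsClosed {w : Y × S | g w.1 = P w.2} :=
    isClosed_eq (hg.comp continuous_fst) (hP.continuous.comp continuous_snd)
  have h2 : IsProperMap (fun z : Function.Pullback g P => (z.fst, g z.fst)) := by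
    have e : (fun z : Function.Pullback g P => (z.fst, g z.fst)) =
        Prod.map (id : Y → Y) P ∘ Subtype.val := funext fun z => Prod.ext rfl z.2
    rw [e]
    exact h1.comp hc.isProperMap_subtypeVal
  rw [isProperMap_iff_isClosedMap_and_compact_fibers] at h2 ⊢
  refine ⟨continuous_fst.comp continuous_subtype_val, fun K hK => ?_, fun y => ?_⟩
  · have h3 := h2.2.1 K hK
    have h4 : Continuous fun y : Y => (y, g y) := continuous_id.prodMk hg
    convert h3.preimage h4 using 1
    ext y
    constructor
    · rintro ⟨z, hz, rfl⟩
      exact ⟨z, hz, rfl⟩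
    · rintro ⟨z, hz, h⟩
      exact ⟨z, hz, congrArg Prod.fst h⟩
  · convert h2.2.2 (y, g y) using 1
    ext z
    constructor
    · rintro h
      have h : z.fst = y := h
      simp [← h]
    · intro h
      exact congrArg Prod.fst h

lemma pullback [T2Space X] [T2Space Y] (h : FiniteCovering P) {g : Y → X} (hg : Continuous g) :
    FiniteCovering (fun z : Function.Pullback g P => z.fst) := by
  have := h.t2
  exact ⟨inferInstanceAs (T2Space {w : Y × S // g w.1 = P w.2}),
    isLocalHomeomorph_pullback h.isLocalHomeomorph hg, isProperMap_pullback_fst h.isProperMap hg⟩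

lemma sumMap {Q : R → Y} (hP : FiniteCovering P) (hQ : FiniteCovering Q) :
    FiniteCovering (Sum.map P Q) := by
  have := hP.t2
  have := hQ.t2
  refine ⟨inferInstance, isLocalHomeomorph_sumElim
      (IsOpenEmbedding.inl.isLocalHomeomorph.comp hP.isLocalHomeomorph)
      (IsOpenEmbedding.inr.isLocalHomeomorph.comp hQ.isLocalHomeomorph), ?_⟩
  have hP' := isProperMap_iff_isClosedMap_and_compact_fibers.1 hP.isProperMap
  have hQ' := isProperMap_iff_isClosedMap_and_compact_fibers.1 hQ.isProperMap
  refine isProperMap_iff_isClosedMap_and_compact_fibers.2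
    ⟨hP.continuous.sumMap hQ.continuous, fun K hK => ?_, ?_⟩
  · rw [isClosed_sum_iff] at hK ⊢
    constructor
    · convert hP'.2.1 _ hK.1 using 1
      ext x
      simp
    · convert hQ'.2.1 _ hK.2 using 1
      ext x
      simp
  · rintro (x | y)
    · convert (hP'.2.2 x).image continuous_inl using 1
      ext (s | s) <;> simp
    · convert (hQ'.2.2 y).image continuous_inr using 1
      ext (s | s) <;> simp

lemma prodMap {Q : R → Y} (hP : FiniteCovering P) (hQ : FiniteCovering Q) :
    FiniteCovering (Prod.map P Q) := by
  have := hP.t2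
  have := hQ.t2
  exact ⟨inferInstance, isLocalHomeomorph_prodMap hP.isLocalHomeomorph hQ.isLocalHomeomorph,
    hP.isProperMap.prodMap hQ.isProperMap⟩

lemma id_map [T2Space X] : FiniteCovering (id : X → X) := of_homeomorph (Homeomorph.refl X)

lemma sumElim {Q : R → X} (hP : FiniteCovering P) (hQ : FiniteCovering Q) :
    FiniteCovering (Sum.elim P Q) := by
  have := hP.t2
  have := hQ.t2
  refine ⟨inferInstance, isLocalHomeomorph_sumElim hP.isLocalHomeomorph hQ.isLocalHomeomorph, ?_⟩
  have hP' := isProperMap_iff_isClosedMap_and_compact_fibers.1 hP.isProperMap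
  have hQ' := isProperMap_iff_isClosedMap_and_compact_fibers.1 hQ.isProperMap
  refine isProperMap_iff_isClosedMap_and_compact_fibers.2
    ⟨hP.continuous.sumElim hQ.continuous, fun K hK => ?_, fun x => ?_⟩
  · rw [isClosed_sum_iff] at hK
    convert (hP'.2.1 _ hK.1).union (hQ'.2.1 _ hK.2) using 1
    ext x
    simp
  · convert ((hP'.2.2 x).image continuous_inl).union ((hQ'.2.2 x).image continuous_inr) using 1
    ext (s | s) <;> simp

/-- The restriction of a finite covering to a subspace of the base. -/
lemma restrictPreimage (hP : FiniteCovering P) (U : Set X) :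
    FiniteCovering (U.restrictPreimage P) := by
  have := hP.t2
  exact ⟨inferInstance, (hP.isCoveringMap.restrictPreimage U).isLocalHomeomorph,
    hP.isProperMap.restrictPreimage U⟩

end FiniteCovering

lemma ClosedCovering.finiteCovering (p : ClosedCovering) : FiniteCovering p.proj :=
  .of_compactSpace p.isCoveringMap.isLocalHomeomorph

namespace Charts

variable {X Y : Type} [TopologicalSpace X] [TopologicalSpace Y]
  {dX : X → ℕ} {dY : Y → ℕ} {A : Charts X dX} {B : Charts Y dY}

lemma finrank_eq_of_contDiffAt_inverse {E F : Type} [NormedAddCommGroup E] [NormedSpace ℝ E]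
    [FiniteDimensional ℝ E] [NormedAddCommGroup F] [NormedSpace ℝ F] [FiniteDimensional ℝ F]
    {f : E → F} {g : F → E} {v : E} (hf : ContDiffAt ℝ ∞ f v) (hg : ContDiffAt ℝ ∞ g (f v))
    (hgf : g ∘ f =ᶠ[𝓝 v] id) : Module.finrank ℝ E ≤ Module.finrank ℝ F := by
  have h1 := (hg.differentiableAt (by simp)).hasFDerivAt.comp v
    (hf.differentiableAt (by simp)).hasFDerivAt
  have h2 := ((hasFDerivAt_id v).congr_of_eventuallyEq hgf).unique h1
  refine LinearMap.finrank_le_finrank_of_injective (f := (fderiv ℝ f v : E →ₗ[ℝ] F)) ?_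
  refine Function.LeftInverse.injective (g := fderiv ℝ g (f v)) fun w => ?_
  exact (DFunLike.congr_fun h2 w).symm

lemma SmoothAt.dim_le {f : X → Y} {g : Y → X} {x : X} (hf : SmoothAt A B f x)
    (hg : SmoothAt B A g (f x)) (hgf : g ∘ f =ᶠ[𝓝 x] id) : dX x ≤ dY (f x) := by
  rw [← A.finrank_eq, ← B.finrank_eq]
  have hx : g (f x) = x := hgf.eq_of_nhds
  have h1 := hf.2
  have h2 : ContDiffAt ℝ ∞ (A.chart x ∘ g ∘ (B.chart (f x)).symm) (B.chart (f x) (f x)) :=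
    ((smoothAt_iff_of_mem_source (B.mem_source (f x)) (y₀ := x)
      (by rw [hx]; exact A.mem_source x)).1 hg).2
  have e : B.chart (f x) (f x) = (B.chart (f x) ∘ f ∘ (A.chart x).symm) (A.chart x x) := by
    simp [(A.chart x).left_inv (A.mem_source x)]
  rw [e] at h2
  refine finrank_eq_of_contDiffAt_inverse h1 h2 ?_
  have t := A.tendsto_chart_symm (A.mem_source x)
  filter_upwards [t.eventually hgf,
    t.eventually (hf.1.eventually ((B.chart (f x)).open_source.mem_nhds (B.mem_source _))),
    (A.chart x).open_target.mem_nhds ((A.chart x).map_source (A.mem_source x))] with v h1 h2 h3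
  simp only [Function.comp_apply, id] at h1 ⊢
  rw [(B.chart (f x)).left_inv h2, h1, (A.chart x).right_inv h3]

/-- A smooth map with a smooth local inverse preserves the dimension. -/
lemma SmoothAt.dim_eq {f : X → Y} {g : Y → X} {x : X} (hf : SmoothAt A B f x)
    (hg : SmoothAt B A g (f x)) (hgf : g ∘ f =ᶠ[𝓝 x] id) (hfg : f ∘ g =ᶠ[𝓝 (f x)] id) :
    dX x = dY (f x) := by
  refine le_antisymm (hf.dim_le hg hgf) ?_
  have hx : g (f x) = x := hgf.eq_of_nhds
  have h := hg.dim_le (g := f) (by rw [hx]; exact hf) hfg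
  rwa [hx] at h

lemma SmoothAt.prodMap {X' Y' : Type} [TopologicalSpace X'] [TopologicalSpace Y']
    {dX' : X' → ℕ} {dY' : Y' → ℕ} {A' : Charts X' dX'} {B' : Charts Y' dY'} {f : X → Y}
    {g : X' → Y'} {z : X × X'} (hf : SmoothAt A B f z.1) (hg : SmoothAt A' B' g z.2) :
    SmoothAt (A.prod A') (B.prod B') (Prod.map f g) z :=
  (hf.comp smoothAt_fst).prodMk (hg.comp smoothAt_snd)

lemma smoothAt_sum_prod_inl {Z W : Type} [TopologicalSpace Z] [TopologicalSpace W] {dZ : Z → ℕ}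
    {dW : W → ℕ} {C : Charts Z dZ} {D : Charts W dW} {f : (X ⊕ Y) × Z → W} {x : X} {c : Z} :
    SmoothAt ((A.sum B).prod C) D f (Sum.inl x, c) ↔
      SmoothAt (A.prod C) D (fun z => f (Sum.inl z.1, z.2)) (x, c) := by
  refine ⟨fun h => SmoothAt.comp (f := Prod.map Sum.inl id) h
    (SmoothAt.prodMap smoothAt_inl smoothAt_id), fun h => ?_⟩
  have h1 : SmoothAt (A.sum B) A (Sum.elim id fun _ => x) (Sum.inl x) :=
    smoothAt_sum_inl.2 smoothAt_id
  have h2 : SmoothAt ((A.sum B).prod C) (A.prod C) (Prod.map (Sum.elim id fun _ => x) id)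
    (Sum.inl x, c) := SmoothAt.prodMap h1 smoothAt_id
  refine (SmoothAt.comp (f := Prod.map (Sum.elim id fun _ => x) id) h h2).congr ?_
  filter_upwards [(continuous_fst.tendsto ((Sum.inl x : X ⊕ Y), c)).eventually
    (isOpen_range_inl.mem_nhds ⟨x, rfl⟩)]
  rintro ⟨_, c'⟩ ⟨x', rfl⟩
  rfl

lemma smoothAt_sum_prod_inr {Z W : Type} [TopologicalSpace Z] [TopologicalSpace W] {dZ : Z → ℕ}
    {dW : W → ℕ} {C : Charts Z dZ} {D : Charts W dW} {f : (X ⊕ Y) × Z → W} {y : Y} {c : Z} :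
    SmoothAt ((A.sum B).prod C) D f (Sum.inr y, c) ↔
      SmoothAt (B.prod C) D (fun z => f (Sum.inr z.1, z.2)) (y, c) := by
  refine ⟨fun h => SmoothAt.comp (f := Prod.map Sum.inr id) h
    (SmoothAt.prodMap smoothAt_inr smoothAt_id), fun h => ?_⟩
  have h1 : SmoothAt (A.sum B) B (Sum.elim (fun _ => y) id) (Sum.inr y) :=
    smoothAt_sum_inr.2 smoothAt_id
  have h2 : SmoothAt ((A.sum B).prod C) (B.prod C) (Prod.map (Sum.elim (fun _ => y) id) id)
    (Sum.inr y, c) := SmoothAt.prodMap h1 smoothAt_id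
  refine (SmoothAt.comp (f := Prod.map (Sum.elim (fun _ => y) id) id) h h2).congr ?_
  filter_upwards [(continuous_fst.tendsto ((Sum.inr y : X ⊕ Y), c)).eventually
    (isOpen_range_inr.mem_nhds ⟨y, rfl⟩)]
  rintro ⟨_, c'⟩ ⟨y', rfl⟩
  rfl

end Charts

lemma continuous_sum_prod {X Y Z W : Type} [TopologicalSpace X] [TopologicalSpace Y]
    [TopologicalSpace Z] [TopologicalSpace W] {f : (X ⊕ Y) × Z → W}
    (h1 : Continuous fun z : X × Z => f (Sum.inl z.1, z.2))
    (h2 : Continuous fun z : Y × Z => f (Sum.inr z.1, z.2)) : Continuous f := by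
  have h : f = Sum.elim (fun z : X × Z => f (Sum.inl z.1, z.2))
      (fun z : Y × Z => f (Sum.inr z.1, z.2)) ∘ Homeomorph.sumProdDistrib := by
    funext z
    rcases z with ⟨x | y, z⟩ <;> rfl
  rw [h]
  exact (h1.sumElim h2).comp Homeomorph.sumProdDistrib.continuous

lemma isOpenEmbedding_of_leftInverse {X Y : Type} [TopologicalSpace X] [TopologicalSpace Y]
    {e : X → Y} (hc : Continuous e) (ho : IsOpen (range e))
    (hi : ∀ x, ∃ ρ : Y → X, Function.LeftInverse ρ e ∧ ContinuousAt ρ (e x)) :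
    IsOpenEmbedding e := by
  have hinj : Function.Injective e := fun x y hxy => by
    obtain ⟨ρ, hρ, -⟩ := hi x
    exact hρ.injective hxy
  refine .of_continuous_injective_isOpenMap hc hinj (isOpenMap_iff_nhds_le.2 fun x => ?_)
  obtain ⟨ρ, hρ, hρc⟩ := hi x
  intro s hs
  have h1 : ρ ⁻¹' (e ⁻¹' s) ∈ 𝓝 (e x) := hρc (by rw [hρ x]; exact hs)
  filter_upwards [h1, ho.mem_nhds (mem_range_self x)]
  rintro _ hy ⟨y, rfl⟩
  rw [mem_preimage, hρ y] at hy
  exact hy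

open Charts

/-- A filling of a covering `π : T → N` of a manifold: a covering of a manifold `X` without boundary
with a cylindrical end over `N × ℝ` (where `N × (-∞, 0)` has a compact complement), over which the
covering is `π × id`. -/
structure Filling {N T : Type} [TopologicalSpace N] [TopologicalSpace T] {dN : N → ℕ}
    (AN : Charts N dN) (π : T → N) where
  X : Type
  [topX : TopologicalSpace X]
  [t2X : T2Space X]
  dim : X → ℕ
  A : Charts X dim
  S : Type
  [topS : TopologicalSpace S]
  P : S → X
  finiteCovering : FiniteCovering P
  e : N × ℝ → X
  smooth_e : ∀ z, SmoothAt (AN.prod (model ℝ)) A e z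
  smooth_inv : ∀ z, ∃ ρ : X → N × ℝ, Function.LeftInverse ρ e ∧
    SmoothAt A (AN.prod (model ℝ)) ρ (e z)
  isOpen_range : IsOpen (range e)
  isClosed_end : IsClosed (e '' {z | z.2 ≤ 0})
  isCompact_core : IsCompact (e '' {z | z.2 < 0})ᶜ
  lift : T × ℝ → S
  continuous_lift : Continuous lift
  injective_lift : Function.Injective lift
  P_lift : ∀ z, P (lift z) = e (π z.1, z.2)
  mem_range_lift : ∀ s, P s ∈ range e → s ∈ range lift

attribute [instance] Filling.topX Filling.t2X Filling.topS

namespace Filling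

section

variable {N T : Type} [TopologicalSpace N] [TopologicalSpace T] {dN : N → ℕ}
  {AN : Charts N dN} {π : T → N} (F : Filling AN π)

lemma isOpenEmbedding : IsOpenEmbedding F.e := by
  refine isOpenEmbedding_of_leftInverse
    (continuous_iff_continuousAt.2 fun z => (F.smooth_e z).1) F.isOpen_range fun z => ?_
  obtain ⟨ρ, h1, h2⟩ := F.smooth_inv z
  exact ⟨ρ, h1, h2.1⟩

lemma injective : Function.Injective F.e := F.isOpenEmbedding.injective

lemma dim_e (z : N × ℝ) : F.dim (F.e z) = dN z.1 + 1 := by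
  obtain ⟨ρ, h1, h2⟩ := F.smooth_inv z
  have := (F.smooth_e z).dim_eq h2 (.of_forall h1) (by
    filter_upwards [F.isOpen_range.mem_nhds (mem_range_self z)]
    rintro _ ⟨y, rfl⟩
    simp [h1 y])
  rw [← this]
  simp

/-- Transport of a filling along an isomorphism of coverings. -/
def congr {N' T' : Type} [TopologicalSpace N'] [TopologicalSpace T'] {dN' : N' → ℕ}
    {AN' : Charts N' dN'} {π' : T' → N'} (φ : N' ≃ N) (hφ : ∀ x, SmoothAt AN' AN φ x)
    (hφ' : ∀ x, SmoothAt AN AN' φ.symm x) (ψ : T' → T) (hψ : Continuous ψ)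
    (hψ' : Function.Bijective ψ) (h : ∀ t, π (ψ t) = φ (π' t)) : Filling AN' π' where
  X := F.X
  dim := F.dim
  A := F.A
  S := F.S
  P := F.P
  finiteCovering := F.finiteCovering
  e := F.e ∘ Prod.map φ id
  smooth_e z := (F.smooth_e _).comp ((hφ _).prodMap smoothAt_id)
  smooth_inv z := by
    obtain ⟨ρ, h1, h2⟩ := F.smooth_inv (Prod.map φ id z)
    refine ⟨Prod.map φ.symm id ∘ ρ, fun y => ?_, ?_⟩
    · simp only [Function.comp_apply]
      rw [h1]
      simp [Prod.map]
    · exact SmoothAt.comp ((hφ' _).prodMap smoothAt_id) h2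
  isOpen_range := by
    rw [(φ.surjective.prodMap Function.surjective_id).range_comp]
    exact F.isOpen_range
  isClosed_end := by
    rw [image_comp]
    convert F.isClosed_end using 2
    ext z
    exact ⟨by rintro ⟨w, hw, rfl⟩; exact hw, fun hz => ⟨(φ.symm z.1, z.2), hz, by simp⟩⟩
  isCompact_core := by
    rw [image_comp]
    convert F.isCompact_core using 3
    ext z
    exact ⟨by rintro ⟨w, hw, rfl⟩; exact hw, fun hz => ⟨(φ.symm z.1, z.2), hz, by simp⟩⟩
  lift := F.lift ∘ Prod.map ψ id
  continuous_lift := F.continuous_lift.comp (hψ.prodMap continuous_id)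
  injective_lift := F.injective_lift.comp (hψ'.1.prodMap Function.injective_id)
  P_lift z := by simp [F.P_lift, h]
  mem_range_lift s hs := by
    rw [(hψ'.2.prodMap Function.surjective_id).range_comp]
    refine F.mem_range_lift s ?_
    rwa [(φ.surjective.prodMap Function.surjective_id).range_comp] at hs

/-- The disjoint union of two fillings. -/
def sum {N' T' : Type} [TopologicalSpace N'] [TopologicalSpace T'] {dN' : N' → ℕ}
    {AN' : Charts N' dN'} {π' : T' → N'} (F' : Filling AN' π') :
    Filling (AN.sum AN') (Sum.map π π') where
  X := F.X ⊕ F'.X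
  dim := Sum.elim F.dim F'.dim
  A := F.A.sum F'.A
  S := F.S ⊕ F'.S
  P := Sum.map F.P F'.P
  finiteCovering := F.finiteCovering.sumMap F'.finiteCovering
  e z := Sum.map (fun x => F.e (x, z.2)) (fun x => F'.e (x, z.2)) z.1
  smooth_e := by
    rintro ⟨x | x, a⟩
    · exact smoothAt_sum_prod_inl.2 (SmoothAt.comp (g := Sum.inl) smoothAt_inl (F.smooth_e (x, a)))
    · exact smoothAt_sum_prod_inr.2 (SmoothAt.comp (g := Sum.inr) smoothAt_inr (F'.smooth_e (x, a)))
  smooth_inv := by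
    rintro ⟨x | x, a⟩
    · obtain ⟨ρ, h1, h2⟩ := F.smooth_inv (x, a)
      classical
      refine ⟨Sum.elim (fun y => (Sum.inl (ρ y).1, (ρ y).2)) (fun y =>
        if h : ∃ z : N' × ℝ, F'.e z = y then (Sum.inr h.choose.1, h.choose.2) else (Sum.inl x, a)),
        ?_, smoothAt_sum_inl.2 ((SmoothAt.comp smoothAt_inl h2.fst).prodMk h2.snd)⟩
      rintro ⟨y | y, b⟩
      · simp [h1 (y, b)]
      · have h : ∃ z : N' × ℝ, F'.e z = F'.e (y, b) := ⟨_, rfl⟩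
        simp only [Sum.map_inr, Sum.elim_inr, dif_pos h, F'.injective h.choose_spec]
    · obtain ⟨ρ, h1, h2⟩ := F'.smooth_inv (x, a)
      classical
      refine ⟨Sum.elim (fun y =>
        if h : ∃ z : N × ℝ, F.e z = y then (Sum.inl h.choose.1, h.choose.2) else (Sum.inr x, a))
        (fun y => (Sum.inr (ρ y).1, (ρ y).2)),
        ?_, smoothAt_sum_inr.2 ((SmoothAt.comp smoothAt_inr h2.fst).prodMk h2.snd)⟩
      rintro ⟨y | y, b⟩
      · have h : ∃ z : N × ℝ, F.e z = F.e (y, b) := ⟨_, rfl⟩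
        simp only [Sum.map_inl, Sum.elim_inl, dif_pos h, F.injective h.choose_spec]
      · simp [h1 (y, b)]
  isOpen_range := by
    convert (IsOpenEmbedding.inl.isOpenMap _ F.isOpen_range).union
      (IsOpenEmbedding.inr.isOpenMap _ F'.isOpen_range) using 1
    ext (x | x) <;> simp
  isClosed_end := by
    rw [isClosed_sum_iff]
    constructor
    · convert F.isClosed_end using 1
      ext x
      simp
    · convert F'.isClosed_end using 1
      ext x
      simp
  isCompact_core := by
    convert (F.isCompact_core.image continuous_inl).union
      (F'.isCompact_core.image continuous_inr) using 1
    ext (x | x) <;> simp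
  lift z := Sum.map (fun x => F.lift (x, z.2)) (fun x => F'.lift (x, z.2)) z.1
  continuous_lift := continuous_sum_prod (continuous_inl.comp F.continuous_lift)
    (continuous_inr.comp F'.continuous_lift)
  injective_lift := by
    rintro ⟨t | t, a⟩ ⟨t' | t', a'⟩ h
    · simpa using F.injective_lift (Sum.inl_injective h)
    · cases h
    · cases h
    · simpa using F'.injective_lift (Sum.inr_injective h)
  P_lift := by
    rintro ⟨t | t, a⟩
    · simp [F.P_lift]
    · simp [F'.P_lift]
  mem_range_lift := by
    rintro (s | s) ⟨⟨x | x, a⟩, h⟩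
    · obtain ⟨⟨t, b⟩, rfl⟩ := F.mem_range_lift s ⟨_, Sum.inl_injective h⟩
      exact ⟨(Sum.inl t, b), rfl⟩
    · cases h
    · cases h
    · obtain ⟨⟨t, b⟩, rfl⟩ := F'.mem_range_lift s ⟨_, Sum.inr_injective h⟩
      exact ⟨(Sum.inr t, b), rfl⟩

/-- The product of a filling with a covering of a closed manifold. -/
def prod {C R : Type} [TopologicalSpace C] [TopologicalSpace R] [T2Space C] [CompactSpace C]
    {dC : C → ℕ} (AC : Charts C dC) {q : R → C} (hq : FiniteCovering q) :
    Filling (AN.prod AC) (Sum.elim (Prod.map π id) (Prod.map id q) : T × C ⊕ N × R → N × C) where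
  X := F.X × C
  dim := _
  A := F.A.prod AC
  S := F.S × C ⊕ F.X × R
  P := Sum.elim (Prod.map F.P id) (Prod.map id q)
  finiteCovering := (F.finiteCovering.prodMap .id_map).sumElim (.prodMap .id_map hq)
  e z := (F.e (z.1.1, z.2), z.1.2)
  smooth_e z := by
    have h : SmoothAt ((AN.prod AC).prod (model ℝ)) (AN.prod (model ℝ))
        (fun z : (N × C) × ℝ => (z.1.1, z.2)) z := smoothAt_fst.fst.prodMk smoothAt_snd
    exact (SmoothAt.comp (f := fun z : (N × C) × ℝ => (z.1.1, z.2)) (F.smooth_e (z.1.1, z.2))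
      h).prodMk smoothAt_fst.snd
  smooth_inv z := by
    obtain ⟨ρ, h1, h2⟩ := F.smooth_inv (z.1.1, z.2)
    refine ⟨fun y => (((ρ y.1).1, y.2), (ρ y.1).2), fun y => by simp [h1 _], ?_⟩
    have h3 : SmoothAt (F.A.prod AC) (AN.prod (model ℝ)) (fun y => ρ y.1)
      (F.e (z.1.1, z.2), z.1.2) := SmoothAt.comp (f := Prod.fst) h2 smoothAt_fst
    exact (h3.fst.prodMk smoothAt_snd).prodMk h3.snd
  isOpen_range := by
    convert F.isOpen_range.preimage (continuous_fst : Continuous (Prod.fst : F.X × C → F.X)) using 1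
    ext ⟨x, c⟩
    simp
  isClosed_end := by
    convert F.isClosed_end.preimage (continuous_fst : Continuous (Prod.fst : F.X × C → F.X)) using 1
    ext ⟨x, c⟩
    simp
  isCompact_core := by
    convert F.isCompact_core.prod (isCompact_univ : IsCompact (univ : Set C)) using 1
    ext ⟨x, c⟩
    simp
  lift z := Sum.map (fun y => (F.lift (y.1, z.2), y.2)) (fun y => (F.e (y.1, z.2), y.2)) z.1
  continuous_lift := by
    refine continuous_sum_prod (continuous_inl.comp ?_) (continuous_inr.comp ?_)
    · exact (F.continuous_lift.comp (f := fun z : (T × C) × ℝ => (z.1.1, z.2))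
        (by fun_prop)).prodMk (by fun_prop)
    · exact (F.isOpenEmbedding.continuous.comp (f := fun z : (N × R) × ℝ => (z.1.1, z.2))
        (by fun_prop)).prodMk (by fun_prop)
  injective_lift := by
    rintro ⟨t | t, a⟩ ⟨t' | t', a'⟩ h
    · have h := Prod.ext_iff.1 (Sum.inl_injective h)
      have h1 := Prod.ext_iff.1 (F.injective_lift h.1)
      have h2 : t = t' := Prod.ext h1.1 h.2
      have h3 : a = a' := h1.2
      rw [h2, h3]
    · cases h
    · cases h
    · have h := Prod.ext_iff.1 (Sum.inr_injective h)
      have h1 := Prod.ext_iff.1 (F.injective h.1)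
      have h2 : t = t' := Prod.ext h1.1 h.2
      have h3 : a = a' := h1.2
      rw [h2, h3]
  P_lift := by
    rintro ⟨t | t, a⟩ <;> simp [F.P_lift]
  mem_range_lift := by
    rintro (⟨s, c⟩ | ⟨x, r⟩) ⟨⟨⟨y, c'⟩, a⟩, h⟩
    · have h := Prod.ext_iff.1 h
      obtain ⟨⟨t, b⟩, rfl⟩ := F.mem_range_lift s ⟨_, h.1⟩
      exact ⟨(Sum.inl (t, c), b), rfl⟩
    · have h : F.e (y, a) = x := (Prod.ext_iff.1 h).1
      exact ⟨(Sum.inr (y, r), a), by simp [h]⟩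

end

/-- The cylinder on a covering of a closed manifold. -/
def cylinder {N T : Type} [TopologicalSpace N] [TopologicalSpace T] [T2Space N] [CompactSpace N]
    {dN : N → ℕ} (AN : Charts N dN) {π : T → N} (hπ : FiniteCovering π) :
    Filling (AN.sum AN) (Sum.map π π) where
  X := N × ℝ
  dim := _
  A := AN.prod (model ℝ)
  S := T × ℝ
  P := Prod.map π id
  finiteCovering := hπ.prodMap .id_map
  e z := Sum.elim (fun x => (x, -Real.exp (-z.2))) (fun x => (x, Real.exp (-z.2))) z.1
  smooth_e := by
    rintro ⟨x | x, a⟩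
    · refine smoothAt_sum_prod_inl.2 (smoothAt_fst.prodMk ?_)
      refine SmoothAt.comp (g := fun a : ℝ => -Real.exp (-a)) (C := model ℝ)
        (smoothAt_model_model_iff.2 ?_) smoothAt_snd
      fun_prop
    · refine smoothAt_sum_prod_inr.2 (smoothAt_fst.prodMk ?_)
      refine SmoothAt.comp (g := fun a : ℝ => Real.exp (-a)) (C := model ℝ)
        (smoothAt_model_model_iff.2 ?_) smoothAt_snd
      fun_prop
  smooth_inv := by
    intro z
    classical
    refine ⟨fun y => (if y.2 < 0 then Sum.inl y.1 else Sum.inr y.1, -Real.log y.2), ?_, ?_⟩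
    · rintro ⟨x | x, a⟩
      · simp [Real.exp_pos]
      · simp [(Real.exp_pos _).not_gt]
    · have hlog (b : ℝ) (hb : b ≠ 0) (x : N) : SmoothAt (AN.prod (model ℝ)) (model ℝ)
          (fun y : N × ℝ => -Real.log y.2) (x, b) := by
        refine SmoothAt.comp (g := fun a : ℝ => -Real.log a) (C := model ℝ)
          (smoothAt_model_model_iff.2 ?_) smoothAt_snd
        exact (Real.contDiffAt_log.2 hb).neg
      rcases z with ⟨x | x, a⟩
      · refine SmoothAt.prodMk ?_ (hlog _ (by simp) _)
        refine (SmoothAt.comp (g := Sum.inl) smoothAt_inl smoothAt_fst).congr ?_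
        filter_upwards [continuousAt_snd.eventually (isOpen_Iio.mem_nhds
          (show (Sum.elim (fun x => (x, -Real.exp (-a))) (fun x => (x, Real.exp (-a)))
            (Sum.inl x : N ⊕ N)).2 ∈ Iio (0 : ℝ) by simp [Real.exp_pos]))] with y hy
        exact if_pos hy
      · refine SmoothAt.prodMk ?_ (hlog _ (Real.exp_ne_zero _) _)
        refine (SmoothAt.comp (g := Sum.inr) smoothAt_inr smoothAt_fst).congr ?_
        filter_upwards [continuousAt_snd.eventually (isOpen_Ioi.mem_nhds
          (show (Sum.elim (fun x => (x, -Real.exp (-a))) (fun x => (x, Real.exp (-a)))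
            (Sum.inr x : N ⊕ N)).2 ∈ Ioi (0 : ℝ) by simp [Real.exp_pos]))] with y hy
        exact if_neg (not_lt.2 (le_of_lt hy))
  isOpen_range := by
    convert (isOpen_ne (x := (0 : ℝ))).preimage
      (continuous_snd : Continuous (Prod.snd : N × ℝ → ℝ)) using 1
    ext ⟨x, a⟩
    constructor
    · rintro ⟨⟨y | y, b⟩, h⟩ <;> simp [← h]
    · intro h
      rcases lt_or_gt_of_ne (show a ≠ 0 from h) with ha | ha
      · exact ⟨(Sum.inl x, -Real.log (-a)), by simp [-Real.log_neg_eq_log, Real.exp_log (neg_pos.2 ha)]⟩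
      · exact ⟨(Sum.inr x, -Real.log a), by simp [Real.exp_log ha]⟩
  isClosed_end := by
    convert (isClosed_Ici (a := (1 : ℝ))).preimage
      ((continuous_snd : Continuous (Prod.snd : N × ℝ → ℝ)).abs) using 1
    ext ⟨x, a⟩
    constructor
    · rintro ⟨⟨y | y, b⟩, hb, h⟩ <;> simp [← h] <;> exact hb
    · intro h
      rcases le_abs.1 (show 1 ≤ |a| from h) with ha | ha
      · exact ⟨(Sum.inr x, -Real.log a), by simpa using Real.log_nonneg ha,
          by simp [Real.exp_log (by linarith : 0 < a)]⟩
      · exact ⟨(Sum.inl x, -Real.log (-a)), by simpa using Real.log_nonneg ha,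
          by simp [-Real.log_neg_eq_log, Real.exp_log (by linarith : 0 < -a)]⟩
  isCompact_core := by
    convert (isCompact_univ : IsCompact (univ : Set N)).prod (isCompact_Icc (a := -1) (b := (1 : ℝ)))
      using 1
    ext ⟨x, a⟩
    rw [mem_compl_iff, not_iff_comm]
    constructor
    · intro h
      have h : ¬ (-1 ≤ a ∧ a ≤ 1) := fun h' => h ⟨mem_univ _, h'⟩
      rcases lt_or_ge a (-1) with ha | ha
      · refine ⟨(Sum.inl x, -Real.log (-a)), ?_, by simp [-Real.log_neg_eq_log, Real.exp_log (by linarith : 0 < -a)]⟩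
        exact neg_lt_zero.2 (Real.log_pos (by linarith))
      · have ha' : 1 < a := not_le.1 fun h' => h ⟨ha, h'⟩
        refine ⟨(Sum.inr x, -Real.log a), ?_, by simp [Real.exp_log (by linarith : 0 < a)]⟩
        exact neg_lt_zero.2 (Real.log_pos (by linarith))
    · rintro ⟨⟨y | y, b⟩, hb, h⟩ ⟨-, h1, h2⟩
      · have h : -Real.exp (-b) = a := congrArg Prod.snd h
        have := Real.one_lt_exp_iff.2 (show 0 < -b from neg_pos.2 hb)
        dsimp only at h1
        linarith
      · have h : Real.exp (-b) = a := congrArg Prod.snd h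
        have := Real.one_lt_exp_iff.2 (show 0 < -b from neg_pos.2 hb)
        dsimp only at h2
        linarith
  lift z := Sum.elim (fun x => (x, -Real.exp (-z.2))) (fun x => (x, Real.exp (-z.2))) z.1
  continuous_lift := continuous_sum_prod
    (show Continuous fun z : T × ℝ => (z.1, -Real.exp (-z.2)) by fun_prop)
    (show Continuous fun z : T × ℝ => (z.1, Real.exp (-z.2)) by fun_prop)
  injective_lift := by
    rintro ⟨t | t, a⟩ ⟨t' | t', a'⟩ h
    · simpa using h
    · have h : -Real.exp (-a) = Real.exp (-a') := congrArg Prod.snd h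
      linarith [Real.exp_pos (-a), Real.exp_pos (-a')]
    · have h : Real.exp (-a) = -Real.exp (-a') := congrArg Prod.snd h
      linarith [Real.exp_pos (-a), Real.exp_pos (-a')]
    · simpa using h
  P_lift := by rintro ⟨t | t, a⟩ <;> rfl
  mem_range_lift := by
    rintro ⟨t, b⟩ ⟨⟨x | x, a⟩, h⟩
    · exact ⟨(Sum.inl t, a), Prod.ext rfl (congrArg Prod.snd h :)⟩
    · exact ⟨(Sum.inr t, a), Prod.ext rfl (congrArg Prod.snd h :)⟩

end Filling

/-! ### Charts on a union of open pieces -/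

namespace Charts

section Cover

variable {I : Type} {Y : I → Type} [∀ i, TopologicalSpace (Y i)] {d : ∀ i, Y i → ℕ}
  (A : ∀ i, Charts (Y i) (d i)) {X : Type} [TopologicalSpace X] {dX : X → ℕ}
  (ι : ∀ i, Y i → X)

/-- Data describing a space as a union of open pieces with compatible charts. -/
structure IsCover (dX : X → ℕ) : Prop where
  isOpenEmbedding : ∀ i, IsOpenEmbedding (ι i)
  surjective : ∀ x, ∃ i y, ι i y = x
  dim_eq : ∀ i y, dX (ι i y) = d i y
  compatible : ∀ i j y z, ι i y = ι j z → ∃ τ : Y i → Y j, SmoothAt (A i) (A j) τ y ∧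
    ∀ᶠ y' in 𝓝 y, ι j (τ y') = ι i y'

variable {A ι} (h : IsCover A ι dX)
include h

/-- The index of a piece containing a given point. -/
def IsCover.index (x : X) : I := (h.surjective x).choose

/-- A point of the piece representing a given point. -/
def IsCover.rep (x : X) : Y (h.index x) := (h.surjective x).choose_spec.choose

lemma IsCover.ι_rep (x : X) : ι _ (h.rep x) = x := (h.surjective x).choose_spec.choose_spec

/-- The chart of a point of the union. -/
def IsCover.chart (x : X) : OpenPartialHomeomorph X ((A (h.index x)).V (h.rep x)) :=
  haveI : Nonempty (Y (h.index x)) := ⟨h.rep x⟩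
  ((h.isOpenEmbedding (h.index x)).toOpenPartialHomeomorph (ι _)).symm ≫ₕ
    (A (h.index x)).chart (h.rep x)

lemma IsCover.mem_chart_source {x y : X} : y ∈ (h.chart x).source ↔
    ∃ z ∈ ((A (h.index x)).chart (h.rep x)).source, ι _ z = y := by
  have : Nonempty (Y (h.index x)) := ⟨h.rep x⟩
  rw [IsCover.chart, OpenPartialHomeomorph.trans_source]
  constructor
  · rintro ⟨h1, h2⟩
    simp only [OpenPartialHomeomorph.symm_source,
      IsOpenEmbedding.toOpenPartialHomeomorph_target] at h1
    obtain ⟨z, rfl⟩ := h1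
    rw [mem_preimage, IsOpenEmbedding.toOpenPartialHomeomorph_left_inv] at h2
    exact ⟨z, h2, rfl⟩
  · rintro ⟨z, hz, rfl⟩
    refine ⟨by simp, ?_⟩
    rwa [mem_preimage, IsOpenEmbedding.toOpenPartialHomeomorph_left_inv]

lemma IsCover.chart_ι {x : X} (z : Y (h.index x)) :
    h.chart x (ι _ z) = (A (h.index x)).chart (h.rep x) z := by
  have : Nonempty (Y (h.index x)) := ⟨h.rep x⟩
  rw [IsCover.chart, OpenPartialHomeomorph.trans_apply,
    IsOpenEmbedding.toOpenPartialHomeomorph_left_inv]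

lemma IsCover.chart_target {x : X} :
    (h.chart x).target = ((A (h.index x)).chart (h.rep x)).target := by
  simp [IsCover.chart]

lemma IsCover.chart_symm {x : X} (v : (A (h.index x)).V (h.rep x)) :
    (h.chart x).symm v = ι _ (((A (h.index x)).chart (h.rep x)).symm v) := rfl

/-- The charts of a union of open pieces. -/
def ofCover : Charts X dX where
  V x := (A (h.index x)).V (h.rep x)
  finrank_eq x := by rw [finrank_eq, ← h.dim_eq, h.ι_rep]
  chart x := h.chart x
  mem_source x := h.mem_chart_source.2 ⟨_, (A _).mem_source _, h.ι_rep x⟩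
  dim_eq x y hy := by
    obtain ⟨z, hz, rfl⟩ := h.mem_chart_source.1 hy
    rw [h.dim_eq, (A _).dim_eq _ _ hz, ← h.dim_eq, h.ι_rep]
  contDiffOn x y := by
    rintro v ⟨hv1, hv2⟩
    rw [h.chart_target] at hv1
    rw [mem_preimage, h.chart_symm, h.mem_chart_source] at hv2
    obtain ⟨z, hz, hz'⟩ := hv2
    obtain ⟨τ, hτ, hτ'⟩ := h.compatible _ _ _ z hz'.symm
    have hτz : τ (((A (h.index x)).chart (h.rep x)).symm v) = z :=
      (h.isOpenEmbedding _).injective (hτ'.self_of_nhds.trans hz'.symm)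
    have h1 : SmoothAt (model _) (A _) ((A (h.index x)).chart (h.rep x)).symm v :=
      smoothAt_chart_symm _ hv1
    have h2 : SmoothAt (A (h.index y)) (model _) ((A (h.index y)).chart (h.rep y)) z :=
      smoothAt_chart _ hz
    have h3 := h2.comp_of_eq (hτ.comp h1) hτz
    refine ((smoothAt_model_model_iff.1 h3).congr_of_eventuallyEq ?_).contDiffWithinAt
    filter_upwards [h1.1.eventually hτ'] with w hw
    simp only [Function.comp_apply]
    rw [h.chart_symm, ← hw, h.chart_ι]

lemma smoothAt_ι (i : I) (y : Y i) : SmoothAt (A i) (ofCover h) (ι i) y := by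
  refine (smoothAt_iff_comp_chart (h.isOpenEmbedding i).continuous.continuousAt
    ((ofCover h).mem_source _)).2 ?_
  obtain ⟨τ, hτ, hτ'⟩ := h.compatible i _ y (h.rep (ι i y)) (h.ι_rep _).symm
  have hτy : τ y = h.rep (ι i y) :=
    (h.isOpenEmbedding _).injective (hτ'.self_of_nhds.trans (h.ι_rep _).symm)
  refine (((A _).smoothAt_chart ((A _).mem_source (h.rep (ι i y)))).comp_of_eq hτ hτy).congr ?_
  filter_upwards [hτ'] with y' hy'
  simp only [Function.comp_apply]
  rw [← hy']
  exact h.chart_ι _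

lemma smoothAt_leftInverse_ι (i : I) (y : Y i) {σ : X → Y i} (hσ : ∀ y, σ (ι i y) = y) :
    SmoothAt (ofCover h) (A i) σ (ι i y) := by
  refine (smoothAt_iff_comp_chart_symm ((ofCover h).mem_source _)).2 ?_
  obtain ⟨τ, hτ, hτ'⟩ := h.compatible _ i (h.rep (ι i y)) y (h.ι_rep _)
  have hv : (ofCover h).chart (ι i y) (ι i y) =
      (A _).chart (h.rep (ι i y)) (h.rep (ι i y)) := by
    have := h.chart_ι (h.rep (ι i y))
    rwa [h.ι_rep] at this
  rw [hv]
  have h1 : SmoothAt (model _) (A _) ((A (h.index (ι i y))).chart (h.rep (ι i y))).symm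
      ((A _).chart (h.rep (ι i y)) (h.rep (ι i y))) :=
    smoothAt_chart_symm _ (((A _).chart _).map_source ((A _).mem_source _))
  have h2 := hτ.comp_of_eq h1 (((A _).chart _).left_inv ((A _).mem_source _))
  refine h2.congr ?_
  have h3 := ((A _).tendsto_chart_symm ((A _).mem_source (h.rep (ι i y)))).eventually hτ'
  filter_upwards [h3] with w hw
  change σ (ι _ (((A (h.index (ι i y))).chart (h.rep (ι i y))).symm w)) = _
  rw [← hw, hσ]
  rfl

end Cover

end Charts

/-! ### Gluing along open subsets -/

section Glue

variable {U X Y : Type} [TopologicalSpace U] [TopologicalSpace X] [TopologicalSpace Y]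
  {a : U → X} {b : U → Y}

/-- The equivalence relation on `X ⊕ Y` identifying `a u` with `b u`. -/
def glueSetoid (ha : Function.Injective a) (hb : Function.Injective b) : Setoid (X ⊕ Y) where
  r z w := match z, w with
    | Sum.inl x, Sum.inl x' => x = x'
    | Sum.inr y, Sum.inr y' => y = y'
    | Sum.inl x, Sum.inr y => ∃ u, a u = x ∧ b u = y
    | Sum.inr y, Sum.inl x => ∃ u, a u = x ∧ b u = y
  iseqv := by
    refine ⟨?_, ?_, ?_⟩
    · rintro (x | x) <;> rfl
    · rintro (x | x) (y | y) h
      · exact Eq.symm h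
      · exact h
      · exact h
      · exact Eq.symm h
    · rintro (x | x) (y | y) (z | z) h h'
      · exact Eq.trans h h'
      · rw [show x = y from h]; exact h'
      · obtain ⟨u, hu1, hu2⟩ := h
        obtain ⟨v, hv1, hv2⟩ := h'
        have : u = v := hb (hu2.trans hv2.symm)
        subst this
        exact hu1.symm.trans hv1
      · obtain ⟨u, hu1, hu2⟩ := h
        exact ⟨u, hu1, hu2.trans h'⟩
      · obtain ⟨u, hu1, hu2⟩ := h
        exact ⟨u, hu1.trans h', hu2⟩
      · obtain ⟨u, hu1, hu2⟩ := h
        obtain ⟨v, hv1, hv2⟩ := h'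
        have : u = v := ha (hu1.trans hv1.symm)
        subst this
        exact hu2.symm.trans hv2
      · rw [show x = y from h]; exact h'
      · exact Eq.trans h h'

variable (ha : IsOpenEmbedding a) (hb : IsOpenEmbedding b)

/-- The space obtained from `X` and `Y` by gluing along open embeddings of `U`. -/
def Glue (ha : IsOpenEmbedding a) (hb : IsOpenEmbedding b) : Type :=
  Quotient (glueSetoid ha.injective hb.injective)

namespace Glue

instance : TopologicalSpace (Glue ha hb) :=
  inferInstanceAs (TopologicalSpace (Quotient (glueSetoid ha.injective hb.injective)))

/-- The inclusion of the first piece. -/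
def inl (x : X) : Glue ha hb := Quotient.mk _ (Sum.inl x)

/-- The inclusion of the second piece. -/
def inr (y : Y) : Glue ha hb := Quotient.mk _ (Sum.inr y)

variable {ha hb}

lemma inl_injective : Function.Injective (inl ha hb) := fun _ _ h => Quotient.exact h

lemma inr_injective : Function.Injective (inr ha hb) := fun _ _ h => Quotient.exact h

lemma inl_eq_inr_iff {x : X} {y : Y} : inl ha hb x = inr ha hb y ↔ ∃ u, a u = x ∧ b u = y :=
  ⟨fun h => Quotient.exact h, fun h => Quotient.sound h⟩

lemma inl_a (u : U) : inl ha hb (a u) = inr ha hb (b u) := inl_eq_inr_iff.2 ⟨u, rfl, rfl⟩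

lemma cases (z : Glue ha hb) : (∃ x, inl ha hb x = z) ∨ ∃ y, inr ha hb y = z := by
  induction z using Quotient.ind with
  | _ z => rcases z with x | y
           · exact Or.inl ⟨x, rfl⟩
           · exact Or.inr ⟨y, rfl⟩

lemma isOpen_iff {s : Set (Glue ha hb)} :
    IsOpen s ↔ IsOpen (inl ha hb ⁻¹' s) ∧ IsOpen (inr ha hb ⁻¹' s) := by
  exact (isQuotientMap_quotient_mk' (s := glueSetoid ha.injective hb.injective)).isOpen_preimage
    |>.symm.trans isOpen_sum_iff

lemma isClosed_iff {s : Set (Glue ha hb)} :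
    IsClosed s ↔ IsClosed (inl ha hb ⁻¹' s) ∧ IsClosed (inr ha hb ⁻¹' s) := by
  rw [← isOpen_compl_iff, isOpen_iff, ← isOpen_compl_iff, ← isOpen_compl_iff]
  rfl

lemma isOpenEmbedding_inl : IsOpenEmbedding (inl ha hb) := by
  refine .of_continuous_injective_isOpenMap
    (continuous_def.2 fun s hs => (isOpen_iff.1 hs).1) inl_injective fun s hs => ?_
  rw [isOpen_iff, preimage_image_eq _ inl_injective]
  refine ⟨hs, ?_⟩
  convert hb.isOpenMap _ (hs.preimage ha.continuous) using 1
  ext y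
  simp only [mem_preimage, mem_image, inl_eq_inr_iff]
  constructor
  · rintro ⟨x, hx, u, rfl, rfl⟩
    exact ⟨u, hx, rfl⟩
  · rintro ⟨u, hu, rfl⟩
    exact ⟨_, hu, u, rfl, rfl⟩

lemma isOpenEmbedding_inr : IsOpenEmbedding (inr ha hb) := by
  refine .of_continuous_injective_isOpenMap
    (continuous_def.2 fun s hs => (isOpen_iff.1 hs).2) inr_injective fun s hs => ?_
  rw [isOpen_iff, preimage_image_eq _ inr_injective]
  refine ⟨?_, hs⟩
  convert ha.isOpenMap _ (hs.preimage hb.continuous) using 1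
  ext x
  simp only [mem_preimage, mem_image]
  constructor
  · rintro ⟨y, hy, h⟩
    obtain ⟨u, rfl, rfl⟩ := inl_eq_inr_iff.1 h.symm
    exact ⟨u, hy, rfl⟩
  · rintro ⟨u, hu, rfl⟩
    exact ⟨_, hu, (inl_a u).symm⟩

lemma t2Space [T2Space X] [T2Space Y] {V : Set X} {W : Set Y} (hV : IsOpen V) (hW : IsOpen W)
    (hV' : ∀ x, x ∉ range a → x ∈ V) (hW' : ∀ y, y ∉ range b → y ∈ W)
    (hd : ∀ u, a u ∈ V → b u ∉ W) : T2Space (Glue ha hb) := by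
  have hl : ∀ x x' : X, inl ha hb x ≠ inl ha hb x' → ∃ s t : Set (Glue ha hb), IsOpen s ∧
      IsOpen t ∧ inl ha hb x ∈ s ∧ inl ha hb x' ∈ t ∧ Disjoint s t := by
    intro x x' h
    obtain ⟨s, t, hs, ht, hxs, hxt, hst⟩ := t2_separation (fun h' : x = x' => h (congrArg _ h'))
    exact ⟨_, _, isOpenEmbedding_inl.isOpenMap _ hs, isOpenEmbedding_inl.isOpenMap _ ht,
      ⟨x, hxs, rfl⟩, ⟨x', hxt, rfl⟩, (disjoint_image_iff inl_injective).2 hst⟩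
  have hr : ∀ x x' : Y, inr ha hb x ≠ inr ha hb x' → ∃ s t : Set (Glue ha hb), IsOpen s ∧
      IsOpen t ∧ inr ha hb x ∈ s ∧ inr ha hb x' ∈ t ∧ Disjoint s t := by
    intro x x' h
    obtain ⟨s, t, hs, ht, hxs, hxt, hst⟩ := t2_separation (fun h' : x = x' => h (congrArg _ h'))
    exact ⟨_, _, isOpenEmbedding_inr.isOpenMap _ hs, isOpenEmbedding_inr.isOpenMap _ ht,
      ⟨x, hxs, rfl⟩, ⟨x', hxt, rfl⟩, (disjoint_image_iff inr_injective).2 hst⟩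
  have hlr : ∀ (x : X) (y : Y), inl ha hb x ≠ inr ha hb y → ∃ s t : Set (Glue ha hb), IsOpen s ∧
      IsOpen t ∧ inl ha hb x ∈ s ∧ inr ha hb y ∈ t ∧ Disjoint s t := by
    intro x y h
    by_cases hx : x ∈ range a
    · obtain ⟨u, rfl⟩ := hx
      rw [inl_a] at h ⊢
      exact hr _ _ h
    by_cases hy : y ∈ range b
    · obtain ⟨u, rfl⟩ := hy
      rw [← inl_a] at h ⊢
      exact hl _ _ h
    refine ⟨_, _, isOpenEmbedding_inl.isOpenMap _ hV, isOpenEmbedding_inr.isOpenMap _ hW,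
      ⟨x, hV' x hx, rfl⟩, ⟨y, hW' y hy, rfl⟩, ?_⟩
    rw [Set.disjoint_left]
    rintro _ ⟨x', hx', rfl⟩ ⟨y', hy', h⟩
    obtain ⟨u, rfl, rfl⟩ := inl_eq_inr_iff.1 h.symm
    exact hd u hx' hy'
  refine ⟨fun z w hzw => ?_⟩
  rcases cases z with ⟨x, rfl⟩ | ⟨y, rfl⟩ <;> rcases cases w with ⟨x', rfl⟩ | ⟨y', rfl⟩
  · exact hl _ _ hzw
  · exact hlr _ _ hzw
  · obtain ⟨s, t, hs, ht, h1, h2, h3⟩ := hlr _ _ hzw.symm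
    exact ⟨t, s, ht, hs, h2, h1, h3.symm⟩
  · exact hr _ _ hzw

/-- The map from a glued space given by compatible maps on the pieces. -/
def elim {Z : Type} (f : X → Z) (g : Y → Z) (h : ∀ u, f (a u) = g (b u)) : Glue ha hb → Z :=
  Quotient.lift (Sum.elim f g) (by
    rintro (x | x) (y | y) hxy
    · exact congrArg f hxy
    · obtain ⟨u, rfl, rfl⟩ := hxy
      exact h u
    · obtain ⟨u, rfl, rfl⟩ := hxy
      exact (h u).symm
    · exact congrArg g hxy)

variable {dU : U → ℕ} {dX : X → ℕ} {dY : Y → ℕ} {AU : Charts U dU} {A : Charts X dX}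
  {B : Charts Y dY}

open Charts

/-- The pieces of a glued space. -/
abbrev Piece (X Y : Type) (i : Bool) : Type := cond i X Y

instance (i : Bool) : TopologicalSpace (Piece X Y i) := by
  cases i
  · exact inferInstanceAs (TopologicalSpace Y)
  · exact inferInstanceAs (TopologicalSpace X)

/-- The charts of the pieces of a glued space. -/
def pieceCharts (A : Charts X dX) (B : Charts Y dY) : ∀ i, Charts (Piece X Y i)
    (Bool.rec (motive := fun i => Piece X Y i → ℕ) dY dX i) :=
  Bool.rec B A

/-- The inclusions of the pieces of a glued space. -/
def incl (ha : IsOpenEmbedding a) (hb : IsOpenEmbedding b) : ∀ i, Piece X Y i → Glue ha hb :=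
  Bool.rec (inr ha hb) (inl ha hb)

lemma isCover (hsa : ∀ u, SmoothAt AU A a u) (hsb : ∀ u, SmoothAt AU B b u)
    (hia : ∀ u, ∃ ρ, Function.LeftInverse ρ a ∧ SmoothAt A AU ρ (a u))
    (hib : ∀ u, ∃ ρ, Function.LeftInverse ρ b ∧ SmoothAt B AU ρ (b u))
    (hdim : ∀ u, dX (a u) = dY (b u)) :
    IsCover (pieceCharts A B) (incl ha hb) (elim dX dY hdim) where
  isOpenEmbedding i := by
    cases i
    · exact isOpenEmbedding_inr
    · exact isOpenEmbedding_inl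
  surjective z := by
    rcases cases z with ⟨x, rfl⟩ | ⟨y, rfl⟩
    · exact ⟨true, x, rfl⟩
    · exact ⟨false, y, rfl⟩
  dim_eq i z := by cases i <;> rfl
  compatible i j y z h := by
    cases i <;> cases j
    · exact ⟨id, smoothAt_id, .of_forall fun _ => rfl⟩
    · obtain ⟨u, rfl, rfl⟩ := inl_eq_inr_iff.1 h.symm
      obtain ⟨ρ, hρ, hρ'⟩ := hib u
      refine ⟨a ∘ ρ, (hsa u).comp_of_eq hρ' (hρ u), ?_⟩
      filter_upwards [hb.isOpen_range.mem_nhds (mem_range_self u)]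
      rintro _ ⟨u', rfl⟩
      simp only [Function.comp_apply, hρ u']
      exact inl_a u'
    · obtain ⟨u, rfl, rfl⟩ := inl_eq_inr_iff.1 h
      obtain ⟨ρ, hρ, hρ'⟩ := hia u
      refine ⟨b ∘ ρ, (hsb u).comp_of_eq hρ' (hρ u), ?_⟩
      filter_upwards [ha.isOpen_range.mem_nhds (mem_range_self u)]
      rintro _ ⟨u', rfl⟩
      simp only [Function.comp_apply, hρ u']
      exact (inl_a u').symm
    · exact ⟨id, smoothAt_id, .of_forall fun _ => rfl⟩

end Glue

end Glue

open Charts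

lemma exists_openPartialHomeomorph_of_comp {S S' X : Type} [TopologicalSpace S]
    [TopologicalSpace S'] [TopologicalSpace X] {i : S' → S} (hi : IsOpenEmbedding i) {f : S → X}
    (hf : IsLocalHomeomorph (f ∘ i)) (s : S') :
    ∃ φ : OpenPartialHomeomorph S X, i s ∈ φ.source ∧ EqOn f φ φ.source := by
  obtain ⟨ψ, hs, hψ⟩ := hf s
  have : Nonempty S' := ⟨s⟩
  refine ⟨(hi.toOpenPartialHomeomorph i).symm ≫ₕ ψ, ?_, ?_⟩
  · rw [OpenPartialHomeomorph.trans_source]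
    exact ⟨by simp, by rwa [mem_preimage, IsOpenEmbedding.toOpenPartialHomeomorph_left_inv]⟩
  · intro z hz
    rw [OpenPartialHomeomorph.trans_source] at hz
    have h1 := hz.1
    simp only [OpenPartialHomeomorph.symm_source,
      IsOpenEmbedding.toOpenPartialHomeomorph_target] at h1
    obtain ⟨w, rfl⟩ := h1
    rw [OpenPartialHomeomorph.trans_apply, IsOpenEmbedding.toOpenPartialHomeomorph_left_inv, ← hψ]
    rfl

namespace Glue

variable {U X Y : Type} [TopologicalSpace U] [TopologicalSpace X] [TopologicalSpace Y]
  {a : U → X} {b : U → Y} {ha : IsOpenEmbedding a} {hb : IsOpenEmbedding b}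
  {U' X' Y' : Type} [TopologicalSpace U'] [TopologicalSpace X'] [TopologicalSpace Y']
  {a' : U' → X'} {b' : U' → Y'} {ha' : IsOpenEmbedding a'} {hb' : IsOpenEmbedding b'}

/-- The map of glued spaces given by compatible maps of the pieces. -/
def map (f : X' → X) (g : Y' → Y) (h : U' → U) (hf : ∀ u, f (a' u) = a (h u))
    (hg : ∀ u, g (b' u) = b (h u)) : Glue ha' hb' → Glue ha hb :=
  elim (fun x => inl ha hb (f x)) (fun y => inr ha hb (g y)) fun u => by
    rw [hf, hg]; exact inl_a _

lemma finiteCovering_map [T2Space (Glue ha' hb')] {f : X' → X} {g : Y' → Y} {h : U' → U}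
    (hf : ∀ u, f (a' u) = a (h u)) (hg : ∀ u, g (b' u) = b (h u)) (hfc : FiniteCovering f)
    (hgc : FiniteCovering g) (hfr : ∀ x, f x ∈ range a → x ∈ range a')
    (hgr : ∀ y, g y ∈ range b → y ∈ range b') :
    FiniteCovering (map (ha := ha) (hb := hb) (ha' := ha') (hb' := hb') f g h hf hg) := by
  have hl : ∀ z x, map (ha := ha) (hb := hb) (ha' := ha') (hb' := hb') f g h hf hg z =
      inl ha hb x → ∃ x', inl ha' hb' x' = z ∧ f x' = x := by
    intro z x hz
    rcases cases z with ⟨x', rfl⟩ | ⟨y', rfl⟩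
    · exact ⟨x', rfl, inl_injective hz⟩
    · obtain ⟨u, rfl, hu⟩ := inl_eq_inr_iff.1 hz.symm
      obtain ⟨u', rfl⟩ := hgr y' ⟨u, hu⟩
      exact ⟨a' u', inl_a u', by rw [hf, hb.injective (hu.trans (hg _))]⟩
  have hr : ∀ z y, map (ha := ha) (hb := hb) (ha' := ha') (hb' := hb') f g h hf hg z =
      inr ha hb y → ∃ y', inr ha' hb' y' = z ∧ g y' = y := by
    intro z y hz
    rcases cases z with ⟨x', rfl⟩ | ⟨y', rfl⟩
    · obtain ⟨u, hu, rfl⟩ := inl_eq_inr_iff.1 hz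
      obtain ⟨u', rfl⟩ := hfr x' ⟨u, hu⟩
      exact ⟨b' u', (inl_a u').symm, by rw [hg, ha.injective (hu.trans (hf _))]⟩
    · exact ⟨y', rfl, inr_injective hz⟩
  refine FiniteCovering.of_isClosedMap ?_ ?_ ?_
  · refine IsLocalHomeomorph.mk _ fun z => ?_
    rcases cases z with ⟨x, rfl⟩ | ⟨y, rfl⟩
    · exact exists_openPartialHomeomorph_of_comp isOpenEmbedding_inl
        (show IsLocalHomeomorph (inl ha hb ∘ f) from
          isOpenEmbedding_inl.isLocalHomeomorph.comp hfc.isLocalHomeomorph) x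
    · exact exists_openPartialHomeomorph_of_comp isOpenEmbedding_inr
        (show IsLocalHomeomorph (inr ha hb ∘ g) from
          isOpenEmbedding_inr.isLocalHomeomorph.comp hgc.isLocalHomeomorph) y
  · intro K hK
    rw [isClosed_iff] at hK ⊢
    constructor
    · convert hfc.isProperMap.isClosedMap _ hK.1 using 1
      ext x
      constructor
      · rintro ⟨z, hz, hzx⟩
        obtain ⟨x', rfl, rfl⟩ := hl z x hzx
        exact ⟨x', hz, rfl⟩
      · rintro ⟨x', hx', rfl⟩
        exact ⟨_, hx', rfl⟩
    · convert hgc.isProperMap.isClosedMap _ hK.2 using 1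
      ext y
      constructor
      · rintro ⟨z, hz, hzy⟩
        obtain ⟨y', rfl, rfl⟩ := hr z y hzy
        exact ⟨y', hz, rfl⟩
      · rintro ⟨y', hy', rfl⟩
        exact ⟨_, hy', rfl⟩
  · intro z
    rcases cases z with ⟨x, rfl⟩ | ⟨y, rfl⟩
    · have := hfc.finite_fiber x
      refine ((toFinite (f ⁻¹' {x})).image (inl ha' hb')).subset ?_
      intro z hz
      obtain ⟨x', rfl, hx'⟩ := hl z x hz
      exact ⟨x', hx', rfl⟩
    · have := hgc.finite_fiber y
      refine ((toFinite (g ⁻¹' {y})).image (inr ha' hb')).subset ?_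
      intro z hz
      obtain ⟨y', rfl, hy'⟩ := hr z y hz
      exact ⟨y', hy', rfl⟩

end Glue

lemma exists_smooth_leftInverse {X Y : Type} [TopologicalSpace X] [TopologicalSpace Y]
    {dX : X → ℕ} {dY : Y → ℕ} {A : Charts X dX} {B : Charts Y dY} {e : X → Y}
    (he : IsOpenEmbedding e) {x : X} {ρ : Y → X} (hρ : SmoothAt B A ρ (e x))
    (h : ∀ᶠ x' in 𝓝 x, ρ (e x') = x') :
    ∃ ρ : Y → X, Function.LeftInverse ρ e ∧ SmoothAt B A ρ (e x) := by
  have : Nonempty X := ⟨x⟩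
  have h1 := Function.leftInverse_invFun he.injective
  refine ⟨Function.invFun e, h1, hρ.congr ?_⟩
  have h2 := he.isOpenMap.image_mem_nhds h
  filter_upwards [h2]
  rintro _ ⟨x', hx', rfl⟩
  rw [h1 x', hx']

namespace Filling

section

variable {N T : Type} [TopologicalSpace N] [TopologicalSpace T] {dN : N → ℕ}
  {AN : Charts N dN} {π : T → N} (F : Filling AN π)

lemma isOpenEmbedding_lift (hπ : FiniteCovering π) : IsOpenEmbedding F.lift := by
  have h1 : IsLocalHomeomorph (F.P ∘ F.lift) := by
    have : F.P ∘ F.lift = F.e ∘ Prod.map π id := funext F.P_lift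
    rw [this]
    exact F.isOpenEmbedding.isLocalHomeomorph.comp
      (isLocalHomeomorph_prodMap hπ.isLocalHomeomorph (Homeomorph.refl ℝ).isLocalHomeomorph)
  exact .of_continuous_injective_isOpenMap F.continuous_lift F.injective_lift
    (h1.of_comp F.finiteCovering.isLocalHomeomorph F.continuous_lift).isOpenMap

lemma isClosed_end_of_isClosed {K : Set N} (hK : IsClosed K) :
    IsClosed (F.e '' {z | z.1 ∈ K ∧ z.2 ≤ 0}) := by
  have h : F.e '' {z | z.1 ∈ K ∧ z.2 ≤ 0} =
      F.e '' {z | z.2 ≤ 0} ∩ (F.e '' {z | z.1 ∈ Kᶜ})ᶜ := by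
    ext x
    constructor
    · rintro ⟨z, ⟨h1, h2⟩, rfl⟩
      refine ⟨⟨z, h2, rfl⟩, ?_⟩
      rintro ⟨w, hw, hwz⟩
      rw [F.injective hwz] at hw
      exact hw h1
    · rintro ⟨⟨z, hz, rfl⟩, h2⟩
      exact ⟨z, ⟨not_not.1 fun h => h2 ⟨z, h, rfl⟩, hz⟩, rfl⟩
  rw [h]
  refine F.isClosed_end.inter (IsOpen.isClosed_compl ?_)
  exact F.isOpenEmbedding.isOpenMap _ (hK.isOpen_compl.preimage continuous_fst)

end

variable {NA TA NB TB NC TC : Type} [TopologicalSpace NA] [TopologicalSpace TA]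
  [TopologicalSpace NB] [TopologicalSpace TB] [TopologicalSpace NC] [TopologicalSpace TC]
  {dA : NA → ℕ} {dB : NB → ℕ} {dC : NC → ℕ} {A : Charts NA dA} {B : Charts NB dB}
  {C : Charts NC dC} {πA : TA → NA} {πB : TB → NB} {πC : TC → NC}
  (F : Filling (A.sum B) (Sum.map πA πB)) (G : Filling (B.sum C) (Sum.map πB πC))

/-- The end over the second part of the boundary. -/
def endInr (z : NB × ℝ) : F.X := F.e (Sum.inr z.1, z.2)

/-- The end over the first part of the boundary, with the opposite direction. -/
def endInl (z : NB × ℝ) : G.X := G.e (Sum.inl z.1, -z.2)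

/-- The total space of the end over the second part of the boundary. -/
def liftInr (z : TB × ℝ) : F.S := F.lift (Sum.inr z.1, z.2)

/-- The total space of the end over the first part of the boundary, with the opposite direction. -/
def liftInl (z : TB × ℝ) : G.S := G.lift (Sum.inl z.1, -z.2)

lemma isOpenEmbedding_endInr : IsOpenEmbedding F.endInr :=
  F.isOpenEmbedding.comp (IsOpenEmbedding.inr.prodMap .id)

lemma isOpenEmbedding_endInl : IsOpenEmbedding G.endInl :=
  G.isOpenEmbedding.comp (IsOpenEmbedding.inl.prodMap (Homeomorph.neg ℝ).isOpenEmbedding)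

lemma isOpenEmbedding_liftInr (hA : FiniteCovering πA) (hB : FiniteCovering πB) :
    IsOpenEmbedding F.liftInr :=
  (F.isOpenEmbedding_lift (hA.sumMap hB)).comp (IsOpenEmbedding.inr.prodMap .id)

lemma isOpenEmbedding_liftInl (hB : FiniteCovering πB) (hC : FiniteCovering πC) :
    IsOpenEmbedding G.liftInl :=
  (G.isOpenEmbedding_lift (hB.sumMap hC)).comp
    (IsOpenEmbedding.inl.prodMap (Homeomorph.neg ℝ).isOpenEmbedding)

lemma P_liftInr (z : TB × ℝ) : F.P (F.liftInr z) = F.endInr (πB z.1, z.2) := F.P_lift _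

lemma P_liftInl (z : TB × ℝ) : G.P (G.liftInl z) = G.endInl (πB z.1, z.2) := G.P_lift _

lemma mem_range_liftInr (s : F.S) (h : F.P s ∈ range F.endInr) : s ∈ range F.liftInr := by
  obtain ⟨z, hz⟩ := h
  obtain ⟨⟨t | t, c⟩, rfl⟩ := F.mem_range_lift s ⟨_, hz⟩
  · rw [F.P_lift] at hz
    cases (Prod.ext_iff.1 (F.injective hz)).1
  · exact ⟨(t, c), rfl⟩

lemma mem_range_liftInl (s : G.S) (h : G.P s ∈ range G.endInl) : s ∈ range G.liftInl := by
  obtain ⟨z, hz⟩ := h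
  obtain ⟨⟨t | t, c⟩, rfl⟩ := G.mem_range_lift s ⟨_, hz⟩
  · exact ⟨(t, -c), by simp [liftInl]⟩
  · rw [G.P_lift] at hz
    cases (Prod.ext_iff.1 (G.injective hz)).1

lemma smoothAt_endInr (z : NB × ℝ) : SmoothAt (B.prod (model ℝ)) F.A F.endInr z :=
  (F.smooth_e _).comp (smoothAt_inr.prodMap smoothAt_id)

lemma smoothAt_neg (x : ℝ) : SmoothAt (model ℝ) (model ℝ) (fun x : ℝ => -x) x :=
  smoothAt_model_model_iff.2 contDiffAt_id.neg

lemma smoothAt_endInl (z : NB × ℝ) : SmoothAt (B.prod (model ℝ)) G.A G.endInl z :=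
  (G.smooth_e _).comp (f := Prod.map Sum.inl fun x : ℝ => -x)
    (smoothAt_inl.prodMap (smoothAt_neg _))

lemma smooth_inv_endInr (z : NB × ℝ) : ∃ ρ, Function.LeftInverse ρ F.endInr ∧
    SmoothAt F.A (B.prod (model ℝ)) ρ (F.endInr z) := by
  obtain ⟨ρ, h1, h2⟩ := F.smooth_inv (Sum.inr z.1, z.2)
  refine ⟨Prod.map (Sum.elim (fun _ => z.1) id) id ∘ ρ, fun w => by simp [endInr, h1 _], ?_⟩
  exact SmoothAt.comp_of_eq (y := (Sum.inr z.1, z.2))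
    (SmoothAt.prodMap (smoothAt_sum_inr.2 smoothAt_id) smoothAt_id) h2 (h1 _)

lemma smooth_inv_endInl (z : NB × ℝ) : ∃ ρ, Function.LeftInverse ρ G.endInl ∧
    SmoothAt G.A (B.prod (model ℝ)) ρ (G.endInl z) := by
  obtain ⟨ρ, h1, h2⟩ := G.smooth_inv (Sum.inl z.1, -z.2)
  refine ⟨Prod.map (Sum.elim id (fun _ => z.1)) (fun x => -x) ∘ ρ,
    fun w => by simp [endInl, h1 _], ?_⟩
  exact SmoothAt.comp_of_eq (y := (Sum.inl z.1, -z.2))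
    (SmoothAt.prodMap (smoothAt_sum_inl.2 smoothAt_id) (smoothAt_neg _)) h2 (h1 _)

lemma isCover_trans : IsCover (Glue.pieceCharts F.A G.A)
    (Glue.incl F.isOpenEmbedding_endInr G.isOpenEmbedding_endInl)
    (Glue.elim F.dim G.dim fun u =>
      (F.dim_e (Sum.inr u.1, u.2)).trans (G.dim_e (Sum.inl u.1, -u.2)).symm) :=
  Glue.isCover F.smoothAt_endInr G.smoothAt_endInl F.smooth_inv_endInr G.smooth_inv_endInl _

lemma t2Space_trans : T2Space (Glue F.isOpenEmbedding_endInr G.isOpenEmbedding_endInl) := by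
  refine Glue.t2Space (F.isClosed_end_of_isClosed isClosed_range_inr).isOpen_compl
    (G.isClosed_end_of_isClosed isClosed_range_inl).isOpen_compl ?_ ?_ ?_
  · rintro x hx ⟨⟨_, c⟩, ⟨⟨y, rfl⟩, -⟩, rfl⟩
    exact hx ⟨(y, c), rfl⟩
  · rintro x hx ⟨⟨_, c⟩, ⟨⟨y, rfl⟩, -⟩, rfl⟩
    exact hx ⟨(y, -c), by simp [endInl]⟩
  · rintro ⟨y, c⟩ h1 h2
    refine h2 ⟨(Sum.inl y, -c), ⟨⟨y, rfl⟩, ?_⟩, rfl⟩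
    by_contra h
    exact h1 ⟨(Sum.inr y, c), ⟨⟨y, rfl⟩, by
      have : ¬ -c ≤ 0 := h
      show c ≤ 0
      linarith⟩, rfl⟩

lemma t2Space_trans_total (hA : FiniteCovering πA) (hB : FiniteCovering πB)
    (hC : FiniteCovering πC) :
    T2Space (Glue (F.isOpenEmbedding_liftInr hA hB) (G.isOpenEmbedding_liftInl hB hC)) := by
  have := F.finiteCovering.t2
  have := G.finiteCovering.t2
  refine Glue.t2Space ((F.isClosed_end_of_isClosed isClosed_range_inr).isOpen_compl.preimage
      F.finiteCovering.continuous)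
    ((G.isClosed_end_of_isClosed isClosed_range_inl).isOpen_compl.preimage
      G.finiteCovering.continuous) ?_ ?_ ?_
  · rintro s hs ⟨⟨_, c⟩, ⟨⟨y, rfl⟩, -⟩, h⟩
    exact hs (F.mem_range_liftInr s ⟨(y, c), h⟩)
  · rintro s hs ⟨⟨_, c⟩, ⟨⟨y, rfl⟩, -⟩, h⟩
    exact hs (G.mem_range_liftInl s ⟨(y, -c), by simpa [endInl] using h⟩)
  · rintro ⟨y, c⟩ h1 h2
    refine h2 ⟨(Sum.inl (πB y), -c), ⟨⟨_, rfl⟩, ?_⟩, (G.P_liftInl (y, c)).symm⟩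
    by_contra h
    exact h1 ⟨(Sum.inr (πB y), c), ⟨⟨_, rfl⟩, by
      have : ¬ -c ≤ 0 := h
      show c ≤ 0
      linarith⟩, (F.P_liftInr (y, c)).symm⟩

/-- The embedding of the ends of the filling obtained by gluing two fillings. -/
def transEnd (z : (NA ⊕ NC) × ℝ) : Glue F.isOpenEmbedding_endInr G.isOpenEmbedding_endInl :=
  Sum.elim (fun x => Glue.inl _ _ (F.e (Sum.inl x, z.2)))
    (fun x => Glue.inr _ _ (G.e (Sum.inr x, z.2))) z.1

/-- The total space over the ends of the filling obtained by gluing two fillings. -/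
def transLift (hA : FiniteCovering πA) (hB : FiniteCovering πB) (hC : FiniteCovering πC)
    (z : (TA ⊕ TC) × ℝ) :
    Glue (F.isOpenEmbedding_liftInr hA hB) (G.isOpenEmbedding_liftInl hB hC) :=
  Sum.elim (fun x => Glue.inl _ _ (F.lift (Sum.inl x, z.2)))
    (fun x => Glue.inr _ _ (G.lift (Sum.inr x, z.2))) z.1

lemma inl_e_inl_ne (x : NA) (c : ℝ) (y : G.X) : Glue.inl F.isOpenEmbedding_endInr
    G.isOpenEmbedding_endInl (F.e (Sum.inl x, c)) ≠ Glue.inr _ _ y := by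
  intro h
  obtain ⟨u, hu, -⟩ := Glue.inl_eq_inr_iff.1 h
  cases (Prod.ext_iff.1 (F.injective hu)).1

lemma inl_ne_inr_e_inr (x : F.X) (y : NC) (c : ℝ) : Glue.inl F.isOpenEmbedding_endInr
    G.isOpenEmbedding_endInl x ≠ Glue.inr _ _ (G.e (Sum.inr y, c)) := by
  intro h
  obtain ⟨u, -, hu⟩ := Glue.inl_eq_inr_iff.1 h
  cases (Prod.ext_iff.1 (G.injective hu)).1

lemma isOpenEmbedding_transEnd : IsOpenEmbedding (F.transEnd G) := by
  have h1 : IsOpenEmbedding fun z : NA × ℝ => F.transEnd G (Sum.inl z.1, z.2) :=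
    Glue.isOpenEmbedding_inl.comp (F.isOpenEmbedding.comp (IsOpenEmbedding.inl.prodMap .id))
  have h2 : IsOpenEmbedding fun z : NC × ℝ => F.transEnd G (Sum.inr z.1, z.2) :=
    Glue.isOpenEmbedding_inr.comp (G.isOpenEmbedding.comp (IsOpenEmbedding.inr.prodMap .id))
  refine .of_continuous_injective_isOpenMap (continuous_sum_prod h1.continuous h2.continuous) ?_ ?_
  · rintro ⟨x | x, c⟩ ⟨y | y, c'⟩ h
    · simpa using h1.injective (a₁ := (x, c)) (a₂ := (y, c')) h
    · exact absurd h (F.inl_e_inl_ne G _ _ _)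
    · exact absurd h.symm (F.inl_e_inl_ne G _ _ _)
    · simpa using h2.injective (a₁ := (x, c)) (a₂ := (y, c')) h
  · rw [isOpenMap_iff_nhds_le]
    rintro ⟨x | x, c⟩
    · have := h1.map_nhds_eq (x, c)
      rw [← this, show (fun z : NA × ℝ => F.transEnd G (Sum.inl z.1, z.2)) =
        F.transEnd G ∘ Prod.map Sum.inl id from rfl, ← Filter.map_map]
      exact Filter.map_mono ((IsOpenEmbedding.inl.prodMap .id).map_nhds_eq (x, c)).le
    · have := h2.map_nhds_eq (x, c)
      rw [← this, show (fun z : NC × ℝ => F.transEnd G (Sum.inr z.1, z.2)) =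
        F.transEnd G ∘ Prod.map Sum.inr id from rfl, ← Filter.map_map]
      exact Filter.map_mono ((IsOpenEmbedding.inr.prodMap .id).map_nhds_eq (x, c)).le

lemma transEnd_smooth_inv (z : (NA ⊕ NC) × ℝ) : ∃ ρ, Function.LeftInverse ρ (F.transEnd G) ∧
    SmoothAt (ofCover (F.isCover_trans G)) ((A.sum C).prod (model ℝ)) ρ (F.transEnd G z) := by
  rcases z with ⟨x | x, c⟩
  · obtain ⟨ρ, h1, h2⟩ := F.smooth_inv (Sum.inl x, c)
    have : Nonempty F.X := ⟨F.e (Sum.inl x, c)⟩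
    have hinv := Function.leftInverse_invFun (Glue.isOpenEmbedding_inl
      (ha := F.isOpenEmbedding_endInr) (hb := G.isOpenEmbedding_endInl)).injective
    have h3 := smoothAt_leftInverse_ι (F.isCover_trans G) true (F.e (Sum.inl x, c)) hinv
    have h4 : SmoothAt ((A.sum B).prod (model ℝ)) ((A.sum C).prod (model ℝ))
        (Prod.map (Sum.elim Sum.inl fun _ => Sum.inl x) id) (Sum.inl x, c) :=
      SmoothAt.prodMap (smoothAt_sum_inl.2 smoothAt_inl) smoothAt_id
    refine exists_smooth_leftInverse (F.isOpenEmbedding_transEnd G)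
      (h4.comp_of_eq (h2.comp_of_eq h3 (hinv _)) ?_) ?_
    · simp only [Function.comp_apply]
      exact (congrArg ρ (hinv _)).trans (h1 _)
    · have : range (Prod.map Sum.inl id) ∈ 𝓝 ((Sum.inl x : NA ⊕ NC), c) :=
        (IsOpenEmbedding.inl.prodMap .id).isOpen_range.mem_nhds ⟨(x, c), rfl⟩
      filter_upwards [this]
      rintro _ ⟨⟨x', c'⟩, rfl⟩
      refine (congrArg (fun w => Prod.map (Sum.elim Sum.inl fun _ => Sum.inl x) id (ρ w))
        (hinv _)).trans ?_
      rw [h1]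
      rfl
  · obtain ⟨ρ, h1, h2⟩ := G.smooth_inv (Sum.inr x, c)
    have : Nonempty G.X := ⟨G.e (Sum.inr x, c)⟩
    have hinv := Function.leftInverse_invFun (Glue.isOpenEmbedding_inr
      (ha := F.isOpenEmbedding_endInr) (hb := G.isOpenEmbedding_endInl)).injective
    have h3 := smoothAt_leftInverse_ι (F.isCover_trans G) false (G.e (Sum.inr x, c)) hinv
    have h4 : SmoothAt ((B.sum C).prod (model ℝ)) ((A.sum C).prod (model ℝ))
        (Prod.map (Sum.elim (fun _ => Sum.inr x) Sum.inr) id) (Sum.inr x, c) :=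
      SmoothAt.prodMap (smoothAt_sum_inr.2 smoothAt_inr) smoothAt_id
    refine exists_smooth_leftInverse (F.isOpenEmbedding_transEnd G)
      (h4.comp_of_eq (h2.comp_of_eq h3 (hinv _)) ?_) ?_
    · simp only [Function.comp_apply]
      exact (congrArg ρ (hinv _)).trans (h1 _)
    · have : range (Prod.map Sum.inr id) ∈ 𝓝 ((Sum.inr x : NA ⊕ NC), c) :=
        (IsOpenEmbedding.inr.prodMap .id).isOpen_range.mem_nhds ⟨(x, c), rfl⟩
      filter_upwards [this]
      rintro _ ⟨⟨x', c'⟩, rfl⟩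
      refine (congrArg (fun w => Prod.map (Sum.elim (fun _ => Sum.inr x) Sum.inr) id (ρ w))
        (hinv _)).trans ?_
      rw [h1]
      rfl

/-- Two fillings glued along a common part of the boundary. -/
def trans (hA : FiniteCovering πA) (hB : FiniteCovering πB) (hC : FiniteCovering πC) :
    Filling (A.sum C) (Sum.map πA πC) :=
  haveI := F.t2Space_trans G
  haveI := F.t2Space_trans_total G hA hB hC
  { X := Glue F.isOpenEmbedding_endInr G.isOpenEmbedding_endInl
    dim := _
    A := ofCover (F.isCover_trans G)
    S := Glue (F.isOpenEmbedding_liftInr hA hB) (G.isOpenEmbedding_liftInl hB hC)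
    P := Glue.map F.P G.P (Prod.map πB id) F.P_liftInr G.P_liftInl
    finiteCovering := Glue.finiteCovering_map _ _ F.finiteCovering G.finiteCovering
      F.mem_range_liftInr G.mem_range_liftInl
    e := F.transEnd G
    smooth_e := by
      rintro ⟨x | x, c⟩
      · refine smoothAt_sum_prod_inl.2 ?_
        exact (smoothAt_ι (F.isCover_trans G) true _).comp
          (f := fun z : NA × ℝ => F.e (Sum.inl z.1, z.2))
          ((F.smooth_e _).comp (f := Prod.map Sum.inl id) (smoothAt_inl.prodMap smoothAt_id))
      · refine smoothAt_sum_prod_inr.2 ?_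
        exact (smoothAt_ι (F.isCover_trans G) false _).comp
          (f := fun z : NC × ℝ => G.e (Sum.inr z.1, z.2))
          ((G.smooth_e _).comp (f := Prod.map Sum.inr id) (smoothAt_inr.prodMap smoothAt_id))
    smooth_inv := F.transEnd_smooth_inv G
    isOpen_range := (F.isOpenEmbedding_transEnd G).isOpen_range
    isClosed_end := by
      rw [Glue.isClosed_iff]
      constructor
      · convert F.isClosed_end_of_isClosed isClosed_range_inl using 1
        ext x
        constructor
        · rintro ⟨⟨y | y, c⟩, hc, h⟩
          · exact ⟨(Sum.inl y, c), ⟨⟨y, rfl⟩, hc⟩, Glue.inl_injective h⟩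
          · exact absurd h.symm (F.inl_ne_inr_e_inr G _ _ _)
        · rintro ⟨⟨_, c⟩, ⟨⟨y, rfl⟩, hc⟩, rfl⟩
          exact ⟨(Sum.inl y, c), hc, rfl⟩
      · convert G.isClosed_end_of_isClosed isClosed_range_inr using 1
        ext x
        constructor
        · rintro ⟨⟨y | y, c⟩, hc, h⟩
          · exact absurd h (F.inl_e_inl_ne G _ _ _)
          · exact ⟨(Sum.inr y, c), ⟨⟨y, rfl⟩, hc⟩, Glue.inr_injective h⟩
        · rintro ⟨⟨_, c⟩, ⟨⟨y, rfl⟩, hc⟩, rfl⟩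
          exact ⟨(Sum.inr y, c), hc, rfl⟩
    isCompact_core := by
      refine ((F.isCompact_core.image Glue.isOpenEmbedding_inl.continuous).union
        (G.isCompact_core.image Glue.isOpenEmbedding_inr.continuous)).of_isClosed_subset
        ((F.isOpenEmbedding_transEnd G).isOpenMap _
          (isOpen_Iio.preimage continuous_snd)).isClosed_compl ?_
      intro z hz
      rcases Glue.cases z with ⟨x, rfl⟩ | ⟨y, rfl⟩
      · by_cases hx : x ∈ F.e '' {z | z.2 < 0}
        · obtain ⟨⟨w | w, c⟩, hc, rfl⟩ := hx
          · exact absurd ⟨(Sum.inl w, c), hc, rfl⟩ hz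
          · have hc : c < 0 := hc
            refine Or.inr ⟨G.e (Sum.inl w, -c), ?_, (Glue.inl_a (ha := F.isOpenEmbedding_endInr)
              (hb := G.isOpenEmbedding_endInl) (w, c)).symm⟩
            rintro ⟨w', hw', h⟩
            rw [G.injective h] at hw'
            have hw' : -c < 0 := hw'
            linarith
        · exact Or.inl ⟨x, hx, rfl⟩
      · by_cases hy : y ∈ G.e '' {z | z.2 < 0}
        · obtain ⟨⟨w | w, c⟩, hc, rfl⟩ := hy
          · have hc : c < 0 := hc
            refine Or.inl ⟨F.e (Sum.inr w, -c), ?_, ?_⟩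
            · rintro ⟨w', hw', h⟩
              rw [F.injective h] at hw'
              have hw' : -c < 0 := hw'
              linarith
            · refine (Glue.inl_a (ha := F.isOpenEmbedding_endInr)
                (hb := G.isOpenEmbedding_endInl) (w, -c)).trans ?_
              simp [endInl]
          · exact absurd ⟨(Sum.inr w, c), hc, rfl⟩ hz
        · exact Or.inr ⟨y, hy, rfl⟩
    lift := F.transLift G hA hB hC
    continuous_lift := continuous_sum_prod
      (Glue.isOpenEmbedding_inl.continuous.comp (F.continuous_lift.comp
        (f := fun z : TA × ℝ => (Sum.inl z.1, z.2)) (by fun_prop)))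
      (Glue.isOpenEmbedding_inr.continuous.comp (G.continuous_lift.comp
        (f := fun z : TC × ℝ => (Sum.inr z.1, z.2)) (by fun_prop)))
    injective_lift := by
      rintro ⟨x | x, c⟩ ⟨y | y, c'⟩ h
      · simpa using F.injective_lift (Glue.inl_injective h)
      · obtain ⟨u, hu, -⟩ := Glue.inl_eq_inr_iff.1 h
        cases (Prod.ext_iff.1 (F.injective_lift hu)).1
      · obtain ⟨u, hu, -⟩ := Glue.inl_eq_inr_iff.1 h.symm
        cases (Prod.ext_iff.1 (F.injective_lift hu)).1
      · simpa using G.injective_lift (Glue.inr_injective h)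
    P_lift := by
      rintro ⟨x | x, c⟩
      · exact congrArg (Glue.inl _ _) (F.P_lift _)
      · exact congrArg (Glue.inr _ _) (G.P_lift _)
    mem_range_lift := by
      rintro s ⟨⟨x | x, c⟩, h⟩
      · rcases Glue.cases s with ⟨s, rfl⟩ | ⟨s, rfl⟩
        · have h : F.e (Sum.inl x, c) = F.P s := Glue.inl_injective h
          obtain ⟨⟨t | t, c'⟩, rfl⟩ := F.mem_range_lift s ⟨_, h⟩
          · exact ⟨(Sum.inl t, c'), rfl⟩
          · rw [F.P_lift] at h
            cases (Prod.ext_iff.1 (F.injective h)).1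
        · exact absurd h (F.inl_e_inl_ne G _ _ _)
      · rcases Glue.cases s with ⟨s, rfl⟩ | ⟨s, rfl⟩
        · exact absurd h.symm (F.inl_ne_inr_e_inr G _ _ _)
        · have h : G.e (Sum.inr x, c) = G.P s := Glue.inr_injective h
          obtain ⟨⟨t | t, c'⟩, rfl⟩ := G.mem_range_lift s ⟨_, h⟩
          · rw [G.P_lift] at h
            cases (Prod.ext_iff.1 (G.injective h)).1
          · exact ⟨(Sum.inr t, c'), rfl⟩ }

end Filling

namespace Charts

section

variable (n : ℕ) (M : Type) [TopologicalSpace M] [ChartedSpace (EuclideanSpace ℝ (Fin n)) M]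
  [IsManifold (𝓡 n) ∞ M]

/-- The charts of a smooth manifold of constant dimension. -/
def ofManifold : Charts M (fun _ => n) where
  V _ := EuclideanSpace ℝ (Fin n)
  finrank_eq _ := finrank_euclideanSpace_fin
  chart x := chartAt _ x
  mem_source x := mem_chart_source _ x
  dim_eq _ _ _ := rfl
  contDiffOn x y := by
    have h := ((contDiffGroupoid ∞ (𝓡 n)).compatible
      (chart_mem_atlas (EuclideanSpace ℝ (Fin n)) x) (chart_mem_atlas (EuclideanSpace ℝ (Fin n)) y))
    rw [contDiffGroupoid, mem_groupoid_of_pregroupoid] at h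
    simpa [contDiffPregroupoid] using h.1

end

section

variable {n m : ℕ} {M M' : Type} [TopologicalSpace M] [ChartedSpace (EuclideanSpace ℝ (Fin n)) M]
  [IsManifold (𝓡 n) ∞ M] [TopologicalSpace M'] [ChartedSpace (EuclideanSpace ℝ (Fin m)) M']
  [IsManifold (𝓡 m) ∞ M']

lemma smoothAt_ofManifold_iff {f : M → M'} {x : M} :
    SmoothAt (ofManifold n M) (ofManifold m M') f x ↔ ContMDiffAt (𝓡 n) (𝓡 m) ∞ f x := by
  rw [contMDiffAt_iff]
  refine and_congr_right fun _ => ?_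
  simp only [mfld_simps, contDiffWithinAt_univ]
  exact Iff.rfl

end

section

variable {n : ℕ} {M M' : Type} [TopologicalSpace M] [ChartedSpace (EuclideanSpace ℝ (Fin n)) M]
  [IsManifold (𝓡 n) ∞ M] [TopologicalSpace M'] [ChartedSpace (EuclideanSpace ℝ (Fin n)) M']
  [IsManifold (𝓡 n) ∞ M'] {Z : Type} [TopologicalSpace Z] {dZ : Z → ℕ} {C : Charts Z dZ}

lemma smoothAt_ofManifold_inl {f : M ⊕ M' → Z} {x : M} :
    SmoothAt (ofManifold n (M ⊕ M')) C f (Sum.inl x) ↔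
      SmoothAt (ofManifold n M) C (f ∘ Sum.inl) x := by
  refine ⟨fun h => h.comp (smoothAt_ofManifold_iff.2 ContMDiff.inl.contMDiffAt), fun h => ?_⟩
  have h1 : ContMDiff (𝓡 n) (𝓡 n) ∞ (Sum.elim id fun _ => x : M ⊕ M' → M) :=
    contMDiff_id.sumElim contMDiff_const
  refine (h.comp_of_eq (smoothAt_ofManifold_iff.2 h1.contMDiffAt) (x := Sum.inl x) rfl).congr ?_
  filter_upwards [isOpen_range_inl.mem_nhds ⟨x, rfl⟩]
  rintro _ ⟨y, rfl⟩
  rfl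

lemma smoothAt_ofManifold_inr {f : M ⊕ M' → Z} {x : M'} :
    SmoothAt (ofManifold n (M ⊕ M')) C f (Sum.inr x) ↔
      SmoothAt (ofManifold n M') C (f ∘ Sum.inr) x := by
  refine ⟨fun h => h.comp (smoothAt_ofManifold_iff.2 ContMDiff.inr.contMDiffAt), fun h => ?_⟩
  have h1 : ContMDiff (𝓡 n) (𝓡 n) ∞ (Sum.elim (fun _ => x) id : M ⊕ M' → M') :=
    contMDiff_const.sumElim contMDiff_id
  refine (h.comp_of_eq (smoothAt_ofManifold_iff.2 h1.contMDiffAt) (x := Sum.inr x) rfl).congr ?_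
  filter_upwards [isOpen_range_inr.mem_nhds ⟨x, rfl⟩]
  rintro _ ⟨y, rfl⟩
  rfl

end

end Charts

open Charts

namespace ClosedManifold

variable (M : ClosedManifold) {n : ℕ}

lemma partChart_val (x z : M.part n) :
    M.partChart x z.1 = chartAt (EuclideanSpace ℝ (Fin n)) x z := by
  have : Nonempty (M.part n) := ⟨x⟩
  simp [partChart, IsOpenEmbedding.toOpenPartialHomeomorph_left_inv
    (Subtype.val : M.part n → M.carrier) (M.isOpenEmbedding_part n)]

lemma smoothAt_part_val (x : M.part n) :
    SmoothAt (ofManifold n (M.part n)) M.charts Subtype.val x := by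
  obtain ⟨x, rfl⟩ := x
  refine (smoothAt_iff_comp_chart continuous_subtype_val.continuousAt
    (M.charts.mem_source x)).2 ?_
  refine ((ofManifold _ (M.part (M.dim x))).smoothAt_chart
    ((ofManifold _ (M.part (M.dim x))).mem_source ⟨x, rfl⟩)).congr ?_
  filter_upwards with z
  exact M.partChart_val ⟨x, rfl⟩ z

lemma exists_smoothAt_part_inv (x : M.part n) : ∃ ρ : M.carrier → M.part n,
    Function.LeftInverse ρ Subtype.val ∧ SmoothAt M.charts (ofManifold n (M.part n)) ρ x.1 := by
  obtain ⟨x, rfl⟩ := x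
  have : Nonempty (M.part (M.dim x)) := ⟨⟨x, rfl⟩⟩
  have he := M.isOpenEmbedding_part (M.dim x)
  have hinv := Function.leftInverse_invFun he.injective
  refine ⟨_, hinv, ?_⟩
  have hc : ContinuousAt (Function.invFun Subtype.val : M.carrier → M.part (M.dim x)) x := by
    refine he.continuousAt_iff (x := (⟨x, rfl⟩ : M.part (M.dim x))).1 ?_
    exact continuousAt_id.congr (.of_forall fun y => (hinv y).symm)
  have h1 : Function.invFun Subtype.val x = (⟨x, rfl⟩ : M.part (M.dim x)) := hinv ⟨x, rfl⟩
  refine (smoothAt_iff_comp_chart hc (y₀ := ⟨x, rfl⟩) ?_).2 ?_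
  · rw [h1]
    exact (ofManifold _ (M.part (M.dim x))).mem_source _
  · refine (M.charts.smoothAt_chart (M.charts.mem_source x)).congr ?_
    filter_upwards [he.isOpen_range.mem_nhds ⟨⟨x, rfl⟩, rfl⟩]
    rintro _ ⟨y, rfl⟩
    refine (congrArg (chartAt (EuclideanSpace ℝ (Fin (M.dim x))) (⟨x, rfl⟩ : M.part (M.dim x)))
      (hinv y)).trans ?_
    exact (M.partChart_val ⟨x, rfl⟩ y).symm

end ClosedManifold

namespace ClosedCovering

variable (p q : ClosedCovering) (n : ℕ)

/-- The inclusion of the `n`-dimensional parts of the bases of two coverings. -/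
def inclPart : p.basePart n ⊕ q.basePart n → p.base.carrier ⊕ q.base.carrier :=
  Sum.map Subtype.val Subtype.val

lemma smoothAt_inclPart (x : p.basePart n ⊕ q.basePart n) :
    SmoothAt (ofManifold n _) (p.base.charts.sum q.base.charts) (inclPart p q n) x := by
  rcases x with x | x
  · exact smoothAt_ofManifold_inl.2 (smoothAt_inl.comp (p.base.smoothAt_part_val x))
  · exact smoothAt_ofManifold_inr.2 (smoothAt_inr.comp (q.base.smoothAt_part_val x))

lemma exists_smoothAt_inclPart_inv (x : p.basePart n ⊕ q.basePart n) :
    ∃ ρ, Function.LeftInverse ρ (inclPart p q n) ∧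
      SmoothAt (p.base.charts.sum q.base.charts) (ofManifold n _) ρ (inclPart p q n x) := by
  have ho : IsOpenEmbedding (inclPart p q n) :=
    .of_continuous_injective_isOpenMap (continuous_subtype_val.sumMap continuous_subtype_val)
      (Sum.map_injective.2 ⟨Subtype.val_injective, Subtype.val_injective⟩)
      ((p.base.isOpenEmbedding_part n).isOpenMap.sumMap (q.base.isOpenEmbedding_part n).isOpenMap)
  rcases x with x | x
  · obtain ⟨ρ, h1, h2⟩ := p.base.exists_smoothAt_part_inv x
    refine exists_smooth_leftInverse ho (ρ := Sum.elim (Sum.inl ∘ ρ) fun _ => Sum.inl x)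
      (smoothAt_sum_inl.2 ((smoothAt_ofManifold_iff.2 ContMDiff.inl.contMDiffAt).comp h2)) ?_
    filter_upwards [isOpen_range_inl.mem_nhds ⟨x, rfl⟩]
    rintro _ ⟨y, rfl⟩
    exact congrArg Sum.inl (h1 y)
  · obtain ⟨ρ, h1, h2⟩ := q.base.exists_smoothAt_part_inv x
    refine exists_smooth_leftInverse ho (ρ := Sum.elim (fun _ => Sum.inr x) (Sum.inr ∘ ρ))
      (smoothAt_sum_inr.2 ((smoothAt_ofManifold_iff.2 ContMDiff.inr.contMDiffAt).comp h2)) ?_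
    filter_upwards [isOpen_range_inr.mem_nhds ⟨x, rfl⟩]
    rintro _ ⟨y, rfl⟩
    exact congrArg Sum.inr (h1 y)

end ClosedCovering

open Charts

/-- The decomposition of `ℝⁿ⁺¹` given by the first coordinate. -/
def consEquiv (n : ℕ) :
    (EuclideanSpace ℝ (Fin n) × ℝ) ≃L[ℝ] EuclideanSpace ℝ (Fin (n + 1)) :=
  LinearEquiv.toContinuousLinearEquiv
    { toFun := fun z => WithLp.toLp 2 (Fin.cons z.2 z.1)
      invFun := fun x => (WithLp.toLp 2 fun i => x i.succ, x 0)
      map_add' := fun z w => by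
        ext i
        refine Fin.cases ?_ (fun i => ?_) i <;> simp
      map_smul' := fun c z => by
        ext i
        refine Fin.cases ?_ (fun i => ?_) i <;> simp
      left_inv := fun z => by
        refine Prod.ext ?_ ?_
        · ext i
          simp
        · simp
      right_inv := fun x => by
        ext i
        refine Fin.cases ?_ (fun i => ?_) i <;> simp }

lemma contMDiffAt_of_smoothAt {n m : ℕ} {N W : Type} [TopologicalSpace N]
    [ChartedSpace (EuclideanSpace ℝ (Fin n)) N] [IsManifold (𝓡 n) ∞ N] [TopologicalSpace W]
    [ChartedSpace (EuclideanHalfSpace (m + 1)) W] {i : N → W} {x : N} (hc : ContinuousAt i x)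
    (h : SmoothAt (ofManifold n N) (model (EuclideanSpace ℝ (Fin (m + 1))))
      (extChartAt (𝓡∂ (m + 1)) (i x) ∘ i) x) : ContMDiffAt (𝓡 n) (𝓡∂ (m + 1)) ∞ i x := by
  rw [contMDiffAt_iff]
  refine ⟨hc, ?_⟩
  simp only [mfld_simps, contDiffWithinAt_univ]
  exact (smoothAt_model_iff ((ofManifold n N).mem_source x)).1 h

lemma smoothAt_of_contMDiffAt {n m : ℕ} {N W : Type} [TopologicalSpace N]
    [ChartedSpace (EuclideanSpace ℝ (Fin n)) N] [IsManifold (𝓡 n) ∞ N] [TopologicalSpace W]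
    [ChartedSpace (EuclideanHalfSpace (m + 1)) W] {i : N → W} {x : N}
    (h : ContMDiffAt (𝓡 n) (𝓡∂ (m + 1)) ∞ i x) :
    SmoothAt (ofManifold n N) (model (EuclideanSpace ℝ (Fin (m + 1))))
      (extChartAt (𝓡∂ (m + 1)) (i x) ∘ i) x := by
  rw [contMDiffAt_iff] at h
  have h2 := h.2
  simp only [mfld_simps, contDiffWithinAt_univ] at h2
  exact (smoothAt_model_iff ((ofManifold n N).mem_source x)).2 h2

lemma mfderiv_eq_fderiv {n m : ℕ} {N W : Type} [TopologicalSpace N]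
    [ChartedSpace (EuclideanSpace ℝ (Fin n)) N] [TopologicalSpace W]
    [ChartedSpace (EuclideanHalfSpace (m + 1)) W] {i : N → W} {x : N}
    (h : ContMDiffAt (𝓡 n) (𝓡∂ (m + 1)) ∞ i x) :
    mfderiv (𝓡 n) (𝓡∂ (m + 1)) i x = fderiv ℝ (extChartAt (𝓡∂ (m + 1)) (i x) ∘ i ∘
      (chartAt (EuclideanSpace ℝ (Fin n)) x).symm) (chartAt (EuclideanSpace ℝ (Fin n)) x x) := by
  refine (h.mdifferentiableAt (by simp)).mfderiv.trans ?_
  simp only [writtenInExtChartAt, mfld_simps, fderivWithin_univ]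
  rfl

lemma injective_mfderiv {n m : ℕ} {N W : Type} [TopologicalSpace N]
    [ChartedSpace (EuclideanSpace ℝ (Fin n)) N] [IsManifold (𝓡 n) ∞ N] [TopologicalSpace W]
    [ChartedSpace (EuclideanHalfSpace (m + 1)) W] {i : N → W} {x : N} (hc : ContinuousAt i x)
    (h : SmoothAt (ofManifold n N) (model (EuclideanSpace ℝ (Fin (m + 1))))
      (extChartAt (𝓡∂ (m + 1)) (i x) ∘ i) x)
    {ρ : EuclideanSpace ℝ (Fin (m + 1)) → N}
    (hρ : SmoothAt (model (EuclideanSpace ℝ (Fin (m + 1)))) (ofManifold n N) ρ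
      (extChartAt (𝓡∂ (m + 1)) (i x) (i x)))
    (hinv : ∀ᶠ y in 𝓝 x, ρ (extChartAt (𝓡∂ (m + 1)) (i x) (i y)) = y) :
    Function.Injective (mfderiv (𝓡 n) (𝓡∂ (m + 1)) i x) := by
  rw [mfderiv_eq_fderiv (contMDiffAt_of_smoothAt hc h)]
  set G := extChartAt (𝓡∂ (m + 1)) (i x) ∘ i ∘ (chartAt (EuclideanSpace ℝ (Fin n)) x).symm
  set v := chartAt (EuclideanSpace ℝ (Fin n)) x x
  have hx : (chartAt (EuclideanSpace ℝ (Fin n)) x).symm v = x :=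
    (chartAt _ x).left_inv (mem_chart_source _ x)
  have h1 : ContDiffAt ℝ ∞ G v := (smoothAt_model_iff ((ofManifold n N).mem_source x)).1 h
  have hρx : ρ (extChartAt (𝓡∂ (m + 1)) (i x) (i x)) = x := hinv.self_of_nhds
  have h2 : ContDiffAt ℝ ∞ (chartAt (EuclideanSpace ℝ (Fin n)) x ∘ ρ) (G v) := by
    have := ((ofManifold n N).smoothAt_chart ((ofManifold n N).mem_source x)).comp_of_eq hρ hρx
    have hG : G v = extChartAt (𝓡∂ (m + 1)) (i x) (i x) :=
      congrArg (fun y => extChartAt (𝓡∂ (m + 1)) (i x) (i y)) hx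
    rw [hG]
    exact smoothAt_model_model_iff.1 this
  have h3 : (chartAt (EuclideanSpace ℝ (Fin n)) x ∘ ρ) ∘ G =ᶠ[𝓝 v] id := by
    have t := (ofManifold n N).tendsto_chart_symm ((ofManifold n N).mem_source x)
    filter_upwards [t.eventually hinv, (chartAt (EuclideanSpace ℝ (Fin n)) x).open_target.mem_nhds
      ((chartAt (EuclideanSpace ℝ (Fin n)) x).map_source (mem_chart_source _ x))] with w hw hw'
    exact (congrArg (chartAt (EuclideanSpace ℝ (Fin n)) x) hw).trans
      ((chartAt (EuclideanSpace ℝ (Fin n)) x).right_inv hw')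
  have h4 := (h2.differentiableAt (by simp)).hasFDerivAt.comp v
    (h1.differentiableAt (by simp)).hasFDerivAt
  have h5 := ((hasFDerivAt_id v).congr_of_eventuallyEq h3).unique h4
  exact Function.LeftInverse.injective (g := fderiv ℝ (chartAt (EuclideanSpace ℝ (Fin n)) x ∘ ρ)
    (G v)) fun w => (DFunLike.congr_fun h5 w).symm

/-! Domains with smooth boundary -/

section HalfSpace

variable {X : Type} [TopologicalSpace X] {n : ℕ} {W : Set X}

open Classical in
/-- A chart of the ambient space which sends a subset to the half space, as a chart of the
subset. -/
def halfChart (Φ : OpenPartialHomeomorph X (EuclideanSpace ℝ (Fin (n + 1))))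
    (h : ∀ x ∈ Φ.source, x ∈ W ↔ 0 ≤ Φ x 0) (w₀ : W) :
    OpenPartialHomeomorph W (EuclideanHalfSpace (n + 1)) where
  toFun w := (𝓡∂ (n + 1)).symm (Φ w)
  invFun v := if hv : Φ.symm v.1 ∈ W then ⟨_, hv⟩ else w₀
  source := Subtype.val ⁻¹' Φ.source
  target := Subtype.val ⁻¹' Φ.target
  map_source' w hw := by
    have h1 : 0 ≤ Φ w 0 := (h _ hw).1 w.2
    have h2 : (𝓡∂ (n + 1)) ((𝓡∂ (n + 1)).symm (Φ w)) = Φ w := (𝓡∂ (n + 1)).right_inv (by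
      rw [range_modelWithCornersEuclideanHalfSpace]; exact h1)
    change (𝓡∂ (n + 1)) ((𝓡∂ (n + 1)).symm (Φ w)) ∈ Φ.target
    rw [h2]
    exact Φ.map_source hw
  map_target' v hv := by
    have h1 : Φ.symm v.1 ∈ W := (h _ (Φ.map_target hv)).2 (by rw [Φ.right_inv hv]; exact v.2)
    rw [dif_pos h1]
    exact Φ.map_target hv
  left_inv' w hw := by
    have h1 : 0 ≤ Φ w 0 := (h _ hw).1 w.2
    have h2 : (𝓡∂ (n + 1)) ((𝓡∂ (n + 1)).symm (Φ w)) = Φ w := (𝓡∂ (n + 1)).right_inv (by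
      rw [range_modelWithCornersEuclideanHalfSpace]; exact h1)
    have h3 : Φ.symm (((𝓡∂ (n + 1)).symm (Φ w)).1) = w := by
      refine (congrArg Φ.symm h2).trans (Φ.left_inv hw)
    rw [dif_pos (by rw [h3]; exact w.2)]
    exact Subtype.ext h3
  right_inv' v hv := by
    have h1 : Φ.symm v.1 ∈ W := (h _ (Φ.map_target hv)).2 (by rw [Φ.right_inv hv]; exact v.2)
    rw [dif_pos h1]
    refine (congrArg (𝓡∂ (n + 1)).symm (Φ.right_inv hv)).trans ?_
    exact (𝓡∂ (n + 1)).left_inv v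
  open_source := Φ.open_source.preimage continuous_subtype_val
  open_target := Φ.open_target.preimage continuous_subtype_val
  continuousOn_toFun := (𝓡∂ (n + 1)).continuous_symm.comp_continuousOn
    (Φ.continuousOn.comp continuous_subtype_val.continuousOn fun w hw => hw)
  continuousOn_invFun := by
    refine IsInducing.subtypeVal.continuousOn_iff.2 ?_
    refine (Φ.continuousOn_symm.comp continuous_subtype_val.continuousOn
      fun v hv => hv).congr fun v hv => ?_
    have h1 : Φ.symm v.1 ∈ W := (h _ (Φ.map_target hv)).2 (by rw [Φ.right_inv hv]; exact v.2)
    simp only [Function.comp_apply, dif_pos h1]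

/-- A family of charts of the ambient space which makes a subset a manifold with boundary. -/
structure HalfAtlas (n : ℕ) (W : Set X) where
  chart : W → OpenPartialHomeomorph X (EuclideanSpace ℝ (Fin (n + 1)))
  mem_source : ∀ w : W, w.1 ∈ (chart w).source
  mem_iff : ∀ w : W, ∀ x ∈ (chart w).source, x ∈ W ↔ 0 ≤ chart w x 0
  contDiffOn : ∀ w w' : W, ContDiffOn ℝ ∞ (chart w' ∘ (chart w).symm)
    ((chart w).target ∩ (chart w).symm ⁻¹' (chart w').source)

namespace HalfAtlas

variable (Φ : HalfAtlas n W)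

/-- The charts of a domain with smooth boundary. -/
def half (w : W) : OpenPartialHomeomorph W (EuclideanHalfSpace (n + 1)) :=
  halfChart (Φ.chart w) (Φ.mem_iff w) w

lemma half_val (w z : W) (hz : z.1 ∈ (Φ.chart w).source) :
    (𝓡∂ (n + 1)) (Φ.half w z) = Φ.chart w z :=
  (𝓡∂ (n + 1)).right_inv (by
    rw [range_modelWithCornersEuclideanHalfSpace]; exact (Φ.mem_iff w _ hz).1 z.2)

lemma half_symm_val (w : W) (v : EuclideanHalfSpace (n + 1)) (hv : v.1 ∈ (Φ.chart w).target) :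
    ((Φ.half w).symm v).1 = (Φ.chart w).symm v.1 := by
  have h1 : (Φ.chart w).symm v.1 ∈ W := (Φ.mem_iff w _ ((Φ.chart w).map_target hv)).2
    (by rw [(Φ.chart w).right_inv hv]; exact v.2)
  exact congrArg Subtype.val (dif_pos h1)

/-- The structure of manifold with boundary on a domain with smooth boundary. -/
@[reducible] def chartedSpace : ChartedSpace (EuclideanHalfSpace (n + 1)) W where
  atlas := range Φ.half
  chartAt := Φ.half
  mem_chart_source w := Φ.mem_source w
  chart_mem_atlas w := mem_range_self w

lemma isManifold : letI := Φ.chartedSpace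
    IsManifold (𝓡∂ (n + 1)) ∞ W := by
  let _ := Φ.chartedSpace
  refine isManifold_of_contDiffOn _ _ _ ?_
  rintro _ _ ⟨w, rfl⟩ ⟨w', rfl⟩
  have key : ∀ v ∈ (𝓡∂ (n + 1)).symm ⁻¹' ((Φ.half w).symm ≫ₕ Φ.half w').source ∩
      range (𝓡∂ (n + 1)), v ∈ (Φ.chart w).target ∧
        (((Φ.half w).symm ((𝓡∂ (n + 1)).symm v)).1 = (Φ.chart w).symm v) ∧
        (Φ.chart w).symm v ∈ (Φ.chart w').source := by
    rintro _ ⟨hv, v, rfl⟩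
    rw [mem_preimage, (𝓡∂ (n + 1)).left_inv, OpenPartialHomeomorph.trans_source] at hv
    have h1 : v.1 ∈ (Φ.chart w).target := hv.1
    have h2 : ((Φ.half w).symm v).1 ∈ (Φ.chart w').source := hv.2
    rw [(𝓡∂ (n + 1)).left_inv]
    rw [Φ.half_symm_val w v h1] at h2 ⊢
    exact ⟨h1, rfl, h2⟩
  refine ((Φ.contDiffOn w w').mono fun v hv => ⟨(key v hv).1, (key v hv).2.2⟩).congr fun v hv => ?_
  obtain ⟨h1, h2, h3⟩ := key v hv
  simp only [Function.comp_apply, OpenPartialHomeomorph.trans_apply]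
  rw [Φ.half_val w' _ (by rw [h2]; exact h3), h2]

lemma extChartAt_apply (w z : W) (hz : z.1 ∈ (Φ.chart w).source) :
    letI := Φ.chartedSpace
    extChartAt (𝓡∂ (n + 1)) w z = Φ.chart w z := Φ.half_val w z hz

lemma mem_boundary_iff (w : W) : letI := Φ.chartedSpace
    w ∈ (𝓡∂ (n + 1)).boundary W ↔ Φ.chart w w 0 = 0 := by
  let _ := Φ.chartedSpace
  change extChartAt (𝓡∂ (n + 1)) w w ∈ frontier (range (𝓡∂ (n + 1))) ↔ _
  rw [frontier_range_modelWithCornersEuclideanHalfSpace, Φ.extChartAt_apply w w (Φ.mem_source w)]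
  exact eq_comm

end HalfAtlas

end HalfSpace

open Charts

namespace Filling

variable {N T : Type} [TopologicalSpace N] [TopologicalSpace T] {dN : N → ℕ}
  {AN : Charts N dN} {π : T → N} (F : Filling AN π) (n : ℕ)

/-- The compact part of dimension `n + 1` of a filling. -/
def core : Set F.X := {x | F.dim x = n + 1} ∩ (F.e '' {z | z.2 < 0})ᶜ

lemma isCompact_core_dim : IsCompact (F.core n) :=
  F.isCompact_core.inter_left ((isClosed_discrete {n + 1}).preimage F.A.continuous_dim)

lemma e_zero_mem_core {x : N} (hx : dN x = n) : F.e (x, 0) ∈ F.core n := by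
  refine ⟨(F.dim_e _).trans (by rw [← hx]), ?_⟩
  rintro ⟨z, hz, h⟩
  rw [F.injective h] at hz
  exact lt_irrefl (0 : ℝ) hz

/-- Charts of the ambient manifold which are adapted to the core. -/
structure IsCoreChart (w : F.X)
    (Φ : OpenPartialHomeomorph F.X (EuclideanSpace ℝ (Fin (n + 1)))) : Prop where
  mem_source : w ∈ Φ.source
  smoothAt : ∀ x ∈ Φ.source, SmoothAt F.A (model _) Φ x
  smoothAt_symm : ∀ v ∈ Φ.target, SmoothAt (model _) F.A Φ.symm v
  mem_iff : ∀ x ∈ Φ.source, x ∈ F.core n ↔ 0 ≤ Φ x 0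
  eq_zero_iff : Φ w 0 = 0 ↔ ∃ x, F.e (x, 0) = w

lemma exists_isCoreChart_boundary {ν : N} (hν : dN ν = n) :
    ∃ Φ, F.IsCoreChart n (F.e (ν, 0)) Φ := by
  have : Nonempty (N × ℝ) := ⟨(ν, 0)⟩
  set ε := F.isOpenEmbedding.toOpenPartialHomeomorph F.e
  have hε : ∀ z, ε.symm (F.e z) = z := fun z => F.isOpenEmbedding.toOpenPartialHomeomorph_left_inv
  let L : (AN.V ν × ℝ) ≃L[ℝ] EuclideanSpace ℝ (Fin (n + 1)) :=
    ((AN.modelEquiv ⟨ν, hν⟩).prodCongr (.refl ℝ ℝ)).trans (consEquiv n)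
  have hL : ∀ v, L v 0 = v.2 := fun v => rfl
  let Φ : OpenPartialHomeomorph F.X (EuclideanSpace ℝ (Fin (n + 1))) :=
    ε.symm ≫ₕ (((AN.chart ν).prod (OpenPartialHomeomorph.refl ℝ)) ≫ₕ
      L.toHomeomorph.toOpenPartialHomeomorph)
  have hΦ : ∀ z, Φ (F.e z) = L (AN.chart ν z.1, z.2) := fun z => by
    change L (AN.chart ν (ε.symm (F.e z)).1, (ε.symm (F.e z)).2) = _
    rw [hε]
  have hsrc : ∀ x, x ∈ Φ.source ↔ ∃ z : N × ℝ, z.1 ∈ (AN.chart ν).source ∧ F.e z = x := by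
    intro x
    rw [OpenPartialHomeomorph.trans_source]
    constructor
    · rintro ⟨h1, h2⟩
      simp only [ε, OpenPartialHomeomorph.symm_source,
        IsOpenEmbedding.toOpenPartialHomeomorph_target] at h1
      obtain ⟨z, rfl⟩ := h1
      rw [mem_preimage, hε] at h2
      exact ⟨z, h2.1.1, rfl⟩
    · rintro ⟨z, hz, rfl⟩
      refine ⟨by simp [ε], ?_⟩
      rw [mem_preimage, hε]
      exact ⟨⟨hz, mem_univ _⟩, mem_univ _⟩
  refine ⟨Φ, (hsrc _).2 ⟨_, AN.mem_source ν, rfl⟩, ?_, ?_, ?_, ?_⟩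
  · intro x hx
    obtain ⟨z, hz, rfl⟩ := (hsrc x).1 hx
    obtain ⟨ρ, h1, h2⟩ := F.smooth_inv z
    have h3 : SmoothAt (AN.prod (model ℝ)) (model (AN.V ν × ℝ))
        (Prod.map (AN.chart ν) id) z :=
      smoothAt_model_prod.1 (SmoothAt.prodMap (AN.smoothAt_chart hz) smoothAt_id)
    have h4 : SmoothAt (AN.prod (model ℝ)) (model (EuclideanSpace ℝ (Fin (n + 1))))
        (L ∘ Prod.map (AN.chart ν) id) z :=
      SmoothAt.comp (smoothAt_model_model_iff.2 L.contDiff.contDiffAt) h3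
    refine (h4.comp_of_eq h2 (h1 z)).congr ?_
    filter_upwards [F.isOpen_range.mem_nhds (mem_range_self z)]
    rintro _ ⟨y, rfl⟩
    simp only [Function.comp_apply]
    rw [hΦ, h1 y]
    rfl
  · intro v hv
    have hv' : (L.symm v).1 ∈ (AN.chart ν).target := by
      simp only [Φ, OpenPartialHomeomorph.trans_target] at hv
      exact hv.1.2.1
    have h1 : SmoothAt (model (EuclideanSpace ℝ (Fin (n + 1)))) ((model (AN.V ν)).prod (model ℝ))
        L.symm v :=
      smoothAt_model_prod.2 (smoothAt_model_model_iff.2 L.symm.contDiff.contDiffAt)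
    exact (F.smooth_e _).comp (f := Prod.map (AN.chart ν).symm id ∘ L.symm)
      ((SmoothAt.prodMap (AN.smoothAt_chart_symm hv') smoothAt_id).comp h1)
  · intro x hx
    obtain ⟨z, hz, rfl⟩ := (hsrc x).1 hx
    rw [hΦ, hL]
    constructor
    · rintro ⟨-, h⟩
      exact not_lt.1 fun hz => h ⟨z, hz, rfl⟩
    · intro h
      refine ⟨(F.dim_e _).trans (by rw [AN.dim_eq ν _ hz, hν]), ?_⟩
      rintro ⟨z', hz', h'⟩
      rw [F.injective h'] at hz'
      exact absurd hz' (not_lt.2 h)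
  · rw [hΦ, hL]
    exact iff_of_true rfl ⟨ν, rfl⟩

lemma exists_isCoreChart_interior {w : F.X} (hw : w ∈ F.core n) (hw' : ∀ x, F.e (x, 0) ≠ w) :
    ∃ Φ, F.IsCoreChart n w Φ := by
  let c : EuclideanSpace ℝ (Fin (n + 1)) := EuclideanSpace.single 0 1
  let L := F.A.modelEquiv ⟨w, hw.1⟩
  let K : F.A.V w ≃ₜ EuclideanSpace ℝ (Fin (n + 1)) :=
    ((Homeomorph.addRight (-F.A.chart w w)).trans L.toHomeomorph).trans (Homeomorph.addRight c)
  have hK : ∀ v, K v = L (v + -F.A.chart w w) + c := fun v => rfl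
  have hK' : ∀ v, K.symm v = L.symm (v + -c) + F.A.chart w w := fun v => by
    rw [Homeomorph.symm_apply_eq, hK]
    simp
  have hKs : ContDiff ℝ ∞ K := by
    exact (L.contDiff.comp (contDiff_id.add contDiff_const)).add contDiff_const
  have hKs' : ContDiff ℝ ∞ K.symm := by
    rw [funext hK']
    exact (L.symm.contDiff.comp (contDiff_id.add contDiff_const)).add contDiff_const
  have hpos : IsOpen {v : EuclideanSpace ℝ (Fin (n + 1)) | 0 < v 0} :=
    isOpen_lt continuous_const (PiLp.continuous_apply 2 _ 0)
  let Φ := ((F.A.chart w ≫ₕ K.toOpenPartialHomeomorph) ≫ₕ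
    OpenPartialHomeomorph.ofSet _ hpos).restrOpen (F.e '' {z | z.2 ≤ 0})ᶜ
      F.isClosed_end.isOpen_compl
  have hΦ : ∀ x, Φ x = K (F.A.chart w x) := fun x => rfl
  have hsrc : ∀ x, x ∈ Φ.source ↔ x ∈ (F.A.chart w).source ∧ 0 < K (F.A.chart w x) 0 ∧
      x ∉ F.e '' {z | z.2 ≤ 0} := by
    intro x
    simp [Φ, and_assoc]
  have hww : Φ w = c := by
    rw [hΦ, hK, add_neg_cancel, map_zero, zero_add]
  refine ⟨Φ, ?_, ?_, ?_, ?_, ?_⟩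
  · refine (hsrc w).2 ⟨F.A.mem_source w, ?_, ?_⟩
    · rw [← hΦ, hww]
      simp [c]
    · rintro ⟨⟨x, t⟩, ht, h⟩
      rcases (show t ≤ 0 from ht).lt_or_eq with ht | rfl
      · exact hw.2 ⟨_, ht, h⟩
      · exact hw' x h
  · intro x hx
    exact SmoothAt.comp (g := K) (smoothAt_model_model_iff.2 hKs.contDiffAt)
      (F.A.smoothAt_chart ((hsrc x).1 hx).1)
  · intro v hv
    have hv' : K.symm v ∈ (F.A.chart w).target := by
      have h1 := Φ.map_target hv
      have h2 := (hsrc _).1 h1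
      have h3 : K (F.A.chart w (Φ.symm v)) = v := Φ.right_inv hv
      rw [← h3, K.symm_apply_apply]
      exact (F.A.chart w).map_source h2.1
    exact (F.A.smoothAt_chart_symm hv').comp (f := K.symm)
      (smoothAt_model_model_iff.2 hKs'.contDiffAt)
  · intro x hx
    obtain ⟨h1, h2, h3⟩ := (hsrc x).1 hx
    refine iff_of_true ⟨(F.A.dim_eq w x h1).trans hw.1, ?_⟩ (by rw [hΦ]; exact h2.le)
    rintro ⟨z, hz, h⟩
    exact h3 ⟨z, (show z.2 < 0 from hz).le, h⟩
  · rw [hww]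
    refine iff_of_false (by simp [c]) ?_
    rintro ⟨x, hx⟩
    exact hw' x hx

lemma exists_isCoreChart (w : F.core n) : ∃ Φ, F.IsCoreChart n w.1 Φ := by
  by_cases h : ∃ x, F.e (x, 0) = w
  · obtain ⟨x, hx⟩ := h
    rw [← hx]
    refine F.exists_isCoreChart_boundary n ?_
    have := w.2.1
    rw [← hx] at this
    exact Nat.succ_injective ((F.dim_e _).symm.trans this)
  · exact F.exists_isCoreChart_interior n w.2 (not_exists.1 h)

/-- The charts of the core of a filling as a manifold with boundary. -/
def coreAtlas : HalfAtlas n (F.core n) where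
  chart w := (F.exists_isCoreChart n w).choose
  mem_source w := (F.exists_isCoreChart n w).choose_spec.mem_source
  mem_iff w := (F.exists_isCoreChart n w).choose_spec.mem_iff
  contDiffOn w w' v hv := by
    have h1 := (F.exists_isCoreChart n w).choose_spec.smoothAt_symm v hv.1
    have h2 := (F.exists_isCoreChart n w').choose_spec.smoothAt _ hv.2
    exact (smoothAt_model_model_iff.1 (h2.comp h1)).contDiffWithinAt

lemma isCoreChart (w : F.core n) : F.IsCoreChart n w.1 ((F.coreAtlas n).chart w) :=
  (F.exists_isCoreChart n w).choose_spec

end Filling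

namespace ClosedCovering

variable {p q : ClosedCovering}

/-- Coverings whose disjoint union has a filling are cobordant. -/
lemma Cobordant.of_filling
    (F : Filling (p.base.charts.sum q.base.charts) (Sum.map p.proj q.proj)) : p.Cobordant q := by
  intro n
  let _ := (F.coreAtlas n).chartedSpace
  have hdim : ∀ x, Sum.elim p.base.dim q.base.dim (inclPart p q n x) = n := by
    rintro (x | x)
    · exact x.2
    · exact x.2
  have hdim' : ∀ x, Sum.elim p.base.dim q.base.dim x = n → ∃ y, inclPart p q n y = x := by
    rintro (x | x) hx
    · exact ⟨Sum.inl ⟨x, hx⟩, rfl⟩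
    · exact ⟨Sum.inr ⟨x, hx⟩, rfl⟩
  have hmem : ∀ x, F.e (inclPart p q n x, 0) ∈ F.core n := fun x => F.e_zero_mem_core n (hdim x)
  let i : p.basePart n ⊕ q.basePart n → F.core n := fun x => ⟨F.e (inclPart p q n x, 0), hmem x⟩
  let K : p.totalPart n ⊕ q.totalPart n → p.total ⊕ q.total := Sum.map Subtype.val Subtype.val
  have hKc : Continuous K := continuous_subtype_val.sumMap continuous_subtype_val
  have hKi : Function.Injective K :=
    Sum.map_injective.2 ⟨Subtype.val_injective, Subtype.val_injective⟩
  have hK : ∀ t, Sum.map p.proj q.proj (K t) =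
      inclPart p q n (Sum.map (p.projPart n) (q.projPart n) t) := by
    rintro (t | t) <;> rfl
  have hK' : ∀ t, Sum.elim p.base.dim q.base.dim (Sum.map p.proj q.proj t) = n → ∃ s, K s = t := by
    rintro (x | x) hx
    · exact ⟨Sum.inl ⟨x, hx⟩, rfl⟩
    · exact ⟨Sum.inr ⟨x, hx⟩, rfl⟩
  have hJi : Function.Injective (inclPart p q n) :=
    Sum.map_injective.2 ⟨Subtype.val_injective, Subtype.val_injective⟩
  have hlift : ∀ t, F.P (F.lift (K t, 0)) =
      F.e (inclPart p q n (Sum.map (p.projPart n) (q.projPart n) t), 0) := fun t => by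
    rw [F.P_lift]
    exact congrArg (fun x => F.e (x, 0)) (hK t)
  let j : p.totalPart n ⊕ q.totalPart n → F.P ⁻¹' F.core n := fun t =>
    ⟨F.lift (K t, 0), by rw [mem_preimage, hlift]; exact hmem _⟩
  have hsmooth : ∀ x, SmoothAt (ofManifold n _) F.A (fun y => F.e (inclPart p q n y, 0)) x :=
    fun x => (F.smooth_e _).comp (f := fun y => (inclPart p q n y, (0 : ℝ)))
      ((smoothAt_inclPart p q n x).prodMk smoothAt_const)
  have hcont : Continuous i :=
    (continuous_iff_continuousAt.2 fun x => (hsmooth x).1).subtype_mk _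
  have hbd : ∀ w : F.core n, w ∈ (𝓡∂ (n + 1)).boundary (F.core n) ↔ ∃ x, i x = w := by
    intro w
    rw [(F.coreAtlas n).mem_boundary_iff, (F.isCoreChart n w).eq_zero_iff]
    constructor
    · rintro ⟨x, hx⟩
      obtain ⟨y, rfl⟩ := hdim' x (by
        have := w.2.1
        rw [← hx] at this
        exact Nat.succ_injective ((F.dim_e _).symm.trans this))
      exact ⟨y, Subtype.ext hx⟩
    · rintro ⟨x, rfl⟩
      exact ⟨_, rfl⟩
  have hchart : ∀ x, ∀ᶠ y in 𝓝 x, (i y).1 ∈ ((F.coreAtlas n).chart (i x)).source := fun x =>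
    (continuous_subtype_val.comp hcont).continuousAt.eventually
      (((F.coreAtlas n).chart (i x)).open_source.mem_nhds ((F.coreAtlas n).mem_source (i x)))
  have hi : ∀ x, SmoothAt (ofManifold n _) (model (EuclideanSpace ℝ (Fin (n + 1))))
      (extChartAt (𝓡∂ (n + 1)) (i x) ∘ i) x := by
    intro x
    refine (((F.isCoreChart n (i x)).smoothAt _ ((F.coreAtlas n).mem_source (i x))).comp_of_eq
      (hsmooth x) rfl).congr ?_
    filter_upwards [hchart x] with y hy
    exact (F.coreAtlas n).extChartAt_apply (i x) (i y) hy
  refine ⟨F.core n, inferInstance, inferInstance,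
    isCompact_iff_compactSpace.1 (F.isCompact_core_dim n), inferInstance,
    (F.coreAtlas n).isManifold, F.P ⁻¹' F.core n, inferInstance,
    (F.core n).restrictPreimage F.P, i, j, F.finiteCovering.isCoveringMap.restrictPreimage _,
    (F.finiteCovering.restrictPreimage _).finite_fiber,
    fun x => contMDiffAt_of_smoothAt hcont.continuousAt (hi x), ?_, ?_, ?_, ?_, ?_, ?_, ?_⟩
  · intro x
    obtain ⟨ρ, h1, h2⟩ := F.smooth_inv (inclPart p q n x, 0)
    obtain ⟨ρ', h3, h4⟩ := exists_smoothAt_inclPart_inv p q n x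
    have h5 := (F.coreAtlas n).extChartAt_apply (i x) (i x) ((F.coreAtlas n).mem_source (i x))
    have h6 := ((F.coreAtlas n).chart (i x)).left_inv ((F.coreAtlas n).mem_source (i x))
    have h7 : SmoothAt (model (EuclideanSpace ℝ (Fin (n + 1)))) F.A
        ((F.coreAtlas n).chart (i x)).symm ((F.coreAtlas n).chart (i x) (i x)) :=
      (F.isCoreChart n (i x)).smoothAt_symm _
        (((F.coreAtlas n).chart (i x)).map_source ((F.coreAtlas n).mem_source (i x)))
    have h8 := h2.comp_of_eq h7 h6
    refine injective_mfderiv hcont.continuousAt (hi x)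
      (ρ := fun v => ρ' (ρ (((F.coreAtlas n).chart (i x)).symm v)).1) ?_ ?_
    · rw [h5]
      refine h4.comp_of_eq h8.fst ?_
      exact (congrArg (fun y => (ρ y).1) h6).trans (congrArg Prod.fst (h1 _))
    · filter_upwards [hchart x] with y hy
      rw [(F.coreAtlas n).extChartAt_apply (i x) (i y) hy,
        ((F.coreAtlas n).chart (i x)).left_inv hy]
      exact (congrArg (fun z : (p.base.carrier ⊕ q.base.carrier) × ℝ => ρ' z.1) (h1 _)).trans (h3 _)
  · intro x y h
    exact hJi (Prod.ext_iff.1 (F.injective (congrArg Subtype.val h))).1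
  · ext w
    exact (hbd w).symm
  · exact (F.continuous_lift.comp (hKc.prodMk continuous_const)).subtype_mk _
  · intro s t h
    exact hKi (Prod.ext_iff.1 (F.injective_lift (congrArg Subtype.val h))).1
  · ext s
    rw [mem_preimage, hbd]
    constructor
    · rintro ⟨t, rfl⟩
      exact ⟨_, Subtype.ext (hlift t).symm⟩
    · rintro ⟨x, hx⟩
      have hx : F.e (inclPart p q n x, 0) = F.P s.1 := congrArg Subtype.val hx
      obtain ⟨⟨t, c⟩, ht⟩ := F.mem_range_lift s.1 ⟨_, hx⟩
      rw [← ht, F.P_lift] at hx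
      have h := Prod.ext_iff.1 (F.injective hx)
      obtain ⟨t', rfl⟩ := hK' t (by rw [← show inclPart p q n x = Sum.map p.proj q.proj t from h.1]; exact hdim x)
      have hc : (0 : ℝ) = c := h.2
      subst hc
      exact ⟨t', Subtype.ext ht⟩
  · intro t
    exact Subtype.ext (hlift t)

end ClosedCovering

/-- A smooth function which vanishes on `(-∞, 0]` and maps `(0, ∞)` diffeomorphically onto
`(0, e⁻¹)`, so flat at `0` that it makes reparametrizations of half lines smooth. -/
def flat (h : ℝ) : ℝ := expNegInvGlue (expNegInvGlue h)

/-- The inverse of `flat`. -/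
def unflat (s : ℝ) : ℝ := (Real.log (-Real.log s))⁻¹

lemma contDiff_flat : ContDiff ℝ ∞ flat := expNegInvGlue.contDiff.comp expNegInvGlue.contDiff

lemma flat_of_nonpos {h : ℝ} (hh : h ≤ 0) : flat h = 0 := by
  simp [flat, expNegInvGlue.zero_of_nonpos hh, expNegInvGlue.zero_of_nonpos le_rfl]

lemma flat_eq_exp {h : ℝ} (hh : 0 < h) : flat h = Real.exp (-Real.exp h⁻¹) := by
  have h1 : expNegInvGlue h = Real.exp (-h⁻¹) := by simp [expNegInvGlue, hh.not_ge]
  rw [flat, h1, expNegInvGlue, if_neg (Real.exp_pos _).not_ge, ← Real.exp_neg, neg_neg]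

lemma flat_pos {h : ℝ} (hh : 0 < h) : 0 < flat h :=
  expNegInvGlue.pos_of_pos (expNegInvGlue.pos_of_pos hh)

lemma flat_nonneg (h : ℝ) : 0 ≤ flat h := expNegInvGlue.nonneg _

lemma flat_lt (h : ℝ) : flat h < Real.exp (-1) := by
  rcases le_or_gt h 0 with hh | hh
  · rw [flat_of_nonpos hh]
    exact Real.exp_pos _
  · rw [flat_eq_exp hh, Real.exp_lt_exp, neg_lt_neg_iff]
    exact Real.one_lt_exp_iff.2 (inv_pos.2 hh)

lemma unflat_zero : unflat 0 = 0 := by simp [unflat]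

lemma unflat_flat {h : ℝ} (hh : 0 ≤ h) : unflat (flat h) = h := by
  rcases hh.eq_or_lt with rfl | hh
  · rw [flat_of_nonpos le_rfl, unflat_zero]
  · rw [flat_eq_exp hh, unflat, Real.log_exp, neg_neg, Real.log_exp, inv_inv]

lemma one_lt_neg_log {s : ℝ} (hs : 0 < s) (hs' : s < Real.exp (-1)) : 1 < -Real.log s := by
  have := Real.log_lt_log hs hs'
  rw [Real.log_exp] at this
  linarith

lemma unflat_pos {s : ℝ} (hs : 0 < s) (hs' : s < Real.exp (-1)) : 0 < unflat s :=
  inv_pos.2 (Real.log_pos (one_lt_neg_log hs hs'))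

lemma unflat_nonneg {s : ℝ} (hs : 0 ≤ s) (hs' : s < Real.exp (-1)) : 0 ≤ unflat s := by
  rcases hs.eq_or_lt with rfl | hs
  · rw [unflat_zero]
  · exact (unflat_pos hs hs').le

lemma flat_unflat {s : ℝ} (hs : 0 ≤ s) (hs' : s < Real.exp (-1)) : flat (unflat s) = s := by
  rcases hs.eq_or_lt with rfl | hs
  · rw [unflat_zero, flat_of_nonpos le_rfl]
  · rw [flat_eq_exp (unflat_pos hs hs'), unflat, inv_inv,
      Real.exp_log (by linarith [one_lt_neg_log hs hs']), neg_neg, Real.exp_log hs]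

lemma contDiffAt_unflat {s : ℝ} (hs : 0 < s) (hs' : s < Real.exp (-1)) :
    ContDiffAt ℝ ∞ unflat s := by
  have h1 := one_lt_neg_log hs hs'
  exact ((contDiffAt_id.log hs.ne').neg.log (by simpa using (by linarith : -Real.log s ≠ 0))).inv
    (Real.log_pos h1).ne'

lemma continuousOn_unflat : ContinuousOn unflat (Ico 0 (Real.exp (-1))) := by
  rintro s ⟨hs, hs'⟩
  rcases hs.eq_or_lt with rfl | hs
  · have h1 : Filter.Tendsto unflat (𝓝[>] 0) (𝓝 (unflat 0)) := by
      rw [unflat_zero]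
      exact (Real.tendsto_log_atTop.comp
        (Filter.tendsto_neg_atBot_atTop.comp Real.tendsto_log_nhdsGT_zero)).inv_tendsto_atTop
    refine (continuousWithinAt_Ioi_iff_Ici.1 h1).mono fun s hs => hs.1
  · exact (contDiffAt_unflat hs hs').continuousAt.continuousWithinAt

/-- Integrals over the unit interval depend smoothly on parameters. -/
lemma contDiffOn_integral {E F : Type} [NormedAddCommGroup E] [NormedSpace ℝ E]
    [NormedAddCommGroup F] [NormedSpace ℝ F] {f : E × ℝ → F} {s : Set E} (hs : IsOpen s)
    (hf : ContDiffOn ℝ ∞ f (s ×ˢ Ioo (-2) 2)) :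
    ContDiffOn ℝ ∞ (fun x => ∫ t in (0 : ℝ)..1, f (x, t)) s := by
  let β : ContDiffBump (0 : ℝ) := ⟨1, 3 / 2, by norm_num, by norm_num⟩
  let g : E → ℝ → F := fun x y => β y • f (x, -y)
  have hg : ContDiffOn ℝ ∞ (fun z : E × ℝ => g z.1 z.2) (s ×ˢ univ) := by
    rintro ⟨x, y⟩ ⟨hx, -⟩
    refine ContDiffAt.contDiffWithinAt ?_
    by_cases hy : y ∈ Ioo (-2 : ℝ) 2
    · have h1 : ContDiffAt ℝ ∞ f (x, -y) := hf.contDiffAt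
        ((hs.prod isOpen_Ioo).mem_nhds ⟨hx, by constructor <;> linarith [hy.1, hy.2]⟩)
      have h2 : ContDiffAt ℝ ∞ (fun z : E × ℝ => (z.1, -z.2)) (x, y) := by fun_prop
      exact (β.contDiff.contDiffAt.comp _ contDiffAt_snd).smul
        (ContDiffAt.comp (f := fun z : E × ℝ => (z.1, -z.2)) (x, y) h1 h2)
    · have h3 : ∀ᶠ z : E × ℝ in 𝓝 (x, y), 3 / 2 < |z.2| := by
        refine continuous_snd.abs.continuousAt.eventually (lt_mem_nhds ?_)
        have : 2 ≤ |y| := not_lt.1 fun h => hy (abs_lt.1 h)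
        change 3 / 2 < |y|
        linarith
      refine (contDiffAt_const (c := (0 : F))).congr_of_eventuallyEq ?_
      filter_upwards [h3] with z hz
      have : β z.2 = 0 := β.zero_of_le_dist (by rw [Real.dist_eq, sub_zero]; exact hz.le)
      simp [g, this]
  have h := MeasureTheory.contDiffOn_convolution_right_with_param (𝕜 := ℝ)
    (μ := MeasureTheory.volume) (f := (Icc (0 : ℝ) 1).indicator fun _ => (1 : ℝ))
    (ContinuousLinearMap.lsmul ℝ ℝ) (g := g) hs (isCompact_Icc (a := -(3 / 2 : ℝ)) (b := 3 / 2))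
    (by
      intro x y hx hy
      have : β y = 0 := β.zero_of_le_dist (by
        rw [Real.dist_eq, sub_zero]
        exact not_lt.1 fun h => hy ⟨(abs_lt.1 h).1.le, (abs_lt.1 h).2.le⟩)
      simp [g, this])
    ((MeasureTheory.integrable_indicator_iff measurableSet_Icc).2
      (by simp)).locallyIntegrable hg
  have h2 : ContDiffOn ℝ ∞ (fun x : E => (x, (0 : ℝ))) s := by fun_prop
  refine (h.comp h2 fun x hx => ⟨hx, mem_univ _⟩).congr fun x hx => ?_
  simp only [Function.comp_apply, MeasureTheory.convolution, ContinuousLinearMap.lsmul_apply]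
  rw [intervalIntegral.integral_of_le zero_le_one, ← MeasureTheory.integral_Icc_eq_integral_Ioc,
    ← MeasureTheory.integral_indicator measurableSet_Icc]
  congr 1
  funext t
  by_cases ht : t ∈ Icc (0 : ℝ) 1
  · have : β (0 - t) = 1 := β.one_of_mem_closedBall (by
      rw [zero_sub, mem_closedBall_zero_iff, Real.norm_eq_abs, abs_neg, abs_of_nonneg ht.1]
      exact ht.2)
    simp only [indicator_of_mem ht, one_smul, g, this]
    simp
  · simp [indicator_of_notMem ht]

/-- The half space in `E × ℝ`. -/
def halfSpace (E : Type) : Set (E × ℝ) := {z | 0 ≤ z.2}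

/-- The smooth map onto the half space given by `flat`. -/
def flatten {E : Type} (z : E × ℝ) : E × ℝ := (z.1, flat z.2)

lemma flatten_mem {E : Type} (z : E × ℝ) : flatten z ∈ halfSpace E := flat_nonneg _

section Collar

variable {E F : Type} [NormedAddCommGroup E] [NormedSpace ℝ E] [NormedAddCommGroup F]
  [NormedSpace ℝ F]

lemma uniqueDiffOn_halfSpace : UniqueDiffOn ℝ (halfSpace E) := by
  have h : halfSpace E = univ ×ˢ Ici (0 : ℝ) := by
    ext z
    simp [halfSpace]
  rw [h]
  exact uniqueDiffOn_univ.prod (uniqueDiffOn_Ici 0)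

lemma contDiff_flatten : ContDiff ℝ ∞ (flatten : E × ℝ → E × ℝ) :=
  contDiff_fst.prodMk (contDiff_flat.comp contDiff_snd)

lemma contDiffAt_comp_flatten {O : Set (E × ℝ)} (hO : IsOpen O) {f : E × ℝ → F}
    (hf : ContDiffOn ℝ ∞ f (halfSpace E ∩ O)) {z : E × ℝ} (hz : flatten z ∈ O) :
    ContDiffAt ℝ ∞ (f ∘ flatten) z := by
  have h := hf.comp (contDiff_flatten.contDiffOn (s := flatten ⁻¹' O))
    fun w hw => ⟨flatten_mem w, hw⟩
  exact h.contDiffAt ((hO.preimage contDiff_flatten.continuous).mem_nhds hz)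

/-- A smooth function on a half space which vanishes on the boundary is divisible by the last
coordinate. -/
lemma exists_eq_flat_mul {O : Set (E × ℝ)} (hO : IsOpen O) {c : E × ℝ → ℝ}
    (hc : ContDiffOn ℝ ∞ c (halfSpace E ∩ O)) (h0 : ∀ z ∈ O, z.2 = 0 → c z = 0) {q : E}
    (hq : (q, (0 : ℝ)) ∈ O) : ∃ b : E × ℝ → ℝ, ContDiffAt ℝ ∞ b (q, 0) ∧
      ∀ᶠ z in 𝓝 (q, (0 : ℝ)), c (flatten z) = flat z.2 * b z := by
  obtain ⟨V, hV, U, hU, hVU⟩ := mem_nhds_prod_iff.1 (hO.mem_nhds hq)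
  obtain ⟨V', hV'V, hV', hqV'⟩ := mem_nhds_iff.1 hV
  obtain ⟨ε, hε, hεU⟩ := Metric.mem_nhds_iff.1 hU
  let s : Set (E × ℝ) := {z | z.1 ∈ V' ∧ 4 * flat z.2 < ε}
  have hs : IsOpen s := (hV'.preimage continuous_fst).inter
    (isOpen_lt ((contDiff_flat.continuous.comp continuous_snd).const_mul 4) continuous_const)
  have hqs : (q, (0 : ℝ)) ∈ s := ⟨hqV', by
    change 4 * flat 0 < ε
    rw [flat_of_nonpos le_rfl, mul_zero]
    exact hε⟩
  have hmem : ∀ z ∈ s, ∀ t ∈ Ioo (-2 : ℝ) 2, (z.1, t ^ 2 * flat z.2) ∈ halfSpace E ∩ O := by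
    rintro z ⟨h1, h2⟩ t ⟨ht1, ht2⟩
    have h3 : 0 ≤ t ^ 2 * flat z.2 := mul_nonneg (sq_nonneg t) (flat_nonneg _)
    refine ⟨h3, hVU ⟨hV'V h1, hεU ?_⟩⟩
    rw [Metric.mem_ball, Real.dist_eq, sub_zero, abs_of_nonneg h3]
    have h4 : t ^ 2 ≤ 4 := by nlinarith
    nlinarith [flat_nonneg z.2]
  have hu : UniqueDiffOn ℝ (halfSpace E ∩ O) := uniqueDiffOn_halfSpace.inter hO
  let D : E × ℝ → ℝ := fun y => fderivWithin ℝ c (halfSpace E ∩ O) y (0, 1)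
  have hD : ContDiffOn ℝ ∞ D (halfSpace E ∩ O) :=
    (hc.fderivWithin hu (by simp)).clm_apply contDiffOn_const
  have hm : ContDiff ℝ ∞ (fun y : (E × ℝ) × ℝ => (y.1.1, y.2 ^ 2 * flat y.1.2)) :=
    contDiff_fst.fst.prodMk ((contDiff_snd.pow 2).mul (contDiff_flat.comp contDiff_fst.snd))
  have hF : ContDiffOn ℝ ∞ (fun y : (E × ℝ) × ℝ => 2 * y.2 * D (y.1.1, y.2 ^ 2 * flat y.1.2))
      (s ×ˢ Ioo (-2) 2) :=
    (contDiff_const.mul contDiff_snd).contDiffOn.mul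
      (hD.comp hm.contDiffOn fun y hy => hmem y.1 hy.1 y.2 hy.2)
  refine ⟨_, (contDiffOn_integral hs hF).contDiffAt (hs.mem_nhds hqs), ?_⟩
  filter_upwards [hs.mem_nhds hqs] with z hz
  have hsub : ∀ t ∈ uIcc (0 : ℝ) 1, t ∈ Ioo (-2 : ℝ) 2 := fun t ht => by
    rw [uIcc_of_le zero_le_one] at ht
    constructor <;> linarith [ht.1, ht.2]
  have hder : ∀ t ∈ uIcc (0 : ℝ) 1, HasDerivAt (fun t : ℝ => c (z.1, t ^ 2 * flat z.2))
      (flat z.2 * (2 * t * D (z.1, t ^ 2 * flat z.2))) t := by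
    intro t ht
    have h1 : HasDerivAt (fun t : ℝ => (z.1, t ^ 2 * flat z.2)) ((0 : E), 2 * t * flat z.2) t := by
      refine (hasDerivAt_const t z.1).prodMk ?_
      simpa using (hasDerivAt_pow 2 t).mul_const (flat z.2)
    have h2 := ((hc.differentiableOn (by simp)) _ (hmem z hz t (hsub t ht))).hasFDerivWithinAt
    have h3 := h2.comp_hasDerivAt t h1 (by
      filter_upwards [isOpen_Ioo.mem_nhds (hsub t ht)] with t' ht'
      exact hmem z hz t' ht')
    refine h3.congr_deriv ?_
    have h4 : ((0 : E), 2 * t * flat z.2) = (2 * t * flat z.2) • ((0 : E), (1 : ℝ)) := by simp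
    rw [h4, map_smul, smul_eq_mul]
    change _ * D _ = flat z.2 * (2 * t * D _)
    ring
  have hcont : ContinuousOn (fun t : ℝ => flat z.2 * (2 * t * D (z.1, t ^ 2 * flat z.2)))
      (uIcc 0 1) := by
    refine continuousOn_const.mul (hF.continuousOn.comp (f := fun t : ℝ => (z, t)) (by fun_prop) ?_)
    exact fun t ht => ⟨hz, hsub t ht⟩
  have h := intervalIntegral.integral_eq_sub_of_hasDerivAt hder hcont.intervalIntegrable
  rw [intervalIntegral.integral_const_mul] at h
  have h5 : c (z.1, (0 : ℝ) ^ 2 * flat z.2) = 0 :=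
    h0 _ (hmem z hz 0 (by norm_num)).2 (by simp)
  rw [h5, sub_zero, one_pow, one_mul] at h
  exact h.symm

/-- The change of collar coordinates given by a change of half space coordinates is smooth. -/
lemma contDiffAt_collar {O : Set (E × ℝ)} {O' : Set (F × ℝ)} (hO : IsOpen O)
    {T : E × ℝ → F × ℝ} {T' : F × ℝ → E × ℝ} (hT : ContDiffOn ℝ ∞ T (halfSpace E ∩ O))
    (hT' : ContDiffOn ℝ ∞ T' (halfSpace F ∩ O')) (hO' : IsOpen O')
    (hmem : ∀ z ∈ halfSpace E ∩ O, T z ∈ halfSpace F ∩ O')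
    (hinv : ∀ z ∈ halfSpace E ∩ O, T' (T z) = z)
    (hzero : ∀ z ∈ halfSpace E ∩ O, z.2 = 0 → (T z).2 = 0)
    (hzero' : ∀ w ∈ halfSpace F ∩ O', w.2 = 0 → (T' w).2 = 0) {z₀ : E × ℝ}
    (hz₀ : flatten z₀ ∈ O) (hδ : (T (flatten z₀)).2 < Real.exp (-1)) :
    ContDiffAt ℝ ∞ (fun z => ((T (flatten z)).1, min z.2 0 + unflat (T (flatten z)).2)) z₀ := by
  have h1 := contDiffAt_comp_flatten hO hT hz₀
  have hev : ∀ᶠ z in 𝓝 z₀, flatten z ∈ halfSpace E ∩ O := by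
    filter_upwards [(hO.preimage contDiff_flatten.continuous).mem_nhds hz₀] with z hz
    exact ⟨flatten_mem z, hz⟩
  refine h1.fst.prodMk ?_
  rcases lt_trichotomy z₀.2 0 with hneg | hzer | hpos
  · refine contDiffAt_snd.congr_of_eventuallyEq ?_
    filter_upwards [hev, continuous_snd.continuousAt.eventually (gt_mem_nhds hneg)] with z hz hz'
    rw [hzero _ hz (flat_of_nonpos hz'.le), unflat_zero, min_eq_left hz'.le, add_zero]
  · obtain ⟨q, h⟩ := z₀
    obtain rfl : h = 0 := hzer
    have hq : (q, (0 : ℝ)) ∈ O := by simpa [flatten, flat_of_nonpos le_rfl] using hz₀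
    obtain ⟨b, hb, hb'⟩ := exists_eq_flat_mul (c := fun z => (T z).2) hO hT.snd
      (fun z hz hz2 => hzero z ⟨hz2.ge, hz⟩ hz2) hq
    have hflat : flatten (q, (0 : ℝ)) = (q, 0) := by simp [flatten, flat_of_nonpos le_rfl]
    rw [hflat] at hδ
    have hq' : (q, (0 : ℝ)) ∈ halfSpace E ∩ O := ⟨le_rfl (α := ℝ), hq⟩
    -- the quotient is positive on the boundary, as the inverse is Lipschitz
    have hbpos : 0 < b (q, 0) := by
      have h2 : ContDiffWithinAt ℝ 1 (fun w => (T' w).2) (halfSpace F) (T (q, 0)) := by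
        refine ((hT'.snd _ (hmem _ hq')).mono_of_mem_nhdsWithin ?_).of_le (by simp)
        exact Filter.inter_mem self_mem_nhdsWithin
          (nhdsWithin_le_nhds (hO'.mem_nhds (hmem _ hq').2))
      have hconv : Convex ℝ (halfSpace F) :=
        (convex_Ici (0 : ℝ)).linear_preimage (LinearMap.snd ℝ F ℝ)
      obtain ⟨K, t, ht, hK⟩ := h2.exists_lipschitzOnWith hconv
      obtain ⟨U, hU, hUt⟩ := mem_nhdsWithin_iff_exists_mem_nhds_inter.1 ht
      have hTc : ContinuousAt (T ∘ flatten) (q, (0 : ℝ)) :=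
        (contDiffAt_comp_flatten hO hT hz₀).continuousAt
      have hT0 : (T (q, 0)).2 = 0 := hzero _ hq' rfl
      have hproj : ContinuousAt (fun z : E × ℝ => ((T (flatten z)).1, (0 : ℝ))) (q, 0) :=
        hTc.fst.prodMk continuousAt_const
      have e1 : T (flatten (q, (0 : ℝ))) = T (q, 0) := by rw [hflat]
      have e2 : ((T (flatten (q, (0 : ℝ)))).1, (0 : ℝ)) = T (q, 0) := by
        rw [e1]
        exact Prod.ext rfl hT0.symm
      have hproj' : Filter.Tendsto (fun z : E × ℝ => ((T (flatten z)).1, (0 : ℝ))) (𝓝 (q, 0))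
          (𝓝 (T (q, 0))) := by
        have h := hproj.tendsto
        simp only [e2] at h
        exact h
      have hev2 : ∀ᶠ z in 𝓝 (q, (0 : ℝ)), 0 < z.2 → 1 ≤ K * b z := by
        filter_upwards [hev, hb', hTc.eventually (by rw [Function.comp_apply, e1]; exact hU),
          hproj'.eventually hU,
          hproj'.eventually (hO'.mem_nhds (hmem _ hq').2)] with z g1 g2 g3 g4 g5 hz
        have k1 : T (flatten z) ∈ t := hUt ⟨g3, (hmem _ g1).1⟩
        have k2 : ((T (flatten z)).1, (0 : ℝ)) ∈ t := hUt ⟨g4, le_rfl (α := ℝ)⟩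
        have k3 := hK.dist_le_mul _ k1 _ k2
        rw [hinv _ g1, hzero' _ ⟨le_rfl (α := ℝ), g5⟩ rfl, Prod.dist_eq, dist_self, Real.dist_eq,
          Real.dist_eq, sub_zero, sub_zero, max_eq_right (abs_nonneg _),
          abs_of_nonneg (show 0 ≤ (T (flatten z)).2 from (hmem _ g1).1), g2] at k3
        have k4 : flat z.2 ≤ K * (flat z.2 * b z) := by
          refine le_trans ?_ k3
          exact le_abs_self _
        have := flat_pos hz
        by_contra hlt
        nlinarith
      have hev3 : ∀ᶠ h : ℝ in 𝓝[>] 0, 1 ≤ K * b (q, h) := by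
        have hcont : Filter.Tendsto (fun h : ℝ => (q, h)) (𝓝[>] 0) (𝓝 (q, 0)) :=
          (Continuous.prodMk_right q).continuousAt.tendsto.mono_left nhdsWithin_le_nhds
        filter_upwards [hcont.eventually hev2, self_mem_nhdsWithin] with h h3 h4
        exact h3 h4
      have hlim : Filter.Tendsto (fun h : ℝ => K * b (q, h)) (𝓝[>] 0) (𝓝 (K * b (q, 0))) := by
        refine Filter.Tendsto.const_mul _ (hb.continuousAt.tendsto.comp ?_)
        exact (Continuous.prodMk_right q).continuousAt.tendsto.mono_left nhdsWithin_le_nhds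
      have h5 : 1 ≤ K * b (q, 0) := ge_of_tendsto hlim hev3
      by_contra hlt
      nlinarith [K.2, NNReal.coe_nonneg K]
    -- the explicit formula
    have hE : expNegInvGlue (0 : ℝ) = 0 := expNegInvGlue.zero
    have hEs : ContDiffAt ℝ ∞ (fun z : E × ℝ => expNegInvGlue z.2) (q, 0) :=
      (expNegInvGlue.contDiff.comp contDiff_snd).contDiffAt
    have h3 : ContDiffAt ℝ ∞ (fun z => 1 - expNegInvGlue z.2 * Real.log (b z)) (q, 0) :=
      contDiffAt_const.sub (hEs.mul (hb.log hbpos.ne'))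
    have h4 : ContDiffAt ℝ ∞
        (fun z => 1 + z.2 * Real.log (1 - expNegInvGlue z.2 * Real.log (b z))) (q, 0) :=
      contDiffAt_const.add (contDiffAt_snd.mul (h3.log (by simp [hE])))
    refine (contDiffAt_snd.div h4 (by simp)).congr_of_eventuallyEq ?_
    filter_upwards [hev, hb', hb.continuousAt.eventually (lt_mem_nhds hbpos),
      h3.continuousAt.eventually (lt_mem_nhds (show (0 : ℝ) < _ by simp [hE]))] with z g1 g2 g3 g4
    simp only [Pi.div_apply]
    rcases le_or_gt z.2 0 with hz | hz
    · rw [hzero _ g1 (flat_of_nonpos hz), unflat_zero, min_eq_left hz,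
        expNegInvGlue.zero_of_nonpos hz]
      simp
    · have e1 : expNegInvGlue z.2 = (Real.exp z.2⁻¹)⁻¹ := by
        rw [← Real.exp_neg]
        simp [expNegInvGlue, hz.not_ge]
      rw [e1] at g4 ⊢
      have e2 : -Real.log (flat z.2 * b z) =
          Real.exp z.2⁻¹ * (1 - (Real.exp z.2⁻¹)⁻¹ * Real.log (b z)) := by
        rw [Real.log_mul (flat_pos hz).ne' g3.ne', flat_eq_exp hz, Real.log_exp]
        field_simp
        ring
      rw [g2, min_eq_right hz.le, zero_add, unflat, e2,
        Real.log_mul (Real.exp_ne_zero _) g4.ne', Real.log_exp]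
      have e3 : 1 + z.2 * Real.log (1 - (Real.exp z.2⁻¹)⁻¹ * Real.log (b z)) =
          z.2 * (z.2⁻¹ + Real.log (1 - (Real.exp z.2⁻¹)⁻¹ * Real.log (b z))) := by
        field_simp
      rw [e3, div_mul_eq_div_div, div_self hz.ne', one_div]
  · have hz := hev.self_of_nhds
    have hTpos : 0 < (T (flatten z₀)).2 := by
      refine lt_of_le_of_ne (hmem _ hz).1 fun h => ?_
      have := hzero' _ (hmem _ hz) h.symm
      rw [hinv _ hz] at this
      exact (flat_pos hpos).ne' this
    have h2 : ContDiffAt ℝ ∞ (fun z => unflat (T (flatten z)).2) z₀ :=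
      ContDiffAt.comp (f := fun z => (T (flatten z)).2) z₀ (contDiffAt_unflat hTpos hδ) h1.snd
    refine h2.congr_of_eventuallyEq ?_
    filter_upwards [continuous_snd.continuousAt.eventually (lt_mem_nhds hpos)] with z hz'
    rw [min_eq_right hz'.le, zero_add]

end Collar

open Charts

/-- Half space valued charts of a space `W` with boundary `bd`, with values close to the boundary
at the base point of a chart. -/
structure HalfCharts (E : Type) [NormedAddCommGroup E] [NormedSpace ℝ E] {W : Type}
    [TopologicalSpace W] (bd : Set W) where
  toFun : W → W → E × ℝ
  invFun : W → E × ℝ → W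
  source : W → Set W
  O : W → Set (E × ℝ)
  isOpen_source : ∀ w, IsOpen (source w)
  isOpen_O : ∀ w, IsOpen (O w)
  mem_source : ∀ w, w ∈ source w
  small : ∀ w, (toFun w w).2 < Real.exp (-1)
  mapsTo : ∀ w, ∀ z ∈ source w, toFun w z ∈ halfSpace E ∩ O w
  mapsTo_inv : ∀ w, ∀ v ∈ halfSpace E ∩ O w, invFun w v ∈ source w
  left_inv : ∀ w, ∀ z ∈ source w, invFun w (toFun w z) = z
  right_inv : ∀ w, ∀ v ∈ halfSpace E ∩ O w, toFun w (invFun w v) = v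
  continuousOn : ∀ w, ContinuousOn (toFun w) (source w)
  continuousOn_inv : ∀ w, ContinuousOn (invFun w) (halfSpace E ∩ O w)
  contDiffOn : ∀ w w', ContDiffOn ℝ ∞ (toFun w' ∘ invFun w)
    (halfSpace E ∩ O w ∩ invFun w ⁻¹' source w')
  mem_bd_iff : ∀ w, ∀ z ∈ source w, z ∈ bd ↔ (toFun w z).2 = 0

/-- The space `W ∪ (bd × (-∞, 0])` obtained by adding an exterior collar to `W`. -/
def collarSet {W : Type} (bd : Set W) : Set (W × ℝ) := {z | z.2 ≤ 0 ∧ (z.2 = 0 ∨ z.1 ∈ bd)}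

namespace HalfCharts

variable {E : Type} [NormedAddCommGroup E] [NormedSpace ℝ E] {W : Type} [TopologicalSpace W]
  {bd : Set W} (κ : HalfCharts E bd)

lemma exists_isOpen_overlap (w w' : W) : ∃ U : Set (E × ℝ), IsOpen U ∧
    halfSpace E ∩ U = halfSpace E ∩ κ.O w ∩ κ.invFun w ⁻¹' κ.source w' := by
  obtain ⟨u, hu, h⟩ := continuousOn_iff'.1 (κ.continuousOn_inv w) _ (κ.isOpen_source w')
  refine ⟨κ.O w ∩ u, (κ.isOpen_O w).inter hu, ?_⟩
  rw [inter_comm _ (κ.invFun w ⁻¹' _), h, inter_comm u, inter_assoc]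

lemma invFun_mem_bd_iff (w : W) (v : E × ℝ) (hv : v ∈ halfSpace E ∩ κ.O w) :
    κ.invFun w v ∈ bd ↔ v.2 = 0 := by
  rw [κ.mem_bd_iff w _ (κ.mapsTo_inv w v hv), κ.right_inv w v hv]

lemma snd_lt_of_flatten (w : W) (v : E × ℝ) (hv : flatten v ∈ κ.O w) :
    (κ.toFun w (κ.invFun w (flatten v))).2 < Real.exp (-1) := by
  rw [κ.right_inv w _ ⟨flatten_mem v, hv⟩]
  exact flat_lt _

lemma invFun_flatten_mem (w : W) (v : E × ℝ) (hv : flatten v ∈ κ.O w) :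
    (κ.invFun w (flatten v), min v.2 0) ∈ collarSet bd := by
  refine ⟨min_le_right _ _, ?_⟩
  rcases le_or_gt v.2 0 with h | h
  · exact Or.inr ((κ.invFun_mem_bd_iff w _ ⟨flatten_mem v, hv⟩).2 (flat_of_nonpos h))
  · exact Or.inl (min_eq_right h.le)

lemma flatten_collar (w : W) {z : W} {t : ℝ} (ht : t ≤ 0) (hzt : t = 0 ∨ z ∈ bd)
    (h1 : z ∈ κ.source w) (h2 : (κ.toFun w z).2 < Real.exp (-1)) :
    flatten ((κ.toFun w z).1, t + unflat (κ.toFun w z).2) = κ.toFun w z := by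
  refine Prod.ext rfl ?_
  change flat (t + unflat (κ.toFun w z).2) = _
  rcases hzt with rfl | hz
  · rw [zero_add, flat_unflat (κ.mapsTo _ z h1).1 h2]
  · rw [(κ.mem_bd_iff _ z h1).1 hz, unflat_zero, add_zero, flat_of_nonpos ht]

lemma min_collar (w : W) {z : W} {t : ℝ} (ht : t ≤ 0) (hzt : t = 0 ∨ z ∈ bd)
    (h1 : z ∈ κ.source w) (h2 : (κ.toFun w z).2 < Real.exp (-1)) :
    min (t + unflat (κ.toFun w z).2) 0 = t := by
  rcases hzt with rfl | hz
  · rw [zero_add, min_eq_right (unflat_nonneg (κ.mapsTo _ z h1).1 h2)]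
  · rw [(κ.mem_bd_iff _ z h1).1 hz, unflat_zero, add_zero, min_eq_left ht]

open Classical in
/-- The chart of the space with an exterior collar around a point over `w`. -/
def collarChart (x : collarSet bd) : OpenPartialHomeomorph (collarSet bd) (E × ℝ) where
  toFun z := ((κ.toFun x.1.1 z.1.1).1, z.1.2 + unflat (κ.toFun x.1.1 z.1.1).2)
  invFun v := if hv : flatten v ∈ κ.O x.1.1 then
    ⟨(κ.invFun x.1.1 (flatten v), min v.2 0), κ.invFun_flatten_mem _ v hv⟩ else x
  source := {z | z.1.1 ∈ κ.source x.1.1 ∧ (κ.toFun x.1.1 z.1.1).2 < Real.exp (-1)}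
  target := {v | flatten v ∈ κ.O x.1.1}
  map_source' := by
    rintro ⟨⟨z, t⟩, ht, hzt⟩ ⟨h1, h2⟩
    have h3 := κ.mapsTo _ z h1
    change flatten ((κ.toFun x.1.1 z).1, t + unflat (κ.toFun x.1.1 z).2) ∈ κ.O x.1.1
    have := κ.flatten_collar x.1.1 ht hzt h1 h2
    rw [this]
    exact h3.2
  map_target' v hv := by
    have hv : flatten v ∈ κ.O x.1.1 := hv
    rw [dif_pos hv]
    exact ⟨κ.mapsTo_inv _ _ ⟨flatten_mem v, hv⟩, κ.snd_lt_of_flatten _ v hv⟩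
  left_inv' := by
    rintro ⟨⟨z, t⟩, ht, hzt⟩ ⟨h1, h2⟩
    have h3 := κ.mapsTo _ z h1
    have := κ.flatten_collar x.1.1 ht hzt h1 h2
    dsimp only at this ⊢
    rw [dif_pos (by rw [this]; exact h3.2)]
    refine Subtype.ext (Prod.ext ?_ ?_)
    · change κ.invFun _ (flatten _) = z
      rw [this, κ.left_inv _ z h1]
    · change min (t + unflat (κ.toFun x.1.1 z).2) 0 = t
      exact κ.min_collar x.1.1 ht hzt h1 h2
  right_inv' v hv := by
    have hv : flatten v ∈ κ.O x.1.1 := hv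
    rw [dif_pos hv]
    dsimp only
    rw [κ.right_inv _ _ ⟨flatten_mem v, hv⟩]
    refine Prod.ext rfl ?_
    change min v.2 0 + unflat (flat v.2) = v.2
    rcases le_or_gt v.2 0 with h | h
    · rw [flat_of_nonpos h, unflat_zero, min_eq_left h, add_zero]
    · rw [unflat_flat h.le, min_eq_right h.le, zero_add]
  open_source := by
    have h := (κ.continuousOn x.1.1).snd.isOpen_inter_preimage (κ.isOpen_source _)
      (isOpen_Iio (a := Real.exp (-1)))
    exact h.preimage (continuous_fst.comp continuous_subtype_val)
  open_target := (κ.isOpen_O _).preimage contDiff_flatten.continuous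
  continuousOn_toFun := by
    have h1 : ContinuousOn (fun z : collarSet bd => κ.toFun x.1.1 z.1.1)
        {z | z.1.1 ∈ κ.source x.1.1 ∧ (κ.toFun x.1.1 z.1.1).2 < Real.exp (-1)} :=
      (κ.continuousOn x.1.1).comp (continuous_fst.comp continuous_subtype_val).continuousOn
        fun z hz => hz.1
    refine h1.fst.prodMk (ContinuousOn.add
      (continuous_snd.comp continuous_subtype_val).continuousOn ?_)
    exact continuousOn_unflat.comp h1.snd fun z hz => ⟨(κ.mapsTo _ _ hz.1).1, hz.2⟩
  continuousOn_invFun := by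
    refine IsInducing.subtypeVal.continuousOn_iff.2 ?_
    refine ContinuousOn.congr (f := fun v => (κ.invFun x.1.1 (flatten v), min v.2 0)) ?_ ?_
    · refine ContinuousOn.prodMk ?_ (continuous_snd.min continuous_const).continuousOn
      exact (κ.continuousOn_inv x.1.1).comp contDiff_flatten.continuous.continuousOn
        fun v hv => ⟨flatten_mem v, hv⟩
    · intro v hv
      have hv : flatten v ∈ κ.O x.1.1 := hv
      simp only [Function.comp_apply, dif_pos hv]

lemma collarChart_symm_apply (x : collarSet bd) {v : E × ℝ}
    (hv : v ∈ (κ.collarChart x).target) :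
    ((κ.collarChart x).symm v).1 = (κ.invFun x.1.1 (flatten v), min v.2 0) :=
  congrArg Subtype.val (dif_pos (show flatten v ∈ κ.O x.1.1 from hv))

lemma contDiffAt_collarChart (x y : collarSet bd) {v : E × ℝ}
    (hv : v ∈ (κ.collarChart x).target ∩ (κ.collarChart x).symm ⁻¹' (κ.collarChart y).source) :
    ContDiffAt ℝ ∞ (κ.collarChart y ∘ (κ.collarChart x).symm) v := by
  obtain ⟨U, hU, hUe⟩ := κ.exists_isOpen_overlap x.1.1 y.1.1
  obtain ⟨U', hU', hUe'⟩ := κ.exists_isOpen_overlap y.1.1 x.1.1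
  have h1 := hv.2
  change ((κ.collarChart x).symm v).1.1 ∈ κ.source y.1.1 ∧
    (κ.toFun y.1.1 ((κ.collarChart x).symm v).1.1).2 < Real.exp (-1) at h1
  rw [κ.collarChart_symm_apply x hv.1] at h1
  have hvU : flatten v ∈ U := by
    have : flatten v ∈ halfSpace E ∩ U := by
      rw [hUe]
      exact ⟨⟨flatten_mem v, hv.1⟩, h1.1⟩
    exact this.2
  have key := contDiffAt_collar (T := κ.toFun y.1.1 ∘ κ.invFun x.1.1)
    (T' := κ.toFun x.1.1 ∘ κ.invFun y.1.1) (z₀ := v) hU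
    (by rw [hUe]; exact κ.contDiffOn _ _) (by rw [hUe']; exact κ.contDiffOn _ _) hU' ?_ ?_ ?_ ?_
    hvU h1.2
  · refine key.congr_of_eventuallyEq ?_
    filter_upwards [(κ.collarChart x).open_target.mem_nhds hv.1] with z hz
    change ((κ.toFun y.1.1 ((κ.collarChart x).symm z).1.1).1, ((κ.collarChart x).symm z).1.2 +
      unflat (κ.toFun y.1.1 ((κ.collarChart x).symm z).1.1).2) = _
    rw [κ.collarChart_symm_apply x hz]
    rfl
  · intro z hz
    rw [hUe] at hz
    rw [hUe']
    refine ⟨κ.mapsTo _ _ hz.2, ?_⟩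
    rw [mem_preimage, Function.comp_apply, κ.left_inv _ _ hz.2]
    exact κ.mapsTo_inv _ _ hz.1
  · intro z hz
    rw [hUe] at hz
    simp only [Function.comp_apply]
    rw [κ.left_inv _ _ hz.2, κ.right_inv _ _ hz.1]
  · intro z hz hz2
    rw [hUe] at hz
    exact (κ.mem_bd_iff _ _ hz.2).1 ((κ.invFun_mem_bd_iff _ _ hz.1).2 hz2)
  · intro z hz hz2
    rw [hUe'] at hz
    exact (κ.mem_bd_iff _ _ hz.2).1 ((κ.invFun_mem_bd_iff _ _ hz.1).2 hz2)

/-- The smooth structure on the space with an exterior collar. -/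
def collarCharts [FiniteDimensional ℝ E] :
    Charts (collarSet bd) (fun _ => Module.finrank ℝ E + 1) where
  V _ := E × ℝ
  finrank_eq _ := by simp
  chart x := κ.collarChart x
  mem_source x := ⟨κ.mem_source _, κ.small _⟩
  dim_eq _ _ _ := rfl
  contDiffOn x y _ hv := (κ.contDiffAt_collarChart x y hv).contDiffWithinAt

end HalfCharts

open Charts

section Boundary

variable {n : ℕ} {W : Type} [TopologicalSpace W] [ChartedSpace (EuclideanHalfSpace (n + 1)) W]
  [IsManifold (𝓡∂ (n + 1)) ∞ W]

lemma mem_boundary_iff_of_mem_source (w z : W)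
    (hz : z ∈ (chartAt (EuclideanHalfSpace (n + 1)) w).source) :
    z ∈ (𝓡∂ (n + 1)).boundary W ↔ extChartAt (𝓡∂ (n + 1)) w z 0 = 0 := by
  have h0 : 0 ≤ extChartAt (𝓡∂ (n + 1)) w z 0 :=
    (chartAt (EuclideanHalfSpace (n + 1)) w z).2
  have h1 : (𝓡∂ (n + 1)).IsInteriorPoint z ↔ 0 < extChartAt (𝓡∂ (n + 1)) w z 0 := by
    rw [(𝓡∂ (n + 1)).isInteriorPoint_iff_of_mem_atlas (n := ∞) (by simp)
      (chart_mem_atlas (EuclideanHalfSpace (n + 1)) w) hz]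
    change extChartAt (𝓡∂ (n + 1)) w z ∈ interior (extChartAt (𝓡∂ (n + 1)) w).target ↔ _
    rw [extChartAt_target, interior_inter, interior_range_modelWithCornersEuclideanHalfSpace,
      ((chartAt (EuclideanHalfSpace (n + 1)) w).open_target.preimage
        (𝓡∂ (n + 1)).continuous_symm).interior_eq]
    refine and_iff_right ?_
    have := (extChartAt (𝓡∂ (n + 1)) w).map_source (by rwa [extChartAt_source])
    rw [extChartAt_target] at this
    exact this.1
  change (𝓡∂ (n + 1)).IsBoundaryPoint z ↔ _
  rw [← not_iff_not, ← (𝓡∂ (n + 1)).isInteriorPoint_iff_not_isBoundaryPoint, h1]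
  exact lt_iff_le_and_ne.trans ((and_iff_right h0).trans ne_comm)

/-- A scaling factor which moves a point close to the boundary. -/
def scaleFactor (w : W) : ℝ := Real.exp (-1) / (1 + extChartAt (𝓡∂ (n + 1)) w w 0)

omit [IsManifold (𝓡∂ (n + 1)) ∞ W] in
lemma extChartAt_nonneg (w z : W) : 0 ≤ extChartAt (𝓡∂ (n + 1)) w z 0 :=
  (chartAt (EuclideanHalfSpace (n + 1)) w z).2

omit [IsManifold (𝓡∂ (n + 1)) ∞ W] in
lemma scaleFactor_pos (w : W) : 0 < scaleFactor (n := n) w :=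
  div_pos (Real.exp_pos _) (by linarith [extChartAt_nonneg (n := n) w w])

/-- The linear change of coordinates in the charts of a manifold with boundary. -/
def scaleEquiv (w : W) :
    EuclideanSpace ℝ (Fin (n + 1)) ≃L[ℝ] EuclideanSpace ℝ (Fin n) × ℝ :=
  (consEquiv n).symm.trans ((ContinuousLinearEquiv.refl ℝ _).prodCongr
    (ContinuousLinearEquiv.unitsEquivAut ℝ (Units.mk0 _ (scaleFactor_pos (n := n) w).ne')))

omit [IsManifold (𝓡∂ (n + 1)) ∞ W] in
lemma scaleEquiv_snd (w : W) (v : EuclideanSpace ℝ (Fin (n + 1))) :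
    (scaleEquiv w v).2 = v 0 * scaleFactor (n := n) w := rfl

omit [IsManifold (𝓡∂ (n + 1)) ∞ W] in
lemma scaleEquiv_symm_nonneg (w : W) (v : EuclideanSpace ℝ (Fin n) × ℝ) :
    0 ≤ (scaleEquiv w).symm v 0 ↔ 0 ≤ v.2 := by
  conv_rhs => rw [← (scaleEquiv w).apply_symm_apply v, scaleEquiv_snd]
  rw [mul_nonneg_iff_of_pos_right (scaleFactor_pos w)]

/-- The charts of a manifold with boundary. -/
def halfCharts (n : ℕ) (W : Type) [TopologicalSpace W]
    [ChartedSpace (EuclideanHalfSpace (n + 1)) W] [IsManifold (𝓡∂ (n + 1)) ∞ W] :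
    HalfCharts (EuclideanSpace ℝ (Fin n)) ((𝓡∂ (n + 1)).boundary W) :=
  have htarget (w : W) (v : EuclideanSpace ℝ (Fin n) × ℝ)
      (hv : v ∈ halfSpace (EuclideanSpace ℝ (Fin n)) ∩ {v | (𝓡∂ (n + 1)).symm
        ((scaleEquiv w).symm v) ∈ (chartAt (EuclideanHalfSpace (n + 1)) w).target}) :
      (scaleEquiv w).symm v ∈ (extChartAt (𝓡∂ (n + 1)) w).target := by
    rw [extChartAt_target, range_modelWithCornersEuclideanHalfSpace]
    exact ⟨hv.2, (scaleEquiv_symm_nonneg w v).2 hv.1⟩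
  { toFun := fun w z => scaleEquiv w (extChartAt (𝓡∂ (n + 1)) w z)
    invFun := fun w v => (extChartAt (𝓡∂ (n + 1)) w).symm ((scaleEquiv w).symm v)
    source := fun w => (chartAt (EuclideanHalfSpace (n + 1)) w).source
    O := fun w => {v | (𝓡∂ (n + 1)).symm ((scaleEquiv w).symm v) ∈
      (chartAt (EuclideanHalfSpace (n + 1)) w).target}
    isOpen_source := fun w => (chartAt (EuclideanHalfSpace (n + 1)) w).open_source
    isOpen_O := fun w => (chartAt (EuclideanHalfSpace (n + 1)) w).open_target.preimage
      ((𝓡∂ (n + 1)).continuous_symm.comp (scaleEquiv w).symm.continuous)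
    mem_source := fun w => mem_chart_source _ w
    small := fun w => by
      have h := extChartAt_nonneg (n := n) w w
      rw [scaleEquiv_snd, scaleFactor, mul_div_assoc', div_lt_iff₀ (by linarith)]
      nlinarith [Real.exp_pos (-1)]
    mapsTo := fun w z hz => by
      refine ⟨mul_nonneg (extChartAt_nonneg w z) (scaleFactor_pos w).le, ?_⟩
      have := (extChartAt (𝓡∂ (n + 1)) w).map_source (by rwa [extChartAt_source])
      rw [extChartAt_target] at this
      change (𝓡∂ (n + 1)).symm ((scaleEquiv w).symm (scaleEquiv w _)) ∈
        (chartAt (EuclideanHalfSpace (n + 1)) w).target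
      rw [ContinuousLinearEquiv.symm_apply_apply]
      exact this.1
    mapsTo_inv := fun w v hv => by
      have := (extChartAt (𝓡∂ (n + 1)) w).map_target (htarget w v hv)
      rwa [extChartAt_source] at this
    left_inv := fun w z hz => by
      rw [ContinuousLinearEquiv.symm_apply_apply]
      exact (extChartAt (𝓡∂ (n + 1)) w).left_inv (by rwa [extChartAt_source])
    right_inv := fun w v hv => by
      rw [(extChartAt (𝓡∂ (n + 1)) w).right_inv (htarget w v hv),
        ContinuousLinearEquiv.apply_symm_apply]
    continuousOn := fun w => by
      have := continuousOn_extChartAt (I := 𝓡∂ (n + 1)) w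
      rw [extChartAt_source] at this
      exact (scaleEquiv w).continuous.comp_continuousOn this
    continuousOn_inv := fun w => (continuousOn_extChartAt_symm w).comp
      (scaleEquiv w).symm.continuous.continuousOn (htarget w)
    contDiffOn := fun w w' => by
      refine (scaleEquiv w').contDiff.comp_contDiffOn
        ((contDiffOn_ext_coord_change (n := ∞) (I := 𝓡∂ (n + 1)) w' w).comp
          (scaleEquiv w).symm.contDiff.contDiffOn ?_)
      rintro v ⟨hv, hv'⟩
      rw [PartialEquiv.trans_source]
      refine ⟨htarget w v hv, ?_⟩
      rw [mem_preimage, extChartAt_source]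
      exact hv'
    mem_bd_iff := fun w z hz => by
      rw [mem_boundary_iff_of_mem_source w z hz, scaleEquiv_snd, mul_eq_zero,
        or_iff_left (scaleFactor_pos w).ne'] }

end Boundary

/-- The inverse function theorem, for maps to vector spaces. -/
lemma exists_smoothAt_localInverse {X : Type} [TopologicalSpace X] {dX : X → ℕ} {A : Charts X dX}
    {F : Type} [NormedAddCommGroup F] [NormedSpace ℝ F] [FiniteDimensional ℝ F] {f : X → F} {x : X}
    (hf : SmoothAt A (model F) f x)
    (hinj : Function.Injective (fderiv ℝ (f ∘ (A.chart x).symm) (A.chart x x)))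
    (hdim : dX x = Module.finrank ℝ F) :
    ∃ σ : F → X, SmoothAt (model F) A σ (f x) ∧ (∀ᶠ y in 𝓝 x, σ (f y) = y) ∧
      ∀ᶠ v in 𝓝 (f x), f (σ v) = v := by
  have := A.fd x
  have := FiniteDimensional.complete ℝ (A.V x)
  have hG := (smoothAt_model_iff (A.mem_source x)).1 hf
  set G := f ∘ (A.chart x).symm
  set v := A.chart x x
  have hx : (A.chart x).symm v = x := (A.chart x).left_inv (A.mem_source x)
  have hGv : G v = f x := congrArg f hx
  let L : A.V x ≃L[ℝ] F := (LinearEquiv.ofInjectiveOfFinrankEq (fderiv ℝ G v : A.V x →ₗ[ℝ] F) hinj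
    (by rw [A.finrank_eq, hdim])).toContinuousLinearEquiv
  have hL : HasFDerivAt G (L : A.V x →L[ℝ] F) v := by
    have h := (hG.differentiableAt (by simp)).hasFDerivAt
    convert h using 1
    ext u
    rfl
  have hst := hG.hasStrictFDerivAt' hL (by simp)
  have h1 := hG.to_localInverse hL (by simp)
  have h2 : ∀ᶠ u in 𝓝 v, hG.localInverse hL (by simp) (G u) = u := hst.eventually_left_inverse
  have h3 : ∀ᶠ u in 𝓝 (G v), G (hG.localInverse hL (by simp) u) = u :=
    hst.eventually_right_inverse
  have h4 : hG.localInverse hL (by simp) (G v) = v := h2.self_of_nhds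
  rw [hGv] at h1 h3 h4
  refine ⟨(A.chart x).symm ∘ hG.localInverse hL (by simp), ?_, ?_, h3⟩
  · exact (A.smoothAt_chart_symm ((A.chart x).map_source (A.mem_source x))).comp_of_eq
      (smoothAt_model_model_iff.2 h1) h4
  · filter_upwards [((A.chart x).continuousAt (A.mem_source x)).eventually h2,
      (A.chart x).open_source.mem_nhds (A.mem_source x)] with y hy hy'
    have : G (A.chart x y) = f y := congrArg f ((A.chart x).left_inv hy')
    rw [this] at hy
    simp only [Function.comp_apply]
    rw [hy, (A.chart x).left_inv hy']

open Charts

lemma isOpenEmbedding_neg_exp : IsOpenEmbedding fun t : ℝ => -Real.exp (-t) := by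
  refine isOpenEmbedding_of_leftInverse (by fun_prop) ?_ fun t => ⟨fun s => -Real.log (-s), fun s => by
    simp only [neg_neg, Real.log_exp], ?_⟩
  · convert isOpen_Iio (a := (0 : ℝ)) using 1
    ext s
    constructor
    · rintro ⟨t, rfl⟩
      exact neg_lt_zero.2 (Real.exp_pos _)
    · intro hs
      have hs : s < 0 := hs
      exact ⟨-Real.log (-s), by simp only [neg_neg]; rw [Real.exp_log (by linarith), neg_neg]⟩
  · refine ContinuousAt.neg (ContinuousAt.log continuousAt_id.neg ?_)
    simp [Real.exp_ne_zero]

section Collar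

set_option linter.unusedSectionVars false

variable {n : ℕ} {W : Type} [TopologicalSpace W] [T2Space W] [CompactSpace W]
  [ChartedSpace (EuclideanHalfSpace (n + 1)) W] [IsManifold (𝓡∂ (n + 1)) ∞ W]
  {N : Type} [TopologicalSpace N] [CompactSpace N] [ChartedSpace (EuclideanSpace ℝ (Fin n)) N]
  [IsManifold (𝓡 n) ∞ N] {i : N → W}

/-- The identification of the boundary times `(-∞, 0)` with the open exterior collar. -/
def collarEnd (hr : range i = (𝓡∂ (n + 1)).boundary W) (z : N × ℝ) :
    collarSet ((𝓡∂ (n + 1)).boundary W) :=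
  ⟨(i z.1, -Real.exp (-z.2)), (neg_lt_zero.2 (Real.exp_pos _)).le, Or.inr (hr ▸ mem_range_self _)⟩

variable (hr : range i = (𝓡∂ (n + 1)).boundary W)

include hr in
lemma range_collarEnd : range (collarEnd hr) = {x | x.1.2 < 0} := by
  ext ⟨⟨w, s⟩, hs, hw⟩
  constructor
  · rintro ⟨z, hz⟩
    have := congrArg (fun x => x.1.2) hz
    change -Real.exp (-z.2) = s at this
    change s < 0
    rw [← this]
    exact neg_lt_zero.2 (Real.exp_pos _)
  · intro h
    have h : s < 0 := h
    obtain ⟨ν, rfl⟩ : w ∈ range i := by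
      rw [hr]
      exact hw.resolve_left h.ne
    refine ⟨(ν, -Real.log (-s)), Subtype.ext (Prod.ext rfl ?_)⟩
    change -Real.exp (- -Real.log (-s)) = s
    rw [neg_neg, Real.exp_log (by linarith), neg_neg]

lemma isOpenEmbedding_collarEnd (hc : Continuous i) (hi : Function.Injective i) :
    IsOpenEmbedding (collarEnd hr) := by
  refine ⟨?_, ?_⟩
  · have h1 := (hc.isClosedEmbedding hi).isEmbedding.prodMap isOpenEmbedding_neg_exp.isEmbedding
    exact IsEmbedding.of_comp (Continuous.subtype_mk h1.continuous _) continuous_subtype_val h1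
  · rw [range_collarEnd]
    exact isOpen_Iio.preimage (continuous_snd.comp continuous_subtype_val)

lemma collarChart_collarEnd (hc : Continuous i) (z : N × ℝ) :
    ((halfCharts n W).collarCharts.chart (collarEnd hr z)) ∘ collarEnd hr =ᶠ[𝓝 z]
      fun z' => ((scaleEquiv (i z.1) (extChartAt (𝓡∂ (n + 1)) (i z.1) (i z'.1))).1,
        -Real.exp (-z'.2)) := by
  have h := (hc.comp continuous_fst).continuousAt (x := z) |>.eventually
    (((halfCharts n W).isOpen_source (i z.1)).mem_nhds ((halfCharts n W).mem_source (i z.1)))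
  filter_upwards [h] with z' hz'
  change (((halfCharts n W).toFun (i z.1) (i z'.1)).1,
    -Real.exp (-z'.2) + unflat ((halfCharts n W).toFun (i z.1) (i z'.1)).2) = _
  have h2 : ((halfCharts n W).toFun (i z.1) (i z'.1)).2 = 0 :=
    ((halfCharts n W).mem_bd_iff _ _ hz').1 (hr ▸ mem_range_self _)
  rw [h2, unflat_zero, add_zero]
  rfl

lemma smoothAt_boundaryChart {x : N} (h : ContMDiffAt (𝓡 n) (𝓡∂ (n + 1)) ∞ i x) :
    SmoothAt (ofManifold n N) (model (EuclideanSpace ℝ (Fin n)))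
      (fun ν => (scaleEquiv (i x) (extChartAt (𝓡∂ (n + 1)) (i x) (i ν))).1) x := by
  refine SmoothAt.comp (g := fun v => (scaleEquiv (i x) v).1) ?_ (smoothAt_of_contMDiffAt h)
  exact smoothAt_model_model_iff.2 (contDiff_fst.comp (scaleEquiv (i x)).contDiff).contDiffAt

include hr in
lemma exists_boundaryChart_inv {x : N} (h : ContMDiffAt (𝓡 n) (𝓡∂ (n + 1)) ∞ i x)
    (hd : Function.Injective (mfderiv (𝓡 n) (𝓡∂ (n + 1)) i x)) :
    ∃ σ : EuclideanSpace ℝ (Fin n) → N, SmoothAt (model _) (ofManifold n N) σ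
      (scaleEquiv (i x) (extChartAt (𝓡∂ (n + 1)) (i x) (i x))).1 ∧
      ∀ᶠ ν in 𝓝 x, σ (scaleEquiv (i x) (extChartAt (𝓡∂ (n + 1)) (i x) (i ν))).1 = ν := by
  have hK := smoothAt_boundaryChart h
  suffices hinj : _ by
    obtain ⟨σ, h1, h2, -⟩ := exists_smoothAt_localInverse hK hinj (by simp)
    exact ⟨σ, h1, h2⟩
  have hG := smoothAt_of_contMDiffAt h
  rw [smoothAt_model_iff ((ofManifold n N).mem_source x)] at hG
  rw [mfderiv_eq_fderiv h] at hd
  have hGd : HasFDerivAt (extChartAt (𝓡∂ (n + 1)) (i x) ∘ i ∘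
      (chartAt (EuclideanSpace ℝ (Fin n)) x).symm) _
      (chartAt (EuclideanSpace ℝ (Fin n)) x x) := (hG.differentiableAt (by simp)).hasFDerivAt
  set D := fderiv ℝ (extChartAt (𝓡∂ (n + 1)) (i x) ∘ i ∘
      (chartAt (EuclideanSpace ℝ (Fin n)) x).symm) (chartAt (EuclideanSpace ℝ (Fin n)) x x)
  have hL := (scaleEquiv (i x)).hasFDerivAt.comp _ hGd
  have hf := (hasFDerivAt_fst (𝕜 := ℝ)).comp _ hL
  have hs := (hasFDerivAt_snd (𝕜 := ℝ)).comp _ hL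
  have h0 := (hasFDerivAt_const (0 : ℝ) (chartAt (EuclideanSpace ℝ (Fin n)) x x)).unique
    (hs.congr_of_eventuallyEq ?_)
  · have he : fderiv ℝ ((fun ν => (scaleEquiv (i x) (extChartAt (𝓡∂ (n + 1)) (i x) (i ν))).1) ∘
        ((ofManifold n N).chart x).symm) ((ofManifold n N).chart x x) = _ := hf.fderiv
    rw [he]
    intro u v huv
    refine hd ((scaleEquiv (i x)).injective (Prod.ext huv ?_))
    have hu := DFunLike.congr_fun h0 u
    have hv := DFunLike.congr_fun h0 v
    exact hu.symm.trans hv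
  · have t := (ofManifold n N).tendsto_chart_symm ((ofManifold n N).mem_source x)
    filter_upwards [t.eventually (h.continuousAt.eventually
      (((halfCharts n W).isOpen_source (i x)).mem_nhds ((halfCharts n W).mem_source (i x))))]
      with v hv
    exact (((halfCharts n W).mem_bd_iff _ _ hv).1 (hr ▸ mem_range_self _)).symm

/-- A compact manifold with boundary, with an exterior collar attached, is a filling of its
boundary. -/
def Filling.ofBoundary {S T : Type} [TopologicalSpace S] [TopologicalSpace T] {P : S → W}
    {π : T → N} {j : T → S} (hP : FiniteCovering P) (hc : ContMDiff (𝓡 n) (𝓡∂ (n + 1)) ∞ i)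
    (hd : ∀ x, Function.Injective (mfderiv (𝓡 n) (𝓡∂ (n + 1)) i x)) (hi : Function.Injective i)
    (hj : Continuous j) (hji : Function.Injective j)
    (hjr : range j = P ⁻¹' (𝓡∂ (n + 1)).boundary W) (h : ∀ t, P (j t) = i (π t)) :
    Filling (ofManifold n N) π where
  X := collarSet ((𝓡∂ (n + 1)).boundary W)
  dim := _
  A := (halfCharts n W).collarCharts
  S := Prod.map P (id : ℝ → ℝ) ⁻¹' collarSet ((𝓡∂ (n + 1)).boundary W)
  P := (collarSet ((𝓡∂ (n + 1)).boundary W)).restrictPreimage (Prod.map P id)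
  finiteCovering := (hP.prodMap .id_map).restrictPreimage _
  e := collarEnd hr
  smooth_e z := by
    refine (smoothAt_iff_comp_chart
      (isOpenEmbedding_collarEnd hr hc.continuous hi).continuous.continuousAt
      ((halfCharts n W).collarCharts.mem_source _)).2 ?_
    refine SmoothAt.congr ?_ (collarChart_collarEnd hr hc.continuous z)
    refine smoothAt_model_prod.1 (SmoothAt.prodMk ?_ ?_)
    · exact SmoothAt.comp (g := fun ν => (scaleEquiv (i z.1) (extChartAt (𝓡∂ (n + 1)) (i z.1)
        (i ν))).1) (smoothAt_boundaryChart (hc z.1)) smoothAt_fst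
    · exact SmoothAt.comp (g := fun t : ℝ => -Real.exp (-t))
        (smoothAt_model_model_iff.2 (by fun_prop)) smoothAt_snd
  smooth_inv z := by
    obtain ⟨σ, h1, h2⟩ := exists_boundaryChart_inv hr (hc z.1) (hd z.1)
    have hch := collarChart_collarEnd hr hc.continuous z
    set Φ := (halfCharts n W).collarCharts.chart (collarEnd hr z)
    have hΦ : SmoothAt (halfCharts n W).collarCharts ((model (EuclideanSpace ℝ (Fin n))).prod
        (model ℝ)) Φ (collarEnd hr z) := smoothAt_model_prod.2
      ((halfCharts n W).collarCharts.smoothAt_chart ((halfCharts n W).collarCharts.mem_source _))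
    have hΦz : Φ (collarEnd hr z) = (_, _) := hch.self_of_nhds
    refine exists_smooth_leftInverse (isOpenEmbedding_collarEnd hr hc.continuous hi)
      (ρ := fun x => (σ (Φ x).1, -Real.log (-(Φ x).2))) ?_ ?_
    · refine SmoothAt.prodMk (SmoothAt.comp_of_eq h1 hΦ.fst (Prod.ext_iff.1 hΦz).1) ?_
      refine SmoothAt.comp (g := fun s : ℝ => -Real.log (-s)) (smoothAt_model_model_iff.2 ?_) hΦ.snd
      refine (ContDiffAt.log contDiffAt_id.neg ?_).neg
      rw [(Prod.ext_iff.1 hΦz).2]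
      simp [Real.exp_ne_zero]
    · filter_upwards [hch, continuousAt_fst.eventually h2] with z' hz' hz''
      have hz' : Φ (collarEnd hr z') = _ := hz'
      rw [hz']
      refine Prod.ext hz'' ?_
      simp
  isOpen_range := (isOpenEmbedding_collarEnd hr hc.continuous hi).isOpen_range
  isClosed_end := by
    convert (isClosed_Iic (a := (-1 : ℝ))).preimage (continuous_snd.comp continuous_subtype_val)
      using 1
    ext x
    constructor
    · rintro ⟨z, hz, rfl⟩
      have := Real.one_le_exp (neg_nonneg.2 hz)
      exact neg_le_neg this
    · intro hx
      have hx : x.1.2 ≤ -1 := hx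
      have : x ∈ range (collarEnd hr) := by
        rw [range_collarEnd]
        exact lt_of_le_of_lt hx (by norm_num)
      obtain ⟨z, rfl⟩ := this
      refine ⟨z, ?_, rfl⟩
      have hx := neg_le_neg_iff.1 hx
      exact neg_nonneg.1 (Real.one_le_exp_iff.1 hx)
  isCompact_core := by
    have hcl : IsClosed (collarSet ((𝓡∂ (n + 1)).boundary W)) := by
      refine (isClosed_Iic.preimage continuous_snd).inter
        ((isClosed_singleton.preimage continuous_snd).union
          (IsClosed.preimage (f := Prod.fst) (t := (𝓡∂ (n + 1)).boundary W) continuous_fst ?_))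
      rw [← hr]
      exact (isCompact_range hc.continuous).isClosed
    convert hcl.isClosedEmbedding_subtypeVal.isCompact_preimage
      ((isCompact_univ (X := W)).prod (isCompact_Icc (a := -1) (b := (0 : ℝ)))) using 1
    ext x
    rw [mem_compl_iff, not_iff_comm]
    constructor
    · intro hx
      have hx' : x.1.2 < -1 := by
        by_contra h'
        exact hx ⟨mem_univ _, not_lt.1 h', x.2.1⟩
      have : x ∈ range (collarEnd hr) := by
        rw [range_collarEnd]
        exact lt_trans hx' (by norm_num)
      obtain ⟨z, rfl⟩ := this
      refine ⟨z, ?_, rfl⟩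
      exact neg_pos.1 (Real.one_lt_exp_iff.1 (neg_lt_neg_iff.1 hx'))
    · rintro ⟨z, hz, rfl⟩ hx
      exact absurd (Real.one_lt_exp_iff.2 (neg_pos.2 hz)) (not_lt.2 (neg_le_neg_iff.1 hx.2.1))
  lift z := ⟨(j z.1, -Real.exp (-z.2)), (neg_lt_zero.2 (Real.exp_pos _)).le,
    Or.inr (by change j z.1 ∈ P ⁻¹' (𝓡∂ (n + 1)).boundary W; rw [← hjr]; exact mem_range_self _)⟩
  continuous_lift := Continuous.subtype_mk (by fun_prop) _
  injective_lift := by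
    intro z z' h
    have h := Prod.ext_iff.1 (Subtype.ext_iff.1 h)
    exact Prod.ext (hji h.1) (isOpenEmbedding_neg_exp.injective h.2)
  P_lift z := Subtype.ext (Prod.ext (h z.1) rfl)
  mem_range_lift := by
    rintro ⟨⟨s, t⟩, hs, ht⟩ h'
    rw [range_collarEnd] at h'
    have h' : t < 0 := h'
    obtain ⟨τ, rfl⟩ : s ∈ range j := by
      rw [hjr]
      exact ht.resolve_left h'.ne
    refine ⟨(τ, -Real.log (-t)), Subtype.ext (Prod.ext rfl ?_)⟩
    change -Real.exp (- -Real.log (-t)) = t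
    rw [neg_neg, Real.exp_log (by linarith), neg_neg]

end Collar

open Charts

/-- The charts of the empty space. -/
def Charts.empty : Charts Empty (fun _ => 0) where
  V x := x.elim
  nacg x := x.elim
  ns x := x.elim
  fd x := x.elim
  finrank_eq x := x.elim
  chart x := x.elim
  mem_source x := x.elim
  dim_eq x := x.elim
  contDiffOn x := x.elim

lemma Charts.smoothAt_subtype_mk {X Y : Type} [TopologicalSpace X] [TopologicalSpace Y] {dX : X → ℕ}
    {dY : Y → ℕ} {A : Charts X dX} {B : Charts Y dY} {U : Set X} (hU : IsOpen U) {f : Y → U} {y : Y}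
    (hf : SmoothAt B A (fun y => (f y).1) y) :
    SmoothAt B (A.comap hU.isOpenEmbedding_subtypeVal.isLocalHomeomorph) f y :=
  (smoothAt_comap_iff _ (IsInducing.subtypeVal.continuousAt_iff.2 hf.1)).2 hf

namespace Filling

variable {N T N₁ T₁ N₂ T₂ : Type} [TopologicalSpace N] [TopologicalSpace T] [TopologicalSpace N₁]
  [TopologicalSpace T₁] [TopologicalSpace N₂] [TopologicalSpace T₂] {d : N → ℕ} {d₁ : N₁ → ℕ}
  {d₂ : N₂ → ℕ} {A : Charts N d} {A₁ : Charts N₁ d₁} {A₂ : Charts N₂ d₂} {π : T → N} {π₁ : T₁ → N₁}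
  {π₂ : T₂ → N₂}

/-- The empty filling. -/
def ofIsEmpty [IsEmpty N] (A : Charts N d) (π : T → N) : Filling A π where
  X := Empty
  dim := _
  A := Charts.empty
  S := Empty
  P := id
  finiteCovering := .id_map
  e z := isEmptyElim z.1
  smooth_e z := isEmptyElim z.1
  smooth_inv z := isEmptyElim z.1
  isOpen_range := by simp
  isClosed_end := by simp
  isCompact_core := by
    convert isCompact_empty
    exact Subsingleton.elim _ _
  lift z := isEmptyElim (π z.1)
  continuous_lift := continuous_iff_continuousAt.2 fun z => isEmptyElim (π z.1)
  injective_lift z := isEmptyElim (π z.1)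
  P_lift z := isEmptyElim (π z.1)
  mem_range_lift s := s.elim

/-- A filling of a manifold which is the disjoint union of two open submanifolds. -/
lemma nonempty_of_isCompl [CompactSpace T₁] [CompactSpace T₂] [T2Space T] {e₁ : N₁ → N}
    {e₂ : N₂ → N} (s₁ : ∀ x, SmoothAt A₁ A e₁ x) (s₂ : ∀ x, SmoothAt A₂ A e₂ x)
    (r₁ : ∀ x, ∃ ρ : N → N₁, Function.LeftInverse ρ e₁ ∧ SmoothAt A A₁ ρ (e₁ x))
    (r₂ : ∀ x, ∃ ρ : N → N₂, Function.LeftInverse ρ e₂ ∧ SmoothAt A A₂ ρ (e₂ x))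
    (o₁ : IsOpen (range e₁)) (o₂ : IsOpen (range e₂)) (hc : IsCompl (range e₁) (range e₂))
    {f₁ : T₁ → T} {f₂ : T₂ → T} (c₁ : Continuous f₁) (c₂ : Continuous f₂)
    (i₁ : Function.Injective f₁) (i₂ : Function.Injective f₂)
    (h₁ : ∀ t, π (f₁ t) = e₁ (π₁ t)) (h₂ : ∀ t, π (f₂ t) = e₂ (π₂ t))
    (m₁ : ∀ t, π t ∈ range e₁ → t ∈ range f₁) (m₂ : ∀ t, π t ∈ range e₂ → t ∈ range f₂)
    (F : Filling A₁ π₁) (G : Filling A₂ π₂) : Nonempty (Filling A π) := by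
  have hdisj (x y) : e₁ x ≠ e₂ y := fun h =>
    Set.disjoint_left.1 hc.disjoint (mem_range_self x) (h ▸ mem_range_self y)
  have hcover (y : N) : y ∈ range e₁ ∨ y ∈ range e₂ := by
    have := hc.sup_eq_top.ge (mem_univ y)
    exact this
  have j₁ : Function.Injective e₁ := fun x y h => by
    obtain ⟨ρ, hρ, -⟩ := r₁ x
    exact hρ.injective h
  have j₂ : Function.Injective e₂ := fun x y h => by
    obtain ⟨ρ, hρ, -⟩ := r₂ x
    exact hρ.injective h
  let φ := Equiv.ofBijective (Sum.elim e₁ e₂) ⟨j₁.sumElim j₂ hdisj, fun y => by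
    rcases hcover y with ⟨x, rfl⟩ | ⟨x, rfl⟩
    · exact ⟨Sum.inl x, rfl⟩
    · exact ⟨Sum.inr x, rfl⟩⟩
  let ψ := Equiv.ofBijective (Sum.elim f₁ f₂) ⟨i₁.sumElim i₂ fun s t h => by
      have := congrArg π h
      rw [h₁, h₂] at this
      exact hdisj _ _ this, fun t => by
    rcases hcover (π t) with h | h
    · obtain ⟨s, rfl⟩ := m₁ t h
      exact ⟨Sum.inl s, rfl⟩
    · obtain ⟨s, rfl⟩ := m₂ t h
      exact ⟨Sum.inr s, rfl⟩⟩
  have hψ : Continuous ψ := c₁.sumElim c₂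
  have hφ₁ (x) : φ.symm (e₁ x) = Sum.inl x := φ.symm_apply_eq.2 rfl
  have hφ₂ (x) : φ.symm (e₂ x) = Sum.inr x := φ.symm_apply_eq.2 rfl
  refine ⟨(F.sum G).congr φ.symm ?_ ?_ ψ.symm (hψ.continuous_symm_of_equiv_compact_to_t2)
    ψ.symm.bijective ?_⟩
  · intro y
    rcases hcover y with ⟨x, rfl⟩ | ⟨x, rfl⟩
    · obtain ⟨ρ, hρ, hs⟩ := r₁ x
      refine (SmoothAt.comp (g := Sum.inl) smoothAt_inl hs).congr ?_
      filter_upwards [o₁.mem_nhds (mem_range_self x)]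
      rintro _ ⟨z, rfl⟩
      rw [hφ₁, Function.comp_apply, hρ]
    · obtain ⟨ρ, hρ, hs⟩ := r₂ x
      refine (SmoothAt.comp (g := Sum.inr) smoothAt_inr hs).congr ?_
      filter_upwards [o₂.mem_nhds (mem_range_self x)]
      rintro _ ⟨z, rfl⟩
      rw [hφ₂, Function.comp_apply, hρ]
  · rintro (x | x)
    · exact smoothAt_sum_inl.2 (s₁ x)
    · exact smoothAt_sum_inr.2 (s₂ x)
  · intro t
    obtain ⟨s | s, rfl⟩ := ψ.surjective t
    · rw [ψ.symm_apply_apply]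
      change _ = φ.symm (π (f₁ s))
      rw [h₁, hφ₁]
      rfl
    · rw [ψ.symm_apply_apply]
      change _ = φ.symm (π (f₂ s))
      rw [h₂, hφ₂]
      rfl

/-- A filling can be constructed one dimension at a time. -/
lemma nonempty_of_parts [CompactSpace N] [CompactSpace T] [T2Space T] (hπ : Continuous π)
    (F : ∀ n, ∃ (N₁ T₁ : Type) (_ : TopologicalSpace N₁) (_ : TopologicalSpace T₁)
      (_ : CompactSpace T₁) (d₁ : N₁ → ℕ) (A₁ : Charts N₁ d₁) (π₁ : T₁ → N₁)
      (e₁ : N₁ → N) (f₁ : T₁ → T), (∀ x, SmoothAt A₁ A e₁ x) ∧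
      (∀ x, ∃ ρ : N → N₁, Function.LeftInverse ρ e₁ ∧ SmoothAt A A₁ ρ (e₁ x)) ∧
      range e₁ = {x | d x = n} ∧ Continuous f₁ ∧ Function.Injective f₁ ∧
      (∀ t, π (f₁ t) = e₁ (π₁ t)) ∧ (∀ t, d (π t) = n → t ∈ range f₁) ∧
      Nonempty (Filling A₁ π₁)) : Nonempty (Filling A π) := by
  have ho (k : ℕ) : IsOpen {x | d x < k} := (isOpen_discrete (Iio k)).preimage A.continuous_dim
  have hcl (k : ℕ) : IsClosed {x | d x < k} :=
    (isClosed_discrete (Iio k)).preimage A.continuous_dim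
  have key (k : ℕ) : Nonempty (Filling
      (A.comap (ho k).isOpenEmbedding_subtypeVal.isLocalHomeomorph)
      ({x | d x < k}.restrictPreimage π)) := by
    induction k with
    | zero =>
      have : IsEmpty {x | d x < 0} := ⟨fun x => absurd x.2 (Nat.not_lt_zero _)⟩
      exact ⟨ofIsEmpty _ _⟩
    | succ k ih =>
      obtain ⟨G⟩ := ih
      obtain ⟨N₁, T₁, _, _, _, d₁, A₁, π₁, e₁, f₁, s, r, hr, hf, hi, hcomm, hm, ⟨F⟩⟩ := F k
      have hd (x) : d (e₁ x) = k := hr.le (mem_range_self x)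
      have hd' (x) : d (e₁ x) < k + 1 := by rw [hd]; exact k.lt_succ_self
      have : CompactSpace (π ⁻¹' {x | d x < k}) :=
        isCompact_iff_compactSpace.1 ((hcl k).preimage hπ).isCompact
      refine nonempty_of_isCompl (N₁ := {x | d x < k})
        (e₁ := fun x => ⟨x.1, lt_trans (show d x.1 < k from x.2) k.lt_succ_self⟩)
        (e₂ := fun x => ⟨e₁ x, hd' x⟩)
        (f₁ := fun t => ⟨t.1, lt_trans (show d (π t.1) < k from t.2) k.lt_succ_self⟩)
        (f₂ := fun t => ⟨f₁ t, by change d (π (f₁ t)) < k + 1; rw [hcomm]; exact hd' _⟩)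
        ?_ ?_ ?_ ?_ ?_ ?_ ?_ ?_ ?_ ?_ ?_ ?_ ?_ ?_ ?_ G F
      · intro x
        exact smoothAt_subtype_mk (ho _) (smoothAt_of_comap _)
      · intro x
        exact smoothAt_subtype_mk (ho _) (s x)
      · rintro ⟨x, hx⟩
        classical
        refine ⟨fun y => if h : d y.1 < k then ⟨y.1, h⟩ else ⟨x, hx⟩, ?_, ?_⟩
        · rintro ⟨y, hy⟩
          exact dif_pos hy
        · refine smoothAt_subtype_mk (ho _) ((smoothAt_of_comap _).congr ?_)
          have : IsOpen {y : {x | d x < k + 1} | d y.1 < k} :=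
            (ho k).preimage continuous_subtype_val
          filter_upwards [this.mem_nhds hx] with y hy
          exact congrArg Subtype.val (dif_pos (show d y.1 < k from hy))
      · intro x
        obtain ⟨ρ, hρ, hs⟩ := r x
        exact ⟨fun y => ρ y.1, fun y => hρ y, SmoothAt.comp hs (smoothAt_of_comap _)⟩
      · convert (ho k).preimage continuous_subtype_val using 1
        ext y
        exact ⟨by rintro ⟨x, rfl⟩; exact x.2, fun h => ⟨⟨y.1, h⟩, rfl⟩⟩
      · have := (isOpen_discrete {k}).preimage A.continuous_dim
        convert this.preimage continuous_subtype_val using 1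
        ext y
        constructor
        · rintro ⟨x, rfl⟩
          exact hd x
        · intro h
          obtain ⟨x, hx⟩ := hr.ge h
          exact ⟨x, Subtype.ext hx⟩
      · refine isCompl_iff.2 ⟨Set.disjoint_left.2 ?_, codisjoint_iff.2 (eq_univ_of_forall ?_)⟩
        · rintro _ ⟨x, rfl⟩ ⟨y, hy⟩
          have : e₁ y = x.1 := congrArg Subtype.val hy
          exact absurd (hd y) (by rw [this]; exact x.2.ne)
        · rintro ⟨y, hy⟩
          rcases Nat.lt_succ_iff_lt_or_eq.1 hy with h | h
          · exact Or.inl ⟨⟨y, h⟩, rfl⟩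
          · obtain ⟨x, hx⟩ := hr.ge h
            exact Or.inr ⟨x, Subtype.ext hx⟩
      · fun_prop
      · fun_prop
      · intro s t h
        exact Subtype.ext (congrArg (fun z => z.1) h)
      · intro s t h
        exact hi (congrArg (fun z => z.1) h)
      · exact fun t => rfl
      · intro t
        exact Subtype.ext (hcomm t)
      · rintro ⟨t, ht⟩ ⟨x, hx⟩
        have hx : x.1 = π t := congrArg Subtype.val hx
        exact ⟨⟨t, by change d (π t) < k; rw [← hx]; exact x.2⟩, rfl⟩
      · rintro ⟨t, ht⟩ ⟨x, hx⟩
        have hx : e₁ x = π t := congrArg Subtype.val hx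
        obtain ⟨s, rfl⟩ := hm t (by rw [← hx]; exact hd x)
        exact ⟨s, rfl⟩
  obtain ⟨k, hk⟩ : ∃ k, ∀ x, d x < k := by
    obtain ⟨k, hk⟩ := (isCompact_range A.continuous_dim).finite_of_discrete.bddAbove
    exact ⟨k + 1, fun x => Nat.lt_succ_of_le (hk (mem_range_self x))⟩
  obtain ⟨G⟩ := key k
  refine ⟨G.congr ⟨fun x => ⟨x, hk x⟩, Subtype.val, fun _ => rfl, fun _ => rfl⟩ (fun x => ?_)
    (fun x => smoothAt_of_comap _) (fun t => ⟨t, hk _⟩) (by fun_prop) ⟨?_, ?_⟩ fun _ => rfl⟩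
  · exact smoothAt_subtype_mk (ho _) smoothAt_id
  · exact fun s t h => congrArg (fun z => z.1) h
  · exact fun t => ⟨t.1, rfl⟩

end Filling

/-- Cobordant coverings have a filling. -/
theorem ClosedCovering.Cobordant.exists_filling {p q : ClosedCovering} (h : p.Cobordant q) :
    Nonempty (Filling (p.base.charts.sum q.base.charts) (Sum.map p.proj q.proj)) := by
  refine Filling.nonempty_of_parts (p.isCoveringMap.continuous.sumMap q.isCoveringMap.continuous)
    fun n => ?_
  have hcomp (M : ClosedManifold) : CompactSpace (M.part n) := isCompact_iff_compactSpace.1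
    ((isClosed_discrete {n}).preimage M.continuous_dim).isCompact
  have hcomp' (p : ClosedCovering) : CompactSpace (p.totalPart n) := isCompact_iff_compactSpace.1
    ((isClosed_discrete {n}).preimage
      (p.base.continuous_dim.comp p.isCoveringMap.continuous)).isCompact
  have := hcomp p.base
  have := hcomp q.base
  have := hcomp' p
  have := hcomp' q
  refine ⟨p.basePart n ⊕ q.basePart n, p.totalPart n ⊕ q.totalPart n, inferInstance, inferInstance,
    inferInstance, _, ofManifold n _, Sum.map (p.projPart n) (q.projPart n), inclPart p q n,
    Sum.map Subtype.val Subtype.val, smoothAt_inclPart p q n, exists_smoothAt_inclPart_inv p q n,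
    ?_, ?_, ?_, ?_, ?_, ?_⟩
  · ext (x | x)
    · constructor
      · rintro ⟨y | y, hy⟩
        · cases hy
          exact y.2
        · cases hy
      · exact fun hx => ⟨Sum.inl ⟨x, hx⟩, rfl⟩
    · constructor
      · rintro ⟨y | y, hy⟩
        · cases hy
        · cases hy
          exact y.2
      · exact fun hx => ⟨Sum.inr ⟨x, hx⟩, rfl⟩
  · exact continuous_subtype_val.sumMap continuous_subtype_val
  · exact Sum.map_injective.2 ⟨Subtype.val_injective, Subtype.val_injective⟩
  · rintro (t | t) <;> rfl
  · rintro (t | t) ht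
    · exact ⟨Sum.inl ⟨t, ht⟩, rfl⟩
    · exact ⟨Sum.inr ⟨t, ht⟩, rfl⟩
  · obtain ⟨W, _, _, _, _, _, S, _, P, i, j, hP, hfin, hc, hd, hi, hr, hj, hji, hjr, hcomm⟩ := h n
    have := PolySpace.t2Space_total hP
    have := PolySpace.compactSpace_total hP
    exact ⟨Filling.ofBoundary hr (.of_compactSpace hP.isLocalHomeomorph) hc hd hi hj hji hjr hcomm⟩

open Charts

namespace PolySpace

attribute [local instance] Fintype.ofFinite

variable {T B X Z : Type} {p : T → B}

lemma ext_of_eq {x y : PolySpace p X} (h : x.base = y.base)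
    (h' : ∀ t (hx : p t = x.base) (hy : p t = y.base), x.map ⟨t, hx⟩ = y.map ⟨t, hy⟩) : x = y := by
  obtain ⟨b, u⟩ := x
  obtain ⟨b', u'⟩ := y
  obtain rfl : b = b' := h
  congr 1
  funext t
  exact h' t.1 t.2 t.2

variable [TopologicalSpace T] [TopologicalSpace B] [TopologicalSpace X] [TopologicalSpace Z]
  (hp : IsCoveringMap p)

include hp in
lemma eventually_sec_mem (b : B) (i : p ⁻¹' {b}) {V : Set T}
    (hV : V ∈ 𝓝 (sec hp b (mem_nbhd hp b) i).1) :
    ∀ᶠ b' in 𝓝 b, ∀ h : b' ∈ nbhd hp b, (sec hp b h i).1 ∈ V := by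
  have h1 : p '' (V ∩ sheet hp b i) ∈ 𝓝 b := by
    have h2 := (sec hp b (mem_nbhd hp b) i).2
    have := hp.isOpenMap.image_mem_nhds (Filter.inter_mem hV
      ((isOpen_sheet hp b i).mem_nhds (sec_mem_sheet hp b (mem_nbhd hp b) i)))
    rwa [show p (sec hp b (mem_nbhd hp b) i).1 = b from h2] at this
  filter_upwards [h1]
  rintro b' ⟨t, ⟨ht, ht'⟩, rfl⟩ h
  have := eq_sec_of_mem_sheet hp b h i ⟨t, rfl⟩ ht'
  rwa [← this]

variable [∀ b, Finite (p ⁻¹' {b})]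

include hp in
lemma isCompact_setOf {K : Set B} {L : Set X} (hK : IsCompact K) (hL : IsCompact L) :
    IsCompact {x : PolySpace p X | x.base ∈ K ∧ ∀ t, x.map t ∈ L} := by
  rw [isCompact_iff_ultrafilter_le_nhds]
  intro 𝒰 h𝒰
  rw [Filter.le_principal_iff] at h𝒰
  obtain ⟨b, hb, hbl⟩ := isCompact_iff_ultrafilter_le_nhds.1 hK (𝒰.map base)
    (Filter.le_principal_iff.2 (Filter.mem_of_superset (x := {x : PolySpace p X | x.base ∈ K ∧
      ∀ t, x.map t ∈ L}) h𝒰 fun x hx => hx.1))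
  have hev : ∀ᶠ y in (𝒰 : Filter (PolySpace p X)), y.base ∈ nbhd hp b :=
    hbl ((isOpen_nbhd hp b).mem_nhds (mem_nbhd hp b))
  obtain ⟨y₀, h₀⟩ := hev.exists
  let x : PolySpace p X := ⟨b, fun i => y₀.map (sec hp b h₀ i)⟩
  have hc (i : p ⁻¹' {b}) : ∃ c ∈ L, (𝒰.map fun y => (toLocal hp x y).2 i) ≤ 𝓝 c := by
    refine isCompact_iff_ultrafilter_le_nhds.1 hL _ (Filter.le_principal_iff.2 ?_)
    change ∀ᶠ y in (𝒰 : Filter (PolySpace p X)), _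
    filter_upwards [hev, h𝒰] with y hy hy'
    rw [toLocal_of_mem hp x y hy]
    exact hy'.2 _
  choose c hcL hcl using hc
  have hbx : b ∈ nbhd hp x.base := mem_nbhd hp b
  have hlim : Filter.Tendsto (fun y => (y.base, (toLocal hp x y).2)) 𝒰 (𝓝 (b, c)) :=
    Filter.Tendsto.prodMk_nhds hbl (tendsto_pi_nhds.2 hcl)
  refine ⟨(localTriv hp x).symm (b, c), ?_, ?_⟩
  · change ofLocal hp x (b, c) ∈ _
    rw [ofLocal_of_mem hp x (b, c) hbx]
    exact ⟨hb, fun t => hcL _⟩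
  · have h1 := ((localTriv hp x).continuousAt_symm (x := (b, c)) hbx).tendsto.comp hlim
    refine Filter.Tendsto.congr' (f₁ := (localTriv hp x).symm ∘ fun y =>
      (y.base, (toLocal hp x y).2)) ?_ h1
    filter_upwards [hev] with y hy
    have : (y.base, (toLocal hp x y).2) = localTriv hp x y := by
      change _ = toLocal hp x y
      rw [toLocal_of_mem hp x y hy]
    rw [Function.comp_apply, this]
    exact (localTriv hp x).left_inv hy

variable {d : B → ℕ} {e : X → ℕ} {dZ : Z → ℕ} {A : Charts B d} {D : Charts X e} {C : Charts Z dZ}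

include hp in
lemma smoothAt_base (x : PolySpace p X) : SmoothAt (charts hp A D) A base x := by
  have h := ((charts hp A D).smoothAt_chart ((charts hp A D).mem_source x))
  refine (smoothAt_iff_comp_chart (continuous_base p).continuousAt (A.mem_source _)).2 ?_
  refine (SmoothAt.comp (g := Prod.fst) (smoothAt_model_model_iff.2 contDiffAt_fst) h).congr ?_
  filter_upwards [(continuous_base p).continuousAt.eventually
    ((isOpen_nbhd hp x.base).mem_nhds (mem_nbhd hp x.base))] with y hy
  exact (congrArg Prod.fst (polyChart_apply hp A D x y hy)).symm

/-- Evaluation is smooth, along a section of the covering. -/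
lemma exists_smoothAt_eval (x : PolySpace p X) (t : T) (ht : p t = x.base) :
    ∃ f : PolySpace p X → X, SmoothAt (charts hp A D) D f x ∧
      ∀ᶠ y in 𝓝 (x, t), ∀ h : p y.2 = y.1.base, y.1.map ⟨y.2, h⟩ = f y.1 := by
  have ht' : p t ∈ nbhd hp x.base := ht ▸ mem_nbhd hp x.base
  set i := idx hp x.base t ht' with hi
  have hev : ∀ᶠ y in 𝓝 x, y ∈ (polyChart hp A D x).source :=
    (polyChart hp A D x).open_source.mem_nhds ((charts hp A D).mem_source x)
  refine ⟨fun y => (D.chart (coord hp x i)).symm ((polyChart hp A D x y).2 i), ?_, ?_⟩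
  · have h : SmoothAt (charts hp A D) (model (A.V x.base × (∀ i : p ⁻¹' {x.base},
        D.V (coord hp x i)))) (polyChart hp A D x) x :=
      (charts hp A D).smoothAt_chart ((charts hp A D).mem_source x)
    refine SmoothAt.comp (f := fun y => (polyChart hp A D x y).2 i)
      (D.smoothAt_chart_symm ?_) (SmoothAt.comp (g := fun v : A.V x.base ×
        (∀ i : p ⁻¹' {x.base}, D.V (coord hp x i)) => v.2 i) (C := model (D.V (coord hp x i))) ?_ h)
    · rw [polyChart_apply hp A D x x (mem_nbhd hp x.base)]
      exact (D.chart (coord hp x i)).map_source (D.mem_source _)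
    · exact smoothAt_model_model_iff.2 ((contDiff_pi.1 contDiff_snd i).contDiffAt)
  · have h1 := (continuous_snd.tendsto (x, t)).eventually
      ((isOpen_sheet hp x.base i).mem_nhds ⟨ht', rfl⟩)
    filter_upwards [(continuous_fst.tendsto (x, t)).eventually hev, h1] with y hy hy' h
    obtain ⟨h2, h3, h4⟩ := (mem_polyChart_source hp A D x y.1).1 hy
    rw [polyChart_apply hp A D x y.1 h2]
    dsimp only
    rw [(D.chart (coord hp x i)).left_inv (h4 i), eq_sec_of_mem_sheet hp x.base h2 i ⟨y.2, h⟩ hy']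

lemma smoothAt_of_eval {g : Z → PolySpace p X} {z : Z} (hb : SmoothAt C A (fun w => (g w).base) z)
    (he : ∀ t, p t = (g z).base → ∃ f : Z → X, SmoothAt C D f z ∧
      ∀ᶠ y in 𝓝 (z, t), ∀ h : p y.2 = (g y.1).base, (g y.1).map ⟨y.2, h⟩ = f y.1) :
    SmoothAt C (charts hp A D) g z := by
  set x := g z with hx
  have hn : ∀ᶠ w in 𝓝 z, (g w).base ∈ nbhd hp x.base :=
    hb.1.eventually ((isOpen_nbhd hp x.base).mem_nhds (mem_nbhd hp x.base))
  have he' (i : p ⁻¹' {x.base}) : ∃ f : Z → X, SmoothAt C D f z ∧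
      ∀ᶠ w in 𝓝 z, ∀ h : (g w).base ∈ nbhd hp x.base, (g w).map (sec hp x.base h i) = f w := by
    obtain ⟨f, hf, hfe⟩ := he (sec hp x.base (mem_nbhd hp x.base) i).1
      (sec hp x.base (mem_nbhd hp x.base) i).2
    refine ⟨f, hf, ?_⟩
    rw [nhds_prod_eq] at hfe
    obtain ⟨U, hU, V, hV, hUV⟩ := Filter.mem_prod_iff.1 hfe
    filter_upwards [hU, hb.1.eventually (eventually_sec_mem hp x.base i hV)] with w hw hw' h
    exact hUV (mk_mem_prod hw (hw' h)) (sec hp x.base h i).2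
  choose f hf hfe using he'
  have hfz (i) : f i z = coord hp x i := ((hfe i).self_of_nhds (mem_nbhd hp x.base)).symm
  have hsrc : ∀ᶠ w in 𝓝 z, g w ∈ (polyChart hp A D x).source := by
    have h1 : ∀ᶠ w in 𝓝 z, ∀ i, f i w ∈ (D.chart (coord hp x i)).source :=
      Filter.eventually_all.2 fun i => (hf i).1.eventually ((D.chart _).open_source.mem_nhds (by
        rw [hfz i]
        exact D.mem_source _))
    filter_upwards [hn, h1, Filter.eventually_all.2 hfe,
      hb.1.eventually ((A.chart x.base).open_source.mem_nhds (A.mem_source x.base))]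
      with w h2 h3 h4 h5
    refine (mem_polyChart_source hp A D x (g w)).2 ⟨h2, h5, fun i => ?_⟩
    rw [h4 i h2]
    exact h3 i
  have key : SmoothAt C (model (A.V x.base × (∀ i : p ⁻¹' {x.base}, D.V (coord hp x i))))
      (fun w => polyChart hp A D x (g w)) z := by
    have h1 : SmoothAt C (model (A.V x.base × (∀ i : p ⁻¹' {x.base}, D.V (coord hp x i))))
        (fun w => (A.chart x.base (g w).base, fun i => D.chart (coord hp x i) (f i w))) z := by
      refine smoothAt_model_prod.1 (SmoothAt.prodMk ?_ ?_)
      · exact SmoothAt.comp (A.smoothAt_chart (A.mem_source _)) hb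
      · refine (smoothAt_model_iff (C.mem_source z)).2 (contDiffAt_pi.2 fun i => ?_)
        have : SmoothAt C (model _) (fun w => D.chart (coord hp x i) (f i w)) z :=
          (D.smoothAt_chart (D.mem_source _)).comp_of_eq (hf i) (hfz i)
        exact (smoothAt_model_iff (C.mem_source z)).1 this
    refine h1.congr ?_
    filter_upwards [hn, Filter.eventually_all.2 hfe] with w h2 h4
    rw [polyChart_apply hp A D x _ h2]
    refine Prod.ext rfl (funext fun i => ?_)
    dsimp only
    rw [h4 i h2]
  have hcont : ContinuousAt g z := by
    have h1 : ContinuousAt (fun w => (polyChart hp A D x).symm (polyChart hp A D x (g w))) z :=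
      ((polyChart hp A D x).continuousAt_symm ((polyChart hp A D x).map_source
        ((charts hp A D).mem_source x))).comp_of_eq key.1 rfl
    refine h1.congr ?_
    filter_upwards [hsrc] with w hw
    exact (polyChart hp A D x).left_inv hw
  exact (smoothAt_iff_comp_chart hcont ((charts hp A D).mem_source x)).2 key

lemma exists_smoothAt_eval_comp {g : Z → PolySpace p X} {z : Z} (hg : SmoothAt C (charts hp A D) g z)
    (t : T) (ht : p t = (g z).base) : ∃ f : Z → X, SmoothAt C D f z ∧
      ∀ᶠ y in 𝓝 (z, t), ∀ h : p y.2 = (g y.1).base, (g y.1).map ⟨y.2, h⟩ = f y.1 := by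
  obtain ⟨f, hf, hfe⟩ := exists_smoothAt_eval hp (A := A) (D := D) (g z) t ht
  refine ⟨f ∘ g, hf.comp hg, ?_⟩
  have : ContinuousAt (fun y : Z × T => (g y.1, y.2)) (z, t) :=
    (hg.1.comp continuousAt_fst).prodMk continuousAt_snd
  exact this.eventually hfe

end PolySpace

open Charts ClosedCovering

namespace PolySpace

variable {T B X Z : Type} {p : T → B} [TopologicalSpace T] [TopologicalSpace B]
  [TopologicalSpace X] [TopologicalSpace Z]

/-- The covering induced on `p(C)` by coverings `p` and `q` of `B` and `C`. -/
abbrev compProj {R C : Type} (p : T → B) (q : R → C)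
    (z : Function.Pullback (eval : Function.Pullback (base : PolySpace p C → B) p → C) q) :
    PolySpace p C := z.fst.fst

lemma finiteCovering_compProj {R C : Type} [TopologicalSpace R] [TopologicalSpace C] [T2Space B]
    [T2Space C] {q : R → C} (hp : FiniteCovering p) (hq : FiniteCovering q) :
    FiniteCovering (compProj p q) := by
  have := hp.t2
  have := hp.finite_fiber
  have := t2Space (X := C) hp.isCoveringMap
  have : T2Space (Function.Pullback (base : PolySpace p C → B) p) :=
    inferInstanceAs (T2Space {z : PolySpace p C × T // z.1.base = p z.2})
  exact (hp.pullback (continuous_base (X := C) p)).comp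
    (hq.pullback (continuous_eval hp.isLocalHomeomorph))

end PolySpace

open PolySpace

namespace Filling

variable {N T C R : Type} [TopologicalSpace N] [TopologicalSpace T] [TopologicalSpace C]
  [TopologicalSpace R] {dN : N → ℕ} {dC : C → ℕ} {AN : Charts N dN} {π : T → N}
  (F : Filling AN π) (AC : Charts C dC)

/-- The end of the filling of `π(C)` induced by a filling of `π`, for `C` a closed manifold. -/
def polyEnd (z : PolySpace π C × ℝ) : PolySpace F.P C where
  base := F.e (z.1.base, z.2)
  map s := z.1.map ⟨(F.mem_range_lift s.1 ⟨_, s.2.symm⟩).choose.1, by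
    have h := (F.mem_range_lift s.1 ⟨_, s.2.symm⟩).choose_spec
    have h1 := F.P_lift (F.mem_range_lift s.1 ⟨_, s.2.symm⟩).choose
    rw [h] at h1
    have h2 := F.injective (h1.symm.trans s.2)
    exact congrArg Prod.fst h2⟩

lemma polyEnd_map (z : PolySpace π C × ℝ) (t : T) (a : ℝ) (h)
    (h' : π t = z.1.base) : (F.polyEnd z).map ⟨F.lift (t, a), h⟩ = z.1.map ⟨t, h'⟩ := by
  refine congrArg z.1.map (Subtype.ext ?_)
  exact congrArg Prod.fst (F.injective_lift
    (F.mem_range_lift (F.lift (t, a)) ⟨_, h.symm⟩).choose_spec)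

/-- A local inverse of `polyEnd`. -/
def polyInv (ρ : F.X → N × ℝ) (hρ : Function.LeftInverse ρ F.e) (y : PolySpace F.P C)
    (hy : y.base ∈ range F.e) : PolySpace π C × ℝ :=
  (⟨(ρ y.base).1, fun t => y.map ⟨F.lift (t.1, (ρ y.base).2), by
    obtain ⟨w, hw⟩ := hy
    have ht : π t.1 = (ρ y.base).1 := t.2
    change F.P (F.lift (t.1, (ρ y.base).2)) = y.base
    rw [F.P_lift]
    change F.e (π t.1, (ρ y.base).2) = _
    rw [ht, Prod.mk.eta, ← hw, hρ]⟩⟩, (ρ y.base).2)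

lemma polyInv_polyEnd (ρ : F.X → N × ℝ) (hρ : Function.LeftInverse ρ F.e)
    (z : PolySpace π C × ℝ) (h) : F.polyInv ρ hρ (F.polyEnd z) h = z := by
  have h0 : ρ (F.polyEnd z).base = (z.1.base, z.2) := hρ _
  have h1 : (ρ (F.polyEnd z).base).1 = z.1.base := congrArg Prod.fst h0
  have h2 : (ρ (F.polyEnd z).base).2 = z.2 := congrArg Prod.snd h0
  exact Prod.ext (ext_of_eq h1 fun t ht ht' => F.polyEnd_map z t _ _ ht') h2

lemma polyEnd_polyInv (ρ : F.X → N × ℝ) (hρ : Function.LeftInverse ρ F.e)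
    (y : PolySpace F.P C) (h : y.base ∈ range F.e) : F.polyEnd (F.polyInv ρ hρ y h) = y := by
  have hb : F.e (ρ y.base) = y.base := by
    obtain ⟨w, hw⟩ := h
    rw [← hw, hρ]
  refine ext_of_eq hb fun s hs hs' => ?_
  obtain ⟨⟨t, a⟩, rfl⟩ := F.mem_range_lift s (by rw [hs']; exact h)
  have h1 := (F.P_lift (t, a)).symm.trans (hs'.trans hb.symm)
  have h2 := F.injective h1
  have ht : π t = (ρ y.base).1 := congrArg Prod.fst h2
  have ha : a = (ρ y.base).2 := congrArg Prod.snd h2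
  refine (F.polyEnd_map _ t a hs ht).trans ?_
  exact congrArg y.map (Subtype.ext (congrArg (fun b => F.lift (t, b)) ha.symm))

lemma range_polyEnd (hρ : ∃ ρ : F.X → N × ℝ, Function.LeftInverse ρ F.e) :
    range (F.polyEnd : PolySpace π C × ℝ → _) = {y | y.base ∈ range F.e} := by
  obtain ⟨ρ, hρ⟩ := hρ
  ext y
  constructor
  · rintro ⟨z, rfl⟩
    exact mem_range_self _
  · exact fun h => ⟨_, F.polyEnd_polyInv ρ hρ y h⟩

lemma image_polyEnd (K : Set ℝ) : (F.polyEnd : PolySpace π C × ℝ → _) '' {z | z.2 ∈ K} =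
    {y | y.base ∈ F.e '' {z | z.2 ∈ K}} := by
  ext y
  constructor
  · rintro ⟨z, hz, rfl⟩
    exact ⟨_, hz, rfl⟩
  · rintro ⟨z, hz, hzy⟩
    obtain ⟨ρ, hρ, -⟩ := F.smooth_inv z
    have h : y.base ∈ range F.e := ⟨z, hzy⟩
    refine ⟨_, ?_, F.polyEnd_polyInv ρ hρ y h⟩
    change (ρ y.base).2 ∈ K
    rw [← hzy, hρ]
    exact hz

lemma injective_polyEnd : Function.Injective (F.polyEnd : PolySpace π C × ℝ → _) := by
  intro z w h
  obtain ⟨ρ, hρ, -⟩ := F.smooth_inv (z.1.base, z.2)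
  rw [← F.polyInv_polyEnd ρ hρ z (mem_range_self _), ← F.polyInv_polyEnd ρ hρ w (mem_range_self _)]
  congr 1

lemma smoothAt_polyEnd [∀ x, Finite (π ⁻¹' {x})] [∀ x, Finite (F.P ⁻¹' {x})]
    (hπ : FiniteCovering π) (z : PolySpace π C × ℝ) :
    SmoothAt ((PolySpace.charts hπ.isCoveringMap AN AC).prod (model ℝ))
      (PolySpace.charts F.finiteCovering.isCoveringMap F.A AC) F.polyEnd z := by
  have hb : SmoothAt ((PolySpace.charts hπ.isCoveringMap AN AC).prod (model ℝ))
      (AN.prod (model ℝ)) (fun z => (z.1.base, z.2)) z :=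
    (SmoothAt.comp (smoothAt_base hπ.isCoveringMap _) smoothAt_fst).prodMk smoothAt_snd
  refine smoothAt_of_eval F.finiteCovering.isCoveringMap
    (SmoothAt.comp (f := fun z : PolySpace π C × ℝ => (z.1.base, z.2)) (F.smooth_e _) hb)
    fun s hs => ?_
  obtain ⟨⟨t, a⟩, rfl⟩ := F.mem_range_lift s ⟨_, hs.symm⟩
  have hs' := F.injective ((F.P_lift _).symm.trans hs)
  have ht : π t = z.1.base := congrArg Prod.fst hs'
  obtain ⟨f, hf, hfe⟩ := exists_smoothAt_eval (A := AN) (D := AC) hπ.isCoveringMap z.1 t ht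
  refine ⟨fun w => f w.1, SmoothAt.comp (f := Prod.fst) hf smoothAt_fst, ?_⟩
  rw [nhds_prod_eq] at hfe ⊢
  obtain ⟨U, hU, V, hV, hUV⟩ := Filter.mem_prod_iff.1 hfe
  have hV' : F.lift '' {w | w.1 ∈ V} ∈ 𝓝 (F.lift (t, a)) :=
    (F.isOpenEmbedding_lift hπ).isOpenMap.image_mem_nhds (continuousAt_fst hV)
  filter_upwards [Filter.prod_mem_prod (continuousAt_fst hU) hV']
  rintro ⟨w, _⟩ ⟨hw, ⟨t', a'⟩, ht', rfl⟩ h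
  have h2 : π t' = w.1.base :=
    congrArg Prod.fst (F.injective ((F.P_lift _).symm.trans h))
  refine (F.polyEnd_map w t' a' h h2).trans ?_
  exact hUV (mk_mem_prod hw ht') h2

variable [T2Space N] [T2Space C]

/-- A filling of a covering `π` induces a filling of the composition of `π` with a covering of a
closed manifold. -/
def poly [CompactSpace C] [∀ x, Finite (π ⁻¹' {x})] [∀ x, Finite (F.P ⁻¹' {x})]
    (hπ : FiniteCovering π) {q : R → C} (hq : FiniteCovering q) :
    Filling (PolySpace.charts hπ.isCoveringMap AN AC) (compProj π q) :=
  have hP := F.finiteCovering.isCoveringMap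
  haveI := t2Space (X := C) hP
  { X := PolySpace F.P C
    dim := _
    A := PolySpace.charts hP F.A AC
    S := _
    P := compProj F.P q
    finiteCovering := finiteCovering_compProj F.finiteCovering hq
    e := F.polyEnd
    smooth_e := F.smoothAt_polyEnd AC hπ
    smooth_inv := fun z => by
      classical
      obtain ⟨ρ, hρ, hs⟩ := F.smooth_inv (z.1.base, z.2)
      refine ⟨fun y => if h : y.base ∈ range F.e then F.polyInv ρ hρ y h else z, fun y => ?_, ?_⟩
      · exact (dif_pos (show (F.polyEnd y).base ∈ range F.e from mem_range_self _)).trans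
          (F.polyInv_polyEnd ρ hρ y _)
      · have hmem : ∀ᶠ y in 𝓝 (F.polyEnd z), y.base ∈ range F.e :=
          (continuous_base F.P).continuousAt.eventually
            (F.isOpen_range.mem_nhds (mem_range_self _))
        have hb : SmoothAt (PolySpace.charts hP F.A AC) (AN.prod (model ℝ))
            (fun y => ρ y.base) (F.polyEnd z) :=
          SmoothAt.comp (f := base) hs (smoothAt_base hP _)
        have hz : (if h : (F.polyEnd z).base ∈ range F.e then
            F.polyInv ρ hρ (F.polyEnd z) h else z) = z := by
          rw [dif_pos (show (F.polyEnd z).base ∈ range F.e from mem_range_self _), polyInv_polyEnd]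
        have hρz : ρ (F.polyEnd z).base = (z.1.base, z.2) := hρ _
        refine SmoothAt.prodMk (f := fun y => (if h : y.base ∈ range F.e then
          F.polyInv ρ hρ y h else z).1) (h := fun y => (if h : y.base ∈ range F.e then
          F.polyInv ρ hρ y h else z).2) (smoothAt_of_eval _ ?_ fun t ht => ?_) ?_
        · refine hb.fst.congr ?_
          filter_upwards [hmem] with y hy
          rw [dif_pos hy]
          rfl
        · rw [hz] at ht
          obtain ⟨f, hf, hfe⟩ := exists_smoothAt_eval (A := F.A) (D := AC) hP (F.polyEnd z)
            (F.lift (t, z.2)) (by rw [F.P_lift, ht]; rfl)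
          refine ⟨f, hf, ?_⟩
          have hc : ContinuousAt (fun w : PolySpace F.P C × T =>
              (w.1, F.lift (w.2, (ρ w.1.base).2))) (F.polyEnd z, t) := by
            refine continuousAt_fst.prodMk (F.continuous_lift.continuousAt.comp ?_)
            exact continuousAt_snd.prodMk (ContinuousAt.comp (f := Prod.fst)
              (g := fun y : PolySpace F.P C => (ρ y.base).2) hb.snd.1 continuousAt_fst)
          have hfe' := hc.eventually (p := fun y => ∀ h : F.P y.2 = y.1.base,
            y.1.map ⟨y.2, h⟩ = f y.1) (by
              dsimp only
              rw [hρz]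
              exact hfe)
          filter_upwards [hfe', continuousAt_fst.eventually hmem]
          rintro ⟨y, t'⟩ hy hy' h
          have hite : (if h : y.base ∈ range F.e then F.polyInv ρ hρ y h else z) =
            F.polyInv ρ hρ y hy' := dif_pos hy'
          have h' : π t' = (F.polyInv ρ hρ y hy').1.base := by
            rw [← hite]
            exact h
          have hb' : F.P (F.lift (t', (ρ y.base).2)) = y.base := by
            obtain ⟨w, hw⟩ := hy'
            rw [F.P_lift, h']
            change F.e (ρ y.base) = _
            rw [← hw, hρ]
          refine Eq.trans ?_ (hy hb')
          have key : ∀ (v : PolySpace π C × ℝ) (hv : v = F.polyInv ρ hρ y hy')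
              (h : π t' = v.1.base), v.1.map ⟨t', h⟩ = y.map ⟨F.lift (t', (ρ y.base).2), hb'⟩ := by
            rintro _ rfl h
            rfl
          exact key _ hite h
        · refine hb.snd.congr ?_
          filter_upwards [hmem] with y hy
          rw [dif_pos hy]
          rfl
    isOpen_range := by
      by_cases hne : Nonempty N
      · obtain ⟨x⟩ := hne
        obtain ⟨ρ, hρ, -⟩ := F.smooth_inv (x, 0)
        rw [F.range_polyEnd ⟨ρ, hρ⟩]
        exact F.isOpen_range.preimage (continuous_base _)
      · have : IsEmpty (PolySpace π C) := ⟨fun x => hne ⟨x.base⟩⟩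
        rw [range_eq_empty]
        exact isOpen_empty
    isClosed_end := by
      have := F.image_polyEnd (C := C) (Iic 0)
      exact this ▸ F.isClosed_end.preimage (continuous_base _)
    isCompact_core := by
      have := F.image_polyEnd (C := C) (Iio 0)
      change IsCompact (F.polyEnd '' {z | z.2 ∈ Iio 0})ᶜ
      rw [this]
      convert isCompact_setOf hP F.isCompact_core (isCompact_univ : IsCompact (univ : Set C)) using 1
      ext y
      exact ⟨fun h => ⟨h, fun _ => mem_univ _⟩, fun h => h.1⟩
    lift := fun z => ⟨(⟨(F.polyEnd (z.1.fst.fst, z.2), F.lift (z.1.fst.snd, z.2)), by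
      rw [F.P_lift]
      exact congrArg (fun b => F.e (b, z.2)) z.1.fst.2⟩, z.1.snd), by
        exact (F.polyEnd_map _ _ _ _ z.1.fst.2.symm).trans z.1.2⟩
    continuous_lift := by
      have hc : Continuous (F.polyEnd : PolySpace π C × ℝ → _) :=
        continuous_iff_continuousAt.2 fun z => (F.smoothAt_polyEnd AC hπ z).1
      have h1 : Continuous fun z : Function.Pullback (eval : Function.Pullback
        (base : PolySpace π C → N) π → C) q => z.1.1 := continuous_fst.comp continuous_subtype_val
      have h2 : Continuous fun z : Function.Pullback (eval : Function.Pullback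
        (base : PolySpace π C → N) π → C) q => z.1.1.1.1 :=
        (continuous_fst.comp continuous_subtype_val).comp h1
      have h3 : Continuous fun z : Function.Pullback (eval : Function.Pullback
        (base : PolySpace π C → N) π → C) q => z.1.1.1.2 :=
        (continuous_snd.comp continuous_subtype_val).comp h1
      refine Continuous.subtype_mk (Continuous.prodMk (Continuous.subtype_mk (Continuous.prodMk
        (hc.comp ((h2.comp continuous_fst).prodMk continuous_snd)) (F.continuous_lift.comp
          ((h3.comp continuous_fst).prodMk continuous_snd))) _) ?_) _
      exact (continuous_snd.comp continuous_subtype_val).comp continuous_fst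
    injective_lift := by
      intro z w h
      have h1 := Prod.ext_iff.1 (Subtype.ext_iff.1 h)
      have h2 := Prod.ext_iff.1 (Subtype.ext_iff.1 h1.1)
      have h3 := Prod.ext_iff.1 (F.injective_polyEnd h2.1)
      have h4 := Prod.ext_iff.1 (F.injective_lift h2.2)
      exact Prod.ext (Subtype.ext (Prod.ext (Subtype.ext (Prod.ext h3.1 h4.1)) h1.2)) h3.2
    P_lift := fun z => rfl
    mem_range_lift := by
      rintro ⟨⟨⟨⟨y, s⟩, hs⟩, r⟩, hr⟩ ⟨w, hw⟩
      obtain rfl : F.polyEnd w = y := hw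
      obtain ⟨⟨t, a⟩, rfl⟩ := F.mem_range_lift s ⟨_, hs⟩
      have h1 := F.injective ((F.P_lift _).symm.trans hs.symm)
      have ht : π t = w.1.base := congrArg Prod.fst h1
      have ha : a = w.2 := congrArg Prod.snd h1
      refine ⟨(⟨(⟨(w.1, t), ht.symm⟩, r), ?_⟩, w.2), ?_⟩
      · exact (F.polyEnd_map w t a hs.symm ht).symm.trans hr
      · refine Subtype.ext (Prod.ext (Subtype.ext (Prod.ext rfl ?_)) rfl)
        exact congrArg (fun b => F.lift (t, b)) ha.symm }

end Filling

open Charts PolySpace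

attribute [local instance] Fintype.ofFinite

lemma exists_rightInverse_of_linearIndependent {E ι : Type} [NormedAddCommGroup E]
    [NormedSpace ℝ E] [Finite ι] {ℓ : ι → E →L[ℝ] ℝ} (h : LinearIndependent ℝ ℓ) :
    ∃ M : (ι → ℝ) →L[ℝ] E, ∀ c i, ℓ i (M c) = c i := by
  classical
  have hr : ((ContinuousLinearMap.pi ℓ : E →L[ℝ] ι → ℝ) : E →ₗ[ℝ] ι → ℝ).range = ⊤ := by
    by_contra hne
    obtain ⟨f, hf, hle⟩ := Submodule.exists_le_ker_of_lt_top _ (lt_top_iff_ne_top.2 hne)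
    refine hf (LinearMap.pi_ext' fun i => LinearMap.ext_ring ?_)
    have h0 : ∑ i, f (Pi.single i 1) • ℓ i = 0 := by
      ext x
      have hx := hle (LinearMap.mem_range_self _ x)
      rw [LinearMap.mem_ker, LinearMap.pi_apply_eq_sum_univ f] at hx
      have hsingle (i : ι) : (fun j => if i = j then (1 : ℝ) else 0) = Pi.single i 1 := by
        funext j
        simp [Pi.single_apply, eq_comm]
      simp only [hsingle] at hx
      simp only [sum_apply, smul_apply, zero_apply]
      rw [← hx]
      refine Finset.sum_congr rfl fun i _ => ?_
      rw [smul_eq_mul, smul_eq_mul, mul_comm]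
      rfl
    exact Fintype.linearIndependent_iff.1 h _ h0 i
  obtain ⟨M, hM⟩ := ContinuousLinearMap.exists_rightInverse_of_surjective _ hr
  exact ⟨M, fun c i => congrFun (DFunLike.congr_fun hM c) i⟩

section Sections

variable {R Y : Type} [TopologicalSpace R] [TopologicalSpace Y] {κ : R → Y} (hκ : IsCoveringMap κ)

open Classical in
/-- The section of a covering defined by a sheet over an evenly covered neighbourhood. -/
def secFun (y₀ : Y) (i : κ ⁻¹' {y₀}) (y : Y) : R :=
  if h : y ∈ nbhd hκ y₀ then (sec hκ y₀ h i).1 else i.1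

lemma secFun_of_mem {y₀ y : Y} (h : y ∈ nbhd hκ y₀) (i : κ ⁻¹' {y₀}) :
    secFun hκ y₀ i y = (sec hκ y₀ h i).1 := dif_pos h

lemma proj_secFun {y₀ y : Y} (h : y ∈ nbhd hκ y₀) (i : κ ⁻¹' {y₀}) : κ (secFun hκ y₀ i y) = y := by
  rw [secFun_of_mem hκ h]
  exact (sec hκ y₀ h i).2

lemma eventually_proj_secFun {y₀ y : Y} (h : y ∈ nbhd hκ y₀) (i : κ ⁻¹' {y₀}) :
    ∀ᶠ y' in 𝓝 y, κ (secFun hκ y₀ i y') = y' := by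
  filter_upwards [(isOpen_nbhd hκ y₀).mem_nhds h] with y' hy'
  exact proj_secFun hκ hy' i

lemma continuousAt_secFun {y₀ y : Y} (h : y ∈ nbhd hκ y₀) (i : κ ⁻¹' {y₀}) :
    ContinuousAt (secFun hκ y₀ i) y := by
  refine ContinuousOn.continuousAt ?_ ((isOpen_nbhd hκ y₀).mem_nhds h)
  rw [continuousOn_iff_continuous_domRestrict]
  have : (nbhd hκ y₀).domRestrict (secFun hκ y₀ i) =
      fun y => ((triv hκ y₀).symm (y, i)).1 := funext fun y => secFun_of_mem hκ y.2 i
  rw [this]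
  fun_prop

lemma secFun_mem_sheet {y₀ y : Y} (h : y ∈ nbhd hκ y₀) (i : κ ⁻¹' {y₀}) :
    secFun hκ y₀ i y ∈ sheet hκ y₀ i := by
  rw [secFun_of_mem hκ h]
  exact sec_mem_sheet hκ y₀ h i

lemma eq_secFun {y₀ : Y} {i : κ ⁻¹' {y₀}} {r : R} (hr : r ∈ sheet hκ y₀ i) :
    r = secFun hκ y₀ i (κ r) := by
  rw [secFun_of_mem hκ hr.1]
  exact congrArg Subtype.val (eq_sec_of_mem_sheet hκ y₀ hr.1 i ⟨r, rfl⟩ hr)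

lemma mem_sheet_idx {y₀ : Y} {r : R} (hr : κ r ∈ nbhd hκ y₀) :
    r ∈ sheet hκ y₀ (idx hκ y₀ r hr) := ⟨hr, rfl⟩

variable {dY : Y → ℕ} {AY : Charts Y dY} {F : Type} [NormedAddCommGroup F] [NormedSpace ℝ F]
  [FiniteDimensional ℝ F]

lemma smoothAt_comp_secFun {s : R → F} {y₀ y : Y} (h : y ∈ nbhd hκ y₀) (i : κ ⁻¹' {y₀})
    (hs : SmoothAt (AY.comap hκ.isLocalHomeomorph) (model F) s (secFun hκ y₀ i y)) :
    SmoothAt AY (model F) (s ∘ secFun hκ y₀ i) y :=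
  hs.comp (smoothAt_section _ (continuousAt_secFun hκ h i) (eventually_proj_secFun hκ h i))

/-- A function on the total space, on a sheet of the covering and in a chart of the base. -/
def onSheet (AY : Charts Y dY) (s : R → F) (y₀ : Y) (i : κ ⁻¹' {y₀}) : AY.V y₀ → F :=
  s ∘ secFun hκ y₀ i ∘ (AY.chart y₀).symm

lemma onSheet_chart {s : R → F} {y₀ y : Y} (hy : y ∈ (AY.chart y₀).source) (i : κ ⁻¹' {y₀}) :
    onSheet hκ AY s y₀ i (AY.chart y₀ y) = s (secFun hκ y₀ i y) :=
  congrArg (fun y => s (secFun hκ y₀ i y)) ((AY.chart y₀).left_inv hy)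

lemma contDiffAt_onSheet {s : R → F} {y₀ y : Y} (h : y ∈ nbhd hκ y₀)
    (hy : y ∈ (AY.chart y₀).source) (i : κ ⁻¹' {y₀})
    (hs : ∀ r, SmoothAt (AY.comap hκ.isLocalHomeomorph) (model F) s r) :
    ContDiffAt ℝ ∞ (onSheet hκ AY s y₀ i) (AY.chart y₀ y) :=
  (smoothAt_model_iff hy).1 (smoothAt_comp_secFun hκ h i (hs _))

end Sections

section Regular

variable {R Y : Type} [TopologicalSpace R] [TopologicalSpace Y] {κ : R → Y} (hκ : IsCoveringMap κ)
  [∀ y, Finite (κ ⁻¹' {y})] {dY : Y → ℕ} {AY : Charts Y dY}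

/-- A function on the total space of a covering is regular at a point `y` of the base, if it does
not vanish on the fibre over `y`, or if its differentials at the points over `y` are linearly
independent (i.e. if there is a smooth right inverse of the values of the function on the
sheets). -/
def Regular (AY : Charts Y dY) (κ : R → Y) [∀ y, Finite (κ ⁻¹' {y})] (s : R → ℝ) (y : Y) : Prop :=
  (∀ r, κ r = y → s r = 0) → ∃ h : (κ ⁻¹' {y} → ℝ) → Y,
    SmoothAt (model (κ ⁻¹' {y} → ℝ)) AY h 0 ∧ h 0 = y ∧
      ∀ r : κ ⁻¹' {y}, ∀ᶠ z in 𝓝 ((0 : κ ⁻¹' {y} → ℝ), r.1), κ z.2 = h z.1 → s z.2 = z.1 r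

variable {s s' : R → ℝ}

lemma Regular.congr {y : Y} (h : Regular AY κ s y) {U : Set Y} (hU : U ∈ 𝓝 y)
    (hs : ∀ r, κ r ∈ U → s' r = s r) : Regular AY κ s' y := by
  intro h0
  obtain ⟨f, hf, hfy, hfr⟩ := h fun r hr => by
    rw [← hs r (by rw [hr]; exact mem_of_mem_nhds hU)]
    exact h0 r hr
  refine ⟨f, hf, hfy, fun r => ?_⟩
  have h1 : ∀ᶠ z in 𝓝 ((0 : κ ⁻¹' {y} → ℝ), r.1), f z.1 ∈ U :=
    (continuousAt_fst (p := ((0 : κ ⁻¹' {y} → ℝ), r.1))).eventually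
      (hf.1.eventually (by rw [hfy]; exact hU))
  filter_upwards [hfr r, h1] with z hz hz' hκz
  rw [hs _ (by rw [hκz]; exact hz'), hz hκz]

lemma linearIndependent_of_regular
    (hs : ∀ r, SmoothAt (AY.comap hκ.isLocalHomeomorph) (model ℝ) s r) {y₀ y : Y}
    (hn : y ∈ nbhd hκ y₀) (hy : y ∈ (AY.chart y₀).source) (h : Regular AY κ s y)
    (h0 : ∀ r, κ r = y → s r = 0) :
    LinearIndependent ℝ fun i => fderiv ℝ (onSheet hκ AY s y₀ i) (AY.chart y₀ y) := by
  classical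
  obtain ⟨f, hf, hfy, hfr⟩ := h h0
  have hG : ContDiffAt ℝ ∞ (AY.chart y₀ ∘ f) 0 := smoothAt_model_model_iff.1
    ((AY.smoothAt_chart hy).comp_of_eq hf hfy)
  have hG' := (hG.differentiableAt (by simp)).hasFDerivAt
  have key (i : κ ⁻¹' {y₀}) (c : κ ⁻¹' {y} → ℝ) :
      fderiv ℝ (onSheet hκ AY s y₀ i) (AY.chart y₀ y) (fderiv ℝ (AY.chart y₀ ∘ f) 0 c) =
        c (secEquiv hκ y₀ hn i) := by
    have h1 := ((contDiffAt_onSheet hκ hn hy i hs).differentiableAt (by simp)).hasFDerivAt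
    have hfy' : (AY.chart y₀ ∘ f) 0 = AY.chart y₀ y := congrArg (AY.chart y₀) hfy
    rw [← hfy'] at h1 ⊢
    have h2 := h1.comp 0 hG'
    have h3 : HasFDerivAt (fun c : κ ⁻¹' {y} → ℝ => c (secEquiv hκ y₀ hn i))
      (ContinuousLinearMap.proj (R := ℝ) (secEquiv hκ y₀ hn i)) 0 :=
        hasFDerivAt_apply _ _
    have h4 : onSheet hκ AY s y₀ i ∘ (AY.chart y₀ ∘ f) =ᶠ[𝓝 0]
        fun c : κ ⁻¹' {y} → ℝ => c (secEquiv hκ y₀ hn i) := by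
      have hc : ContinuousAt (fun c => (c, secFun hκ y₀ i (f c))) 0 :=
        continuousAt_id.prodMk (ContinuousAt.comp (f := f) (g := secFun hκ y₀ i) (by
          rw [hfy]
          exact continuousAt_secFun hκ hn i) hf.1)
      have h5 := hfr (secEquiv hκ y₀ hn i)
      have h6 : (secEquiv hκ y₀ hn i).1 = secFun hκ y₀ i (f 0) := by
        rw [hfy, secFun_of_mem hκ hn]
        rfl
      rw [h6] at h5
      filter_upwards [hc.eventually h5, hf.1.eventually
        ((isOpen_nbhd hκ y₀).mem_nhds (by rw [hfy]; exact hn)),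
        hf.1.eventually ((AY.chart y₀).open_source.mem_nhds (by rw [hfy]; exact hy))] with c h7 h8 h9
      exact (onSheet_chart hκ h9 i).trans (h7 (proj_secFun hκ h8 i))
    exact DFunLike.congr_fun (h2.unique (h3.congr_of_eventuallyEq h4)) c
  rw [Fintype.linearIndependent_iff]
  intro g hg i
  have h1 := DFunLike.congr_fun hg
    (fderiv ℝ (AY.chart y₀ ∘ f) 0 (Pi.single (secEquiv hκ y₀ hn i) 1))
  simp only [sum_apply, smul_apply,
    zero_apply, key, smul_eq_mul] at h1
  rw [Finset.sum_eq_single i] at h1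
  · simpa using h1
  · intro j _ hj
    rw [Pi.single_eq_of_ne ((secEquiv hκ y₀ hn).injective.ne hj), mul_zero]
  · simp

lemma regular_of_linearIndependent
    (hs : ∀ r, SmoothAt (AY.comap hκ.isLocalHomeomorph) (model ℝ) s r) {y₀ y : Y}
    (hn : y ∈ nbhd hκ y₀) (hy : y ∈ (AY.chart y₀).source)
    (h : (∀ r, κ r = y → s r = 0) →
      LinearIndependent ℝ fun i => fderiv ℝ (onSheet hκ AY s y₀ i) (AY.chart y₀ y)) :
    Regular AY κ s y := by
  classical
  intro h0
  obtain ⟨M, hM⟩ := exists_rightInverse_of_linearIndependent (h h0)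
  set v := AY.chart y₀ y with hv
  let Γ : (κ ⁻¹' {y₀} → ℝ) → κ ⁻¹' {y₀} → ℝ := fun c i => onSheet hκ AY s y₀ i (v + M c)
  have hv0 : v + M 0 = v := by simp
  have hΓ : ContDiffAt ℝ ∞ Γ 0 := by
    refine contDiffAt_pi.2 fun i => ContDiffAt.comp (g := onSheet hκ AY s y₀ i)
      (f := fun c => v + M c) 0 ?_ (by fun_prop)
    rw [hv0]
    exact contDiffAt_onSheet hκ hn hy i hs
  have hΓd : HasFDerivAt Γ (ContinuousLinearMap.id ℝ _) 0 := by
    rw [hasFDerivAt_pi']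
    intro i
    have h1 := ((contDiffAt_onSheet hκ hn hy i hs).differentiableAt (by simp)).hasFDerivAt
    have h2 : HasFDerivAt (fun c => v + M c) M 0 := M.hasFDerivAt.const_add v
    have h1' : HasFDerivAt (onSheet hκ AY s y₀ i) (fderiv ℝ (onSheet hκ AY s y₀ i) v) (v + M 0) := by
      rw [hv0]
      exact h1
    have h3 := h1'.comp 0 h2
    have h4 : (ContinuousLinearMap.proj (R := ℝ) (φ := fun _ => ℝ) i).comp
        (ContinuousLinearMap.id ℝ (κ ⁻¹' {y₀} → ℝ)) =
          (fderiv ℝ (onSheet hκ AY s y₀ i) v).comp M :=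
      ContinuousLinearMap.ext fun c => (hM c i).symm
    rw [h4]
    exact h3
  have hΓ0 : Γ 0 = 0 := by
    funext i
    change onSheet hκ AY s y₀ i (v + M 0) = 0
    rw [hv0, onSheet_chart hκ hy]
    exact h0 _ (proj_secFun hκ hn i)
  obtain ⟨γ, hγ, hγ1, hγ2⟩ := exists_smoothAt_localInverse (A := model (κ ⁻¹' {y₀} → ℝ))
    (smoothAt_model_model_iff.2 hΓ) (x := 0) (by
      have : fderiv ℝ Γ 0 = ContinuousLinearMap.id ℝ _ := hΓd.fderiv
      change Function.Injective (fderiv ℝ Γ 0)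
      rw [this]
      exact fun _ _ h => h) rfl
  rw [hΓ0] at hγ hγ2
  have hγ0 : γ 0 = 0 := by
    have := hγ1.self_of_nhds
    rwa [hΓ0] at this
  let e := secEquiv hκ y₀ hn
  have hre : ContDiffAt ℝ ∞ (fun c : κ ⁻¹' {y} → ℝ => fun i => c (e i)) 0 :=
    contDiffAt_pi.2 fun i => (contDiff_apply ℝ ℝ (e i)).contDiffAt
  have hγ' : SmoothAt (model (κ ⁻¹' {y} → ℝ)) (model (AY.V y₀))
      (fun c => v + M (γ fun i => c (e i))) 0 := by
    refine SmoothAt.comp (g := fun c => v + M c) (B := model (κ ⁻¹' {y₀} → ℝ))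
      (smoothAt_model_model_iff.2 (by fun_prop)) ?_
    exact SmoothAt.comp (f := fun c : κ ⁻¹' {y} → ℝ => fun i => c (e i)) hγ
      (smoothAt_model_model_iff.2 hre)
  have hγ'0 : v + M (γ fun i => (0 : κ ⁻¹' {y} → ℝ) (e i)) = v := by
    change v + M (γ 0) = v
    rw [hγ0, hv0]
  have hvt : v ∈ (AY.chart y₀).target := (AY.chart y₀).map_source hy
  refine ⟨fun c => (AY.chart y₀).symm (v + M (γ fun i => c (e i))),
    (AY.smoothAt_chart_symm hvt).comp_of_eq hγ' hγ'0, ?_, fun r => ?_⟩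
  · dsimp only
    rw [hγ'0]
    exact (AY.chart y₀).left_inv hy
  · obtain ⟨i, rfl⟩ := e.surjective r
    have h1 : ∀ᶠ z in 𝓝 ((0 : κ ⁻¹' {y} → ℝ), (e i).1), z.2 ∈ sheet hκ y₀ i :=
      continuousAt_snd.eventually ((isOpen_sheet hκ y₀ i).mem_nhds (sec_mem_sheet hκ y₀ hn i))
    have h2 : ∀ᶠ c in 𝓝 (0 : κ ⁻¹' {y} → ℝ), v + M (γ fun i => c (e i)) ∈ (AY.chart y₀).target :=
      hγ'.1.eventually ((AY.chart y₀).open_target.mem_nhds (by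
        change v + M (γ fun i => (0 : κ ⁻¹' {y} → ℝ) (e i)) ∈ _
        rwa [hγ'0]))
    have h3 : ∀ᶠ c in 𝓝 (0 : κ ⁻¹' {y} → ℝ), Γ (γ fun i => c (e i)) = fun i => c (e i) :=
      hre.continuousAt.eventually hγ2
    filter_upwards [h1, continuousAt_fst.eventually h2, continuousAt_fst.eventually h3]
      with z hz1 hz2 hz3 hz
    have h4 := eq_secFun hκ hz1
    rw [hz] at h4
    rw [h4]
    exact congrFun hz3 i

/-- Regularity is stable under small perturbations. -/
lemma eventually_regular {P : Type} [NormedAddCommGroup P] [NormedSpace ℝ P] [FiniteDimensional ℝ P]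
    {g : R → P →L[ℝ] ℝ} (hs : ∀ r, SmoothAt (AY.comap hκ.isLocalHomeomorph) (model ℝ) s r)
    (hg : ∀ r, SmoothAt (AY.comap hκ.isLocalHomeomorph) (model (P →L[ℝ] ℝ)) g r) {y₁ : Y}
    (h : Regular AY κ s y₁) :
    ∀ᶠ z in 𝓝 ((0 : P), y₁), Regular AY κ (fun r => s r + g r z.1) z.2 := by
  have hn := mem_nbhd hκ y₁
  have hy := AY.mem_source y₁
  have hsm (π : P) (r) : SmoothAt (AY.comap hκ.isLocalHomeomorph) (model ℝ)
      (fun r => s r + g r π) r := by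
    refine SmoothAt.comp (f := fun r => (s r, g r)) (g := fun z : ℝ × (P →L[ℝ] ℝ) => z.1 + z.2 π)
      (B := model _) (smoothAt_model_model_iff.2 ?_) (smoothAt_model_prod.1 ((hs r).prodMk (hg r)))
    fun_prop
  by_cases h0 : ∀ r, κ r = y₁ → s r = 0
  · have hli := linearIndependent_of_regular hκ hs hn hy h h0
    have h1 (i : κ ⁻¹' {y₁}) : ContinuousAt (fun z : P × Y =>
        fderiv ℝ (onSheet hκ AY s y₁ i) (AY.chart y₁ z.2) + (ContinuousLinearMap.apply ℝ ℝ z.1).comp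
          (fderiv ℝ (onSheet hκ AY g y₁ i) (AY.chart y₁ z.2))) (0, y₁) := by
      have hc : ContinuousAt (fun z : P × Y => AY.chart y₁ z.2) (0, y₁) :=
        ContinuousAt.comp (f := Prod.snd) ((AY.chart y₁).continuousAt hy) continuousAt_snd
      have h2 := ((contDiffAt_onSheet hκ hn hy i hs).fderiv_right (m := 0) (by simp)).continuousAt
      have h3 := ((contDiffAt_onSheet hκ hn hy i hg).fderiv_right (m := 0) (by simp)).continuousAt
      refine ContinuousAt.add (ContinuousAt.comp (f := fun z : P × Y => AY.chart y₁ z.2) h2 hc) ?_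
      refine ContinuousAt.clm_comp ?_ (ContinuousAt.comp
        (f := fun z : P × Y => AY.chart y₁ z.2) h3 hc)
      exact (ContinuousLinearMap.apply ℝ ℝ).continuous.continuousAt.comp continuousAt_fst
    have h2 := (continuousAt_pi.2 h1).eventually
      ((isOpen_setOfPred_linearIndependent (𝕜 := ℝ)).mem_nhds (by
        change LinearIndependent ℝ _
        simpa using hli))
    filter_upwards [h2, continuousAt_snd.eventually ((isOpen_nbhd hκ y₁).mem_nhds hn),
      continuousAt_snd.eventually ((AY.chart y₁).open_source.mem_nhds hy)] with z hz hzn hzy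
    refine regular_of_linearIndependent hκ (hsm z.1) hzn hzy fun _ => ?_
    have h2 : (fun i => fderiv ℝ (onSheet hκ AY (fun r => s r + g r z.1) y₁ i)
        (AY.chart y₁ z.2)) = fun i => fderiv ℝ (onSheet hκ AY s y₁ i) (AY.chart y₁ z.2) +
          (ContinuousLinearMap.apply ℝ ℝ z.1).comp
            (fderiv ℝ (onSheet hκ AY g y₁ i) (AY.chart y₁ z.2)) := ?_
    · rw [h2]
      exact hz
    funext i
    have h3 := ((contDiffAt_onSheet hκ hzn hzy i hs).differentiableAt (by simp)).hasFDerivAt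
    have h4 := ((contDiffAt_onSheet hκ hzn hzy i hg).differentiableAt (by simp)).hasFDerivAt
    exact (h3.add ((ContinuousLinearMap.apply ℝ ℝ z.1).hasFDerivAt.comp _ h4)).fderiv
  · push Not at h0
    obtain ⟨r, rfl, hr⟩ := h0
    set i : κ ⁻¹' {κ r} := idx hκ (κ r) r hn
    have hri : secFun hκ (κ r) i (κ r) = r := (eq_secFun hκ (mem_sheet_idx hκ hn)).symm
    have hc : ContinuousAt (fun z : P × Y => s (secFun hκ (κ r) i z.2) +
        g (secFun hκ (κ r) i z.2) z.1) (0, κ r) := by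
      have h1 : ContinuousAt (fun z : P × Y => secFun hκ (κ r) i z.2) (0, κ r) :=
        ContinuousAt.comp (f := Prod.snd) (g := secFun hκ (κ r) i)
          (continuousAt_secFun hκ hn i) continuousAt_snd
      have h2 : ContinuousAt (fun z : P × Y => g (secFun hκ (κ r) i z.2)) (0, κ r) :=
        ContinuousAt.comp (f := fun z : P × Y => secFun hκ (κ r) i z.2) (hg _).1 h1
      exact (ContinuousAt.comp (f := fun z : P × Y => secFun hκ (κ r) i z.2) (hs _).1 h1).add
        (h2.clm_apply continuousAt_fst)
    have hne := hc.eventually_ne (y := 0) (by simpa [hri] using hr)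
    filter_upwards [hne, continuousAt_snd.eventually ((isOpen_nbhd hκ _).mem_nhds hn)] with z hz hzn h1
    exact absurd (h1 _ (proj_secFun hκ hzn i)) hz

end Regular

open Charts PolySpace

attribute [local instance] Fintype.ofFinite

section Perturbation

variable {E ι : Type} [NormedAddCommGroup E] [NormedSpace ℝ E] [FiniteDimensional ℝ E] [Fintype ι]

/-- The rows of a matrix of which the `i`-th one is a linear combination of the other ones. -/
def dependentRows [DecidableEq ι] (i : ι) (ℓ : {j // j ≠ i} → E →L[ℝ] ℝ) (μ : {j // j ≠ i} → ℝ)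
    (j : ι) : E →L[ℝ] ℝ :=
  if h : j ≠ i then ℓ ⟨j, h⟩ else ∑ k, μ k • ℓ k

lemma exists_eq_dependentRows [DecidableEq ι] {v : ι → E →L[ℝ] ℝ} (h : ¬ LinearIndependent ℝ v) :
    ∃ i μ, v = dependentRows i (fun j => v j.1) μ := by
  obtain ⟨g, hg, i, hi⟩ := Fintype.not_linearIndependent_iff.1 h
  refine ⟨i, fun j => -(g i)⁻¹ * g j.1, ?_⟩
  funext j
  rw [dependentRows]
  split_ifs with hj
  · rfl
  · rw [not_not] at hj
    subst hj
    rw [Fintype.sum_eq_add_sum_subtype_ne _ j] at hg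
    have h1 : v j = (g j)⁻¹ • (g j • v j) := by rw [smul_smul, inv_mul_cancel₀ hi, one_smul]
    rw [h1, eq_neg_of_add_eq_zero_left hg, smul_neg, ← neg_smul, Finset.smul_sum]
    exact Finset.sum_congr rfl fun k _ => smul_smul _ _ _

/-- For most affine perturbations of finitely many smooth functions, the differentials are linearly
independent at the common zeros. -/
lemma dense_linearIndependent {O : Set E} (hO : IsOpen O) {S : ι → E → ℝ}
    (hS : ∀ i, ContDiffOn ℝ ∞ (S i) O) :
    Dense {π : ι → ℝ × (E →L[ℝ] ℝ) | ∀ x ∈ O, (∀ i, S i x + ((π i).1 + (π i).2 x) = 0) →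
      LinearIndependent ℝ fun i => fderiv ℝ (S i) x + (π i).2} := by
  classical
  let Q (i : ι) : Type := E × ({j // j ≠ i} → E →L[ℝ] ℝ) × ({j // j ≠ i} → ℝ)
  let G (i : ι) (q : E × ({j // j ≠ i} → E →L[ℝ] ℝ) × ({j // j ≠ i} → ℝ)) (j : ι) :
      ℝ × (E →L[ℝ] ℝ) :=
    (-(S j q.1) - (dependentRows i q.2.1 q.2.2 j - fderiv ℝ (S j) q.1) q.1,
      dependentRows i q.2.1 q.2.2 j - fderiv ℝ (S j) q.1)
  have hG (i : ι) (q) (hq : q.1 ∈ O) : ContDiffAt ℝ 1 (G i) q := by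
    refine contDiffAt_pi.2 fun j => ?_
    have h1 : ContDiffAt ℝ ∞ (S j) q.1 := (hS j).contDiffAt (hO.mem_nhds hq)
    have h2 : ContDiffAt ℝ 1 (fun q : E × ({j // j ≠ i} → E →L[ℝ] ℝ) × ({j // j ≠ i} → ℝ) =>
        S j q.1) q :=
      ContDiffAt.comp (f := Prod.fst) q (h1.of_le (mod_cast le_top)) contDiffAt_fst
    have h3 : ContDiffAt ℝ 1 (fun q : E × ({j // j ≠ i} → E →L[ℝ] ℝ) × ({j // j ≠ i} → ℝ) =>
        fderiv ℝ (S j) q.1) q :=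
      ContDiffAt.comp (f := Prod.fst) q (h1.fderiv_right (m := 1)
        (WithTop.coe_le_coe.2 (le_top : (1 + 1 : ℕ∞) ≤ ⊤))) contDiffAt_fst
    have h4 : ContDiffAt ℝ 1 (fun q : E × ({j // j ≠ i} → E →L[ℝ] ℝ) × ({j // j ≠ i} → ℝ) =>
        dependentRows i q.2.1 q.2.2 j) q := by
      unfold dependentRows
      split_ifs with h <;> fun_prop
    exact (h2.neg.sub ((h4.sub h3).clm_apply contDiffAt_fst)).prodMk (h4.sub h3)
  have hdim (i : ι) : dimH (G i '' {q | q.1 ∈ O}) <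
      Module.finrank ℝ (ι → ℝ × (E →L[ℝ] ℝ)) := by
    refine lt_of_le_of_lt (dimH_image_le_of_locally_lipschitzOn fun q hq => ?_)
      (lt_of_le_of_lt (dimH_mono (subset_univ _)) ?_)
    · obtain ⟨C, t, ht, hC⟩ := (hG i q hq).exists_lipschitzOnWith
      exact ⟨C, t, nhdsWithin_le_nhds ht, hC⟩
    · rw [Real.dimH_univ_eq_finrank, Nat.cast_lt]
      have h1 : Module.finrank ℝ (E →L[ℝ] ℝ) = Module.finrank ℝ E := by
        rw [← LinearMap.toContinuousLinearMap.finrank_eq, Module.finrank_linearMap,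
          Module.finrank_self, mul_one]
      have h2 : Fintype.card {j // j ≠ i} + 1 = Fintype.card ι := by
        rw [Fintype.card_subtype_compl, Fintype.card_subtype_eq]
        exact Nat.sub_add_cancel (Fintype.card_pos_iff.2 ⟨i⟩)
      simp only [Module.finrank_prod, Module.finrank_pi_fintype, h1, Module.finrank_self,
        Finset.sum_const, Finset.card_univ, smul_eq_mul, ← h2]
      nlinarith
  cases isEmpty_or_nonempty ι
  · exact dense_univ.mono fun π _ x _ _ => linearIndependent_empty_type
  refine (dense_compl_of_dimH_lt_finrank (s := ⋃ i, G i '' {q | q.1 ∈ O}) ?_).mono ?_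
  · rw [dimH_iUnion]
    obtain ⟨i, hi⟩ := exists_eq_ciSup_of_finite (f := fun i => dimH (G i '' {q | q.1 ∈ O}))
    rw [← hi]
    exact hdim i
  · intro π hπ x hx h0
    by_contra hli
    obtain ⟨i, μ, h⟩ := exists_eq_dependentRows hli
    refine hπ (mem_iUnion.2 ⟨i, (x, fun j => fderiv ℝ (S j) x + (π j).2, μ), hx, ?_⟩)
    funext j
    have h1 : dependentRows i (fun j : {j // j ≠ i} => fderiv ℝ (S j) x + (π j).2) μ j -
        fderiv ℝ (S j) x = (π j).2 := by
      rw [← congrFun h j]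
      exact add_sub_cancel_left _ _
    refine Prod.ext ?_ h1
    change -(S j x) - (dependentRows i (fun j : {j // j ≠ i} => fderiv ℝ (S j) x + (π j).2) μ j -
        fderiv ℝ (S j) x) x = (π j).1
    rw [h1]
    linarith [h0 j]

end Perturbation

section Regular

variable {R Y : Type} [TopologicalSpace R] [TopologicalSpace Y] {κ : R → Y}
  (hκ : IsCoveringMap κ) [∀ y, Finite (κ ⁻¹' {y})] {dY : Y → ℕ} {AY : Charts Y dY}

/-- The evaluation of a family of affine functions. -/
def affineEval {E ι : Type} [NormedAddCommGroup E] [NormedSpace ℝ E] [Fintype ι] (i : ι) (x : E) :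
    (ι → ℝ × (E →L[ℝ] ℝ)) →L[ℝ] ℝ :=
  (ContinuousLinearMap.fst ℝ ℝ (E →L[ℝ] ℝ) + (ContinuousLinearMap.apply ℝ ℝ x).comp
    (ContinuousLinearMap.snd ℝ ℝ (E →L[ℝ] ℝ))).comp (ContinuousLinearMap.proj i)

lemma contDiff_affineEval {E ι : Type} [NormedAddCommGroup E] [NormedSpace ℝ E] [Fintype ι]
    (i : ι) : ContDiff ℝ ∞ (affineEval (E := E) i) := by
  unfold affineEval
  fun_prop

lemma contDiff_smul_affineEval {E ι : Type} [NormedAddCommGroup E] [NormedSpace ℝ E] [Fintype ι]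
    {χ : E → ℝ} (hχ : ContDiff ℝ ∞ χ) (i : ι) : ContDiff ℝ ∞ fun x => χ x • affineEval i x :=
  have key {F : Type} [NormedAddCommGroup F] [NormedSpace ℝ F] {f : E → F} (hf : ContDiff ℝ ∞ f) :
      ContDiff ℝ ∞ fun x => χ x • f x := hχ.smul hf
  key (contDiff_affineEval i)

open Classical in
/-- Locally supported perturbations of functions on the total space of a covering, which are affine
on each sheet over a neighbourhood of `y₀`. -/
def localPerturbation (AY : Charts Y dY) (y₀ : Y) (χ : AY.V y₀ → ℝ) (r : R) :
    (κ ⁻¹' {y₀} → ℝ × (AY.V y₀ →L[ℝ] ℝ)) →L[ℝ] ℝ :=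
  if h : κ r ∈ nbhd hκ y₀ then
    if κ r ∈ (AY.chart y₀).source then
      χ (AY.chart y₀ (κ r)) • affineEval (idx hκ y₀ r h) (AY.chart y₀ (κ r))
    else 0
  else 0

lemma localPerturbation_of_mem_sheet {y₀ : Y} {χ : AY.V y₀ → ℝ} {i : κ ⁻¹' {y₀}} {r : R}
    (hr : r ∈ sheet hκ y₀ i) (hr' : κ r ∈ (AY.chart y₀).source) :
    localPerturbation hκ AY y₀ χ r =
      χ (AY.chart y₀ (κ r)) • affineEval i (AY.chart y₀ (κ r)) := by
  obtain ⟨h, rfl⟩ := hr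
  rw [localPerturbation, dif_pos h, if_pos hr']

/-- Locally, a function on the total space of a covering can be made regular by a small
perturbation, preserving regularity on a given compact set. -/
lemma exists_regular_local [T2Space Y] (y₀ : Y) : ∃ C D : Set Y, C ∈ 𝓝 y₀ ∧ IsCompact C ∧ IsCompact D ∧
    ∀ s : R → ℝ, (∀ r, SmoothAt (AY.comap hκ.isLocalHomeomorph) (model ℝ) s r) →
    ∀ K : Set Y, IsCompact K → (∀ y ∈ K, Regular AY κ s y) →
    ∃ s' : R → ℝ, (∀ r, SmoothAt (AY.comap hκ.isLocalHomeomorph) (model ℝ) s' r) ∧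
      (∀ r, κ r ∉ D → s' r = s r) ∧ ∀ y ∈ K ∪ C, Regular AY κ s' y := by
  set φ := AY.chart y₀ with hφ
  have hn := mem_nbhd hκ y₀
  have hy := AY.mem_source y₀
  have hT : φ.target ∩ φ.symm ⁻¹' nbhd hκ y₀ ∈ 𝓝 (φ y₀) :=
    (φ.isOpen_inter_preimage_symm (isOpen_nbhd hκ y₀)).mem_nhds
      ⟨φ.map_source hy, by rwa [mem_preimage, φ.left_inv hy]⟩
  obtain ⟨ρ, hρ, hρT⟩ := Metric.nhds_basis_closedBall.mem_iff.1 hT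
  let χ : ContDiffBump (φ y₀) := ⟨ρ / 2, ρ, by positivity, by linarith⟩
  have hcomp {a : ℝ} (ha : a ≤ ρ) : IsCompact (φ.symm '' Metric.closedBall (φ y₀) a) :=
    (isCompact_closedBall _ _).image_of_continuousOn (φ.continuousOn_symm.mono fun v hv =>
      (hρT (Metric.closedBall_subset_closedBall ha hv)).1)
  set D := φ.symm '' Metric.closedBall (φ y₀) ρ with hD
  let g : R → _ := localPerturbation hκ AY y₀ χ
  have hg0 (r) (hr : κ r ∉ D) : g r = 0 := by
    change localPerturbation hκ AY y₀ χ r = 0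
    rw [localPerturbation]
    split_ifs with h1 h2
    · rw [χ.zero_of_le_dist, zero_smul]
      by_contra hlt
      exact hr ⟨_, (not_le.1 hlt).le, φ.left_inv h2⟩
    · rfl
    · rfl
  have hg (r) : SmoothAt (AY.comap hκ.isLocalHomeomorph) (model _) g r := by
    by_cases hr : κ r ∈ D
    · obtain ⟨v, hv, hv'⟩ := hr
      have h1 : κ r ∈ nbhd hκ y₀ := hv' ▸ (hρT hv).2
      have h2 : κ r ∈ φ.source := hv' ▸ φ.map_target (hρT hv).1
      set i := idx hκ y₀ r h1
      have h3 : SmoothAt (AY.comap hκ.isLocalHomeomorph) (model _)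
          (fun r => χ (φ (κ r)) • affineEval i (φ (κ r))) r := by
        refine SmoothAt.comp (f := φ ∘ κ) (g := fun x => χ x • affineEval i x)
          (B := model _) (smoothAt_model_model_iff.2 ?_)
          (smoothAt_comap_of_comp _ (AY.smoothAt_chart h2))
        exact (contDiff_smul_affineEval χ.contDiff i).contDiffAt
      refine h3.congr ?_
      filter_upwards [(isOpen_sheet hκ y₀ i).mem_nhds (mem_sheet_idx hκ h1),
        (φ.open_source.preimage hκ.continuous).mem_nhds h2] with r' h4 h5
      exact localPerturbation_of_mem_sheet hκ h4 h5
    · refine (smoothAt_const (y := 0)).congr ?_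
      filter_upwards [((hcomp le_rfl).isClosed.isOpen_compl.preimage hκ.continuous).mem_nhds hr]
        with r' hr'
      exact hg0 r' hr'
  refine ⟨φ.symm '' Metric.closedBall (φ y₀) (ρ / 4), D, ?_, hcomp (by linarith), hcomp le_rfl,
    fun s hs K hK hsK => ?_⟩
  · have h1 := φ.symm.image_mem_nhds (x := φ y₀) (φ.map_source hy)
      (Metric.closedBall_mem_nhds (φ y₀) (show 0 < ρ / 4 by positivity))
    rwa [φ.left_inv hy] at h1
  · have h1 : ∀ᶠ π in 𝓝 (0 : κ ⁻¹' {y₀} → ℝ × (AY.V y₀ →L[ℝ] ℝ)), ∀ y ∈ K,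
        Regular AY κ (fun r => s r + g r π) y :=
      hK.eventually_forall_of_forall_eventually fun y hyK => eventually_regular hκ hs hg (hsK y hyK)
    have hball : Metric.ball (φ y₀) (ρ / 2) ⊆ φ.target ∩ φ.symm ⁻¹' nbhd hκ y₀ := fun v hv =>
      hρT (Metric.closedBall_subset_closedBall (by linarith) (Metric.ball_subset_closedBall hv))
    have hsm (i) : ContDiffOn ℝ ∞ (onSheet hκ AY s y₀ i) (Metric.ball (φ y₀) (ρ / 2)) := by
      intro v hv
      have h2 := contDiffAt_onSheet hκ (y := φ.symm v) (hball hv).2 (φ.map_target (hball hv).1) i hs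
      change ContDiffAt ℝ ∞ _ (φ (φ.symm v)) at h2
      rw [φ.right_inv (hball hv).1] at h2
      exact h2.contDiffWithinAt
    obtain ⟨π, hπ, hπK⟩ := (dense_linearIndependent Metric.isOpen_ball hsm).inter_nhds_nonempty h1
    have hsm' (r) : SmoothAt (AY.comap hκ.isLocalHomeomorph) (model ℝ) (fun r => s r + g r π) r := by
      refine SmoothAt.comp (f := fun r => (s r, g r))
        (g := fun z : ℝ × ((κ ⁻¹' {y₀} → ℝ × (AY.V y₀ →L[ℝ] ℝ)) →L[ℝ] ℝ) => z.1 + z.2 π)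
        (B := model _) (smoothAt_model_model_iff.2 ?_) (smoothAt_model_prod.1 ((hs r).prodMk (hg r)))
      fun_prop
    refine ⟨fun r => s r + g r π, hsm', fun r hr => ?_, ?_⟩
    · dsimp only
      rw [hg0 r hr, zero_apply, add_zero]
    · rintro y (hyK | ⟨v, hv, rfl⟩)
      · exact hπK y hyK
      have hvb : v ∈ Metric.ball (φ y₀) (ρ / 2) :=
        lt_of_le_of_lt (Metric.mem_closedBall.1 hv) (show ρ / 4 < ρ / 2 by linarith)
      have h2 (i) : onSheet hκ AY (fun r => s r + g r π) y₀ i =ᶠ[𝓝 v]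
          fun x => onSheet hκ AY s y₀ i x + ((π i).1 + (π i).2 x) := by
        filter_upwards [Metric.isOpen_ball.mem_nhds hvb] with x hx
        have h3 : secFun hκ y₀ i (φ.symm x) ∈ sheet hκ y₀ i := secFun_mem_sheet hκ (hball hx).2 i
        have h4 : κ (secFun hκ y₀ i (φ.symm x)) = φ.symm x := proj_secFun hκ (hball hx).2 i
        have h5 := localPerturbation_of_mem_sheet hκ (AY := AY) (χ := χ) h3
          (by rw [h4]; exact φ.map_target (hball hx).1)
        rw [h4] at h5
        change s (secFun hκ y₀ i (φ.symm x)) + g (secFun hκ y₀ i (φ.symm x)) π = _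
        change g (secFun hκ y₀ i (φ.symm x)) = χ (φ (φ.symm x)) • affineEval i (φ (φ.symm x)) at h5
        rw [h5, φ.right_inv (hball hx).1,
          χ.one_of_mem_closedBall (Metric.ball_subset_closedBall hx), one_smul]
        rfl
      refine regular_of_linearIndependent hκ hsm' (y₀ := y₀) (hball hvb).2
        (φ.map_target (hball hvb).1) fun h0 => ?_
      change LinearIndependent ℝ fun i => fderiv ℝ _ (φ (φ.symm v))
      rw [φ.right_inv (hball hvb).1]
      have h3 := hπ v hvb fun i => by
        refine (h2 i).self_of_nhds.symm.trans ?_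
        exact h0 _ (proj_secFun hκ (hball hvb).2 i)
      have h4 : (fun i => fderiv ℝ (onSheet hκ AY (fun r => s r + g r π) y₀ i) v) =
          fun i => fderiv ℝ (onSheet hκ AY s y₀ i) v + (π i).2 := by
        funext i
        rw [(h2 i).fderiv_eq]
        have h5 := (((hsm i).contDiffAt (Metric.isOpen_ball.mem_nhds hvb)).differentiableAt
          (by simp)).hasFDerivAt
        exact (h5.add ((π i).2.hasFDerivAt.const_add (π i).1)).fderiv
      rw [h4]
      exact h3

/-- A function on the total space of a covering can be made regular by a compactly supported
perturbation, if it is regular outside of a compact set. -/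
theorem exists_regular [T2Space Y] {s : R → ℝ}
    (hs : ∀ r, SmoothAt (AY.comap hκ.isLocalHomeomorph) (model ℝ) s r) {K : Set Y}
    (hK : IsCompact K) (hsK : ∀ y ∉ K, Regular AY κ s y) :
    ∃ (s' : R → ℝ) (D : Set Y), (∀ r, SmoothAt (AY.comap hκ.isLocalHomeomorph) (model ℝ) s' r) ∧
      IsCompact D ∧ (∀ r, κ r ∉ D → s' r = s r) ∧ ∀ y, Regular AY κ s' y := by
  classical
  choose C D hC hCc hDc h using exists_regular_local (AY := AY) hκ
  obtain ⟨t, -, ht⟩ := hK.elim_nhds_subcover (fun y => interior (C y))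
    fun y _ => interior_mem_nhds.2 (hC y)
  set V := ⋃ y ∈ t, interior (C y)
  have hV : IsOpen V := isOpen_biUnion fun y _ => isOpen_interior
  set K' := ⋃ y ∈ t, D y
  have hK' : IsCompact K' := t.isCompact_biUnion fun y _ => hDc y
  have key (u : Finset Y) : ∃ s' : R → ℝ,
      (∀ r, SmoothAt (AY.comap hκ.isLocalHomeomorph) (model ℝ) s' r) ∧
      (∀ r, κ r ∉ ⋃ y ∈ u, D y → s' r = s r) ∧
      ∀ y ∈ K' \ V ∪ ⋃ y ∈ u, C y, Regular AY κ s' y := by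
    induction u using Finset.induction_on with
    | empty =>
      refine ⟨s, hs, fun _ _ => rfl, fun y hy => hsK y fun hy' => ?_⟩
      simp only [Finset.notMem_empty, iUnion_of_empty, iUnion_empty, union_empty] at hy
      exact hy.2 (ht hy')
    | insert a u ha ih =>
      obtain ⟨s₁, hs₁, hD₁, hr₁⟩ := ih
      obtain ⟨s₂, hs₂, hD₂, hr₂⟩ := h a s₁ hs₁ _
        ((hK'.diff hV).union (u.isCompact_biUnion fun y _ => hCc y)) hr₁
      refine ⟨s₂, hs₂, fun r hr => ?_, fun y hy => hr₂ y ?_⟩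
      · rw [Finset.set_biUnion_insert, mem_union, not_or] at hr
        rw [hD₂ r hr.1, hD₁ r hr.2]
      · rw [Finset.set_biUnion_insert] at hy
        rcases hy with hy | hy | hy
        exacts [Or.inl (Or.inl hy), Or.inr hy, Or.inl (Or.inr hy)]
  obtain ⟨s', hs', hD', hr'⟩ := key t
  refine ⟨s', K', hs', hK', hD', fun y => ?_⟩
  by_cases hyV : y ∈ V
  · exact hr' y (Or.inr (biUnion_mono subset_rfl (fun y _ => interior_subset) hyV))
  by_cases hy : y ∈ K'
  · exact hr' y (Or.inl ⟨hy, hyV⟩)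
  · exact (hsK y fun hyK => hyV (ht hyK)).congr (hK'.isClosed.isOpen_compl.mem_nhds hy)
      fun r hr => hD' r hr

end Regular

open Charts PolySpace

attribute [local instance] Fintype.ofFinite

/-- The inverse function theorem, with a smooth inverse on all of the target. -/
lemma exists_openPartialHomeomorph {E F : Type} [NormedAddCommGroup E] [NormedSpace ℝ E]
    [FiniteDimensional ℝ E] [NormedAddCommGroup F] [NormedSpace ℝ F] [FiniteDimensional ℝ F]
    {Φ : E → F} {U : Set E} (hU : IsOpen U) (hΦ : ContDiffOn ℝ ∞ Φ U) {x : E} (hx : x ∈ U)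
    (hinj : Function.Injective (fderiv ℝ Φ x))
    (hdim : Module.finrank ℝ E = Module.finrank ℝ F) :
    ∃ ψ : OpenPartialHomeomorph E F, x ∈ ψ.source ∧ ψ.source ⊆ U ∧ (∀ y, ψ y = Φ y) ∧
      ∀ w ∈ ψ.target, ContDiffAt ℝ ∞ ψ.symm w := by
  have : CompleteSpace E := FiniteDimensional.complete ℝ E
  let e : E ≃L[ℝ] F :=
    (LinearEquiv.ofInjectiveOfFinrankEq (fderiv ℝ Φ x : E →ₗ[ℝ] F) hinj hdim).toContinuousLinearEquiv
  have he : (e : E →L[ℝ] F) = fderiv ℝ Φ x := ContinuousLinearMap.ext fun y => rfl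
  have hΦ' {y} (hy : y ∈ U) : ContDiffAt ℝ ∞ Φ y := hΦ.contDiffAt (hU.mem_nhds hy)
  have hd {y} (hy : y ∈ U) : HasFDerivAt Φ (fderiv ℝ Φ y) y :=
    ((hΦ' hy).differentiableAt (by simp)).hasFDerivAt
  have hV : IsOpen (U ∩ fderiv ℝ Φ ⁻¹' range ((↑) : (E ≃L[ℝ] F) → E →L[ℝ] F)) :=
    ((hΦ.fderiv_of_isOpen hU (m := 0) (by simp)).continuousOn).isOpen_inter_preimage hU
      ContinuousLinearEquiv.isOpen
  let ψ := (hΦ' hx).toOpenPartialHomeomorph Φ (he ▸ hd hx) (by simp)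
  refine ⟨ψ.restrOpen _ hV, ⟨(hΦ' hx).mem_toOpenPartialHomeomorph_source _ _, hx, e, he⟩,
    fun y hy => hy.2.1, fun y => rfl, fun w hw => ?_⟩
  have h1 := (ψ.restrOpen _ hV).map_target hw
  obtain ⟨h2, h3, e', he'⟩ := h1
  exact (ψ.restrOpen _ hV).contDiffAt_symm (f₀' := e') hw (he' ▸ hd h3) (hΦ' h3)

section

variable {R Y : Type} [TopologicalSpace R] [TopologicalSpace Y] {κ : R → Y}
  (hκ : IsCoveringMap κ) [∀ y, Finite (κ ⁻¹' {y})] {dY : Y → ℕ} {AY : Charts Y dY} {s : R → ℝ}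

/-- The points of the base of a covering over which a function on the total space vanishes. -/
def zeroSet (κ : R → Y) (s : R → ℝ) : Set Y := {y | ∀ r, κ r = y → s r = 0}

/-- The dimension of the zero set of a regular function. -/
def zeroDim (dY : Y → ℕ) (κ : R → Y) (s : R → ℝ) (z : zeroSet κ s) : ℕ :=
  dY z.1 - Nat.card (κ ⁻¹' {z.1})

include hκ in
lemma isClosed_zeroSet [T2Space Y] (hs : Continuous s) : IsClosed (zeroSet κ s) := by
  have : (zeroSet κ s)ᶜ = κ '' {r | s r ≠ 0} := by
    ext y
    simp only [zeroSet, mem_compl_iff, mem_ofPred_eq, not_forall, mem_image]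
    exact exists_congr fun r => ⟨fun ⟨h, h'⟩ => ⟨h', h⟩, fun ⟨h, h'⟩ => ⟨h', h⟩⟩
  rw [← isOpen_compl_iff, this]
  exact hκ.isOpenMap _ (isOpen_ne_fun hs continuous_const)

lemma exists_slice (hs : ∀ r, SmoothAt (AY.comap hκ.isLocalHomeomorph) (model ℝ) s r)
    (hr : ∀ y, Regular AY κ s y) (z : zeroSet κ s) :
    ∃ Ψ : OpenPartialHomeomorph Y
        ((κ ⁻¹' {z.1} → ℝ) × EuclideanSpace ℝ (Fin (zeroDim dY κ s z))),
      z.1 ∈ Ψ.source ∧ (∀ y ∈ Ψ.source, SmoothAt AY (model _) Ψ y) ∧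
      (∀ w ∈ Ψ.target, SmoothAt (model _) AY Ψ.symm w) ∧
      (∀ y ∈ Ψ.source, y ∈ zeroSet κ s ↔ (Ψ y).1 = 0) ∧
      ∀ y (hy : y ∈ zeroSet κ s), y ∈ Ψ.source → zeroDim dY κ s ⟨y, hy⟩ = zeroDim dY κ s z := by
  obtain ⟨z, hz⟩ := z
  set φ := AY.chart z with hφ
  have hn := mem_nbhd hκ z
  have hm := AY.mem_source z
  set Γ : AY.V z → κ ⁻¹' {z} → ℝ := fun x i => onSheet hκ AY s z i x with hΓ
  set U := φ.target ∩ φ.symm ⁻¹' nbhd hκ z with hU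
  have hUo : IsOpen U := φ.isOpen_inter_preimage_symm (isOpen_nbhd hκ z)
  have hzU : φ z ∈ U := ⟨φ.map_source hm, by rwa [mem_preimage, φ.left_inv hm]⟩
  have hsm (i) {v} (hv : v ∈ U) : ContDiffAt ℝ ∞ (onSheet hκ AY s z i) v := by
    have h2 := contDiffAt_onSheet hκ (y := φ.symm v) hv.2 (φ.map_target hv.1) i hs
    change ContDiffAt ℝ ∞ _ (φ (φ.symm v)) at h2
    rwa [φ.right_inv hv.1] at h2
  have hli := linearIndependent_of_regular hκ hs hn hm (hr z) hz
  obtain ⟨M, hM⟩ := exists_rightInverse_of_linearIndependent hli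
  let L : AY.V z →L[ℝ] κ ⁻¹' {z} → ℝ :=
    ContinuousLinearMap.pi fun i => fderiv ℝ (onSheet hκ AY s z i) (φ z)
  have hLM (c) : L (M c) = c := funext (hM c)
  have hLr : (L : AY.V z →ₗ[ℝ] κ ⁻¹' {z} → ℝ).range = ⊤ :=
    LinearMap.range_eq_top.2 fun c => ⟨M c, hLM c⟩
  have hcard : Module.finrank ℝ (κ ⁻¹' {z} → ℝ) = Nat.card (κ ⁻¹' {z}) := by
    rw [Module.finrank_fintype_fun_eq_card, Nat.card_eq_fintype_card]
  have hK := (L : AY.V z →ₗ[ℝ] κ ⁻¹' {z} → ℝ).finrank_range_add_finrank_ker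
  rw [hLr, finrank_top, hcard, AY.finrank_eq] at hK
  have hK' : Module.finrank ℝ (L : AY.V z →ₗ[ℝ] κ ⁻¹' {z} → ℝ).ker =
      Module.finrank ℝ (EuclideanSpace ℝ (Fin (zeroDim dY κ s ⟨z, hz⟩))) := by
    rw [finrank_euclideanSpace_fin, zeroDim]
    dsimp only
    omega
  let e := LinearEquiv.ofFinrankEq _ _ hK'
  let N : AY.V z →ₗ[ℝ] EuclideanSpace ℝ (Fin (zeroDim dY κ s ⟨z, hz⟩)) :=
    e.toLinearMap.comp (LinearMap.codRestrict _
      (LinearMap.id - (M : (κ ⁻¹' {z} → ℝ) →ₗ[ℝ] AY.V z).comp (L : AY.V z →ₗ[ℝ] κ ⁻¹' {z} → ℝ))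
      fun x => by
        change L (x - M (L x)) = 0
        rw [map_sub, hLM, sub_self])
  let N' := N.toContinuousLinearMap
  have hN (x) (h1 : L x = 0) (h2 : N' x = 0) : x = 0 := by
    have h3 := congrArg Subtype.val (e.injective (h2.trans (map_zero e).symm))
    change x - M (L x) = 0 at h3
    rwa [h1, map_zero, sub_zero] at h3
  have hd : HasFDerivAt (fun x => (Γ x, N' x)) (L.prod N') (φ z) := by
    refine HasFDerivAt.prodMk (hasFDerivAt_pi.2 fun i => ?_) N'.hasFDerivAt
    exact ((hsm i hzU).differentiableAt (by simp)).hasFDerivAt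
  obtain ⟨ψ, hψz, hψU, hψ, hψ'⟩ := exists_openPartialHomeomorph (Φ := fun x => (Γ x, N' x)) hUo
    (fun v hv => ((contDiffAt_pi.2 fun i => hsm i hv).prodMk
      N'.contDiff.contDiffAt).contDiffWithinAt) hzU (by
      rw [hd.fderiv]
      refine (injective_iff_map_eq_zero _).2 fun x hx => ?_
      exact hN x (congrArg Prod.fst hx) (congrArg Prod.snd hx)) (by
      rw [Module.finrank_prod, hcard, finrank_euclideanSpace_fin, AY.finrank_eq, zeroDim]
      dsimp only
      omega)
  refine ⟨φ ≫ₕ ψ, ⟨hm, hψz⟩, fun y hy => ?_, fun w hw => ?_, fun y hy => ?_, fun y hyZ hy => ?_⟩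
  · refine SmoothAt.comp (f := φ) (g := ψ) (B := model _) (smoothAt_model_model_iff.2 ?_)
      (AY.smoothAt_chart hy.1)
    rw [show (ψ : AY.V z → _) = fun x => (Γ x, N' x) from funext hψ]
    exact (contDiffAt_pi.2 fun i => hsm i (hψU hy.2)).prodMk N'.contDiff.contDiffAt
  · rw [OpenPartialHomeomorph.trans_target] at hw
    exact SmoothAt.comp (g := φ.symm) (f := ψ.symm) (B := model _) (AY.smoothAt_chart_symm hw.2)
      (smoothAt_model_model_iff.2 (hψ' w hw.1))
  · have h1 : y ∈ nbhd hκ z := by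
      have h0 : φ y ∈ U := hψU hy.2
      have := h0.2
      rwa [mem_preimage, φ.left_inv hy.1] at this
    have h2 : ((φ ≫ₕ ψ) y).1 = fun i => s (secFun hκ z i y) := by
      change (ψ (φ y)).1 = _
      rw [hψ]
      exact funext fun i => onSheet_chart hκ hy.1 i
    rw [h2]
    constructor
    · exact fun h => funext fun i => h _ (proj_secFun hκ h1 i)
    · rintro h r rfl
      rw [eq_secFun hκ (mem_sheet_idx hκ h1)]
      exact congrFun h _
  · have h1 : y ∈ nbhd hκ z := by
      have h0 : φ y ∈ U := hψU hy.2
      have := h0.2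
      rwa [mem_preimage, φ.left_inv hy.1] at this
    rw [zeroDim, zeroDim, AY.dim_eq z y hy.1, Nat.card_congr (secEquiv hκ z h1)]

variable (hs : ∀ r, SmoothAt (AY.comap hκ.isLocalHomeomorph) (model ℝ) s r)
  (hr : ∀ y, Regular AY κ s y)

/-- A chart of the base in which the zero set is a linear subspace. -/
def slice (z : zeroSet κ s) : OpenPartialHomeomorph Y
    ((κ ⁻¹' {z.1} → ℝ) × EuclideanSpace ℝ (Fin (zeroDim dY κ s z))) :=
  (exists_slice hκ hs hr z).choose

open Classical in
/-- A chart of the zero set of a regular function. -/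
def zeroChart (z : zeroSet κ s) :
    OpenPartialHomeomorph (zeroSet κ s) (EuclideanSpace ℝ (Fin (zeroDim dY κ s z))) :=
  have h := (exists_slice hκ hs hr z).choose_spec
  have hmem {v} (hv : ((0 : κ ⁻¹' {z.1} → ℝ), v) ∈ (slice hκ hs hr z).target) :
      (slice hκ hs hr z).symm (0, v) ∈ zeroSet κ s :=
    (h.2.2.2.1 _ ((slice hκ hs hr z).map_target hv)).2
      (congrArg Prod.fst ((slice hκ hs hr z).right_inv hv))
  { toFun := fun y => (slice hκ hs hr z y.1).2
    invFun := fun v => if hv : (0, v) ∈ (slice hκ hs hr z).target then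
      ⟨(slice hκ hs hr z).symm (0, v), hmem hv⟩ else z
    source := Subtype.val ⁻¹' (slice hκ hs hr z).source
    target := {v | (0, v) ∈ (slice hκ hs hr z).target}
    map_source' := fun y hy => by
      have h1 : slice hκ hs hr z y.1 = (0, (slice hκ hs hr z y.1).2) :=
        Prod.ext ((h.2.2.2.1 _ hy).1 y.2) rfl
      rw [mem_ofPred_eq, ← h1]
      exact (slice hκ hs hr z).map_source hy
    map_target' := fun v (hv : (0, v) ∈ (slice hκ hs hr z).target) => by
      rw [dif_pos hv]
      exact (slice hκ hs hr z).map_target hv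
    left_inv' := fun y hy => by
      have h1 : slice hκ hs hr z y.1 = (0, (slice hκ hs hr z y.1).2) :=
        Prod.ext ((h.2.2.2.1 _ hy).1 y.2) rfl
      have h2 := (slice hκ hs hr z).map_source hy
      rw [h1] at h2
      refine (dif_pos h2).trans (Subtype.ext ?_)
      dsimp only
      rw [← h1]
      exact (slice hκ hs hr z).left_inv hy
    right_inv' := fun v (hv : (0, v) ∈ (slice hκ hs hr z).target) => by
      rw [dif_pos hv]
      exact congrArg Prod.snd ((slice hκ hs hr z).right_inv hv)
    open_source := (slice hκ hs hr z).open_source.preimage continuous_subtype_val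
    open_target := (slice hκ hs hr z).open_target.preimage (by fun_prop)
    continuousOn_toFun := continuous_snd.comp_continuousOn
      ((slice hκ hs hr z).continuousOn.comp continuous_subtype_val.continuousOn fun _ h => h)
    continuousOn_invFun := by
      refine IsInducing.subtypeVal.continuousOn_iff.2 ?_
      refine ((slice hκ hs hr z).continuousOn_symm.comp (f := fun v => (0, v))
        (s := {v | (0, v) ∈ (slice hκ hs hr z).target}) (by fun_prop) fun v hv => hv).congr ?_
      intro v hv
      exact congrArg Subtype.val (dif_pos hv) }

lemma zeroChart_symm_apply (z : zeroSet κ s) {v} (hv : v ∈ (zeroChart hκ hs hr z).target) :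
    ((zeroChart hκ hs hr z).symm v).1 = (slice hκ hs hr z).symm (0, v) :=
  congrArg Subtype.val (dif_pos hv)

lemma smoothAt_zeroChart_symm (z : zeroSet κ s) {v} (hv : v ∈ (zeroChart hκ hs hr z).target) :
    SmoothAt (model _) AY (fun v => ((zeroChart hκ hs hr z).symm v).1) v := by
  have h := (exists_slice hκ hs hr z).choose_spec
  have h1 : SmoothAt (model _) AY (fun v => (slice hκ hs hr z).symm (0, v)) v :=
    SmoothAt.comp (f := fun v => ((0 : κ ⁻¹' {z.1} → ℝ), v)) (h.2.2.1 _ hv)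
      (smoothAt_model_model_iff.2 (by fun_prop))
  refine h1.congr ?_
  filter_upwards [(zeroChart hκ hs hr z).open_target.mem_nhds hv] with v hv
  exact zeroChart_symm_apply hκ hs hr z hv

lemma smoothAt_slice_snd (z : zeroSet κ s) {y : Y} (hy : y ∈ (slice hκ hs hr z).source) :
    SmoothAt AY (model _) (fun y => (slice hκ hs hr z y).2) y :=
  SmoothAt.comp (g := Prod.snd) (B := model _) (smoothAt_model_model_iff.2 contDiffAt_snd)
    ((exists_slice hκ hs hr z).choose_spec.2.1 y hy)

/-- The zero set of a regular function is a manifold. -/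
def zeroCharts : Charts (zeroSet κ s) (zeroDim dY κ s) where
  V z := EuclideanSpace ℝ (Fin (zeroDim dY κ s z))
  finrank_eq z := finrank_euclideanSpace_fin
  chart z := zeroChart hκ hs hr z
  mem_source z := (exists_slice hκ hs hr z).choose_spec.1
  dim_eq z y hy := (exists_slice hκ hs hr z).choose_spec.2.2.2.2 y.1 y.2 hy
  contDiffOn z z' v hv := (smoothAt_model_model_iff.1 (SmoothAt.comp
    (f := fun v => ((zeroChart hκ hs hr z).symm v).1)
    (g := fun y => (slice hκ hs hr z' y).2) (smoothAt_slice_snd hκ hs hr z' hv.2)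
      (smoothAt_zeroChart_symm hκ hs hr z hv.1))).contDiffWithinAt

lemma smoothAt_zeroCharts_val (z : zeroSet κ s) :
    SmoothAt (zeroCharts hκ hs hr) AY Subtype.val z :=
  (smoothAt_iff_comp_chart_symm ((zeroCharts hκ hs hr).mem_source z)).2
    (smoothAt_zeroChart_symm hκ hs hr z
      ((zeroChart hκ hs hr z).map_source ((zeroCharts hκ hs hr).mem_source z)))

lemma smoothAt_zeroCharts_iff {W : Type} [TopologicalSpace W] {dW : W → ℕ} {AW : Charts W dW}
    {f : W → zeroSet κ s} {w : W} :
    SmoothAt AW (zeroCharts hκ hs hr) f w ↔ SmoothAt AW AY (fun w => (f w).1) w := by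
  refine ⟨fun h => SmoothAt.comp (g := Subtype.val) (smoothAt_zeroCharts_val hκ hs hr _) h,
    fun h => ?_⟩
  have hm := (zeroCharts hκ hs hr).mem_source (f w)
  refine (smoothAt_iff_comp_chart (IsInducing.subtypeVal.continuousAt_iff.2 h.1) hm).2 ?_
  exact SmoothAt.comp (f := fun w => (f w).1) (g := fun y => (slice hκ hs hr (f w) y).2)
    (smoothAt_slice_snd hκ hs hr (f w) hm) h

end

open Charts PolySpace

/-- A cylindrical end of a manifold, together with a covering. -/
structure CoveredEnd {X S N T : Type} [TopologicalSpace X] [TopologicalSpace S]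
    [TopologicalSpace N] [TopologicalSpace T] {dX : X → ℕ} {dN : N → ℕ} (A : Charts X dX)
    (P : S → X) (AN : Charts N dN) (π : T → N) where
  e : N × ℝ → X
  isOpenEmbedding : IsOpenEmbedding e
  smooth_e : ∀ z, SmoothAt (AN.prod (model ℝ)) A e z
  smooth_inv : ∀ z, ∃ ρ : X → N × ℝ, SmoothAt A (AN.prod (model ℝ)) ρ (e z) ∧
    ∀ᶠ z' in 𝓝 z, ρ (e z') = z'
  lift : T × ℝ → S
  continuous_lift : Continuous lift
  injective_lift : Function.Injective lift
  P_lift : ∀ z, P (lift z) = e (π z.1, z.2)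
  mem_range_lift : ∀ s, P s ∈ range e → s ∈ range lift

namespace Filling

variable {N N' T T' : Type} [TopologicalSpace N] [TopologicalSpace T] [TopologicalSpace N']
  [TopologicalSpace T'] {dN : N → ℕ} {dN' : N' → ℕ} {AN : Charts N dN} {AN' : Charts N' dN'}
  {π : T → N} {π' : T' → N'}

/-- The first end of a filling. -/
def endLeft (F : Filling (AN.sum AN') (Sum.map π π')) : CoveredEnd F.A F.P AN π where
  e z := F.e (Sum.inl z.1, z.2)
  isOpenEmbedding := F.isOpenEmbedding.comp (IsOpenEmbedding.inl.prodMap .id)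
  smooth_e z := smoothAt_sum_prod_inl.1 (F.smooth_e (Sum.inl z.1, z.2))
  smooth_inv z := by
    obtain ⟨ρ, h1, h2⟩ := F.smooth_inv (Sum.inl z.1, z.2)
    have h4 : SmoothAt ((AN.sum AN').prod (model ℝ)) (AN.prod (model ℝ))
        (Prod.map (Sum.elim id fun _ => z.1) id) (Sum.inl z.1, z.2) :=
      SmoothAt.prodMap (smoothAt_sum_inl.2 smoothAt_id) smoothAt_id
    refine ⟨_, h4.comp_of_eq h2 (h1 _), .of_forall fun z' => ?_⟩
    rw [Function.comp_apply, h1]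
    rfl
  lift z := F.lift (Sum.inl z.1, z.2)
  continuous_lift := F.continuous_lift.comp (by fun_prop)
  injective_lift z w h := by
    have := F.injective_lift h
    simpa [Prod.ext_iff] using this
  P_lift z := F.P_lift _
  mem_range_lift := by
    rintro s ⟨z, hz⟩
    obtain ⟨⟨t | t, a⟩, rfl⟩ := F.mem_range_lift s ⟨_, hz⟩
    · exact ⟨(t, a), rfl⟩
    · have := F.injective (hz.trans (F.P_lift _))
      simp at this

/-- The second end of a filling. -/
def endRight (F : Filling (AN.sum AN') (Sum.map π π')) : CoveredEnd F.A F.P AN' π' where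
  e z := F.e (Sum.inr z.1, z.2)
  isOpenEmbedding := F.isOpenEmbedding.comp (IsOpenEmbedding.inr.prodMap .id)
  smooth_e z := smoothAt_sum_prod_inr.1 (F.smooth_e (Sum.inr z.1, z.2))
  smooth_inv z := by
    obtain ⟨ρ, h1, h2⟩ := F.smooth_inv (Sum.inr z.1, z.2)
    have h4 : SmoothAt ((AN.sum AN').prod (model ℝ)) (AN'.prod (model ℝ))
        (Prod.map (Sum.elim (fun _ => z.1) id) id) (Sum.inr z.1, z.2) :=
      SmoothAt.prodMap (smoothAt_sum_inr.2 smoothAt_id) smoothAt_id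
    refine ⟨_, h4.comp_of_eq h2 (h1 _), .of_forall fun z' => ?_⟩
    rw [Function.comp_apply, h1]
    rfl
  lift z := F.lift (Sum.inr z.1, z.2)
  continuous_lift := F.continuous_lift.comp (by fun_prop)
  injective_lift z w h := by
    have := F.injective_lift h
    simpa [Prod.ext_iff] using this
  P_lift z := F.P_lift _
  mem_range_lift := by
    rintro s ⟨z, hz⟩
    obtain ⟨⟨t | t, a⟩, rfl⟩ := F.mem_range_lift s ⟨_, hz⟩
    · have := F.injective (hz.trans (F.P_lift _))
      simp at this
    · exact ⟨(t, a), rfl⟩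

/-- A filling is given by two disjoint ends. -/
def ofEnds {X S : Type} [TopologicalSpace X] [T2Space X] [TopologicalSpace S] {dX : X → ℕ}
    {A : Charts X dX} {P : S → X} (hP : FiniteCovering P) (E : CoveredEnd A P AN π)
    (E' : CoveredEnd A P AN' π') (hd : ∀ z w, E.e z ≠ E'.e w) (hc : IsClosed (E.e '' {z | z.2 ≤ 0}))
    (hc' : IsClosed (E'.e '' {z | z.2 ≤ 0}))
    (hK : IsCompact ((E.e '' {z | z.2 < 0})ᶜ ∩ (E'.e '' {z | z.2 < 0})ᶜ)) :
    Filling (AN.sum AN') (Sum.map π π') :=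
  have himage (p : ℝ → Prop) : (fun z : (N ⊕ N') × ℝ =>
      Sum.elim (fun x => E.e (x, z.2)) (fun x => E'.e (x, z.2)) z.1) '' {z | p z.2} =
        E.e '' {z | p z.2} ∪ E'.e '' {z | p z.2} := by
    ext y
    constructor
    · rintro ⟨⟨x | x, a⟩, h, rfl⟩
      exacts [Or.inl ⟨_, h, rfl⟩, Or.inr ⟨_, h, rfl⟩]
    · rintro (⟨⟨x, a⟩, h, rfl⟩ | ⟨⟨x, a⟩, h, rfl⟩)
      exacts [⟨(Sum.inl x, a), h, rfl⟩, ⟨(Sum.inr x, a), h, rfl⟩]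
  have hemb : IsOpenEmbedding (fun z : (N ⊕ N') × ℝ =>
      Sum.elim (fun x => E.e (x, z.2)) (fun x => E'.e (x, z.2)) z.1) := by
    have h1 : IsOpenEmbedding (Sum.elim E.e E'.e) := by
      refine .of_continuous_injective_isOpenMap
        (E.isOpenEmbedding.continuous.sumElim E'.isOpenEmbedding.continuous) ?_
        (IsOpenMap.sumElim E.isOpenEmbedding.isOpenMap E'.isOpenEmbedding.isOpenMap)
      exact E.isOpenEmbedding.injective.sumElim E'.isOpenEmbedding.injective hd
    convert h1.comp (Homeomorph.sumProdDistrib (X := N) (Y := N') (Z := ℝ)).isOpenEmbedding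
      using 1
    funext ⟨x, a⟩
    rcases x with x | x <;> rfl
  { X := X
    dim := _
    A := A
    S := S
    P := P
    finiteCovering := hP
    e := fun z => Sum.elim (fun x => E.e (x, z.2)) (fun x => E'.e (x, z.2)) z.1
    smooth_e := by
      rintro ⟨x | x, a⟩
      · exact smoothAt_sum_prod_inl.2 (E.smooth_e (x, a))
      · exact smoothAt_sum_prod_inr.2 (E'.smooth_e (x, a))
    smooth_inv := by
      rintro ⟨x | x, a⟩
      · obtain ⟨ρ, h1, h2⟩ := E.smooth_inv (x, a)
        refine exists_smooth_leftInverse hemb (SmoothAt.comp (g := Prod.map Sum.inl id)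
          (SmoothAt.prodMap smoothAt_inl smoothAt_id) h1) ?_
        have h3 := (IsOpenEmbedding.inl.prodMap (.id (X := ℝ))).isOpenMap.image_mem_nhds
          (Y := (N ⊕ N') × ℝ) h2
        filter_upwards [h3]
        rintro _ ⟨z, hz, rfl⟩
        exact congrArg (Prod.map Sum.inl id) hz
      · obtain ⟨ρ, h1, h2⟩ := E'.smooth_inv (x, a)
        refine exists_smooth_leftInverse hemb (SmoothAt.comp (g := Prod.map Sum.inr id)
          (SmoothAt.prodMap smoothAt_inr smoothAt_id) h1) ?_
        have h3 := (IsOpenEmbedding.inr.prodMap (.id (X := ℝ))).isOpenMap.image_mem_nhds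
          (Y := (N ⊕ N') × ℝ) h2
        filter_upwards [h3]
        rintro _ ⟨z, hz, rfl⟩
        exact congrArg (Prod.map Sum.inr id) hz
    isOpen_range := hemb.isOpen_range
    isClosed_end := by
      rw [himage (· ≤ 0)]
      exact hc.union hc'
    isCompact_core := by
      rw [himage (· < 0), compl_union]
      exact hK
    lift := fun z => Sum.elim (fun x => E.lift (x, z.2)) (fun x => E'.lift (x, z.2)) z.1
    continuous_lift := continuous_sum_prod E.continuous_lift E'.continuous_lift
    injective_lift := by
      rintro ⟨t | t, a⟩ ⟨t' | t', a'⟩ h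
      · have := E.injective_lift h
        simpa [Prod.ext_iff] using this
      · exact (hd _ _ ((E.P_lift _).symm.trans ((congrArg P h).trans (E'.P_lift _)))).elim
      · exact (hd _ _ ((E.P_lift _).symm.trans ((congrArg P h.symm).trans (E'.P_lift _)))).elim
      · have := E'.injective_lift h
        simpa [Prod.ext_iff] using this
    P_lift := by
      rintro ⟨t | t, a⟩
      · exact E.P_lift _
      · exact E'.P_lift _
    mem_range_lift := by
      rintro s ⟨⟨x | x, a⟩, h⟩
      · obtain ⟨⟨t, a⟩, rfl⟩ := E.mem_range_lift s ⟨_, h⟩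
        exact ⟨(Sum.inl t, a), rfl⟩
      · obtain ⟨⟨t, a⟩, rfl⟩ := E'.mem_range_lift s ⟨_, h⟩
        exact ⟨(Sum.inr t, a), rfl⟩ }

/-- A smooth function which is the identity for `t ≤ -2` and vanishes for `t ≥ -1`. -/
def cutoff (t : ℝ) : ℝ := t * (1 - Real.smoothTransition (t + 2))

lemma contDiff_cutoff : ContDiff ℝ ∞ cutoff :=
  contDiff_id.mul (contDiff_const.sub (Real.smoothTransition.contDiff.comp
    (contDiff_id.add contDiff_const)))

lemma cutoff_of_le {t : ℝ} (h : t ≤ -2) : cutoff t = t := by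
  rw [cutoff, Real.smoothTransition.zero_of_nonpos (by linarith)]
  ring

lemma cutoff_of_ge {t : ℝ} (h : -1 ≤ t) : cutoff t = 0 := by
  rw [cutoff, Real.smoothTransition.one_of_one_le (by linarith)]
  ring

lemma cutoff_nonpos (t : ℝ) : cutoff t ≤ 0 := by
  rcases le_total (-1) t with h | h
  · exact (cutoff_of_ge h).le
  · exact mul_nonpos_of_nonpos_of_nonneg (by linarith)
      (by linarith [Real.smoothTransition.le_one (t + 2)])

lemma cutoff_of_lt {t : ℝ} (h : cutoff t < -2) : cutoff t = t := by
  rcases le_total t (-2) with h1 | h1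
  · exact cutoff_of_le h1
  rcases le_total (-1) t with h2 | h2
  · rw [cutoff_of_ge h2] at h
    linarith
  · have := Real.smoothTransition.nonneg (t + 2)
    rw [cutoff] at h
    nlinarith

open Classical in
/-- A function on a filling with two ends, tending to `-∞` at the first end and to `+∞` at the
second one. -/
def height (F : Filling (AN.sum AN') (Sum.map π π')) : F.X → ℝ :=
  Function.extend F.e (fun z => Sum.elim (fun _ => cutoff z.2) (fun _ => -cutoff z.2) z.1) 0

variable (F : Filling (AN.sum AN') (Sum.map π π'))

lemma height_inl (x : N) (t : ℝ) : F.height (F.e (Sum.inl x, t)) = cutoff t :=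
  F.injective.extend_apply _ _ _

lemma height_inr (x : N') (t : ℝ) : F.height (F.e (Sum.inr x, t)) = -cutoff t :=
  F.injective.extend_apply _ _ _

lemma height_of_notMem {x : F.X} (hx : x ∉ F.e '' {z | z.2 ≤ 0}) : F.height x = 0 := by
  by_cases h : x ∈ range F.e
  · obtain ⟨⟨z | z, a⟩, rfl⟩ := h
    · have ha : 0 < a := not_le.1 fun ha => hx ⟨_, ha, rfl⟩
      rw [height_inl, cutoff_of_ge (by linarith)]
    · have ha : 0 < a := not_le.1 fun ha => hx ⟨_, ha, rfl⟩
      rw [height_inr, cutoff_of_ge (by linarith), neg_zero]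
  · exact Function.extend_apply' _ _ _ h

lemma smoothAt_height (x : F.X) : SmoothAt F.A (model ℝ) F.height x := by
  by_cases hx : x ∈ F.e '' {z | z.2 ≤ 0}
  · obtain ⟨z, -, rfl⟩ := hx
    obtain ⟨ρ, h1, h2⟩ := F.smooth_inv z
    have h3 : SmoothAt ((AN.sum AN').prod (model ℝ)) (model ℝ) (F.height ∘ F.e) z := by
      rcases z with ⟨x | x, a⟩
      · refine smoothAt_sum_prod_inl.2 ?_
        simp only [Function.comp_apply, height_inl]
        exact SmoothAt.comp (g := cutoff) (smoothAt_model_model_iff.2 contDiff_cutoff.contDiffAt)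
          smoothAt_snd
      · refine smoothAt_sum_prod_inr.2 ?_
        simp only [Function.comp_apply, height_inr]
        exact SmoothAt.comp (g := fun a => -cutoff a) (B := model ℝ)
          (smoothAt_model_model_iff.2 contDiff_cutoff.neg.contDiffAt) smoothAt_snd
    refine (h3.comp_of_eq h2 (h1 z)).congr ?_
    filter_upwards [F.isOpen_range.mem_nhds (mem_range_self z)]
    rintro _ ⟨y, rfl⟩
    simp [h1 y]
  · refine (smoothAt_const (y := 0)).congr ?_
    filter_upwards [F.isClosed_end.isOpen_compl.mem_nhds hx] with y hy
    exact F.height_of_notMem hy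

lemma eq_of_height_lt {x : F.X} (h : F.height x < -2) : ∃ y, x = F.e (Sum.inl y, F.height x) := by
  by_cases hx : x ∈ F.e '' {z | z.2 ≤ 0}
  · obtain ⟨⟨z | z, a⟩, -, rfl⟩ := hx
    · rw [height_inl] at h ⊢
      exact ⟨z, by rw [cutoff_of_lt h]⟩
    · rw [height_inr] at h
      linarith [cutoff_nonpos a]
  · rw [F.height_of_notMem hx] at h
    norm_num at h

lemma eq_of_lt_height {x : F.X} (h : 2 < F.height x) : ∃ y, x = F.e (Sum.inr y, -F.height x) := by
  by_cases hx : x ∈ F.e '' {z | z.2 ≤ 0}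
  · obtain ⟨⟨z | z, a⟩, -, rfl⟩ := hx
    · rw [height_inl] at h
      linarith [cutoff_nonpos a]
    · rw [height_inr] at h ⊢
      exact ⟨z, by rw [neg_neg, cutoff_of_lt (by linarith)]⟩
  · rw [F.height_of_notMem hx] at h
    norm_num at h

lemma isCompact_height_le [CompactSpace N] [CompactSpace N'] (M : ℝ) :
    IsCompact {x | |F.height x| ≤ M} := by
  have hcont : Continuous F.height := continuous_iff_continuousAt.2 fun x => (F.smoothAt_height x).1
  have h1 : IsCompact (F.e '' (univ ×ˢ Icc (-max M 2) 0)) :=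
    (isCompact_univ.prod isCompact_Icc).image F.isOpenEmbedding.continuous
  refine (F.isCompact_core.union h1).of_isClosed_subset (isClosed_le hcont.abs continuous_const) ?_
  intro x hx
  by_cases hxc : x ∈ (F.e '' {z | z.2 < 0})ᶜ
  · exact Or.inl hxc
  rw [notMem_compl_iff] at hxc
  obtain ⟨⟨z, a⟩, ha, rfl⟩ := hxc
  refine Or.inr ⟨(z, a), ⟨mem_univ _, ?_, le_of_lt ha⟩, rfl⟩
  by_contra hlt
  have hlt : a < -max M 2 := not_le.1 hlt
  have h2 : cutoff a = a := cutoff_of_le (by linarith [le_max_right M 2])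
  have h3 : |F.height (F.e (z, a))| = -a := by
    rcases z with z | z
    · rw [height_inl, h2, abs_of_neg (by linarith [le_max_right M 2])]
    · rw [height_inr, h2, abs_of_pos (by linarith [le_max_right M 2])]
  have h4 : |F.height (F.e (z, a))| ≤ M := hx
  linarith [le_max_left M 2]

end Filling

open Charts ClosedCovering

attribute [local instance] Fintype.ofFinite

lemma eventually_eq_of_proj_eq {T B : Type} [TopologicalSpace T] [TopologicalSpace B] {p : T → B}
    (hp : IsLocalHomeomorph p) (t : T) : ∀ᶠ t' in 𝓝 t, p t' = p t → t' = t := by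
  obtain ⟨e, he, rfl⟩ := hp t
  filter_upwards [e.open_source.mem_nhds he] with t' ht' h
  exact e.injOn ht' he h

namespace PolySpace

section

variable {T B X : Type} [TopologicalSpace T] [TopologicalSpace B] [TopologicalSpace X] (p : T → B)

/-- The covering of `p(X) × ℝ` induced by the covering `p`. -/
def evalProj (X : Type) (z : Function.Pullback (base : PolySpace p X → B) p × ℝ) :
    PolySpace p X × ℝ := (z.1.fst, z.2)

/-- The difference of a function on `X`, evaluated at the points of a family, and the last
coordinate. -/
def evalFun (f : X → ℝ) (z : Function.Pullback (base : PolySpace p X → B) p × ℝ) : ℝ :=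
  f (eval z.1) - z.2

/-- The point over `(x, τ)` given by `t`. -/
def evalPoint {p : T → B} (y : PolySpace p X × ℝ) (t : p ⁻¹' {y.1.base}) :
    evalProj p X ⁻¹' {y} := ⟨(⟨(y.1, t.1), t.2.symm⟩, y.2), rfl⟩

lemma exists_evalPoint {p : T → B} {y : PolySpace p X × ℝ} (r : evalProj p X ⁻¹' {y}) :
    ∃ t, r = evalPoint y t := by
  obtain ⟨⟨⟨⟨x, t⟩, h⟩, τ⟩, rfl⟩ := r
  exact ⟨⟨t, h.symm⟩, rfl⟩

instance [∀ b, Finite (p ⁻¹' {b})] (y : PolySpace p X × ℝ) : Finite (evalProj p X ⁻¹' {y}) :=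
  Finite.of_surjective (evalPoint y) fun r => (exists_evalPoint r).imp fun _ h => h.symm

variable {p}

lemma finiteCovering_evalProj [T2Space B] [T2Space X] (hp : FiniteCovering p) :
    FiniteCovering (evalProj p X) := by
  have := hp.finite_fiber
  have := t2Space (X := X) hp.isCoveringMap
  exact (hp.pullback (continuous_base (X := X) p)).prodMap .id_map

variable [∀ b, Finite (p ⁻¹' {b})] {dB : B → ℕ} {dX : X → ℕ} {AB : Charts B dB}
  {AX : Charts X dX} {f : X → ℝ}

lemma smoothAt_evalFun (hp : IsCoveringMap p) (hκ : IsLocalHomeomorph (evalProj p X))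
    (hf : ∀ x, SmoothAt AX (model ℝ) f x) (z) :
    SmoothAt (((charts hp AB AX).prod (model ℝ)).comap hκ) (model ℝ) (evalFun p f) z := by
  obtain ⟨⟨⟨x, t⟩, h⟩, τ⟩ := z
  obtain ⟨g, hg, hge⟩ := exists_smoothAt_eval hp (A := AB) (D := AX) x t h.symm
  have h1 : SmoothAt ((charts hp AB AX).prod (model ℝ)) (model ℝ)
      (fun y : PolySpace p X × ℝ => f (g y.1) - y.2) (x, τ) := by
    have h2 : SmoothAt ((charts hp AB AX).prod (model ℝ)) ((model ℝ).prod (model ℝ))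
        (fun y : PolySpace p X × ℝ => (f (g y.1), y.2)) (x, τ) :=
      ((hf _).comp (SmoothAt.comp (f := Prod.fst) hg smoothAt_fst)).prodMk smoothAt_snd
    refine SmoothAt.comp (f := fun y : PolySpace p X × ℝ => (f (g y.1), y.2)) (g := fun v : ℝ × ℝ => v.1 - v.2)
      (B := model _) (smoothAt_model_model_iff.2 ?_) (smoothAt_model_prod.1 h2)
    fun_prop
  refine (smoothAt_comap_of_comp hκ (f := evalProj p X) (x := (⟨(x, t), h⟩, τ)) h1).congr ?_
  have hc : ContinuousAt (fun z : Function.Pullback (base : PolySpace p X → B) p × ℝ => z.1.1)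
    (⟨(x, t), h⟩, τ) := (continuous_subtype_val.comp continuous_fst).continuousAt
  filter_upwards [hc.eventually hge] with z hz
  exact congrArg (f · - z.2) (hz z.1.2.symm)

lemma regular_of_curves (hp : IsCoveringMap p) {y : PolySpace p X × ℝ}
    (γ : p ⁻¹' {y.1.base} → ℝ → X) (hγ : ∀ t, SmoothAt (model ℝ) AX (γ t) 0)
    (h0 : ∀ t, γ t 0 = y.1.map t) (hf : ∀ t, ∀ᶠ u in 𝓝 0, f (γ t u) = y.2 + u) :
    Regular ((charts hp AB AX).prod (model ℝ)) (evalProj p X) (evalFun p f) y := by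
  intro _
  refine ⟨fun c => (⟨y.1.base, fun t => γ t (c (evalPoint y t))⟩, y.2), ?_, ?_, fun r => ?_⟩
  · refine SmoothAt.prodMk ?_ smoothAt_const
    refine smoothAt_of_eval hp smoothAt_const fun t ht => ?_
    refine ⟨fun c => γ ⟨t, ht⟩ (c (evalPoint y ⟨t, ht⟩)), ?_, ?_⟩
    · refine SmoothAt.comp (f := fun c : evalProj p X ⁻¹' {y} → ℝ => c (evalPoint y ⟨t, ht⟩))
        (hγ _) (smoothAt_model_model_iff.2 (contDiff_apply ℝ ℝ _).contDiffAt)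
    · filter_upwards [continuousAt_snd.eventually
        (eventually_eq_of_proj_eq hp.isLocalHomeomorph t)] with z hz h
      obtain ⟨c, t'⟩ := z
      obtain rfl : t' = t := hz (h.trans ht.symm)
      rfl
  · exact Prod.ext (ext_of_eq rfl fun t ht _ => h0 ⟨t, ht⟩) rfl
  · obtain ⟨t, rfl⟩ := exists_evalPoint r
    have h1 : ContinuousAt (fun z : (evalProj p X ⁻¹' {y} → ℝ) ×
        (Function.Pullback (base : PolySpace p X → B) p × ℝ) => z.2.1.1.2)
          (0, (evalPoint y t).1) := by
      have : Continuous fun z : Function.Pullback (base : PolySpace p X → B) p => z.1.2 :=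
        continuous_snd.comp continuous_subtype_val
      exact (this.comp (continuous_fst.comp continuous_snd)).continuousAt
    have h2 : ContinuousAt (fun z : (evalProj p X ⁻¹' {y} → ℝ) ×
        (Function.Pullback (base : PolySpace p X → B) p × ℝ) => z.1 (evalPoint y t))
          (0, (evalPoint y t).1) := ((continuous_apply _).comp continuous_fst).continuousAt
    filter_upwards [h1.eventually (eventually_eq_of_proj_eq hp.isLocalHomeomorph t.1),
      h2.eventually (hf t)]
    rintro ⟨c, ⟨⟨x, t'⟩, ht'⟩, τ⟩ hz1 hz2 hz3
    obtain ⟨hx, hτ⟩ := Prod.ext_iff.1 hz3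
    change x = ⟨y.1.base, fun t => γ t (c (evalPoint y t))⟩ at hx
    change τ = y.2 at hτ
    subst hx hτ
    obtain rfl : t' = t.1 := hz1 (ht'.symm.trans t.2.symm)
    change f (γ t (c (evalPoint y t))) - y.2 = c (evalPoint y t)
    rw [hz2]
    ring

end

section

variable {T B X S D R : Type} [TopologicalSpace T] [TopologicalSpace B] [TopologicalSpace X]
  [TopologicalSpace S] [TopologicalSpace D] [TopologicalSpace R] {p : T → B}
  [∀ b, Finite (p ⁻¹' {b})] {dB : B → ℕ} {dX : X → ℕ} {dD : D → ℕ} {AB : Charts B dB}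
  {AX : Charts X dX} {AD : Charts D dD} {P : S → X} {q : R → D} (E : CoveredEnd AX P AD q)
  {f : X → ℝ} {ε : ℝ} (hε : ε * ε = 1)

include hε in
lemma regular_evalFun_of_lt (hp : IsCoveringMap p)
    (hE : ∀ x, ε * f x < -2 → ∃ d, x = E.e (d, ε * f x))
    (hf : ∀ d w, w ≤ -2 → f (E.e (d, w)) = ε * w) {y : PolySpace p X × ℝ} (hy : ε * y.2 < -2) :
    Regular ((charts hp AB AX).prod (model ℝ)) (evalProj p X) (evalFun p f) y := by
  intro h0
  have h1 (t) : f (y.1.map t) = y.2 :=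
    sub_eq_zero.1 (h0 (evalPoint y t).1 (evalPoint y t).2)
  choose d hd using fun t => hE (y.1.map t) (by rwa [h1])
  refine regular_of_curves hp (fun t u => E.e (d t, ε * (y.2 + u))) (fun t => ?_) (fun t => ?_)
    (fun t => ?_) h0
  · refine SmoothAt.comp (f := fun u => (d t, ε * (y.2 + u))) (E.smooth_e _)
      (smoothAt_const.prodMk (smoothAt_model_model_iff.2 ?_))
    fun_prop
  · rw [add_zero, ← h1 t]
    exact (hd t).symm
  · have hc : ContinuousAt (fun u : ℝ => ε * (y.2 + u)) 0 := by fun_prop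
    filter_upwards [hc.eventually (isOpen_Iio.mem_nhds (show _ ∈ Iio (-2 : ℝ) by simpa using hy))] with u hu
    rw [hf _ _ hu.le, ← mul_assoc, hε, one_mul]

variable {K : ℝ} (hK : 2 < K) {s : Function.Pullback (base : PolySpace p X → B) p × ℝ → ℝ}
  (hsf : ∀ z, K ≤ |z.2| → s z = evalFun p f z)

/-- The parameter of a cylindrical end. -/
def endParam (K a : ℝ) : ℝ := -K - Real.exp (-a)

lemma endParam_lt (K a : ℝ) : endParam K a < -K := by
  have := Real.exp_pos (-a)
  rw [endParam]
  linarith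

lemma injective_endParam (K : ℝ) : Function.Injective (endParam K) := fun a b h =>
  neg_injective (Real.exp_injective (sub_right_injective h))

lemma endParam_neg_log {w : ℝ} (hw : w < -K) : endParam K (-Real.log (-K - w)) = w := by
  rw [endParam, neg_neg, Real.exp_log (by linarith)]
  ring

lemma contDiff_endParam : ContDiff ℝ ∞ (endParam K) := by
  unfold endParam
  fun_prop

/-- The families of points of an end of a manifold. -/
def polyCyl (x : PolySpace p D) (w : ℝ) : PolySpace p X := ⟨x.base, fun t => E.e (x.map t, w)⟩

lemma injective_polyCyl {x x' : PolySpace p D} {w : ℝ} (h : polyCyl E x w = polyCyl E x' w) :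
    x = x' := by
  obtain ⟨b, u⟩ := x
  obtain ⟨b', u'⟩ := x'
  obtain rfl : b = b' := congrArg base h
  congr 1
  funext t
  have h1 := congrFun (eq_of_heq (PolySpace.mk.inj h).2) t
  exact congrArg Prod.fst (E.isOpenEmbedding.injective h1)

include hsf in
lemma mem_zeroSet_iff {x : PolySpace p X} {τ : ℝ} (hτ : K ≤ |τ|) :
    (x, τ) ∈ zeroSet (evalProj p X) s ↔ ∀ t, f (x.map t) = τ := by
  constructor
  · intro h t
    have h1 := h (evalPoint (x, τ) t).1 rfl
    rw [hsf _ hτ] at h1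
    exact sub_eq_zero.1 h1
  · intro h r hr
    obtain ⟨t, ht⟩ := exists_evalPoint ⟨r, hr⟩
    obtain rfl : r = (evalPoint (x, τ) t).1 := congrArg Subtype.val ht
    rw [hsf _ hτ]
    exact sub_eq_zero.2 (h t)

include hε in
lemma abs_sign_mul (w : ℝ) : |ε * w| = |w| := by
  rcases mul_self_eq_one_iff.1 hε with rfl | rfl <;> simp

include hε in
lemma sign_mul_sign_mul (w : ℝ) : ε * (ε * w) = w := by rw [← mul_assoc, hε, one_mul]

variable (hf : ∀ d w, w ≤ -2 → f (E.e (d, w)) = ε * w)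
  (hE : ∀ x, ε * f x < -2 → ∃ d, x = E.e (d, ε * f x))

/-- A cylindrical end of the zero set of a function with prescribed values for large values of the
last coordinate. -/
def endMap (z : PolySpace p D × ℝ) : zeroSet (evalProj p X) s :=
  ⟨(polyCyl E z.1 (endParam K z.2), ε * endParam K z.2), by
    have h := endParam_lt K z.2
    refine (mem_zeroSet_iff hsf ?_).2 fun t => hf _ _ (by linarith)
    rw [abs_sign_mul hε, abs_of_neg (by linarith)]
    linarith⟩

lemma injective_endMap : Function.Injective (endMap E hε hK hsf hf) := by
  intro z w h
  have h1 := congrArg (fun y => ε * y.1.2) h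
  have h2 := congrArg (fun y => y.1.1) h
  simp only [endMap, sign_mul_sign_mul hε] at h1 h2
  have h3 := injective_endParam K h1
  rw [h3] at h2
  exact Prod.ext (injective_polyCyl E h2) h3

include hE in
lemma image_endMap (Q : ℝ → Prop) : endMap E hε hK hsf hf '' {z | Q z.2} =
    {y | ε * y.1.2 < -K ∧ Q (-Real.log (-K - ε * y.1.2))} := by
  ext y
  constructor
  · rintro ⟨z, hz, rfl⟩
    simp only [endMap, mem_ofPred_eq, sign_mul_sign_mul hε]
    refine ⟨endParam_lt K z.2, ?_⟩
    rw [endParam, sub_sub_cancel, Real.log_exp, neg_neg]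
    exact hz
  · rintro ⟨h1, h2⟩
    obtain ⟨⟨x, τ⟩, hy⟩ := y
    dsimp only at h1 h2
    have h3 : K ≤ |τ| := by
      rw [← abs_sign_mul hε, abs_of_neg (by linarith)]
      linarith
    have h4 := (mem_zeroSet_iff hsf h3).1 hy
    choose d hd using fun t => hE (x.map t) (by rw [h4]; linarith)
    refine ⟨(⟨x.base, d⟩, -Real.log (-K - ε * τ)), h2, Subtype.ext (Prod.ext ?_ ?_)⟩
    · refine ext_of_eq rfl fun t ht ht' => ?_
      change E.e (d ⟨t, ht⟩, endParam K (-Real.log (-K - ε * τ))) = _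
      rw [endParam_neg_log h1, hd ⟨t, ht⟩, h4]
    · change ε * endParam K (-Real.log (-K - ε * τ)) = τ
      rw [endParam_neg_log h1, sign_mul_sign_mul hε]

include hE in
lemma range_endMap : range (endMap E hε hK hsf hf) = {y | ε * y.1.2 < -K} := by
  rw [← image_univ]
  have := image_endMap E hε hK hsf hf hE fun _ => True
  simpa using this

variable (hp : IsCoveringMap p) (hκ : IsCoveringMap (evalProj p X))
  (hs : ∀ r, SmoothAt (((charts hp AB AX).prod (model ℝ)).comap hκ.isLocalHomeomorph) (model ℝ) s r)
  (hr : ∀ y, Regular ((charts hp AB AX).prod (model ℝ)) (evalProj p X) s y)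

lemma smoothAt_endMap (z) : SmoothAt ((charts hp AB AD).prod (model ℝ)) (zeroCharts hκ hs hr)
    (endMap E hε hK hsf hf) z := by
  have h1 : SmoothAt ((charts hp AB AD).prod (model ℝ)) (model ℝ) (fun z => endParam K z.2) z :=
    SmoothAt.comp (f := Prod.snd) (g := endParam K) (B := model ℝ)
      (smoothAt_model_model_iff.2 contDiff_endParam.contDiffAt) smoothAt_snd
  refine (smoothAt_zeroCharts_iff hκ hs hr).2 (SmoothAt.prodMk (smoothAt_of_eval hp
    (SmoothAt.comp (f := Prod.fst) (smoothAt_base hp _) smoothAt_fst) fun t ht => ?_) ?_)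
  · obtain ⟨g, hg, hge⟩ := exists_smoothAt_eval_comp hp (A := AB) (D := AD)
      (smoothAt_fst (A := charts hp AB AD) (B := model ℝ) (z := z)) t ht
    refine ⟨fun z => E.e (g z, endParam K z.2), SmoothAt.comp (f := fun z => (g z, endParam K z.2))
      (E.smooth_e _) (hg.prodMk h1), ?_⟩
    filter_upwards [hge] with y hy h
    exact congrArg (fun d => E.e (d, endParam K y.1.2)) (hy h)
  · exact SmoothAt.comp (g := fun w : ℝ => ε * w) (B := model ℝ)
      (smoothAt_model_model_iff.2 (by fun_prop)) h1

include hE in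
lemma exists_leftInverse_endMap (z : PolySpace p D × ℝ) : ∃ ρ : zeroSet (evalProj p X) s → _,
    Function.LeftInverse ρ (endMap E hε hK hsf hf) ∧ SmoothAt (zeroCharts hκ hs hr)
      ((charts hp AB AD).prod (model ℝ)) ρ (endMap E hε hK hsf hf z) := by
  have : Nonempty (PolySpace p D × ℝ) := ⟨z⟩
  set e := endMap E hε hK hsf hf with he
  obtain ⟨ρ, hinv⟩ : ∃ ρ, Function.LeftInverse ρ e :=
    ⟨_, Function.leftInverse_invFun (injective_endMap E hε hK hsf hf)⟩
  have hval : Continuous fun y : zeroSet (evalProj p X) s => ε * y.1.2 :=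
    continuous_const.mul (continuous_snd.comp continuous_subtype_val)
  have hmem : ∀ᶠ y in 𝓝 (e z), y ∈ range e := by
    rw [range_endMap E hε hK hsf hf hE]
    refine (isOpen_Iio.preimage hval).mem_nhds ?_
    have : e z ∈ range e := mem_range_self z
    rwa [range_endMap E hε hK hsf hf hE] at this
  have h1 : SmoothAt (zeroCharts hκ hs hr) (charts hp AB AX) (fun y => y.1.1) (e z) :=
    (smoothAt_zeroCharts_val hκ hs hr _).fst
  refine ⟨ρ, hinv, SmoothAt.prodMk (smoothAt_of_eval hp ?_ fun t ht => ?_) ?_⟩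
  · refine (SmoothAt.comp (g := base) (smoothAt_base hp _) h1).congr ?_
    filter_upwards [hmem]
    rintro _ ⟨y, rfl⟩
    rw [hinv]
    rfl
  · have ht' : p t = (e z).1.1.base := by
      rw [hinv] at ht
      exact ht
    obtain ⟨g, hg, hge⟩ := exists_smoothAt_eval_comp hp h1 t ht'
    obtain ⟨ρ', hρ, hρe⟩ := E.smooth_inv (z.1.map ⟨t, ht'⟩, endParam K z.2)
    have hgz : g (e z) = E.e (z.1.map ⟨t, ht'⟩, endParam K z.2) := (hge.self_of_nhds ht').symm
    refine ⟨fun y => (ρ' (g y)).1, (SmoothAt.comp_of_eq (f := g) hρ hg hgz).fst, ?_⟩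
    have hρe' := E.isOpenEmbedding.isOpenMap.image_mem_nhds hρe
    rw [← hgz] at hρe'
    filter_upwards [hge, continuousAt_fst.eventually hmem,
      continuousAt_fst.eventually (hg.1.eventually hρe')]
    rintro ⟨_, t'⟩ hy1 ⟨y, rfl⟩ ⟨w, hw, hwe⟩ h
    have h2 : p t' = y.1.base := by
      rw [hinv] at h
      exact h
    have h3 : E.e (y.1.map ⟨t', h2⟩, endParam K y.2) = g (e y) := hy1 h2
    have h4 : w = (y.1.map ⟨t', h2⟩, endParam K y.2) :=
      E.isOpenEmbedding.injective (hwe.trans h3.symm)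
    have h5 : ρ' (g (e y)) = w := by
      rw [← hwe]
      exact hw
    have h6 : (ρ (e y)).1.map ⟨t', h⟩ = y.1.map ⟨t', h2⟩ := by
      have key : ∀ (v : PolySpace p D × ℝ) (_ : v = y) (h' : p t' = v.1.base),
          v.1.map ⟨t', h'⟩ = y.1.map ⟨t', h2⟩ := by
        rintro _ rfl _
        rfl
      exact key _ (hinv y) h
    refine h6.trans ?_
    dsimp only
    rw [h5, h4]
  · have h2 : SmoothAt (zeroCharts hκ hs hr) (model ℝ)
        (fun y => -Real.log (-K - ε * y.1.2)) (e z) := by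
      refine SmoothAt.comp (f := fun y : zeroSet (evalProj p X) s => y.1.2) (g := fun w : ℝ => -Real.log (-K - ε * w))
        (B := model ℝ) (smoothAt_model_model_iff.2 ?_) (smoothAt_zeroCharts_val hκ hs hr _).snd
      refine (ContDiffAt.log (by fun_prop) (ne_of_gt ?_)).neg
      change 0 < -K - ε * (ε * endParam K z.2)
      rw [sign_mul_sign_mul hε]
      linarith [endParam_lt K z.2]
    refine h2.congr ?_
    filter_upwards [hmem]
    rintro _ ⟨y, rfl⟩
    rw [hinv]
    change y.2 = -Real.log (-K - ε * (ε * endParam K y.2))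
    rw [sign_mul_sign_mul hε, endParam, sub_sub_cancel, Real.log_exp, neg_neg]

/-- The covering of the zero set induced by a covering of `X`. -/
abbrev zeroProj (P : S → X) (s : Function.Pullback (base : PolySpace p X → B) p × ℝ → ℝ)
    (w : Function.Pullback (fun z : zeroSet (evalProj p X) s => z.1.1) (compProj p P)) :
    zeroSet (evalProj p X) s := w.fst

/-- The cylindrical end of the zero set, with the covering. -/
def zeroEnd : CoveredEnd (zeroCharts hκ hs hr) (zeroProj P s) (charts hp AB AD) (compProj p q) where
  e := endMap E hε hK hsf hf
  isOpenEmbedding := isOpenEmbedding_of_leftInverse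
    (continuous_iff_continuousAt.2 fun z => (smoothAt_endMap E hε hK hsf hf hp hκ hs hr z).1)
    (by
      rw [range_endMap E hε hK hsf hf hE]
      exact isOpen_Iio.preimage (continuous_const.mul
        (continuous_snd.comp continuous_subtype_val)))
    fun z => (exists_leftInverse_endMap E hε hK hsf hf hE hp hκ hs hr z).imp
      fun _ h => ⟨h.1, h.2.1⟩
  smooth_e := smoothAt_endMap E hε hK hsf hf hp hκ hs hr
  smooth_inv z := (exists_leftInverse_endMap E hε hK hsf hf hE hp hκ hs hr z).imp
    fun _ h => ⟨h.2, .of_forall h.1⟩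
  lift w := ⟨(endMap E hε hK hsf hf (w.1.1.1.1.1, w.2),
    ⟨(⟨(polyCyl E w.1.1.1.1.1 (endParam K w.2), w.1.1.1.1.2), w.1.1.1.2⟩,
      E.lift (w.1.1.2, endParam K w.2)), by
        rw [E.P_lift, ← w.1.2]
        rfl⟩), rfl⟩
  continuous_lift := by
    have h1 : Continuous fun w : Function.Pullback
        (eval : Function.Pullback (base : PolySpace p D → B) p → D) q × ℝ =>
          endMap E hε hK hsf hf (w.1.1.1.1.1, w.2) :=
      (continuous_iff_continuousAt.2 fun z =>
        (smoothAt_endMap (AB := AB) E hε hK hsf hf hp hκ hs hr z).1).comp (by fun_prop)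
    have h2 : Continuous fun w : Function.Pullback
        (eval : Function.Pullback (base : PolySpace p D → B) p → D) q × ℝ =>
          E.lift (w.1.1.2, endParam K w.2) :=
      E.continuous_lift.comp ((by fun_prop : Continuous _).prodMk
        (contDiff_endParam.continuous.comp continuous_snd))
    exact Continuous.subtype_mk (h1.prodMk (Continuous.subtype_mk ((Continuous.subtype_mk
      ((continuous_fst.comp (continuous_subtype_val.comp h1)).prodMk (by fun_prop)) _).prodMk
        h2) _)) _
  injective_lift := by
    intro w w' h
    have h1 := injective_endMap E hε hK hsf hf (congrArg (fun z => z.1.1) h)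
    have h2 := E.injective_lift (congrArg (fun z => z.1.2.1.2) h)
    exact Prod.ext (Subtype.ext (Prod.ext (Subtype.ext (Prod.ext (Prod.ext_iff.1 h1).1
      (congrArg (fun z => z.1.2.1.1.1.2) h))) (Prod.ext_iff.1 h2).1)) (Prod.ext_iff.1 h1).2
  P_lift _ := rfl
  mem_range_lift := by
    rintro ⟨⟨_, ⟨⟨⟨⟨x, t⟩, ht⟩, s₀⟩, hs₀⟩⟩, h⟩ ⟨y, rfl⟩
    obtain rfl : polyCyl E y.1 (endParam K y.2) = x := h
    have h1 : E.e (y.1.map ⟨t, ht.symm⟩, endParam K y.2) = P s₀ := hs₀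
    obtain ⟨⟨r, a⟩, rfl⟩ := E.mem_range_lift s₀ ⟨_, h1⟩
    rw [E.P_lift] at h1
    have h2 := E.isOpenEmbedding.injective h1
    obtain rfl : endParam K y.2 = a := congrArg Prod.snd h2
    exact ⟨(⟨(⟨(y.1, t), ht⟩, r), congrArg Prod.fst h2⟩, y.2), rfl⟩

end

end PolySpace

open PolySpace in
/-- Cobordant coverings have cobordant compositions with a given covering on the left. -/
theorem Filling.nonempty_compProj {T B C C' R R' : Type} [TopologicalSpace T] [TopologicalSpace B]
    [TopologicalSpace C] [TopologicalSpace C'] [TopologicalSpace R] [TopologicalSpace R']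
    [T2Space B] [CompactSpace B] [T2Space C] [CompactSpace C] [T2Space C'] [CompactSpace C']
    {p : T → B} [∀ b, Finite (p ⁻¹' {b})] (hp : FiniteCovering p) {dB : B → ℕ} {dC : C → ℕ}
    {dC' : C' → ℕ} (AB : Charts B dB) {AC : Charts C dC} {AC' : Charts C' dC'} {q : R → C}
    {q' : R' → C'} (F : Filling (AC.sum AC') (Sum.map q q')) :
    Nonempty (Filling ((PolySpace.charts hp.isCoveringMap AB AC).sum
      (PolySpace.charts hp.isCoveringMap AB AC')) (Sum.map (compProj p q) (compProj p q'))) := by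
  have hp' := hp.isCoveringMap
  have := t2Space (X := F.X) hp'
  have hκ := (finiteCovering_evalProj (X := F.X) hp).isCoveringMap
  have hE1 (x) (h : 1 * F.height x < -2) : ∃ d, x = F.endLeft.e (d, 1 * F.height x) := by
    rw [one_mul] at h ⊢
    exact F.eq_of_height_lt h
  have hE2 (x) (h : -1 * F.height x < -2) : ∃ d, x = F.endRight.e (d, -1 * F.height x) := by
    rw [neg_one_mul] at h ⊢
    exact F.eq_of_lt_height (by linarith)
  have hf1 (d w) (h : w ≤ -2) : F.height (F.endLeft.e (d, w)) = 1 * w := by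
    rw [one_mul]
    exact (F.height_inl d w).trans (cutoff_of_le h)
  have hf2 (d w) (h : w ≤ -2) : F.height (F.endRight.e (d, w)) = -1 * w := by
    rw [neg_one_mul]
    exact (F.height_inr d w).trans (congrArg Neg.neg (cutoff_of_le h))
  have hreg (y : PolySpace p F.X × ℝ)
      (hy : y ∉ {x : PolySpace p F.X | x.base ∈ univ ∧ ∀ t, x.map t ∈ {x | |F.height x| ≤ 2}} ×ˢ
        Icc (-2 : ℝ) 2) :
      Regular ((charts hp' AB F.A).prod (model ℝ)) (evalProj p F.X) (evalFun p F.height) y := by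
    rcases lt_or_ge y.2 (-2) with h1 | h1
    · exact regular_evalFun_of_lt F.endLeft (one_mul 1) hp' hE1 hf1 (by linarith)
    rcases lt_or_ge 2 y.2 with h2 | h2
    · exact regular_evalFun_of_lt F.endRight (by norm_num) hp' hE2 hf2 (by linarith)
    · intro h0
      refine absurd ⟨⟨mem_univ _, fun t => ?_⟩, h1, h2⟩ hy
      have h3 : F.height (y.1.map t) = y.2 :=
        sub_eq_zero.1 (h0 (evalPoint y t).1 (evalPoint y t).2)
      change |F.height (y.1.map t)| ≤ 2
      rw [h3]
      exact abs_le.2 ⟨h1, h2⟩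
  obtain ⟨s, D, hs, hD, hsD, hr⟩ := exists_regular hκ
    (smoothAt_evalFun (AB := AB) hp' hκ.isLocalHomeomorph F.smoothAt_height)
    ((isCompact_setOf hp' isCompact_univ (F.isCompact_height_le 2)).prod isCompact_Icc) hreg
  obtain ⟨M, hM⟩ := (hD.image continuous_snd).isBounded.exists_norm_le
  set K := max M 2 + 1 with hKdef
  have hK : 2 < K := by linarith [le_max_right M 2]
  have hDK {y : PolySpace p F.X × ℝ} (hy : K ≤ |y.2|) : y ∉ D := fun hyD => by
    have := hM _ (mem_image_of_mem _ hyD)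
    rw [Real.norm_eq_abs] at this
    linarith [le_max_left M 2]
  have hsf (z) (hz : K ≤ |z.2|) : s z = evalFun p F.height z := hsD z (hDK hz)
  have hval : Continuous fun y : zeroSet (evalProj p F.X) s => y.1.2 :=
    continuous_snd.comp continuous_subtype_val
  have hlog1 (w : ℝ) : w < -K ∧ -Real.log (-K - w) ≤ 0 ↔ w ≤ -K - 1 := by
    constructor
    · rintro ⟨h1, h2⟩
      have := (Real.log_nonneg_iff (by linarith)).1 (neg_nonpos.1 h2)
      linarith
    · exact fun h => ⟨by linarith, neg_nonpos.2 (Real.log_nonneg (by linarith))⟩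
  have hlog2 (w : ℝ) : w < -K ∧ -Real.log (-K - w) < 0 ↔ w < -K - 1 := by
    constructor
    · rintro ⟨h1, h2⟩
      have := (Real.log_pos_iff (by linarith)).1 (neg_neg_iff_pos.1 h2)
      linarith
    · exact fun h => ⟨by linarith, neg_neg_iff_pos.2 (Real.log_pos (by linarith))⟩
  have hscont : Continuous s := continuous_iff_continuousAt.2 fun z => (hs z).1
  have hZ := isClosed_zeroSet hκ hscont
  refine ⟨Filling.ofEnds (P := zeroProj F.P s) ?_
    (zeroEnd F.endLeft (one_mul 1) hK hsf hf1 hE1 hp' hκ hs hr)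
    (zeroEnd F.endRight (by norm_num) hK hsf hf2 hE2 hp' hκ hs hr) ?_ ?_ ?_ ?_⟩
  · exact (finiteCovering_compProj hp F.finiteCovering).pullback
      (continuous_fst.comp continuous_subtype_val)
  · intro z w h
    have h1 : 1 * endParam K z.2 = -1 * endParam K w.2 := congrArg (fun y => y.1.2) h
    linarith [endParam_lt K z.2, endParam_lt K w.2]
  · refine (image_endMap F.endLeft (one_mul 1) hK hsf hf1 hE1 (· ≤ 0)).symm ▸ ?_
    simp only [hlog1]
    exact isClosed_Iic.preimage (continuous_const.mul hval)
  · refine (image_endMap F.endRight (by norm_num) hK hsf hf2 hE2 (· ≤ 0)).symm ▸ ?_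
    simp only [hlog1]
    exact isClosed_Iic.preimage (continuous_const.mul hval)
  · have h1 : IsCompact (D ∪ {x : PolySpace p F.X | x.base ∈ univ ∧
        ∀ t, x.map t ∈ {x | |F.height x| ≤ K + 1}} ×ˢ Icc (-(K + 1)) (K + 1)) :=
      hD.union ((isCompact_setOf hp' isCompact_univ (F.isCompact_height_le _)).prod isCompact_Icc)
    refine (congrArg₂ (fun a b => IsCompact (aᶜ ∩ bᶜ))
      (image_endMap F.endLeft (one_mul 1) hK hsf hf1 hE1 (· < 0))
      (image_endMap F.endRight (by norm_num) hK hsf hf2 hE2 (· < 0))).mpr ?_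
    simp only [hlog2]
    refine (hZ.isClosedEmbedding_subtypeVal.isCompact_preimage h1).of_isClosed_subset ?_ ?_
    · exact (isOpen_Iio.preimage (continuous_const.mul hval)).isClosed_compl.inter
        (isOpen_Iio.preimage (continuous_const.mul hval)).isClosed_compl
    · rintro ⟨⟨x, τ⟩, hy⟩ ⟨h2, h3⟩
      have h2 : ¬ (1 * τ < -K - 1) := h2
      have h3 : ¬ (-1 * τ < -K - 1) := h3
      by_cases hyD : (x, τ) ∈ D
      · exact Or.inl hyD
      have h4 : τ ∈ Icc (-(K + 1)) (K + 1) := ⟨by linarith, by linarith⟩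
      refine Or.inr ⟨⟨mem_univ _, fun t => ?_⟩, h4⟩
      have h5 := hy (evalPoint (x, τ) t).1 rfl
      rw [hsD (evalPoint (x, τ) t).1 hyD] at h5
      have h6 : F.height (x.map t) = τ := sub_eq_zero.1 h5
      change |F.height (x.map t)| ≤ K + 1
      rw [h6]
      exact abs_le.2 h4

open Charts ClosedCovering

/-- An isomorphism of coverings of manifolds, which is a diffeomorphism on the bases. -/
structure CoveringIso {N T N' T' : Type} [TopologicalSpace N] [TopologicalSpace T]
    [TopologicalSpace N'] [TopologicalSpace T'] {d : N → ℕ} {d' : N' → ℕ} (A : Charts N d)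
    (π : T → N) (A' : Charts N' d') (π' : T' → N') where
  φ : N ≃ N'
  smooth_φ : ∀ x, SmoothAt A A' φ x
  smooth_symm : ∀ x, SmoothAt A' A φ.symm x
  ψ : T ≃ₜ T'
  comm : ∀ t, π' (ψ t) = φ (π t)

/-- Two coverings are bordant if together they have a filling. -/
def Bordant {N T N' T' : Type} [TopologicalSpace N] [TopologicalSpace T]
    [TopologicalSpace N'] [TopologicalSpace T'] {d : N → ℕ} {d' : N' → ℕ} (A : Charts N d)
    (π : T → N) (A' : Charts N' d') (π' : T' → N') : Prop :=
  Nonempty (Filling (A.sum A') (Sum.map π π'))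

section

variable {N₁ T₁ N₂ T₂ N₃ T₃ N₄ T₄ : Type} [TopologicalSpace N₁] [TopologicalSpace T₁]
  [TopologicalSpace N₂] [TopologicalSpace T₂] [TopologicalSpace N₃] [TopologicalSpace T₃]
  [TopologicalSpace N₄] [TopologicalSpace T₄] {d₁ : N₁ → ℕ} {d₂ : N₂ → ℕ} {d₃ : N₃ → ℕ}
  {d₄ : N₄ → ℕ} {A₁ : Charts N₁ d₁} {A₂ : Charts N₂ d₂} {A₃ : Charts N₃ d₃} {A₄ : Charts N₄ d₄}
  {π₁ : T₁ → N₁} {π₂ : T₂ → N₂} {π₃ : T₃ → N₃} {π₄ : T₄ → N₄}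

lemma Charts.smoothAt_sum_iff {f : N₁ ⊕ N₂ → N₃} : (∀ x, SmoothAt (A₁.sum A₂) A₃ f x) ↔
    (∀ x, SmoothAt A₁ A₃ (f ∘ Sum.inl) x) ∧ ∀ x, SmoothAt A₂ A₃ (f ∘ Sum.inr) x :=
  Sum.forall.trans (and_congr (forall_congr' fun _ => smoothAt_sum_inl)
    (forall_congr' fun _ => smoothAt_sum_inr))

lemma Charts.SmoothAt.sumMap {f : N₁ → N₂} {g : N₃ → N₄} (hf : ∀ x, SmoothAt A₁ A₂ f x)
    (hg : ∀ x, SmoothAt A₃ A₄ g x) (x) : SmoothAt (A₁.sum A₃) (A₂.sum A₄) (Sum.map f g) x := by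
  rcases x with x | x
  · exact smoothAt_sum_inl.2 (SmoothAt.comp (f := f) (g := Sum.inl) smoothAt_inl (hf x))
  · exact smoothAt_sum_inr.2 (SmoothAt.comp (f := g) (g := Sum.inr) smoothAt_inr (hg x))

namespace CoveringIso

/-- The identity. -/
def refl (A : Charts N₁ d₁) (π : T₁ → N₁) : CoveringIso A π A π :=
  ⟨.refl _, fun _ => smoothAt_id, fun _ => smoothAt_id, .refl _, fun _ => rfl⟩

/-- The inverse isomorphism. -/
def symm (i : CoveringIso A₁ π₁ A₂ π₂) : CoveringIso A₂ π₂ A₁ π₁ :=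
  ⟨i.φ.symm, i.smooth_symm, i.smooth_φ, i.ψ.symm, fun t => by
    rw [Equiv.eq_symm_apply, ← i.comm, Homeomorph.apply_symm_apply]⟩

/-- The disjoint union of isomorphisms. -/
def sumCongr (i : CoveringIso A₁ π₁ A₂ π₂) (j : CoveringIso A₃ π₃ A₄ π₄) :
    CoveringIso (A₁.sum A₃) (Sum.map π₁ π₃) (A₂.sum A₄) (Sum.map π₂ π₄) where
  φ := i.φ.sumCongr j.φ
  smooth_φ := SmoothAt.sumMap i.smooth_φ j.smooth_φ
  smooth_symm := SmoothAt.sumMap i.smooth_symm j.smooth_symm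
  ψ := i.ψ.sumCongr j.ψ
  comm := by
    rintro (t | t)
    · exact congrArg Sum.inl (i.comm t)
    · exact congrArg Sum.inr (j.comm t)

/-- Commutativity of the disjoint union. -/
def sumComm (A₁ : Charts N₁ d₁) (π₁ : T₁ → N₁) (A₂ : Charts N₂ d₂) (π₂ : T₂ → N₂) :
    CoveringIso (A₁.sum A₂) (Sum.map π₁ π₂) (A₂.sum A₁) (Sum.map π₂ π₁) where
  φ := .sumComm _ _
  smooth_φ := smoothAt_sum_iff.2 ⟨fun _ => smoothAt_inr, fun _ => smoothAt_inl⟩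
  smooth_symm := smoothAt_sum_iff.2 ⟨fun _ => smoothAt_inr, fun _ => smoothAt_inl⟩
  ψ := .sumComm _ _
  comm := by rintro (t | t) <;> rfl

/-- A rearrangement of disjoint unions. -/
def sumSumSumComm (A₁ : Charts N₁ d₁) (π₁ : T₁ → N₁) (A₂ : Charts N₂ d₂) (π₂ : T₂ → N₂)
    (A₃ : Charts N₃ d₃) (π₃ : T₃ → N₃) (A₄ : Charts N₄ d₄) (π₄ : T₄ → N₄) :
    CoveringIso ((A₁.sum A₂).sum (A₃.sum A₄)) (Sum.map (Sum.map π₁ π₂) (Sum.map π₃ π₄))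
      ((A₁.sum A₃).sum (A₂.sum A₄)) (Sum.map (Sum.map π₁ π₃) (Sum.map π₂ π₄)) where
  φ := ⟨Sum.elim (Sum.map Sum.inl Sum.inl) (Sum.map Sum.inr Sum.inr),
    Sum.elim (Sum.map Sum.inl Sum.inl) (Sum.map Sum.inr Sum.inr),
    by rintro ((x | x) | (x | x)) <;> rfl, by rintro ((x | x) | (x | x)) <;> rfl⟩
  smooth_φ := smoothAt_sum_iff.2 ⟨SmoothAt.sumMap (fun _ => smoothAt_inl) fun _ => smoothAt_inl,
    SmoothAt.sumMap (fun _ => smoothAt_inr) fun _ => smoothAt_inr⟩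
  smooth_symm := smoothAt_sum_iff.2 ⟨SmoothAt.sumMap (fun _ => smoothAt_inl) fun _ => smoothAt_inl,
    SmoothAt.sumMap (fun _ => smoothAt_inr) fun _ => smoothAt_inr⟩
  ψ := .sumSumSumComm _ _ _ _
  comm := by rintro ((t | t) | (t | t)) <;> rfl

end CoveringIso

/-- Transport of a filling along an isomorphism of coverings. -/
def Filling.ofIso (F : Filling A₂ π₂) (i : CoveringIso A₁ π₁ A₂ π₂) : Filling A₁ π₁ :=
  F.congr i.φ i.smooth_φ i.smooth_symm i.ψ i.ψ.continuous i.ψ.bijective i.comm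

namespace Bordant

lemma congr (h : Bordant A₁ π₁ A₂ π₂) (i : CoveringIso A₃ π₃ A₁ π₁)
    (j : CoveringIso A₄ π₄ A₂ π₂) : Bordant A₃ π₃ A₄ π₄ :=
  h.map fun F => F.ofIso (i.sumCongr j)

lemma symm (h : Bordant A₁ π₁ A₂ π₂) : Bordant A₂ π₂ A₁ π₁ :=
  h.map fun F => F.ofIso (.sumComm _ _ _ _)

lemma of_iso [T2Space N₂] [CompactSpace N₂] (i : CoveringIso A₁ π₁ A₂ π₂)
    (h : FiniteCovering π₂) : Bordant A₁ π₁ A₂ π₂ :=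
  congr ⟨Filling.cylinder A₂ h⟩ i (.refl _ _)

lemma sum (h : Bordant A₁ π₁ A₂ π₂) (h' : Bordant A₃ π₃ A₄ π₄) :
    Bordant (A₁.sum A₃) (Sum.map π₁ π₃) (A₂.sum A₄) (Sum.map π₂ π₄) :=
  h.elim fun F => h'.elim fun F' => ⟨(F.sum F').ofIso (.sumSumSumComm _ _ _ _ _ _ _ _)⟩

/-- The projection of a product of coverings. -/
abbrev prodProj (π₁ : T₁ → N₁) (π₂ : T₂ → N₂) : T₁ × N₂ ⊕ N₁ × T₂ → N₁ × N₂ :=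
  Sum.elim (Prod.map π₁ id) (Prod.map id π₂)

/-- Distributivity of the product over the disjoint union. -/
def _root_.CoveringBordism.CoveringIso.sumProd (A₁ : Charts N₁ d₁) (π₁ : T₁ → N₁)
    (A₂ : Charts N₂ d₂) (π₂ : T₂ → N₂) (A₃ : Charts N₃ d₃) (π₃ : T₃ → N₃) :
    CoveringIso ((A₁.prod A₃).sum (A₂.prod A₃)) (Sum.map (prodProj π₁ π₃) (prodProj π₂ π₃))
      ((A₁.sum A₂).prod A₃) (prodProj (Sum.map π₁ π₂) π₃) where
  φ := (Equiv.sumProdDistrib _ _ _).symm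
  smooth_φ := smoothAt_sum_iff.2 ⟨fun _ => SmoothAt.prodMap smoothAt_inl smoothAt_id,
    fun _ => SmoothAt.prodMap smoothAt_inr smoothAt_id⟩
  smooth_symm := by
    rintro ⟨x | x, y⟩
    · exact smoothAt_sum_prod_inl.2 smoothAt_inl
    · exact smoothAt_sum_prod_inr.2 smoothAt_inr
  ψ := (Homeomorph.sumSumSumComm _ _ _ _).trans
    (Homeomorph.sumProdDistrib.symm.sumCongr Homeomorph.sumProdDistrib.symm)
  comm := by rintro ((t | t) | (t | t)) <;> rfl

lemma prod_right [T2Space N₃] [CompactSpace N₃] (h : Bordant A₁ π₁ A₂ π₂)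
    (hπ : FiniteCovering π₃) :
    Bordant (A₁.prod A₃) (prodProj π₁ π₃) (A₂.prod A₃) (prodProj π₂ π₃) := by
  exact h.map fun F => (F.prod A₃ hπ).ofIso (.sumProd _ _ _ _ _ _)

end Bordant

end

section Comp

open PolySpace

variable {N₁ T₁ N₂ T₂ C R : Type} [TopologicalSpace N₁] [TopologicalSpace T₁]
  [TopologicalSpace N₂] [TopologicalSpace T₂] [TopologicalSpace C] [TopologicalSpace R]
  {d₁ : N₁ → ℕ} {d₂ : N₂ → ℕ} {dC : C → ℕ} {A₁ : Charts N₁ d₁} {A₂ : Charts N₂ d₂}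
  (AC : Charts C dC) {π₁ : T₁ → N₁} {π₂ : T₂ → N₂} {q : R → C}

/-- The inclusion of `π₁(C)` in `(π₁ + π₂)(C)`. -/
def PolySpace.sumInl (π₂ : T₂ → N₂) (x : PolySpace π₁ C) : PolySpace (Sum.map π₁ π₂) C where
  base := Sum.inl x.base
  map
    | ⟨Sum.inl t, h⟩ => x.map ⟨t, Sum.inl_injective h⟩
    | ⟨Sum.inr _, h⟩ => (Sum.inr_ne_inl h).elim

/-- The inclusion of `π₂(C)` in `(π₁ + π₂)(C)`. -/
def PolySpace.sumInr (π₁ : T₁ → N₁) (x : PolySpace π₂ C) : PolySpace (Sum.map π₁ π₂) C where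
  base := Sum.inr x.base
  map
    | ⟨Sum.inr t, h⟩ => x.map ⟨t, Sum.inr_injective h⟩
    | ⟨Sum.inl _, h⟩ => (Sum.inl_ne_inr h).elim

/-- The inverse of the inclusions of `π₁(C)` and `π₂(C)` in `(π₁ + π₂)(C)`. -/
def PolySpace.sumCases : PolySpace (Sum.map π₁ π₂) C → PolySpace π₁ C ⊕ PolySpace π₂ C
  | ⟨Sum.inl b, u⟩ => Sum.inl ⟨b, fun t => u ⟨Sum.inl t.1, congrArg Sum.inl t.2⟩⟩
  | ⟨Sum.inr b, u⟩ => Sum.inr ⟨b, fun t => u ⟨Sum.inr t.1, congrArg Sum.inr t.2⟩⟩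

/-- The set `(π₁ + π₂)(C)` is the disjoint union of `π₁(C)` and `π₂(C)`. -/
def PolySpace.sumEquiv : PolySpace π₁ C ⊕ PolySpace π₂ C ≃ PolySpace (Sum.map π₁ π₂) C where
  toFun := Sum.elim (sumInl π₂) (sumInr π₁)
  invFun := sumCases
  left_inv := by rintro (x | x) <;> rfl
  right_inv := by
    rintro ⟨b | b, u⟩
    · refine ext_of_eq rfl ?_
      rintro (t | t) h h'
      · rfl
      · exact (Sum.inr_ne_inl h).elim
    · refine ext_of_eq rfl ?_
      rintro (t | t) h h'
      · exact (Sum.inl_ne_inr h).elim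
      · rfl

variable [∀ b, Finite (π₁ ⁻¹' {b})] [∀ b, Finite (π₂ ⁻¹' {b})]
  [∀ b, Finite (Sum.map π₁ π₂ ⁻¹' {b})]

lemma smoothAt_sumInl (h₁ : IsCoveringMap π₁) (h : IsCoveringMap (Sum.map π₁ π₂)) (x) :
    SmoothAt (charts h₁ A₁ AC) (charts h (A₁.sum A₂) AC) (sumInl π₂) x := by
  refine smoothAt_of_eval h (SmoothAt.comp (g := Sum.inl) smoothAt_inl (smoothAt_base h₁ x)) ?_
  rintro (t | t) ht
  · obtain ⟨f, hf, hfe⟩ := exists_smoothAt_eval h₁ (A := A₁) (D := AC) x t (Sum.inl_injective ht)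
    refine ⟨f, hf, ?_⟩
    have h2 := (IsOpenEmbedding.id.prodMap (IsOpenEmbedding.inl (X := T₁) (Y := T₂))).isOpenMap
      |>.image_mem_nhds hfe
    filter_upwards [h2]
    rintro _ ⟨⟨y, t'⟩, hy, rfl⟩ h'
    exact hy (Sum.inl_injective h')
  · exact (Sum.inr_ne_inl ht).elim

lemma smoothAt_sumInr (h₂ : IsCoveringMap π₂) (h : IsCoveringMap (Sum.map π₁ π₂)) (x) :
    SmoothAt (charts h₂ A₂ AC) (charts h (A₁.sum A₂) AC) (sumInr π₁) x := by
  refine smoothAt_of_eval h (SmoothAt.comp (g := Sum.inr) smoothAt_inr (smoothAt_base h₂ x)) ?_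
  rintro (t | t) ht
  · exact (Sum.inl_ne_inr ht).elim
  · obtain ⟨f, hf, hfe⟩ := exists_smoothAt_eval h₂ (A := A₂) (D := AC) x t (Sum.inr_injective ht)
    refine ⟨f, hf, ?_⟩
    have h2 := (IsOpenEmbedding.id.prodMap (IsOpenEmbedding.inr (X := T₁) (Y := T₂))).isOpenMap
      |>.image_mem_nhds hfe
    filter_upwards [h2]
    rintro _ ⟨⟨y, t'⟩, hy, rfl⟩ h'
    exact hy (Sum.inr_injective h')

lemma smoothAt_sumCases (h₁ : IsCoveringMap π₁) (h₂ : IsCoveringMap π₂)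
    (h : IsCoveringMap (Sum.map π₁ π₂)) (y) : SmoothAt (charts h (A₁.sum A₂) AC)
      ((charts h₁ A₁ AC).sum (charts h₂ A₂ AC)) (sumCases (C := C)) y := by
  have hb := smoothAt_base (A := A₁.sum A₂) (D := AC) h y
  have hc := (continuous_base (X := C) (Sum.map π₁ π₂)).continuousAt (x := y)
  obtain ⟨b | b, u⟩ := y
  · let x₀ : PolySpace π₁ C := ⟨b, fun t => u ⟨Sum.inl t.1, congrArg Sum.inl t.2⟩⟩
    have hev := hc.eventually (isOpen_range_inl.mem_nhds ⟨b, rfl⟩)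
    have h1 : SmoothAt (charts h (A₁.sum A₂) AC) (charts h₁ A₁ AC)
        (fun y => Sum.elim id (fun _ => x₀) (sumCases y)) ⟨Sum.inl b, u⟩ := by
      refine smoothAt_of_eval h₁ ?_ fun t ht => ?_
      · refine (SmoothAt.comp_of_eq (g := Sum.elim id fun _ => b)
          (smoothAt_sum_inl.2 smoothAt_id) hb rfl).congr ?_
        filter_upwards [hev]
        rintro ⟨_, v⟩ ⟨b', rfl⟩
        rfl
      · obtain ⟨f, hf, hfe⟩ := exists_smoothAt_eval h (A := A₁.sum A₂) (D := AC) ⟨Sum.inl b, u⟩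
          (Sum.inl t) (congrArg Sum.inl ht)
        refine ⟨f, hf, ?_⟩
        have h2 : ContinuousAt (fun z : PolySpace (Sum.map π₁ π₂) C × T₁ =>
          (z.1, (Sum.inl z.2 : T₁ ⊕ T₂))) (⟨Sum.inl b, u⟩, t) := by fun_prop
        filter_upwards [h2.eventually hfe, continuousAt_fst.eventually hev]
        rintro ⟨⟨_, v⟩, t'⟩ h3 ⟨b', rfl⟩ h4
        exact h3 (congrArg Sum.inl h4)
    refine (SmoothAt.comp (g := Sum.inl) smoothAt_inl h1).congr ?_
    filter_upwards [hev]
    rintro ⟨_, v⟩ ⟨b', rfl⟩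
    rfl
  · let x₀ : PolySpace π₂ C := ⟨b, fun t => u ⟨Sum.inr t.1, congrArg Sum.inr t.2⟩⟩
    have hev := hc.eventually (isOpen_range_inr.mem_nhds ⟨b, rfl⟩)
    have h1 : SmoothAt (charts h (A₁.sum A₂) AC) (charts h₂ A₂ AC)
        (fun y => Sum.elim (fun _ => x₀) id (sumCases y)) ⟨Sum.inr b, u⟩ := by
      refine smoothAt_of_eval h₂ ?_ fun t ht => ?_
      · refine (SmoothAt.comp_of_eq (g := Sum.elim (fun _ => b) id)
          (smoothAt_sum_inr.2 smoothAt_id) hb rfl).congr ?_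
        filter_upwards [hev]
        rintro ⟨_, v⟩ ⟨b', rfl⟩
        rfl
      · obtain ⟨f, hf, hfe⟩ := exists_smoothAt_eval h (A := A₁.sum A₂) (D := AC) ⟨Sum.inr b, u⟩
          (Sum.inr t) (congrArg Sum.inr ht)
        refine ⟨f, hf, ?_⟩
        have h2 : ContinuousAt (fun z : PolySpace (Sum.map π₁ π₂) C × T₂ =>
          (z.1, (Sum.inr z.2 : T₁ ⊕ T₂))) (⟨Sum.inr b, u⟩, t) := by fun_prop
        filter_upwards [h2.eventually hfe, continuousAt_fst.eventually hev]
        rintro ⟨⟨_, v⟩, t'⟩ h3 ⟨b', rfl⟩ h4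
        exact h3 (congrArg Sum.inr h4)
    refine (SmoothAt.comp (g := Sum.inr) smoothAt_inr h1).congr ?_
    filter_upwards [hev]
    rintro ⟨_, v⟩ ⟨b', rfl⟩
    rfl

variable {AC} in
lemma Bordant.comp_left [T2Space N₁] [T2Space N₂] [T2Space C] [CompactSpace C]
    (H : Bordant A₁ π₁ A₂ π₂) (h₁ : FiniteCovering π₁) (h₂ : FiniteCovering π₂)
    (hq : FiniteCovering q) : Bordant (charts h₁.isCoveringMap A₁ AC) (compProj π₁ q)
      (charts h₂.isCoveringMap A₂ AC) (compProj π₂ q) := by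
  obtain ⟨F⟩ := H
  have h := h₁.sumMap h₂
  have := F.finiteCovering.finite_fiber
  have c1 : Continuous (sumInl π₂ : PolySpace π₁ C → _) := continuous_iff_continuousAt.2 fun x =>
    (smoothAt_sumInl (A₁ := A₁) (A₂ := A₂) AC h₁.isCoveringMap h.isCoveringMap x).1
  have c2 : Continuous (sumInr π₁ : PolySpace π₂ C → _) := continuous_iff_continuousAt.2 fun x =>
    (smoothAt_sumInr (A₁ := A₁) (A₂ := A₂) AC h₂.isCoveringMap h.isCoveringMap x).1
  refine ⟨(F.poly AC h hq).congr sumEquiv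
    (smoothAt_sum_iff.2 ⟨smoothAt_sumInl AC h₁.isCoveringMap h.isCoveringMap,
      smoothAt_sumInr AC h₂.isCoveringMap h.isCoveringMap⟩)
    (smoothAt_sumCases AC h₁.isCoveringMap h₂.isCoveringMap h.isCoveringMap)
    (Sum.elim
      (fun z => ⟨(⟨(sumInl π₂ z.1.1.1.1, Sum.inl z.1.1.1.2), congrArg Sum.inl z.1.1.2⟩, z.1.2), z.2⟩)
      (fun z => ⟨(⟨(sumInr π₁ z.1.1.1.1, Sum.inr z.1.1.1.2), congrArg Sum.inr z.1.1.2⟩, z.1.2), z.2⟩))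
    ?_ ⟨?_, ?_⟩ ?_⟩
  · refine Continuous.sumElim ?_ ?_
    · exact Continuous.subtype_mk ((Continuous.subtype_mk
        ((c1.comp (by fun_prop)).prodMk (by fun_prop)) _).prodMk (by fun_prop)) _
    · exact Continuous.subtype_mk ((Continuous.subtype_mk
        ((c2.comp (by fun_prop)).prodMk (by fun_prop)) _).prodMk (by fun_prop)) _
  · have hinj := (sumEquiv : PolySpace π₁ C ⊕ PolySpace π₂ C ≃ _).injective
    rintro (⟨⟨⟨⟨x, t⟩, hx⟩, r⟩, hr⟩ | ⟨⟨⟨⟨x, t⟩, hx⟩, r⟩, hr⟩)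
      (⟨⟨⟨⟨y, u⟩, hy⟩, v⟩, hv⟩ | ⟨⟨⟨⟨y, u⟩, hy⟩, v⟩, hv⟩) H
    · obtain rfl := Sum.inl_injective (hinj (congrArg (fun z => z.1.1.1.1) H))
      obtain rfl := Sum.inl_injective (congrArg (fun z => z.1.1.1.2) H)
      obtain rfl := congrArg (fun z => z.1.2) H
      rfl
    · exact (Sum.inl_ne_inr (congrArg (fun z => z.1.1.1.2) H)).elim
    · exact (Sum.inr_ne_inl (congrArg (fun z => z.1.1.1.2) H)).elim
    · obtain rfl := Sum.inr_injective (hinj (congrArg (fun z => z.1.1.1.1) H))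
      obtain rfl := Sum.inr_injective (congrArg (fun z => z.1.1.1.2) H)
      obtain rfl := congrArg (fun z => z.1.2) H
      rfl
  · rintro ⟨⟨⟨⟨x, t⟩, hx⟩, r⟩, hr⟩
    obtain ⟨x | x, rfl⟩ := (sumEquiv : PolySpace π₁ C ⊕ PolySpace π₂ C ≃ _).surjective x <;>
      obtain t | t := t
    · exact ⟨Sum.inl ⟨(⟨(x, t), Sum.inl_injective hx⟩, r), hr⟩, rfl⟩
    · exact (Sum.inl_ne_inr hx).elim
    · exact (Sum.inr_ne_inl hx).elim
    · exact ⟨Sum.inr ⟨(⟨(x, t), Sum.inr_injective hx⟩, r), hr⟩, rfl⟩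
  · rintro (z | z) <;> rfl

end Comp

open Charts ClosedCovering

namespace CoveringIso

open Bordant

variable {N₁ T₁ N₂ T₂ N₃ T₃ N₄ T₄ : Type} [TopologicalSpace N₁] [TopologicalSpace T₁]
  [TopologicalSpace N₂] [TopologicalSpace T₂] [TopologicalSpace N₃] [TopologicalSpace T₃]
  [TopologicalSpace N₄] [TopologicalSpace T₄] {d₁ : N₁ → ℕ} {d₂ : N₂ → ℕ} {d₃ : N₃ → ℕ}
  {d₄ : N₄ → ℕ} {A₁ : Charts N₁ d₁} {A₂ : Charts N₂ d₂} {A₃ : Charts N₃ d₃} {A₄ : Charts N₄ d₄}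
  {π₁ : T₁ → N₁} {π₂ : T₂ → N₂} {π₃ : T₃ → N₃} {π₄ : T₄ → N₄}

/-- The composition of isomorphisms. -/
def trans (i : CoveringIso A₁ π₁ A₂ π₂) (j : CoveringIso A₂ π₂ A₃ π₃) :
    CoveringIso A₁ π₁ A₃ π₃ where
  φ := i.φ.trans j.φ
  smooth_φ x := SmoothAt.comp (g := j.φ) (f := i.φ) (j.smooth_φ _) (i.smooth_φ x)
  smooth_symm x := SmoothAt.comp (g := i.φ.symm) (f := j.φ.symm) (i.smooth_symm _) (j.smooth_symm x)
  ψ := i.ψ.trans j.ψ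
  comm t := (j.comm _).trans (congrArg j.φ (i.comm t))

/-- The homeomorphism of the bases. -/
def homeomorph (i : CoveringIso A₁ π₁ A₂ π₂) : N₁ ≃ₜ N₂ where
  toEquiv := i.φ
  continuous_toFun := continuous_iff_continuousAt.2 fun x => (i.smooth_φ x).1
  continuous_invFun := continuous_iff_continuousAt.2 fun x => (i.smooth_symm x).1

/-- The product of isomorphisms. -/
def prodCongr (i : CoveringIso A₁ π₁ A₂ π₂) (j : CoveringIso A₃ π₃ A₄ π₄) :
    CoveringIso (A₁.prod A₃) (prodProj π₁ π₃) (A₂.prod A₄) (prodProj π₂ π₄) where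
  φ := i.φ.prodCongr j.φ
  smooth_φ x := SmoothAt.prodMap (i.smooth_φ x.1) (j.smooth_φ x.2)
  smooth_symm x := SmoothAt.prodMap (i.smooth_symm x.1) (j.smooth_symm x.2)
  ψ := (i.ψ.prodCongr j.homeomorph).sumCongr (i.homeomorph.prodCongr j.ψ)
  comm := by
    rintro (t | t)
    · exact Prod.ext (i.comm t.1) rfl
    · exact Prod.ext rfl (j.comm t.2)

/-- Associativity of the disjoint union. -/
def sumAssoc (A₁ : Charts N₁ d₁) (π₁ : T₁ → N₁) (A₂ : Charts N₂ d₂) (π₂ : T₂ → N₂)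
    (A₃ : Charts N₃ d₃) (π₃ : T₃ → N₃) :
    CoveringIso ((A₁.sum A₂).sum A₃) (Sum.map (Sum.map π₁ π₂) π₃)
      (A₁.sum (A₂.sum A₃)) (Sum.map π₁ (Sum.map π₂ π₃)) where
  φ := .sumAssoc _ _ _
  smooth_φ := smoothAt_sum_iff.2 ⟨smoothAt_sum_iff.2 ⟨fun _ => smoothAt_inl,
    fun _ => SmoothAt.comp (f := Sum.inl) (g := Sum.inr) smoothAt_inr smoothAt_inl⟩,
    fun _ => SmoothAt.comp (f := Sum.inr) (g := Sum.inr) smoothAt_inr smoothAt_inr⟩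
  smooth_symm := smoothAt_sum_iff.2 ⟨
    fun _ => SmoothAt.comp (f := Sum.inl) (g := Sum.inl) smoothAt_inl smoothAt_inl,
    smoothAt_sum_iff.2 ⟨
      fun _ => SmoothAt.comp (f := Sum.inr) (g := Sum.inl) smoothAt_inl smoothAt_inr,
      fun _ => smoothAt_inr⟩⟩
  ψ := .sumAssoc _ _ _
  comm := by rintro ((t | t) | t) <;> rfl

/-- The empty covering is neutral for the disjoint union. -/
def emptySum (A : Charts N₁ d₁) (π : T₁ → N₁) :
    CoveringIso (Charts.empty.sum A) (Sum.map id π) A π where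
  φ := .emptySum _ _
  smooth_φ := smoothAt_sum_iff.2 ⟨fun x => x.elim, fun _ => smoothAt_id⟩
  smooth_symm _ := smoothAt_inr
  ψ := (Homeomorph.sumComm _ _).trans (.sumEmpty _ _)
  comm := by
    rintro (t | t)
    · exact t.elim
    · rfl

/-- Commutativity of the product. -/
def prodComm (A₁ : Charts N₁ d₁) (π₁ : T₁ → N₁) (A₂ : Charts N₂ d₂) (π₂ : T₂ → N₂) :
    CoveringIso (A₁.prod A₂) (prodProj π₁ π₂) (A₂.prod A₁) (prodProj π₂ π₁) where
  φ := .prodComm _ _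
  smooth_φ _ := smoothAt_snd.prodMk smoothAt_fst
  smooth_symm _ := smoothAt_snd.prodMk smoothAt_fst
  ψ := (Homeomorph.sumComm _ _).trans ((Homeomorph.prodComm _ _).sumCongr (.prodComm _ _))
  comm := by rintro (t | t) <;> rfl

/-- Associativity of the product. -/
def prodAssoc (A₁ : Charts N₁ d₁) (π₁ : T₁ → N₁) (A₂ : Charts N₂ d₂) (π₂ : T₂ → N₂)
    (A₃ : Charts N₃ d₃) (π₃ : T₃ → N₃) :
    CoveringIso ((A₁.prod A₂).prod A₃) (prodProj (prodProj π₁ π₂) π₃)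
      (A₁.prod (A₂.prod A₃)) (prodProj π₁ (prodProj π₂ π₃)) where
  φ := .prodAssoc _ _ _
  smooth_φ _ := (smoothAt_fst.fst).prodMk (smoothAt_fst.snd.prodMk smoothAt_snd)
  smooth_symm _ := (smoothAt_fst.prodMk smoothAt_snd.fst).prodMk smoothAt_snd.snd
  ψ := (Homeomorph.sumCongr .sumProdDistrib (.refl _)).trans ((Homeomorph.sumAssoc _ _ _).trans
    (Homeomorph.sumCongr (.prodAssoc _ _ _) ((Homeomorph.sumCongr (.prodAssoc _ _ _)
      (.prodAssoc _ _ _)).trans Homeomorph.prodSumDistrib.symm)))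
  comm := by rintro (⟨t | t, x⟩ | t) <;> rfl

/-- The identity of a point, with empty total space, is neutral for the product. -/
def oneProd (A : Charts N₁ d₁) (π : T₁ → N₁) :
    CoveringIso ((model PUnit).prod A) (prodProj Empty.elim π) A π where
  φ := .punitProd _
  smooth_φ _ := smoothAt_snd
  smooth_symm _ := smoothAt_const.prodMk smoothAt_id
  ψ := (Homeomorph.sumComm _ _).trans ((Homeomorph.sumEmpty _ _).trans (.punitProd _))
  comm := by
    rintro (t | t)
    · exact t.1.elim
    · rfl

/-- An atlas of a closed manifold, and the associated preferred atlas. -/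
def toClosedManifold [T2Space N₁] [CompactSpace N₁] (A : Charts N₁ d₁) (π : T₁ → N₁) :
    CoveringIso A.toClosedManifold.charts π A π where
  φ := .refl _
  smooth_φ := A.smoothAt_ofClosedManifold
  smooth_symm := A.smoothAt_toClosedManifold
  ψ := .refl _
  comm _ := rfl

end CoveringIso

namespace ClosedCovering

open PolySpace

/-- The disjoint union of closed coverings, without the preferred atlas. -/
def isoSum (p q : ClosedCovering) : CoveringIso (p.sum q).base.charts (p.sum q).proj
    (p.base.charts.sum q.base.charts) (Sum.map p.proj q.proj) :=
  .toClosedManifold (p.base.charts.sum q.base.charts) (Sum.map p.proj q.proj)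

/-- The product of closed coverings, without the preferred atlas. -/
def isoProd (p q : ClosedCovering) : CoveringIso (p.prod q).base.charts (p.prod q).proj
    (p.base.charts.prod q.base.charts) (Bordant.prodProj p.proj q.proj) :=
  .toClosedManifold (p.base.charts.prod q.base.charts) (Bordant.prodProj p.proj q.proj)

/-- The composition of closed coverings, without the preferred atlas. -/
def isoComp (p q : ClosedCovering) : CoveringIso (p.comp q).base.charts (p.comp q).proj
    (PolySpace.charts p.isCoveringMap p.base.charts q.base.charts) (compProj p.proj q.proj) :=
  haveI := PolySpace.t2Space (X := q.base.carrier) p.isCoveringMap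
  haveI := PolySpace.compactSpace (X := q.base.carrier) p.isCoveringMap
  .toClosedManifold (PolySpace.charts p.isCoveringMap p.base.charts q.base.charts)
    (compProj p.proj q.proj)

variable {p p' q q' r : ClosedCovering}

lemma cobordant_iff : p.Cobordant q ↔ Bordant p.base.charts p.proj q.base.charts q.proj :=
  ⟨fun h => h.exists_filling, fun ⟨F⟩ => .of_filling F⟩

lemma Cobordant.of_iso (i : CoveringIso p.base.charts p.proj q.base.charts q.proj) :
    p.Cobordant q := cobordant_iff.2 (.of_iso i q.finiteCovering)

lemma Cobordant.symm (h : p.Cobordant q) : q.Cobordant p :=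
  cobordant_iff.2 (cobordant_iff.1 h).symm

lemma Cobordant.trans (h : p.Cobordant q) (h' : q.Cobordant r) : p.Cobordant r := by
  obtain ⟨F⟩ := cobordant_iff.1 h
  obtain ⟨G⟩ := cobordant_iff.1 h'
  exact cobordant_iff.2 ⟨F.trans G p.finiteCovering q.finiteCovering r.finiteCovering⟩

lemma equivalence_cobordant : Equivalence Cobordant :=
  ⟨fun _ => .of_iso (.refl _ _), Cobordant.symm, Cobordant.trans⟩

lemma Cobordant.sum (h : p.Cobordant p') (h' : q.Cobordant q') :
    (p.sum q).Cobordant (p'.sum q') :=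
  cobordant_iff.2 (((cobordant_iff.1 h).sum (cobordant_iff.1 h')).congr (isoSum p q) (isoSum p' q'))

lemma Cobordant.prod_comm (p q : ClosedCovering) : (p.prod q).Cobordant (q.prod p) :=
  .of_iso (((isoProd p q).trans (.prodComm _ _ _ _)).trans (isoProd q p).symm)

lemma Cobordant.prod_right (h : p.Cobordant p') (q : ClosedCovering) :
    (p.prod q).Cobordant (p'.prod q) :=
  cobordant_iff.2 (((cobordant_iff.1 h).prod_right q.finiteCovering).congr
    (isoProd p q) (isoProd p' q))

lemma Cobordant.prod (h : p.Cobordant p') (h' : q.Cobordant q') :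
    (p.prod q).Cobordant (p'.prod q') :=
  (h.prod_right q).trans (((prod_comm p' q).trans (h'.prod_right p')).trans (prod_comm q' p'))

lemma Cobordant.comp (h : p.Cobordant p') (h' : q.Cobordant q') :
    (p.comp q).Cobordant (p'.comp q') := by
  have := (p.finiteCovering.sumMap p'.finiteCovering).finite_fiber
  have h1 : (p.comp q).Cobordant (p'.comp q) :=
    cobordant_iff.2 (((cobordant_iff.1 h).comp_left p.finiteCovering p'.finiteCovering
      q.finiteCovering).congr (isoComp p q) (isoComp p' q))
  obtain ⟨F⟩ := cobordant_iff.1 h'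
  have h2 : Bordant _ _ _ _ := F.nonempty_compProj p'.finiteCovering p'.base.charts
  exact h1.trans (cobordant_iff.2 (h2.congr (isoComp p' q) (isoComp p' q')))

/-- The empty covering. -/
def empty : ClosedCovering :=
  ofIsLocalHomeomorph Charts.empty.toClosedManifold (T := Empty) id
    (Homeomorph.refl Empty).isLocalHomeomorph

/-- The covering of a point with an empty fibre. -/
def one : ClosedCovering :=
  ofIsLocalHomeomorph (model PUnit).toClosedManifold (T := Empty) Empty.elim
    (.mk _ fun t => t.elim)

/-- The empty covering, without the preferred atlas. -/
def isoEmpty : CoveringIso empty.base.charts empty.proj Charts.empty id := .toClosedManifold _ _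

/-- The covering of a point with an empty fibre, without the preferred atlas. -/
def isoOne : CoveringIso one.base.charts one.proj (model PUnit) Empty.elim := .toClosedManifold _ _

lemma Cobordant.sum_assoc (p q r : ClosedCovering) :
    ((p.sum q).sum r).Cobordant (p.sum (q.sum r)) :=
  .of_iso ((((isoSum _ _).trans ((isoSum p q).sumCongr (.refl _ _))).trans
    (.sumAssoc _ _ _ _ _ _)).trans
      (((isoSum _ _).trans ((CoveringIso.refl _ _).sumCongr (isoSum q r))).symm))

lemma Cobordant.empty_sum (p : ClosedCovering) : (empty.sum p).Cobordant p :=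
  .of_iso (((isoSum _ _).trans (isoEmpty.sumCongr (.refl _ _))).trans (.emptySum _ _))

lemma Cobordant.sum_self (p : ClosedCovering) : (p.sum p).Cobordant empty := by
  have F := Filling.cylinder p.base.charts p.finiteCovering
  have h : Bordant (p.base.charts.sum p.base.charts) (Sum.map p.proj p.proj) Charts.empty id :=
    ⟨F.ofIso ((CoveringIso.sumComm _ _ _ _).trans (.emptySum _ _))⟩
  exact cobordant_iff.2 (h.congr (isoSum p p) isoEmpty)

lemma Cobordant.prod_assoc (p q r : ClosedCovering) :
    ((p.prod q).prod r).Cobordant (p.prod (q.prod r)) :=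
  .of_iso ((((isoProd _ _).trans ((isoProd p q).prodCongr (.refl _ _))).trans
    (.prodAssoc _ _ _ _ _ _)).trans
      (((isoProd _ _).trans ((CoveringIso.refl _ _).prodCongr (isoProd q r))).symm))

lemma Cobordant.one_prod (p : ClosedCovering) : (one.prod p).Cobordant p :=
  .of_iso (((isoProd _ _).trans (isoOne.prodCongr (.refl _ _))).trans (.oneProd _ _))

lemma Cobordant.sum_prod (p q r : ClosedCovering) :
    ((p.sum q).prod r).Cobordant ((p.prod r).sum (q.prod r)) :=
  .of_iso ((((isoProd _ _).trans ((isoSum p q).prodCongr (.refl _ _))).trans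
    (CoveringIso.sumProd _ _ _ _ _ _).symm).trans
      (((isoSum _ _).trans ((isoProd p r).sumCongr (isoProd q r))).symm))

end ClosedCovering

namespace CobordismClasses

open ClosedCovering

/-- The commutative ring of cobordism classes. -/
@[reducible] def commRing : CommRing CobordismClasses :=
  letI : Add CobordismClasses := ⟨Quot.map₂ ClosedCovering.sum
    (fun p _ _ h => (equivalence_cobordant.refl p).sum h)
    (fun _ _ q h => h.sum (equivalence_cobordant.refl q))⟩
  letI : Mul CobordismClasses := ⟨Quot.map₂ ClosedCovering.prod
    (fun p _ _ h => (equivalence_cobordant.refl p).prod h)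
    (fun _ _ q h => h.prod (equivalence_cobordant.refl q))⟩
  letI : Neg CobordismClasses := ⟨id⟩
  letI : Zero CobordismClasses := ⟨mk empty⟩
  letI : One CobordismClasses := ⟨mk one⟩
  have mul_comm (a b : CobordismClasses) : a * b = b * a := by
    induction a using Quot.ind
    induction b using Quot.ind
    exact Quot.sound (.prod_comm _ _)
  .ofMinimalAxioms
    (by rintro ⟨p⟩ ⟨q⟩ ⟨r⟩; exact Quot.sound (.sum_assoc p q r))
    (by rintro ⟨p⟩; exact Quot.sound (.empty_sum p))
    (by rintro ⟨p⟩; exact Quot.sound (.sum_self p))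
    (by rintro ⟨p⟩ ⟨q⟩ ⟨r⟩; exact Quot.sound (.prod_assoc p q r))
    mul_comm
    (by rintro ⟨p⟩; exact Quot.sound (.one_prod p))
    (by
      intro a b c
      rw [mul_comm a, mul_comm a, mul_comm a]
      obtain ⟨p⟩ := a
      obtain ⟨q⟩ := b
      obtain ⟨r⟩ := c
      exact Quot.sound (.sum_prod q r p))

end CobordismClasses

open Charts ClosedCovering

/-- `ι` and `κ` embed the covering `π₀` into the covering `π`, as the part of `π` over the
components whose dimension lies in `D`. -/
structure IsPart {N T N₀ T₀ : Type} [TopologicalSpace N] [TopologicalSpace T]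
    [TopologicalSpace N₀] [TopologicalSpace T₀] {d : N → ℕ} {d₀ : N₀ → ℕ} (D : Set ℕ)
    (A : Charts N d) (π : T → N) (A₀ : Charts N₀ d₀) (π₀ : T₀ → N₀) (ι : N₀ → N) (κ : T₀ → T) :
    Prop where
  smooth_ι : ∀ x, SmoothAt A₀ A ι x
  smooth_inv : ∀ x, ∃ ρ : N → N₀, Function.LeftInverse ρ ι ∧ SmoothAt A A₀ ρ (ι x)
  mem_range_ι : ∀ x, x ∈ range ι ↔ d x ∈ D
  continuous_κ : Continuous κ
  injective_κ : Function.Injective κ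
  comm : ∀ t, π (κ t) = ι (π₀ t)
  mem_range_κ : ∀ t, d (π t) ∈ D → t ∈ range κ

namespace IsPart

variable {N T N₀ T₀ N₁ T₁ N' T' N₀' T₀' : Type} [TopologicalSpace N] [TopologicalSpace T]
  [TopologicalSpace N₀] [TopologicalSpace T₀] [TopologicalSpace N₁] [TopologicalSpace T₁]
  [TopologicalSpace N'] [TopologicalSpace T'] [TopologicalSpace N₀'] [TopologicalSpace T₀']
  {d : N → ℕ} {d₀ : N₀ → ℕ} {d₁ : N₁ → ℕ} {d' : N' → ℕ} {d₀' : N₀' → ℕ} {D D' : Set ℕ}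
  {A : Charts N d} {π : T → N} {A₀ : Charts N₀ d₀} {π₀ : T₀ → N₀} {A₁ : Charts N₁ d₁}
  {π₁ : T₁ → N₁} {A' : Charts N' d'} {π' : T' → N'} {A₀' : Charts N₀' d₀'} {π₀' : T₀' → N₀'}
  {ι : N₀ → N} {κ : T₀ → T} {ι₁ : N₁ → N} {κ₁ : T₁ → T} {ι' : N₀' → N'} {κ' : T₀' → T'}

lemma injective_ι (h : IsPart D A π A₀ π₀ ι κ) : Function.Injective ι := fun x y hxy => by
  obtain ⟨ρ, hρ, -⟩ := h.smooth_inv x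
  exact hρ.injective hxy

lemma isOpen_range_ι (h : IsPart D A π A₀ π₀ ι κ) : IsOpen (range ι) := by
  rw [show range ι = d ⁻¹' D from ext h.mem_range_ι]
  exact (isOpen_discrete D).preimage A.continuous_dim

lemma dim_eq (h : IsPart D A π A₀ π₀ ι κ) (x : N₀) : d (ι x) = d₀ x := by
  obtain ⟨ρ, h1, h2⟩ := h.smooth_inv x
  refine ((h.smooth_ι x).dim_eq h2 (.of_forall h1) ?_).symm
  filter_upwards [h.isOpen_range_ι.mem_nhds (mem_range_self x)]
  rintro _ ⟨y, rfl⟩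
  exact congrArg ι (h1 y)

lemma dim_mem (h : IsPart D A π A₀ π₀ ι κ) (x : N₀) : d₀ x ∈ D := by
  rw [← h.dim_eq]
  exact (h.mem_range_ι _).1 (mem_range_self x)

/-- A covering all of whose components have dimension in `D`. -/
lemma refl (A : Charts N d) (π : T → N) (h : ∀ x, d x ∈ D) : IsPart D A π A π id id where
  smooth_ι _ := smoothAt_id
  smooth_inv _ := ⟨id, fun _ => rfl, smoothAt_id⟩
  mem_range_ι x := ⟨fun _ => h x, fun _ => ⟨x, rfl⟩⟩
  continuous_κ := continuous_id
  injective_κ := Function.injective_id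
  comm _ := rfl
  mem_range_κ t _ := ⟨t, rfl⟩

/-- A covering none of whose components has dimension in `D`. -/
lemma of_isEmpty [IsEmpty N₀] (A : Charts N d) (π : T → N) (A₀ : Charts N₀ d₀) (π₀ : T₀ → N₀)
    (h : ∀ x, d x ∉ D) : IsPart D A π A₀ π₀ isEmptyElim fun t => isEmptyElim (π₀ t) where
  smooth_ι x := isEmptyElim x
  smooth_inv x := isEmptyElim x
  mem_range_ι x := ⟨fun ⟨y, _⟩ => isEmptyElim y, fun hx => (h x hx).elim⟩
  continuous_κ := continuous_iff_continuousAt.2 fun t => isEmptyElim (π₀ t)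
  injective_κ t _ := isEmptyElim (π₀ t)
  comm t := isEmptyElim (π₀ t)
  mem_range_κ t ht := (h _ ht).elim

/-- Parts of a disjoint union. -/
lemma sum (h : IsPart D A π A₀ π₀ ι κ) (h' : IsPart D A' π' A₀' π₀' ι' κ') :
    IsPart D (A.sum A') (Sum.map π π') (A₀.sum A₀') (Sum.map π₀ π₀') (Sum.map ι ι')
      (Sum.map κ κ') where
  smooth_ι := by
    rintro (x | x)
    · exact smoothAt_sum_inl.2 (SmoothAt.comp (g := Sum.inl) smoothAt_inl (h.smooth_ι x))
    · exact smoothAt_sum_inr.2 (SmoothAt.comp (g := Sum.inr) smoothAt_inr (h'.smooth_ι x))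
  smooth_inv := by
    have ho : Function.Injective (Sum.map ι ι') :=
      Sum.map_injective.2 ⟨h.injective_ι, h'.injective_ι⟩
    rintro (x | x)
    · obtain ⟨ρ, h1, h2⟩ := h.smooth_inv x
      have : Nonempty (N₀ ⊕ N₀') := ⟨Sum.inl x⟩
      have h3 : SmoothAt (A.sum A') (A₀.sum A₀') (Sum.elim (Sum.inl ∘ ρ) fun _ => Sum.inl x)
          (Sum.inl (ι x)) := smoothAt_sum_inl.2 (SmoothAt.comp (g := Sum.inl) smoothAt_inl h2)
      refine ⟨Function.invFun (Sum.map ι ι'), Function.leftInverse_invFun ho, h3.congr ?_⟩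
      filter_upwards [(isOpenMap_inl _ h.isOpen_range_ι).mem_nhds ⟨_, mem_range_self x, rfl⟩]
      rintro _ ⟨_, ⟨y, rfl⟩, rfl⟩
      exact (Function.leftInverse_invFun ho (Sum.inl y)).trans (congrArg Sum.inl (h1 y).symm)
    · obtain ⟨ρ, h1, h2⟩ := h'.smooth_inv x
      have : Nonempty (N₀ ⊕ N₀') := ⟨Sum.inr x⟩
      have h3 : SmoothAt (A.sum A') (A₀.sum A₀') (Sum.elim (fun _ => Sum.inr x) (Sum.inr ∘ ρ))
          (Sum.inr (ι' x)) := smoothAt_sum_inr.2 (SmoothAt.comp (g := Sum.inr) smoothAt_inr h2)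
      refine ⟨Function.invFun (Sum.map ι ι'), Function.leftInverse_invFun ho, h3.congr ?_⟩
      filter_upwards [(isOpenMap_inr _ h'.isOpen_range_ι).mem_nhds ⟨_, mem_range_self x, rfl⟩]
      rintro _ ⟨_, ⟨y, rfl⟩, rfl⟩
      exact (Function.leftInverse_invFun ho (Sum.inr y)).trans (congrArg Sum.inr (h1 y).symm)
  mem_range_ι := by
    rintro (x | x)
    · simpa using h.mem_range_ι x
    · simpa using h'.mem_range_ι x
  continuous_κ := h.continuous_κ.sumMap h'.continuous_κ
  injective_κ := Sum.map_injective.2 ⟨h.injective_κ, h'.injective_κ⟩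
  comm := by
    rintro (t | t)
    · exact congrArg Sum.inl (h.comm t)
    · exact congrArg Sum.inr (h'.comm t)
  mem_range_κ := by
    rintro (t | t) ht
    · obtain ⟨s, rfl⟩ := h.mem_range_κ t ht
      exact ⟨Sum.inl s, rfl⟩
    · obtain ⟨s, rfl⟩ := h'.mem_range_κ t ht
      exact ⟨Sum.inr s, rfl⟩

/-- The union of two disjoint parts. -/
lemma union (h : IsPart D A π A₀ π₀ ι κ) (h' : IsPart D' A π A₁ π₁ ι₁ κ₁) (hD : Disjoint D D') :
    IsPart (D ∪ D') A π (A₀.sum A₁) (Sum.map π₀ π₁) (Sum.elim ι ι₁) (Sum.elim κ κ₁) where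
  smooth_ι := smoothAt_sum_iff.2 ⟨h.smooth_ι, h'.smooth_ι⟩
  smooth_inv := by
    have ho : Function.Injective (Sum.elim ι ι₁) := h.injective_ι.sumElim h'.injective_ι
      fun x y hxy => disjoint_left.1 hD ((h.mem_range_ι _).1 ⟨x, rfl⟩)
        ((h'.mem_range_ι _).1 ⟨y, hxy.symm⟩)
    rintro (x | x)
    · obtain ⟨ρ, h1, h2⟩ := h.smooth_inv x
      have : Nonempty (N₀ ⊕ N₁) := ⟨Sum.inl x⟩
      refine ⟨Function.invFun (Sum.elim ι ι₁), Function.leftInverse_invFun ho,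
        SmoothAt.congr (SmoothAt.comp (g := Sum.inl) smoothAt_inl h2) ?_⟩
      filter_upwards [h.isOpen_range_ι.mem_nhds (mem_range_self x)]
      rintro _ ⟨y, rfl⟩
      exact (Function.leftInverse_invFun ho (Sum.inl y)).trans (congrArg Sum.inl (h1 y).symm)
    · obtain ⟨ρ, h1, h2⟩ := h'.smooth_inv x
      have : Nonempty (N₀ ⊕ N₁) := ⟨Sum.inr x⟩
      refine ⟨Function.invFun (Sum.elim ι ι₁), Function.leftInverse_invFun ho,
        SmoothAt.congr (SmoothAt.comp (g := Sum.inr) smoothAt_inr h2) ?_⟩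
      filter_upwards [h'.isOpen_range_ι.mem_nhds (mem_range_self x)]
      rintro _ ⟨y, rfl⟩
      exact (Function.leftInverse_invFun ho (Sum.inr y)).trans (congrArg Sum.inr (h1 y).symm)
  mem_range_ι x := by
    rw [Set.Sum.elim_range, mem_union, h.mem_range_ι, h'.mem_range_ι, mem_union]
  continuous_κ := h.continuous_κ.sumElim h'.continuous_κ
  injective_κ := h.injective_κ.sumElim h'.injective_κ fun s t hst =>
    disjoint_left.1 hD ((h.mem_range_ι _).1 ⟨_, (h.comm s).symm⟩)
      ((h'.mem_range_ι _).1 ⟨_, (h'.comm t).symm.trans (congrArg π hst.symm)⟩)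
  comm := by
    rintro (t | t)
    · exact h.comm t
    · exact h'.comm t
  mem_range_κ t ht := by
    rw [Set.Sum.elim_range]
    exact ht.imp (h.mem_range_κ t) (h'.mem_range_κ t)

end IsPart

namespace Filling

variable {N T N₀ T₀ : Type} [TopologicalSpace N] [TopologicalSpace T] [TopologicalSpace N₀]
  [TopologicalSpace T₀] {d : N → ℕ} {d₀ : N₀ → ℕ} {D : Set ℕ} {A : Charts N d} {π : T → N}
  {A₀ : Charts N₀ d₀} {π₀ : T₀ → N₀} {ι : N₀ → N} {κ : T₀ → T}

/-- The components of a filling which fill the components of dimension in `D`. -/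
def domain (F : Filling A π) (D : Set ℕ) : Set F.X := F.dim ⁻¹' ((· + 1) '' D)

lemma isClopen_domain (F : Filling A π) (D : Set ℕ) : IsClopen (F.domain D) :=
  (isClopen_discrete _).preimage F.A.continuous_dim

lemma e_mem_domain (F : Filling A π) {z : N × ℝ} : F.e z ∈ F.domain D ↔ d z.1 ∈ D := by
  rw [domain, mem_preimage, dim_e]
  exact (add_left_injective 1).mem_set_image

/-- The end of a filling of a part. -/
def partEnd (F : Filling A π) (h : IsPart D A π A₀ π₀ ι κ) (z : N₀ × ℝ) : F.domain D :=
  ⟨F.e (ι z.1, z.2), F.e_mem_domain.2 ((h.mem_range_ι _).1 (mem_range_self z.1))⟩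

lemma partEnd_image (F : Filling A π) (h : IsPart D A π A₀ π₀ ι κ) (s : Set ℝ) :
    F.partEnd h '' {z | z.2 ∈ s} = Subtype.val ⁻¹' (F.e '' {z | z.2 ∈ s}) := by
  ext ⟨x, hx⟩
  constructor
  · rintro ⟨z, hz, hzx⟩
    exact ⟨_, hz, congrArg Subtype.val hzx⟩
  · rintro ⟨⟨y, s⟩, hz, rfl⟩
    obtain ⟨x, rfl⟩ := (h.mem_range_ι y).2 (F.e_mem_domain.1 hx)
    exact ⟨(x, s), hz, rfl⟩

lemma range_partEnd (F : Filling A π) (h : IsPart D A π A₀ π₀ ι κ) :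
    range (F.partEnd h) = Subtype.val ⁻¹' range F.e := by
  simpa using F.partEnd_image h univ

/-- The covering over the end of a filling of a part. -/
def partLift (F : Filling A π) (h : IsPart D A π A₀ π₀ ι κ) (z : T₀ × ℝ) : F.P ⁻¹' F.domain D :=
  ⟨F.lift (κ z.1, z.2), by
    rw [mem_preimage, F.P_lift, h.comm]
    exact (F.partEnd h (π₀ z.1, z.2)).2⟩

lemma exists_smooth_partEnd_inv (F : Filling A π) (h : IsPart D A π A₀ π₀ ι κ) (z : N₀ × ℝ) :
    ∃ ρ : F.domain D → N₀ × ℝ, Function.LeftInverse ρ (F.partEnd h) ∧ SmoothAt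
      (F.A.comap (F.isClopen_domain D).isOpen.isOpenEmbedding_subtypeVal.isLocalHomeomorph)
      (A₀.prod (model ℝ)) ρ (F.partEnd h z) := by
  obtain ⟨ρ, h1, h2⟩ := F.smooth_inv (ι z.1, z.2)
  obtain ⟨σ, h3, h4⟩ := h.smooth_inv z.1
  refine ⟨fun x => (σ (ρ x.1).1, (ρ x.1).2), fun w => ?_, ?_⟩
  · change (σ (ρ (F.e (ι w.1, w.2))).1, (ρ (F.e (ι w.1, w.2))).2) = w
    rw [h1, h3]
  · have h5 : SmoothAt (F.A.comap
        (F.isClopen_domain D).isOpen.isOpenEmbedding_subtypeVal.isLocalHomeomorph)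
        (A.prod (model ℝ)) (fun x : F.domain D => ρ x.1) (F.partEnd h z) :=
      SmoothAt.comp (g := ρ) h2 (smoothAt_of_comap _)
    exact (SmoothAt.comp_of_eq (g := σ) h4 h5.fst (Prod.ext_iff.1 (h1 _)).1).prodMk h5.snd

/-- A filling of a part. -/
def ofIsPart (F : Filling A π) (h : IsPart D A π A₀ π₀ ι κ) : Filling A₀ π₀ where
  X := F.domain D
  dim := F.dim ∘ Subtype.val
  A := F.A.comap (F.isClopen_domain D).isOpen.isOpenEmbedding_subtypeVal.isLocalHomeomorph
  S := F.P ⁻¹' F.domain D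
  P := (F.domain D).restrictPreimage F.P
  finiteCovering := F.finiteCovering.restrictPreimage _
  e := F.partEnd h
  smooth_e z := smoothAt_subtype_mk (F.isClopen_domain D).isOpen
    (SmoothAt.comp (g := F.e) (F.smooth_e _) (((h.smooth_ι _).comp smoothAt_fst).prodMk
      smoothAt_snd))
  smooth_inv := F.exists_smooth_partEnd_inv h
  isOpen_range := by
    rw [range_partEnd]
    exact F.isOpen_range.preimage continuous_subtype_val
  isClosed_end := by
    rw [show {z : N₀ × ℝ | z.2 ≤ 0} = {z | z.2 ∈ Iic 0} from rfl, partEnd_image]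
    exact F.isClosed_end.preimage continuous_subtype_val
  isCompact_core := by
    rw [show {z : N₀ × ℝ | z.2 < 0} = {z | z.2 ∈ Iio 0} from rfl, partEnd_image, ← preimage_compl]
    exact (F.isClopen_domain D).isClosed.isClosedEmbedding_subtypeVal.isCompact_preimage
      F.isCompact_core
  lift := F.partLift h
  continuous_lift := (F.continuous_lift.comp
    ((h.continuous_κ.comp continuous_fst).prodMk continuous_snd)).subtype_mk _
  injective_lift z w hzw := by
    have := F.injective_lift (congrArg Subtype.val hzw)
    exact Prod.ext (h.injective_κ (Prod.ext_iff.1 this).1) (Prod.ext_iff.1 this).2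
  P_lift z := Subtype.ext ((F.P_lift _).trans (by rw [h.comm]; rfl))
  mem_range_lift := by
    rintro ⟨s, hs⟩ hs'
    rw [range_partEnd] at hs'
    obtain ⟨⟨t, a⟩, rfl⟩ := F.mem_range_lift s hs'
    rw [mem_preimage, F.P_lift, e_mem_domain] at hs
    obtain ⟨t, rfl⟩ := h.mem_range_κ t hs
    exact ⟨(t, a), rfl⟩

end Filling

namespace ClosedCovering

variable {p q p₀ q₀ : ClosedCovering} {D : Set ℕ}

lemma Cobordant.of_isPart (h : p.Cobordant q) {ι κ ι' κ'}
    (i : IsPart D p.base.charts p.proj p₀.base.charts p₀.proj ι κ)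
    (j : IsPart D q.base.charts q.proj q₀.base.charts q₀.proj ι' κ') : p₀.Cobordant q₀ := by
  obtain ⟨F⟩ := cobordant_iff.1 h
  exact cobordant_iff.2 ⟨F.ofIsPart (i.sum j)⟩

end ClosedCovering

open Charts ClosedCovering

lemma IsPart.of_iso {N T N₀ T₀ N₁ T₁ : Type} [TopologicalSpace N] [TopologicalSpace T]
    [TopologicalSpace N₀] [TopologicalSpace T₀] [TopologicalSpace N₁] [TopologicalSpace T₁]
    {d : N → ℕ} {d₀ : N₀ → ℕ} {d₁ : N₁ → ℕ} {D : Set ℕ} {A : Charts N d} {π : T → N}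
    {A₀ : Charts N₀ d₀} {π₀ : T₀ → N₀} {A₁ : Charts N₁ d₁} {π₁ : T₁ → N₁} {ι : N₀ → N} {κ : T₀ → T}
    (h : IsPart D A π A₀ π₀ ι κ) (i : CoveringIso A₁ π₁ A₀ π₀) :
    IsPart D A π A₁ π₁ (ι ∘ i.φ) (κ ∘ i.ψ) where
  smooth_ι x := SmoothAt.comp (g := ι) (f := i.φ) (h.smooth_ι _) (i.smooth_φ x)
  smooth_inv x := by
    obtain ⟨ρ, h1, h2⟩ := h.smooth_inv (i.φ x)
    exact ⟨i.φ.symm ∘ ρ, fun y => i.φ.symm_apply_eq.2 (h1 _),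
      SmoothAt.comp (g := i.φ.symm) (f := ρ) (i.smooth_symm _) h2⟩
  mem_range_ι x := by rw [i.φ.surjective.range_comp, h.mem_range_ι]
  continuous_κ := h.continuous_κ.comp i.ψ.continuous
  injective_κ := h.injective_κ.comp i.ψ.injective
  comm t := (h.comm _).trans (congrArg ι (i.comm t))
  mem_range_κ t ht := by
    rw [i.ψ.surjective.range_comp]
    exact h.mem_range_κ t ht

/-- The part of a covering over an open and closed set of components. -/
lemma IsPart.restrict {N T : Type} [TopologicalSpace N] [TopologicalSpace T] {d : N → ℕ}
    (A : Charts N d) {π : T → N} {D : Set ℕ} (ho : IsOpen (d ⁻¹' D)) :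
    IsPart D A π (A.comap ho.isOpenEmbedding_subtypeVal.isLocalHomeomorph)
      ((d ⁻¹' D).restrictPreimage π) Subtype.val Subtype.val where
  smooth_ι _ := smoothAt_of_comap _
  smooth_inv x := by
    have : Nonempty (d ⁻¹' D) := ⟨x⟩
    have h1 := Function.leftInverse_invFun (Subtype.val_injective (p := (· ∈ d ⁻¹' D)))
    obtain ⟨ρ, hρ⟩ : ∃ ρ : N → d ⁻¹' D, Function.LeftInverse ρ Subtype.val := ⟨_, h1⟩
    have h2 : ∀ᶠ y in 𝓝 x.1, (ρ y).1 = y := by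
      filter_upwards [ho.mem_nhds x.2] with y hy
      exact congrArg Subtype.val (hρ ⟨y, hy⟩)
    exact ⟨ρ, hρ, smoothAt_section _ (IsInducing.subtypeVal.continuousAt_iff.2
      (continuousAt_id.congr (h2.mono fun _ h => h.symm))) h2⟩
  mem_range_ι x := by simp
  continuous_κ := continuous_subtype_val
  injective_κ := Subtype.val_injective
  comm _ := rfl
  mem_range_κ t ht := ⟨⟨t, ht⟩, rfl⟩

namespace ClosedCovering

variable {p q p₀ q₀ p₁ r : ClosedCovering} {D D' : Set ℕ}

/-- `p₀` is the part of `p` over the components whose dimension lies in `D`. -/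
def HasPart (D : Set ℕ) (p p₀ : ClosedCovering) : Prop :=
  ∃ ι κ, IsPart D p.base.charts p.proj p₀.base.charts p₀.proj ι κ

lemma exists_hasPart (D : Set ℕ) (p : ClosedCovering) : ∃ p₀, HasPart D p p₀ := by
  have hV : IsClopen (p.base.dim ⁻¹' D) := (isClopen_discrete D).preimage p.base.continuous_dim
  have : CompactSpace (p.base.dim ⁻¹' D) := isCompact_iff_compactSpace.1 hV.isClosed.isCompact
  have : CompactSpace (p.proj ⁻¹' (p.base.dim ⁻¹' D)) := isCompact_iff_compactSpace.1
    (hV.isClosed.preimage p.isCoveringMap.continuous).isCompact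
  exact ⟨ofIsLocalHomeomorph
    (p.base.charts.comap hV.isOpen.isOpenEmbedding_subtypeVal.isLocalHomeomorph).toClosedManifold
    ((p.base.dim ⁻¹' D).restrictPreimage p.proj)
    (p.finiteCovering.restrictPreimage _).isLocalHomeomorph, _, _,
    (IsPart.restrict p.base.charts hV.isOpen).of_iso (.toClosedManifold _ _)⟩

lemma HasPart.dim_mem (h : HasPart D p p₀) (x) : p₀.base.dim x ∈ D := by
  obtain ⟨ι, κ, h⟩ := h
  exact h.dim_mem x

lemma HasPart.refl (h : ∀ x, p.base.dim x ∈ D) : HasPart D p p := ⟨_, _, .refl _ _ h⟩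

lemma hasPart_empty (h : ∀ x, p.base.dim x ∉ D) : HasPart D p empty :=
  haveI : IsEmpty empty.base.carrier := inferInstanceAs (IsEmpty Empty)
  ⟨_, _, .of_isEmpty _ _ _ _ h⟩

lemma HasPart.cobordant (h : HasPart D p p₀) (h' : HasPart D q q₀) (hpq : p.Cobordant q) :
    p₀.Cobordant q₀ := by
  obtain ⟨ι, κ, h⟩ := h
  obtain ⟨ι', κ', h'⟩ := h'
  exact hpq.of_isPart h h'

lemma HasPart.cobordant_sum (h : HasPart D p p₀) (h' : HasPart D q q₀)
    (h'' : HasPart D (p.sum q) r) : r.Cobordant (p₀.sum q₀) := by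
  obtain ⟨ι, κ, h⟩ := h
  obtain ⟨ι', κ', h'⟩ := h'
  obtain ⟨ι'', κ'', h''⟩ := h''
  obtain ⟨F⟩ : Bordant (p.sum q).base.charts (p.sum q).proj (p.base.charts.sum q.base.charts)
    (Sum.map p.proj q.proj) := .of_iso (isoSum p q) (p.finiteCovering.sumMap q.finiteCovering)
  exact cobordant_iff.2 (Bordant.congr ⟨F.ofIsPart (h''.sum (h.sum h'))⟩ (.refl _ _)
    (isoSum p₀ q₀))

lemma HasPart.cobordant_sum_of_disjoint (h : HasPart D p p₀) (h' : HasPart D' p p₁)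
    (hD : Disjoint D D') (hp : ∀ x, p.base.dim x ∈ D ∪ D') : p.Cobordant (p₀.sum p₁) := by
  obtain ⟨ι, κ, h⟩ := h
  obtain ⟨ι', κ', h'⟩ := h'
  have h1 := (h.union h' hD).of_iso (isoSum p₀ p₁)
  exact (equivalence_cobordant.refl p).of_isPart (.refl _ _ hp) h1

lemma exists_dim_lt (p : ClosedCovering) : ∃ k, ∀ x, p.base.dim x < k := by
  obtain ⟨k, hk⟩ := (isCompact_range p.base.continuous_dim).finite_of_discrete.bddAbove
  exact ⟨k + 1, fun x => Nat.lt_succ_of_le (hk (mem_range_self x))⟩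

/-- The fibre of a composition of coverings. -/
def compFiberEquiv (p q : ClosedCovering) (x : PolySpace p.proj q.base.carrier) :
    ((p.comp q).proj ⁻¹' {x} : Set _) ≃ Σ t : p.proj ⁻¹' {x.base}, q.proj ⁻¹' {x.map t} where
  toFun z := ⟨⟨z.1.fst.snd, z.1.fst.2.symm.trans (congrArg PolySpace.base z.2)⟩,
    ⟨z.1.snd, by obtain ⟨z, rfl⟩ := z; exact z.2.symm⟩⟩
  invFun w := ⟨⟨(⟨(x, w.1.1), w.1.2.symm⟩, w.2.1), w.2.2.symm⟩, rfl⟩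
  left_inv := by rintro ⟨z, rfl⟩; rfl
  right_inv _ := rfl

end ClosedCovering

namespace CobordismClasses

instance : CommRing CobordismClasses := commRing

lemma mk_add (p q : ClosedCovering) : mk p + mk q = mk (p.sum q) := rfl

lemma mk_eq_mk {p q : ClosedCovering} (h : p.Cobordant q) : mk p = mk q := Quot.sound h

lemma add_self (a : CobordismClasses) : a + a = 0 := by
  obtain ⟨p⟩ := a
  exact mk_eq_mk (.sum_self p)

instance : Module (ZMod 2) CobordismClasses :=
  AddCommGroup.zmodModule fun a => by rw [two_nsmul, add_self]

instance : Algebra (ZMod 2) CobordismClasses :=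
  .ofModule (fun r x y => ZMod.map_smul (AddMonoidHom.mulRight y) r x)
    fun r x y => ZMod.map_smul (AddMonoidHom.mulLeft x) r y

/-- The cobordism classes of coverings of manifolds of dimension `d`. -/
def dimSubmodule (d : ℕ) : Submodule (ZMod 2) CobordismClasses :=
  AddSubgroup.toZModSubmodule 2
    { carrier := ofDim d
      add_mem' := by
        rintro _ _ ⟨p, hp, rfl⟩ ⟨q, hq, rfl⟩
        exact ⟨p.sum q, Sum.rec hp hq, rfl⟩
      zero_mem' := ⟨empty, fun x => Empty.elim x, rfl⟩
      neg_mem' := fun h => h }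

/-- The part of dimension `d` of a cobordism class. -/
def dimPart (d : ℕ) : CobordismClasses →ₗ[ZMod 2] CobordismClasses :=
  AddMonoidHom.toZModLinearMap 2
    { toFun := Quot.map (fun p => (exists_hasPart {d} p).choose) fun p q =>
        (exists_hasPart {d} p).choose_spec.cobordant (exists_hasPart {d} q).choose_spec
      map_zero' := mk_eq_mk ((exists_hasPart {d} empty).choose_spec.cobordant
        (hasPart_empty fun x => Empty.elim x) (equivalence_cobordant.refl _))
      map_add' := by
        rintro ⟨p⟩ ⟨q⟩
        exact mk_eq_mk ((exists_hasPart {d} p).choose_spec.cobordant_sum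
          (exists_hasPart {d} q).choose_spec (exists_hasPart {d} (p.sum q)).choose_spec) }

lemma dimPart_mk {d : ℕ} {p p₀ : ClosedCovering} (h : HasPart {d} p p₀) :
    dimPart d (mk p) = mk p₀ :=
  mk_eq_mk ((exists_hasPart {d} p).choose_spec.cobordant h (equivalence_cobordant.refl _))

lemma dimPart_of_mem {d : ℕ} {a : CobordismClasses} (ha : a ∈ dimSubmodule d) :
    dimPart d a = a := by
  obtain ⟨p, hp, rfl⟩ := ha
  exact dimPart_mk (.refl hp)

lemma dimPart_of_mem_of_ne {d e : ℕ} {a : CobordismClasses} (ha : a ∈ dimSubmodule e) (h : e ≠ d) :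
    dimPart d a = 0 := by
  obtain ⟨p, hp, rfl⟩ := ha
  exact dimPart_mk (hasPart_empty fun x hx => h ((hp x).symm.trans hx))

lemma iSupIndep_dimSubmodule : iSupIndep dimSubmodule := by
  intro d
  rw [Submodule.disjoint_def]
  intro a ha ha'
  have : ⨆ (e : ℕ) (_ : e ≠ d), dimSubmodule e ≤ LinearMap.ker (dimPart d) :=
    iSup₂_le fun e he a ha => dimPart_of_mem_of_ne ha he
  rw [← dimPart_of_mem ha]
  exact this ha'

lemma mk_mem_iSup_dimSubmodule (k : ℕ) (p : ClosedCovering) (hp : ∀ x, p.base.dim x < k) :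
    mk p ∈ ⨆ d, dimSubmodule d := by
  induction k generalizing p with
  | zero => exact Submodule.mem_iSup_of_mem 0 ⟨p, fun x => absurd (hp x) (Nat.not_lt_zero _), rfl⟩
  | succ k ih =>
    obtain ⟨p₀, h₀⟩ := exists_hasPart (Iio k) p
    obtain ⟨p₁, h₁⟩ := exists_hasPart {k} p
    rw [mk_eq_mk (h₀.cobordant_sum_of_disjoint h₁ (by simp)
      fun x => Nat.lt_succ_iff_lt_or_eq.1 (hp x)), ← mk_add]
    exact add_mem (ih p₀ h₀.dim_mem) (Submodule.mem_iSup_of_mem k ⟨p₁, h₁.dim_mem, rfl⟩)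

lemma isInternal_dimSubmodule : DirectSum.IsInternal dimSubmodule := by
  refine (DirectSum.isInternal_submodule_iff_iSupIndep_and_iSup_eq_top _).2
    ⟨iSupIndep_dimSubmodule, eq_top_iff.2 ?_⟩
  rintro ⟨p⟩ -
  obtain ⟨k, hk⟩ := p.exists_dim_lt
  exact mk_mem_iSup_dimSubmodule k p hk

instance : SetLike.GradedMonoid dimSubmodule where
  one_mem := ⟨one, fun _ => Module.finrank_zero_of_subsingleton (R := ℝ) (M := PUnit), rfl⟩
  mul_mem := by
    rintro d e _ _ ⟨p, hp, rfl⟩ ⟨q, hq, rfl⟩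
    exact ⟨p.prod q, fun x => congrArg₂ (· + ·) (hp x.1) (hq x.2), rfl⟩

/-- The grading by dimension. -/
instance : GradedAlgebra dimSubmodule where
  __ := isInternal_dimSubmodule.chooseDecomposition

/-- The operation induced by the composition of coverings. -/
def comp : CobordismClasses → CobordismClasses → CobordismClasses :=
  Quot.map₂ ClosedCovering.comp (fun p _ _ h => (equivalence_cobordant.refl p).comp h)
    fun _ _ q h => h.comp (equivalence_cobordant.refl q)

lemma comp_mem {k m r n : ℕ} {a b : CobordismClasses} (ha : a ∈ ofDimDegree k m)
    (hb : b ∈ ofDimDegree r n) : comp a b ∈ ofDimDegree (m * r + k) (m * n) := by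
  obtain ⟨p, hp, hp', rfl⟩ := ha
  obtain ⟨q, hq, hq', rfl⟩ := hb
  refine ⟨p.comp q, fun x => ?_, fun x => ?_, rfl⟩
  · change p.base.dim x.base + ∑ᶠ t : p.proj ⁻¹' {x.base}, q.base.dim (x.map t) = _
    have := Fintype.ofFinite (p.proj ⁻¹' {x.base})
    simp only [hp, hq]
    rw [finsum_eq_sum_of_fintype, Finset.sum_const, Finset.card_univ, ← Nat.card_eq_fintype_card,
      hp', smul_eq_mul, add_comm]
  · have := Fintype.ofFinite (p.proj ⁻¹' {PolySpace.base x})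
    have h := (Nat.card_congr (compFiberEquiv p q x)).trans Nat.card_sigma
    refine h.trans ?_
    rw [Finset.sum_congr rfl fun t _ => hq' (PolySpace.map x t), Finset.sum_const,
      Finset.card_univ, ← Nat.card_eq_fintype_card, hp', smul_eq_mul]

end CobordismClasses

end CoveringBordism

end

theorem proposition1 :
    Equivalence CoveringBordism.ClosedCovering.Cobordant ∧
    (∀ p p' q q' : CoveringBordism.ClosedCovering, p.Cobordant p' → q.Cobordant q' →
      (p.sum q).Cobordant (p'.sum q') ∧
      (p.prod q).Cobordant (p'.prod q') ∧
      (p.comp q).Cobordant (p'.comp q')) ∧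
    ∃ (_ : CommRing CoveringBordism.CobordismClasses)
      (_ : Algebra (ZMod 2) CoveringBordism.CobordismClasses)
      (𝒩 : ℕ → Submodule (ZMod 2) CoveringBordism.CobordismClasses)
      (comp : CoveringBordism.CobordismClasses → CoveringBordism.CobordismClasses →
        CoveringBordism.CobordismClasses),
      (∀ p q : CoveringBordism.ClosedCovering,
        CoveringBordism.CobordismClasses.mk p + CoveringBordism.CobordismClasses.mk q =
          CoveringBordism.CobordismClasses.mk (p.sum q)) ∧
      (∀ p q : CoveringBordism.ClosedCovering,
        CoveringBordism.CobordismClasses.mk p * CoveringBordism.CobordismClasses.mk q =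
          CoveringBordism.CobordismClasses.mk (p.prod q)) ∧
      (∀ p q : CoveringBordism.ClosedCovering,
        comp (CoveringBordism.CobordismClasses.mk p) (CoveringBordism.CobordismClasses.mk q) =
          CoveringBordism.CobordismClasses.mk (p.comp q)) ∧
      (∀ d : ℕ, (𝒩 d : Set CoveringBordism.CobordismClasses) =
        CoveringBordism.CobordismClasses.ofDim d) ∧
      Nonempty (GradedAlgebra 𝒩) ∧
      (∀ k m r n : ℕ, ∀ a ∈ CoveringBordism.CobordismClasses.ofDimDegree k m,
        ∀ b ∈ CoveringBordism.CobordismClasses.ofDimDegree r n,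
          comp a b ∈ CoveringBordism.CobordismClasses.ofDimDegree (m * r + k) (m * n)) := by
  exact ⟨CoveringBordism.ClosedCovering.equivalence_cobordant,
    fun _ _ _ _ h h' => ⟨h.sum h', h.prod h', h.comp h'⟩,
    inferInstance, inferInstance, CoveringBordism.CobordismClasses.dimSubmodule,
    CoveringBordism.CobordismClasses.comp, fun _ _ => rfl, fun _ _ => rfl, fun _ _ => rfl,
    fun _ => rfl, ⟨inferInstance⟩,
    fun _ _ _ _ _ ha _ hb => CoveringBordism.CobordismClasses.comp_mem ha hb⟩
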